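/- **Setting.** Let $\mathbf R^{2,2}$ be $\mathbf R^4$ with the scalar product $s$ for which the standard basis is pseudo-orthonormal, with Gram matrix $\eta=\mathrm{diag}(1,1,-1,-1)$; a basis with Gram matrix $\eta$ is called $\Psi$-ON. A Witt basis is a basis $E_1,\dots,E_4$ whose only nonzero scalar products are $s(E_1,E_3)=s(E_2,E_4)=1$. $O(2,2)$ acts on endomorphisms by $S\mapsto LSL^{-1}$; the isotropy subgroup of $S$ consists of the $L\in O(2,2)$ commuting with $S$. We consider traceless self-adjoint endomorphisms. Below, $\epsilon,\omega\in\{1,-1\}$ are fixed signs, and a *subtype* consists of the traceless self-adjoint $S$ which have, with respect to some basis of the indicated kind, the indicated matrix form $\underline M$ with parameters satisfying the stated condition. Matrix forms (rows separated by semicolons): * I (Witt): $[\lambda,1,0,0;\,0,\lambda,0,\epsilon;\,0,0,\lambda,0;\,0,0,1,\lambda]$. * II (Witt), $b\ne0$: $[a,b,1,0;\,-b,a,0,-1;\,0,0,a,-b;\,0,0,b,a]$. * IIIa ($\Psi$-ON), $r=1/\sqrt2$: $[\lambda,0,0,0;\,0,\mu,r,0;\,0,-r,\mu,r;\,0,0,r,\mu]$.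 * IIIb ($\Psi$-ON), $r=1/\sqrt2$: $[\lambda,r,0,0;\,r,\lambda,-r,0;\,0,r,\lambda,0;\,0,0,0,\mu]$. * IV ($\Psi$-ON): $[\lambda,0,0,0;\,0,\mu+\frac\epsilon2,-\frac\epsilon2,0;\,0,\frac\epsilon2,\mu-\frac\epsilon2,0;\,0,0,0,\nu]$. * V ($\Psi$-ON), $b\neq0$: $[\lambda,0,0,0;\,0,a,b,0;\,0,-b,a,0;\,0,0,0,\nu]$. * VI ($\Psi$-ON), $b\ne0$: $[\lambda+\frac\epsilon2,0,0,-\frac\epsilon2;\,0,a,b,0;\,0,-b,a,0;\,\frac\epsilon2,0,0,\lambda-\frac\epsilon2]$. * VII (Witt): $[\lambda,0,\epsilon,0;\,0,\mu,0,\omega;\,0,0,\lambda,0;\,0,0,0,\mu]$. * VIII ($\Psi$-ON), $b,d\ne0$: $[a,0,b,0;\,0,c,0,d;\,-b,0,a,0;\,0,-d,0,c]$. * IX ($\Psi$-ON): $\mathrm{diag}(\lambda,\mu,\nu,\sigma)$. Isotropy matrices: $Z_1=\mathrm{diag}(1,-1,-1,-1)$, $Z_2=\mathrm{diag}(1,1,1,-1)$,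 $Z_3=\mathrm{diag}(1,-1,-1,1)$, $Z_4=\mathrm{diag}(1,-1,1,-1)$; * $T_1(h)=[1,h,0,-h;\,-h,\frac{2-h^2}2,0,\frac{h^2}2;\,0,0,1,0;\,-h,-\frac{h^2}2,0,\frac{2+h^2}2]$, * $T_2(g)=[\frac{2+g^2}2,0,-\frac{g^2}2,g;\,0,1,0,0;\,\frac{g^2}2,0,\frac{2-g^2}2,g;\,g,0,-g,1]$, * $T_3(k)=[1,0,0,0;\,0,\frac{2+k^2}2,-\frac{k^2}2,k;\,0,\frac{k^2}2,\frac{2-k^2}2,k;\,0,k,-k,1]$, * $T_4(g)=[1,-g,g,0;\,g,\frac{2-g^2}2,\frac{g^2}2,0;\,g,-\frac{g^2}2,\frac{2+g^2}2,0;\,0,0,0,1]$; * $K_5$: all $[\alpha,0,0,\gamma;\,0,s,0,0;\,0,0,s,0;\,\beta,0,0,\delta]$ with $s=\pm1$ and $L=\begin{pmatrix}\alpha&\gamma\\ \beta&\delta\end{pmatrix}\in O(1,1)$; * $K_6$: all $[\alpha,-sF,sF,\gamma;\; e,s\frac{2+k^2-e^2}2,s\frac{e^2-k^2}2,k;\;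 e,s\frac{k^2-e^2}2,s\frac{2+e^2-k^2}2,k;\; \beta,-sG,sG,\delta]$ with $s=\pm1$, $L$ as above in $O(1,1)$, $e,k\in\mathbf R$, and $\binom FG=L\binom{e}{-k}$; * $K_7(G)$: all $\begin{pmatrix}A&tAJ\\0&(A^{T})^{-1}\end{pmatrix}$ with $A\in G$, $t\in\mathbf R$, $J=\begin{pmatrix}0&-1\\1&0\end{pmatrix}$. **Statement.** For each subtype in the table, let $D\subseteq\mathbf R^m$ be the domain of the free parameters that remain when $\operatorname{tr}S=0$ is imposed. The table expresses the parameters of $\underline M$ through the free ones and gives $D$; this describes exactly the parameter values for which $\underline M$ is traceless and has the coincidences of eigenvalues defining the subtype. Then: $D$ is open with exactly $p$ connected components ("there are $p$ $m$-parameter families of orbits"); the subtype is the union, over $x\in D$, of the sets $\mathcal O_x$ of endomorphisms having matrix $\underline M(x)$ in some basis of the indicated kind; each $\mathcal O_x$ is a single (nonempty) $O(2,2)$-orbit, and for different $x$ in the same connected component of $D$ these orbits are disjoint (parameters in different components of $D$ may give the same orbit); with respect to every basis of the indicated kind in which $S$ has matrix $\underline M(x)$, the isotropy subgroup of $S$ is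 represented exactly by the set of matrices $K$ in the table; the map $L\mapsto LSL^{-1}$ induces a homeomorphism of $O(2,2)/K$ (the isotropy subgroup) onto the orbit; and each orbit is a smooth embedded submanifold of the space of endomorphisms, of dimension $n$, with exactly $q$ connected components. In particular the subtype has $\mathrm{df}=m+n$ degrees of freedom. | subtype | parameters of $\underline M$ | $D$ | $K$ | $m+n$ | $p\times q$ | |---|---|---|---|---|---| | I | $\lambda=0$ | point | $\{\pm1\}$ | $0+6$ | $1\times4$ | | II | $a=0$, $b$ | $b\ne0$ | $\{\pm1\}$ | $1+6$ | $2\times4$ | | IIIa, $\lambda\ne\mu$ | $\lambda=-3\mu$ | $\mu\ne0$ | $\{\pm1,\pm Z_1\}$ | $1+6$ | $2\times2$ | | IIIa, $\lambda=\mu$ | $0,0$ | point | generated by $-1,Z_1$, all $T_1(h)$ | $0+5$ | $1\times2$ | | IIIb, $\lambda\ne\mu$ | $\mu=-3\lambda$ | $\lambda\ne0$ | $\{\pm1,\pm Z_2\}$ | $1+6$ | $2\times2$ | | IIIb, $\lambda=\mu$ | $0,0$ | point | generated by $-1,Z_2$, all $T_2(g)$ | $0+5$ | $1\times2$ | | IV,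 $\lambda,\mu,\nu$ distinct | $\mu=-(\lambda+\nu)/2$ | $\lambda+3\nu\ne0$, $3\lambda+\nu\neq0$, $\lambda\ne\nu$ | $\{\pm1,\pm Z_1,\pm Z_2,\pm Z_3\}$ | $2+6$ | $6\times1$ | | IV, $\mu=\nu\ne\lambda$ | $\lambda=-3\nu$ | $\nu\ne0$ | generated by $-1,Z_1,Z_2,Z_3$, all $T_3(k)$ | $1+5$ | $2\times1$ | | IV, $\lambda=\mu\neq\nu$ | $\nu=-3\lambda$ | $\lambda\ne0$ | generated by $-1,Z_1,Z_2,Z_3$, all $T_4(g)$ | $1+5$ | $2\times1$ | | IV, $\lambda=\nu\ne\mu$ | $\mu=-\lambda$ | $\lambda\ne0$ | $K_5$ | $1+5$ | $2\times1$ | | IV, $\lambda=\mu=\nu$ | $0,0,0$ | point | $K_6$ | $0+3$ | $1\times1$ | | V, $\lambda\neq\nu$ | $a=-(\lambda+\nu)/2$ | $b\ne0$, $\lambda\ne\nu$ | $\{\pm1,\pm Z_1,\pm Z_2,\pm Z_3\}$ | $3+6$ | $4\times1$ | | V, $\lambda=\nu$ | $a=-\lambda$ | $b\neq0$ | $K_5$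 | $2+5$ | $2\times1$ | | VI | $a=-\lambda$ | $b\ne0$ | $\{\pm1,\pm Z_3\}$ | $2+6$ | $2\times2$ | | VII, $\lambda\ne\mu$ | $\mu=-\lambda$ | $\lambda\neq0$ | $\{\pm1,\pm Z_4\}$ | $1+6$ | $2\times2$ | | VII, $\lambda=\mu$, $\epsilon=\omega$ | $0,0$ | point | $K_7(O(2))$ | $0+4$ | $1\times2$ | | VII, $\lambda=\mu$, $\epsilon=-\omega$ | $0,0$ | point | $K_7(O(1,1))$ | $0+4$ | $1\times2$ | | VIII, $a\ne c$ | $c=-a$ | $a,b,d\ne0$ | $\{\pm1,\pm Z_4\}$ | $3+6$ | $8\times2$ | | VIII, $a=c$, $b\ne\pm d$ | $a=c=0$ | $b,d\ne0$, $b\neq\pm d$ | $\{\pm1,\pm Z_4\}$ | $2+6$ | $8\times2$ | | VIII, $a=c$, $b=d$ | $a=c=0$ | $b\ne0$ | $O(2;\mathbf C)=\left\{\begin{pmatrix}A&-B\\B&A\end{pmatrix}: A+iB\in O(2;\mathbf C)\right\}$ | $1+4$ | $2\times2$ | | IX, all distinct | $\lambda+\mu+\nu+\sigma=0$ | no two equal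 | all $\mathrm{diag}(\pm1,\pm1,\pm1,\pm1)$ (order 16) | $3+6$ | $24\times1$ | | IX, exactly one pair equal (each of the six pairs; remaining eigenvalues $u,v$) | common value $-(u+v)/2$ | $u\neq v$, $3u+v\ne0$, $u+3v\ne0$ | $O(2)$ (pairs $\lambda\mu$, $\nu\sigma$) or $O(1,1)$ (the other four pairs) on the two coordinates of the pair, $\pm1$ on each of the other two | $2+5$ | $6\times1$ | | IX, $\lambda=\mu\ne\nu=\sigma$ | $\nu=-\lambda$ | $\lambda\ne0$ | $O(2)\times O(2)$ on coordinates $\{1,2\},\{3,4\}$ | $1+4$ | $2\times1$ | | IX, $\lambda=\nu\ne\mu=\sigma$ | $\mu=-\lambda$ | $\lambda\ne0$ | $O(1,1)\times O(1,1)$ on $\{1,3\},\{2,4\}$ | $1+4$ | $2\times1$ | | IX, $\lambda=\sigma\ne\mu=\nu$ | $\mu=-\lambda$ | $\lambda\ne0$ | $O(1,1)\times O(1,1)$ on $\{1,4\},\{2,3\}$ | $1+4$ | $2\times1$ | | IX, exactly three equal (each of the four triples; common value $u$) | fourth value $-3u$ | $u\ne0$ | $O(2,1)$ (triples $\lambda\mu\nu$,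 $\lambda\mu\sigma$) or $O(1,2)$ (triples $\lambda\nu\sigma$, $\mu\nu\sigma$) on the three coordinates, $\pm1$ on the fourth | $1+3$ | $2\times1$ | | IX, all equal | $0,0,0,0$ | point | $O(2,2)$ | $0+0$ | $1\times1$ | -/

import Mathlib

open scoped ContDiff Matrix

noncomputable section

namespace NeutralEnd

/-- Endomorphisms of `ℝ⁴`, written as matrices with respect to the standard basis. -/
abbrev Mat := Matrix (Fin 4) (Fin 4) ℝ

/-- The Gram matrix of the standard scalar product of `ℝ^{2,2}` in a pseudo-orthonormal basis. -/
def eta : Mat := Matrix.diagonal ![1, 1, -1, -1]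

/-- The Gram matrix of the scalar product of `ℝ^{2,2}` in a Witt basis:
`s(E₁, E₃) = s(E₂, E₄) = 1`, all other products zero. -/
def hyp : Mat :=
  !![0, 0, 1, 0;
     0, 0, 0, 1;
     1, 0, 0, 0;
     0, 1, 0, 0]

/-- `O(2,2)`, the group of orthogonal automorphisms of `ℝ^{2,2}`. -/
def O22 : Subgroup (GL (Fin 4) ℝ) where
  carrier := {L | (L : Mat)ᵀ * eta * (L : Mat) = eta}
  one_mem' := by simp
  mul_mem' := by
    intro a b ha hb
    simp only [Set.mem_ofPred_eq] at ha hb ⊢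
    calc ((a * b : GL (Fin 4) ℝ) : Mat)ᵀ * eta * ((a * b : GL (Fin 4) ℝ) : Mat)
        = (b : Mat)ᵀ * ((a : Mat)ᵀ * eta * (a : Mat)) * (b : Mat) := by
          simp [Matrix.transpose_mul, Matrix.mul_assoc]
      _ = eta := by rw [ha, hb]
  inv_mem' := by
    intro a ha
    simp only [Set.mem_ofPred_eq] at ha ⊢
    have h1 : (a : Mat) * ((a⁻¹ : GL (Fin 4) ℝ) : Mat) = 1 := by
      rw [← Units.val_mul]; simp
    have h2 : ((a⁻¹ : GL (Fin 4) ℝ) : Mat)ᵀ * (a : Mat)ᵀ = 1 := by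
      rw [← Matrix.transpose_mul, h1, Matrix.transpose_one]
    calc ((a⁻¹ : GL (Fin 4) ℝ) : Mat)ᵀ * eta * ((a⁻¹ : GL (Fin 4) ℝ) : Mat)
        = ((a⁻¹ : GL (Fin 4) ℝ) : Mat)ᵀ * ((a : Mat)ᵀ * eta * (a : Mat)) *
            ((a⁻¹ : GL (Fin 4) ℝ) : Mat) := by rw [ha]
      _ = (((a⁻¹ : GL (Fin 4) ℝ) : Mat)ᵀ * (a : Mat)ᵀ) * eta *
            ((a : Mat) * ((a⁻¹ : GL (Fin 4) ℝ) : Mat)) := by simp only [Matrix.mul_assoc]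
      _ = eta := by rw [h1, h2, Matrix.one_mul, Matrix.mul_one]

/-- The action `S ↦ L S L⁻¹` of `O(2,2)` on endomorphisms. -/
def act (L : O22) (S : Mat) : Mat :=
  ((L : GL (Fin 4) ℝ) : Mat) * S * (((L : GL (Fin 4) ℝ)⁻¹ : GL (Fin 4) ℝ) : Mat)

/-- The orbit of `S` under `O(2,2)`. -/
def orbit (S : Mat) : Set Mat := {T | ∃ L : O22, T = act L S}

/-- The isotropy subgroup of `S` in `O(2,2)`: the elements commuting with `S`. -/
def isotropy (S : Mat) : Subgroup O22 where
  carrier := {L | ((L : GL (Fin 4) ℝ) : Mat) * S = S * ((L : GL (Fin 4) ℝ) : Mat)}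
  one_mem' := by simp
  mul_mem' := by
    intro a b ha hb
    simp only [Set.mem_ofPred_eq, Subgroup.coe_mul, Units.val_mul] at ha hb ⊢
    rw [Matrix.mul_assoc, hb, ← Matrix.mul_assoc, ha, Matrix.mul_assoc]
  inv_mem' := by
    intro a ha
    simp only [Set.mem_ofPred_eq, Subgroup.coe_inv] at ha ⊢
    have h : Commute ((a : GL (Fin 4) ℝ) : Mat) S := ha
    exact h.units_inv_left

/-- The columns of `b` form a basis of `ℝ^{2,2}` with Gram matrix `H`
(`H = eta`: a pseudo-orthonormal basis; `H = hyp`: a Witt basis). -/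
def IsFrame (H : Mat) (b : GL (Fin 4) ℝ) : Prop :=
  (b : Mat)ᵀ * eta * (b : Mat) = H

/-- `S` has matrix representation `M` with respect to the basis given by the columns of `b`. -/
def HasMatrix (b : GL (Fin 4) ℝ) (M S : Mat) : Prop := S * (b : Mat) = (b : Mat) * M

/-- The endomorphisms that have matrix representation `M` with respect to some basis of
`ℝ^{2,2}` with Gram matrix `H`. -/
def realizing (H M : Mat) : Set Mat :=
  {S | ∃ b : GL (Fin 4) ℝ, IsFrame H b ∧ HasMatrix b M S}

/-- The space of traceless self-adjoint endomorphisms of `ℝ^{2,2}`. -/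
def tracelessSelfAdjoint : Set Mat := {S | eta.IsSelfAdjoint S ∧ S.trace = 0}

/-- The traceless self-adjoint endomorphisms having matrix form `M y`, with respect to a basis with
Gram matrix `H`, for some value `y` of the parameters satisfying the condition `C`. -/
def tracelessSubtype {k : ℕ} (H : Mat) (M : (Fin k → ℝ) → Mat) (C : Set (Fin k → ℝ)) : Set Mat :=
  {S | S ∈ tracelessSelfAdjoint ∧ ∃ y ∈ C, S ∈ realizing H (M y)}

/-- `A` is a (smooth, embedded) submanifold of dimension `n` of the normed space `E`: near each of
its points a smooth change of coordinates carries `A` to an `n`-dimensional linear subspace. -/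
def IsSubmanifold {E : Type*} [NormedAddCommGroup E] [NormedSpace ℝ E] (n : ℕ) (A : Set E) :
    Prop :=
  ∀ x ∈ A, ∃ (φ : OpenPartialHomeomorph E E) (F : Submodule ℝ E),
    x ∈ φ.source ∧ ContDiffOn ℝ ∞ φ φ.source ∧ ContDiffOn ℝ ∞ φ.symm φ.target ∧
    Module.finrank ℝ F = n ∧ φ '' (φ.source ∩ A) = φ.target ∩ (F : Set E)

/-- The number of connected components of a subset of a topological space. -/
def numComponents {X : Type*} [TopologicalSpace X] (A : Set X) : ℕ :=
  Nat.card (ConnectedComponents A)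

/-- One line of the computation. A subtype consists of the traceless self-adjoint endomorphisms
that have, in some basis with Gram matrix `H`, the matrix form `M y` with `y` satisfying `C`.
After tracelessness is imposed, there remain `m` free parameters `x`, ranging over the open set
`D`, with `y = ι x`. The common isotropy subgroup is represented by the set of matrices `K`, the
orbits have dimension `n` and `q` connected components, and `D` has `p` connected components. -/
structure Computation (m n p q : ℕ) {k : ℕ} (H : Mat) (M : (Fin k → ℝ) → Mat)
    (C : Set (Fin k → ℝ)) (ι : (Fin m → ℝ) → (Fin k → ℝ)) (D : Set (Fin m → ℝ))
    (K : Set Mat) : Prop where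
  /-- The meaning of the trace-free condition for the parameters. -/
  traceless : {y | y ∈ C ∧ (M y).trace = 0} = ι '' D
  injOn : Set.InjOn ι D
  isOpen_domain : IsOpen D
  /-- The subtype is the union of the orbits with parameters in the domain. -/
  subtype_eq : tracelessSubtype H M C = ⋃ x ∈ D, realizing H (M (ι x))
  nonempty : ∀ x ∈ D, (realizing H (M (ι x))).Nonempty
  orbit_eq : ∀ x ∈ D, ∀ S ∈ realizing H (M (ι x)), realizing H (M (ι x)) = orbit S
  /-- In any adapted basis, the isotropy subgroup is represented exactly by the matrices in `K`. -/
  isotropy_eq : ∀ x ∈ D, ∀ (b : GL (Fin 4) ℝ) (S : Mat), IsFrame H b → HasMatrix b (M (ι x)) S →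
    {A : Mat | ∃ L ∈ isotropy S, A = ((b⁻¹ * (L : GL (Fin 4) ℝ) * b : GL (Fin 4) ℝ) : Mat)} = K
  /-- The orbit is `O(2,2)` modulo the isotropy subgroup. -/
  orbit_homeo : ∀ x ∈ D, ∀ S ∈ realizing H (M (ι x)),
    ∃ e : (O22 ⧸ isotropy S) ≃ₜ orbit S, ∀ L : O22, (e (QuotientGroup.mk L) : Mat) = act L S
  /-- The orbit is a manifold of dimension `n`. -/
  orbit_dim : ∀ x ∈ D, ∀ S ∈ realizing H (M (ι x)),
    IsSubmanifold n ((Matrix.of : (Fin 4 → Fin 4 → ℝ) ≃ Mat) ⁻¹' orbit S)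
  orbit_components : ∀ x ∈ D, ∀ S ∈ realizing H (M (ι x)), numComponents (orbit S) = q
  /-- There are `p` families, one for each connected component of the parameter domain. -/
  families : numComponents D = p
  /-- Within a family, distinct parameters give distinct (hence disjoint) orbits. -/
  distinct : ∀ x ∈ D, ∀ x' ∈ connectedComponentIn D x, x' ≠ x →
    Disjoint (realizing H (M (ι x))) (realizing H (M (ι x')))

/-! ### The matrix forms -/

/-- Type I: Jordan block `J₄(l)`; with respect to a Witt basis, `e = ±1`. -/
def formI (e l : ℝ) : Mat :=
  !![l, 1, 0, 0;
     0, l, 0, e;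
     0, 0, l, 0;
     0, 0, 1, l]

/-- Type II: realized Jordan form `K₂(a,b)`; with respect to a Witt basis. -/
def formII (a b : ℝ) : Mat :=
  !![a, b, 1, 0;
     -b, a, 0, -1;
     0, 0, a, -b;
     0, 0, b, a]

/-- Type IIIa: `J₁(l)` on `ℝ^{1,0}` and `J₃(m)` on `ℝ^{1,2}`; pseudo-orthonormal basis. -/
def formIIIa (l m : ℝ) : Mat :=
  !![l, 0, 0, 0;
     0, m, 1 / √2, 0;
     0, -(1 / √2), m, 1 / √2;
     0, 0, 1 / √2, m]

/-- Type IIIb: `J₃(l)` on `ℝ^{2,1}` and `J₁(m)` on `ℝ^{0,1}`; pseudo-orthonormal basis. -/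
def formIIIb (l m : ℝ) : Mat :=
  !![l, 1 / √2, 0, 0;
     1 / √2, l, -(1 / √2), 0;
     0, 1 / √2, l, 0;
     0, 0, 0, m]

/-- Type IV: `J₁(l)` on `ℝ^{1,0}`, `J_{±2}(m)` on `ℝ^{1,1}`, `J₁(n)` on `ℝ^{0,1}`;
pseudo-orthonormal basis, `e = ±1`. -/
def formIV (e l m n : ℝ) : Mat :=
  !![l, 0, 0, 0;
     0, m + e / 2, -(e / 2), 0;
     0, e / 2, m - e / 2, 0;
     0, 0, 0, n]

/-- Type V: `J₁(l)` on `ℝ^{1,0}`, `K₁(a,b)` on `ℝ^{1,1}`, `J₁(n)` on `ℝ^{0,1}`;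
pseudo-orthonormal basis. -/
def formV (l a b n : ℝ) : Mat :=
  !![l, 0, 0, 0;
     0, a, b, 0;
     0, -b, a, 0;
     0, 0, 0, n]

/-- Type VI: `J_{±2}(l)` and `K₁(a,b)`, each on an `ℝ^{1,1}`; pseudo-orthonormal basis,
`e = ±1`. -/
def formVI (e l a b : ℝ) : Mat :=
  !![l + e / 2, 0, 0, -(e / 2);
     0, a, b, 0;
     0, -b, a, 0;
     e / 2, 0, 0, l - e / 2]

/-- Type VII: `J_{±2}(l)` and `J_{±2}(m)`, each on an `ℝ^{1,1}`; Witt basis, `e = ±1`, `w = ±1`. -/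
def formVII (e w l m : ℝ) : Mat :=
  !![l, 0, e, 0;
     0, m, 0, w;
     0, 0, l, 0;
     0, 0, 0, m]

/-- Type VIII: `K₁(a,b)` and `K₁(c,d)`, each on an `ℝ^{1,1}`; pseudo-orthonormal basis. -/
def formVIII (a b c d : ℝ) : Mat :=
  !![a, 0, b, 0;
     0, c, 0, d;
     -b, 0, a, 0;
     0, -d, 0, c]

/-- Type IX: four real eigenvalues; pseudo-orthonormal basis. -/
def formIX (y : Fin 4 → ℝ) : Mat := Matrix.diagonal y

/-! ### Matrices representing the isotropy subgroups -/

def Z1 : Mat := Matrix.diagonal ![1, -1, -1, -1]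

def Z2 : Mat := Matrix.diagonal ![1, 1, 1, -1]

def Z3 : Mat := Matrix.diagonal ![1, -1, -1, 1]

def Z4 : Mat := Matrix.diagonal ![1, -1, 1, -1]

def T1 (h : ℝ) : Mat :=
  !![1, h, 0, -h;
     -h, (2 - h ^ 2) / 2, 0, h ^ 2 / 2;
     0, 0, 1, 0;
     -h, -(h ^ 2 / 2), 0, (2 + h ^ 2) / 2]

def T2 (g : ℝ) : Mat :=
  !![(2 + g ^ 2) / 2, 0, -(g ^ 2 / 2), g;
     0, 1, 0, 0;
     g ^ 2 / 2, 0, (2 - g ^ 2) / 2, g;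
     g, 0, -g, 1]

def T3 (k : ℝ) : Mat :=
  !![1, 0, 0, 0;
     0, (2 + k ^ 2) / 2, -(k ^ 2 / 2), k;
     0, k ^ 2 / 2, (2 - k ^ 2) / 2, k;
     0, k, -k, 1]

def T4 (g : ℝ) : Mat :=
  !![1, -g, g, 0;
     g, (2 - g ^ 2) / 2, g ^ 2 / 2, 0;
     g, -(g ^ 2 / 2), (2 + g ^ 2) / 2, 0;
     0, 0, 0, 1]

/-- The matrices of the group generated by a set of invertible matrices. -/
def generated (X : Set Mat) : Set Mat :=
  {A | ∃ g ∈ Subgroup.closure {g : GL (Fin 4) ℝ | (g : Mat) ∈ X}, (g : Mat) = A}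

/-- The real matrices preserving the scalar product with Gram matrix `diag(d)`. -/
def orth {r : ℕ} (d : Fin r → ℝ) : Set (Matrix (Fin r) (Fin r) ℝ) :=
  {A | Aᵀ * Matrix.diagonal d * A = Matrix.diagonal d}

/-- `O(2)`. -/
def O2 : Set (Matrix (Fin 2) (Fin 2) ℝ) := orth ![1, 1]

/-- `O(1,1)`. -/
def O11 : Set (Matrix (Fin 2) (Fin 2) ℝ) := orth ![1, -1]

/-- `O(2,1)`. -/
def O21 : Set (Matrix (Fin 3) (Fin 3) ℝ) := orth ![1, 1, -1]

/-- `O(1,2)`. -/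
def O12 : Set (Matrix (Fin 3) (Fin 3) ℝ) := orth ![1, -1, -1]

/-- Isotropy for the coincidence of the two simple eigenvalues in types IV and V. -/
def isoT5 : Set Mat :=
  {A | ∃ L ∈ O11, ∃ s : ℝ, (s = 1 ∨ s = -1) ∧
    A = !![L 0 0, 0, 0, L 0 1;
           0, s, 0, 0;
           0, 0, s, 0;
           L 1 0, 0, 0, L 1 1]}

/-- Isotropy for the coincidence of all eigenvalues in type IV, where
`(F, G) = L (e, -k)`. -/
def isoT6 : Set Mat :=
  {A | ∃ L ∈ O11, ∃ e k F G s : ℝ, (s = 1 ∨ s = -1) ∧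
    F = L 0 0 * e - L 0 1 * k ∧ G = L 1 0 * e - L 1 1 * k ∧
    A = !![L 0 0, -(s * F), s * F, L 0 1;
           e, s * ((2 + k ^ 2 - e ^ 2) / 2), s * ((e ^ 2 - k ^ 2) / 2), k;
           e, s * ((k ^ 2 - e ^ 2) / 2), s * ((2 + e ^ 2 - k ^ 2) / 2), k;
           L 1 0, -(s * G), s * G, L 1 1]}

/-- The `4 × 4` matrix with the given `2 × 2` blocks. -/
def blocks (A B C D : Matrix (Fin 2) (Fin 2) ℝ) : Mat :=
  !![A 0 0, A 0 1, B 0 0, B 0 1;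
     A 1 0, A 1 1, B 1 0, B 1 1;
     C 0 0, C 0 1, D 0 0, D 0 1;
     C 1 0, C 1 1, D 1 0, D 1 1]

/-- Isotropy for coincident eigenvalues in type VII, for a group `G` of `2 × 2` matrices. -/
def isoVII (G : Set (Matrix (Fin 2) (Fin 2) ℝ)) : Set Mat :=
  {X | ∃ A ∈ G, ∃ a : ℝ, X = blocks A (a • (A * !![0, -1; 1, 0])) 0 (Aᵀ)⁻¹}

/-- `O(2;ℂ)`, as real `4 × 4` matrices: `A + iB ↦ ((A, -B), (B, A))`. -/
def isoVIII : Set Mat :=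
  {X | ∃ Q ∈ Matrix.orthogonalGroup (Fin 2) ℂ,
    X = blocks (Q.map Complex.re) (-Q.map Complex.im) (Q.map Complex.im) (Q.map Complex.re)}

/-- The diagonal matrices with diagonal entries `±1`. -/
def signMatrices : Set Mat :=
  {A | ∃ d : Fin 4 → ℝ, (∀ i, d i = 1 ∨ d i = -1) ∧ A = Matrix.diagonal d}

/-- The matrices acting by an element of `G` on the coordinates `i`, `j`, and by signs on the
coordinates `k`, `l`. -/
def isoPair (i j k l : Fin 4) (G : Set (Matrix (Fin 2) (Fin 2) ℝ)) : Set Mat :=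
  {X | ∃ A ∈ G, ∃ e f : ℝ, (e = 1 ∨ e = -1) ∧ (f = 1 ∨ f = -1) ∧
    X.submatrix ![i, j, k, l] ![i, j, k, l] = blocks A 0 0 (Matrix.diagonal ![e, f])}

/-- The matrices acting by an element of `G` on the coordinates `i`, `j`, and by an element of `G'`
on the coordinates `k`, `l`. -/
def isoPairs (i j k l : Fin 4) (G G' : Set (Matrix (Fin 2) (Fin 2) ℝ)) : Set Mat :=
  {X | ∃ A ∈ G, ∃ B ∈ G', X.submatrix ![i, j, k, l] ![i, j, k, l] = blocks A 0 0 B}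

/-- The matrices acting by an element of `G` on the coordinates `i`, `j`, `k`, and by a sign on the
coordinate `l`. -/
def isoTriple (i j k l : Fin 4) (G : Set (Matrix (Fin 3) (Fin 3) ℝ)) : Set Mat :=
  {X | ∃ A ∈ G, ∃ f : ℝ, (f = 1 ∨ f = -1) ∧
    X.submatrix ![i, j, k, l] ![i, j, k, l] =
      !![A 0 0, A 0 1, A 0 2, 0;
         A 1 0, A 1 1, A 1 2, 0;
         A 2 0, A 2 1, A 2 2, 0;
         0, 0, 0, f]}

end NeutralEnd

end

noncomputable section

namespace NeutralEnd

/-! Two bases with the same Gram matrix differ by exactly one element of `O(2,2)`, so the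
endomorphisms with a fixed matrix in adapted bases form a single orbit (`realizing_eq_orbit`). In an
adapted basis the isotropy group becomes the set `orthCentralizer H M` of matrices that preserve `H`
and commute with `M`. It is computed type by type: the commutation relations are linear and cut the
matrix down to a few entries, and the orthogonality relations fix or relate those.

The geometry of the orbits rests on one construction, carried out for an anti-involution `τ` of a
finite-dimensional normed algebra: near a self-adjoint `S₀`, the orbit map has a smooth local
section (`exists_local_section`). An element `P S` with `S * P S = P S * S₀` is found first,
depending smoothly on `S`. It is then made orthogonal by a polar correction: divide by the square
root `Q` of `τ P * P`. Square roots near `1` are unique, so `Q` commutes with `S₀` and the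
intertwining relation survives. The section makes the orbit map open, whence the homeomorphism with
the quotient group. It also gives a smooth retraction onto the orbit, and a smooth retract is a
submanifold (`exists_chart_of_retraction`). The tangent space consists of the commutators of `S`
with skew-adjoint matrices, so its dimension is six minus the dimension of the commuting ones, a
linear computation (`finrank_range_adMap`).

`O(2,2)` has four components, told apart by the signs of the upper left and lower right minors of
size two; together these signs are a homomorphism to `ℤˣ × ℤˣ`. The components of an orbit
correspond to the quotient of this group by the image of the isotropy group (`numComponents_orbit`),
so one only has to know which sign pairs the isotropy matrices attain.

The parameter domains are disjoint unions of open convex pieces, cut out by signs of linear forms or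
by the order of the eigenvalues. The characteristic polynomial is constant on an orbit. It
determines the eigenvalues up to relabelling, and the sign or order conditions of a single piece
remove that ambiguity, so orbits within a family are disjoint. -/

/-! ### Explicit `4 × 4` matrices -/

/-- The `4 × 4` matrix with given entries, listed by rows. -/
abbrev lit (a₀ a₁ a₂ a₃ b₀ b₁ b₂ b₃ c₀ c₁ c₂ c₃ d₀ d₁ d₂ d₃ : ℝ) : Mat :=
  !![a₀, a₁, a₂, a₃; b₀, b₁, b₂, b₃; c₀, c₁, c₂, c₃; d₀, d₁, d₂, d₃]

theorem exists_lit (A : Mat) : ∃ a₀ a₁ a₂ a₃ b₀ b₁ b₂ b₃ c₀ c₁ c₂ c₃ d₀ d₁ d₂ d₃,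
    A = lit a₀ a₁ a₂ a₃ b₀ b₁ b₂ b₃ c₀ c₁ c₂ c₃ d₀ d₁ d₂ d₃ :=
  ⟨A 0 0, A 0 1, A 0 2, A 0 3, A 1 0, A 1 1, A 1 2, A 1 3, A 2 0, A 2 1, A 2 2, A 2 3,
    A 3 0, A 3 1, A 3 2, A 3 3, by ext i j; fin_cases i <;> fin_cases j <;> rfl⟩

theorem lit_inj {a₀ a₁ a₂ a₃ b₀ b₁ b₂ b₃ c₀ c₁ c₂ c₃ d₀ d₁ d₂ d₃
    a₀' a₁' a₂' a₃' b₀' b₁' b₂' b₃' c₀' c₁' c₂' c₃' d₀' d₁' d₂' d₃' : ℝ} :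
    lit a₀ a₁ a₂ a₃ b₀ b₁ b₂ b₃ c₀ c₁ c₂ c₃ d₀ d₁ d₂ d₃ =
      lit a₀' a₁' a₂' a₃' b₀' b₁' b₂' b₃' c₀' c₁' c₂' c₃' d₀' d₁' d₂' d₃' ↔
    (a₀ = a₀' ∧ a₁ = a₁' ∧ a₂ = a₂' ∧ a₃ = a₃') ∧ (b₀ = b₀' ∧ b₁ = b₁' ∧ b₂ = b₂' ∧ b₃ = b₃') ∧
    (c₀ = c₀' ∧ c₁ = c₁' ∧ c₂ = c₂' ∧ c₃ = c₃') ∧ (d₀ = d₀' ∧ d₁ = d₁' ∧ d₂ = d₂' ∧ d₃ = d₃') := by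
  refine ⟨fun h => ?_, ?_⟩
  · have h' := fun i j => congrFun (congrFun h i) j
    exact ⟨⟨h' 0 0, h' 0 1, h' 0 2, h' 0 3⟩, ⟨h' 1 0, h' 1 1, h' 1 2, h' 1 3⟩,
      ⟨h' 2 0, h' 2 1, h' 2 2, h' 2 3⟩, ⟨h' 3 0, h' 3 1, h' 3 2, h' 3 3⟩⟩
  · rintro ⟨⟨rfl, rfl, rfl, rfl⟩, ⟨rfl, rfl, rfl, rfl⟩, ⟨rfl, rfl, rfl, rfl⟩, rfl, rfl, rfl, rfl⟩
    rfl

theorem lit_mul (a₀ a₁ a₂ a₃ b₀ b₁ b₂ b₃ c₀ c₁ c₂ c₃ d₀ d₁ d₂ d₃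
    x₀ x₁ x₂ x₃ y₀ y₁ y₂ y₃ z₀ z₁ z₂ z₃ w₀ w₁ w₂ w₃ : ℝ) :
    lit a₀ a₁ a₂ a₃ b₀ b₁ b₂ b₃ c₀ c₁ c₂ c₃ d₀ d₁ d₂ d₃ *
      lit x₀ x₁ x₂ x₃ y₀ y₁ y₂ y₃ z₀ z₁ z₂ z₃ w₀ w₁ w₂ w₃ =
    lit (a₀ * x₀ + a₁ * y₀ + a₂ * z₀ + a₃ * w₀) (a₀ * x₁ + a₁ * y₁ + a₂ * z₁ + a₃ * w₁)
      (a₀ * x₂ + a₁ * y₂ + a₂ * z₂ + a₃ * w₂) (a₀ * x₃ + a₁ * y₃ + a₂ * z₃ + a₃ * w₃)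
      (b₀ * x₀ + b₁ * y₀ + b₂ * z₀ + b₃ * w₀) (b₀ * x₁ + b₁ * y₁ + b₂ * z₁ + b₃ * w₁)
      (b₀ * x₂ + b₁ * y₂ + b₂ * z₂ + b₃ * w₂) (b₀ * x₃ + b₁ * y₃ + b₂ * z₃ + b₃ * w₃)
      (c₀ * x₀ + c₁ * y₀ + c₂ * z₀ + c₃ * w₀) (c₀ * x₁ + c₁ * y₁ + c₂ * z₁ + c₃ * w₁)
      (c₀ * x₂ + c₁ * y₂ + c₂ * z₂ + c₃ * w₂) (c₀ * x₃ + c₁ * y₃ + c₂ * z₃ + c₃ * w₃)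
      (d₀ * x₀ + d₁ * y₀ + d₂ * z₀ + d₃ * w₀) (d₀ * x₁ + d₁ * y₁ + d₂ * z₁ + d₃ * w₁)
      (d₀ * x₂ + d₁ * y₂ + d₂ * z₂ + d₃ * w₂) (d₀ * x₃ + d₁ * y₃ + d₂ * z₃ + d₃ * w₃) := by
  ext i j
  rw [Matrix.mul_apply, Fin.sum_univ_four]
  fin_cases i <;> fin_cases j <;> rfl

theorem lit_transpose (a₀ a₁ a₂ a₃ b₀ b₁ b₂ b₃ c₀ c₁ c₂ c₃ d₀ d₁ d₂ d₃ : ℝ) :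
    (lit a₀ a₁ a₂ a₃ b₀ b₁ b₂ b₃ c₀ c₁ c₂ c₃ d₀ d₁ d₂ d₃)ᵀ =
      lit a₀ b₀ c₀ d₀ a₁ b₁ c₁ d₁ a₂ b₂ c₂ d₂ a₃ b₃ c₃ d₃ := by
  ext i j
  fin_cases i <;> fin_cases j <;> rfl

theorem lit_neg (a₀ a₁ a₂ a₃ b₀ b₁ b₂ b₃ c₀ c₁ c₂ c₃ d₀ d₁ d₂ d₃ : ℝ) :
    -(lit a₀ a₁ a₂ a₃ b₀ b₁ b₂ b₃ c₀ c₁ c₂ c₃ d₀ d₁ d₂ d₃) =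
      lit (-a₀) (-a₁) (-a₂) (-a₃) (-b₀) (-b₁) (-b₂) (-b₃) (-c₀) (-c₁) (-c₂) (-c₃)
        (-d₀) (-d₁) (-d₂) (-d₃) := by
  ext i j
  fin_cases i <;> fin_cases j <;> rfl

theorem diagonal_eq_lit (d : Fin 4 → ℝ) :
    Matrix.diagonal d = lit (d 0) 0 0 0 0 (d 1) 0 0 0 0 (d 2) 0 0 0 0 (d 3) := by
  ext i j
  fin_cases i <;> fin_cases j <;> simp

theorem one_eq_lit : (1 : Mat) = lit 1 0 0 0 0 1 0 0 0 0 1 0 0 0 0 1 := by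
  rw [← Matrix.diagonal_one, diagonal_eq_lit]

theorem zero_eq_lit : (0 : Mat) = lit 0 0 0 0 0 0 0 0 0 0 0 0 0 0 0 0 := by
  ext i j
  fin_cases i <;> fin_cases j <;> rfl

theorem eta_eq_lit : eta = lit 1 0 0 0 0 1 0 0 0 0 (-1) 0 0 0 0 (-1) := diagonal_eq_lit _

/-- The matrices that preserve the scalar product with Gram matrix `H` and commute with `M`. -/
def orthCentralizer (H M : Mat) : Set Mat := {A | Aᵀ * H * A = H ∧ A * M = M * A}

theorem lit_orth_eta_iff (a₀ a₁ a₂ a₃ b₀ b₁ b₂ b₃ c₀ c₁ c₂ c₃ d₀ d₁ d₂ d₃ : ℝ) :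
    (lit a₀ a₁ a₂ a₃ b₀ b₁ b₂ b₃ c₀ c₁ c₂ c₃ d₀ d₁ d₂ d₃)ᵀ * eta *
      lit a₀ a₁ a₂ a₃ b₀ b₁ b₂ b₃ c₀ c₁ c₂ c₃ d₀ d₁ d₂ d₃ = eta ↔
    (a₀ ^ 2 + b₀ ^ 2 - c₀ ^ 2 - d₀ ^ 2 = 1 ∧ a₁ ^ 2 + b₁ ^ 2 - c₁ ^ 2 - d₁ ^ 2 = 1 ∧
      a₂ ^ 2 + b₂ ^ 2 - c₂ ^ 2 - d₂ ^ 2 = -1 ∧ a₃ ^ 2 + b₃ ^ 2 - c₃ ^ 2 - d₃ ^ 2 = -1) ∧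
    a₀ * a₁ + b₀ * b₁ - c₀ * c₁ - d₀ * d₁ = 0 ∧ a₀ * a₂ + b₀ * b₂ - c₀ * c₂ - d₀ * d₂ = 0 ∧
    a₀ * a₃ + b₀ * b₃ - c₀ * c₃ - d₀ * d₃ = 0 ∧ a₁ * a₂ + b₁ * b₂ - c₁ * c₂ - d₁ * d₂ = 0 ∧
    a₁ * a₃ + b₁ * b₃ - c₁ * c₃ - d₁ * d₃ = 0 ∧ a₂ * a₃ + b₂ * b₃ - c₂ * c₃ - d₂ * d₃ = 0 := by
  rw [lit_transpose, eta_eq_lit, lit_mul, lit_mul, lit_inj]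
  constructor
  · rintro ⟨⟨h1, h2, h3, h4⟩, ⟨-, h5, h6, h7⟩, ⟨-, -, h8, h9⟩, -, -, -, h10⟩
    refine ⟨⟨?_, ?_, ?_, ?_⟩, ?_, ?_, ?_, ?_, ?_, ?_⟩ <;> linarith
  · rintro ⟨⟨h1, h2, h3, h4⟩, h5, h6, h7, h8, h9, h10⟩
    refine ⟨⟨?_, ?_, ?_, ?_⟩, ⟨?_, ?_, ?_, ?_⟩, ⟨?_, ?_, ?_, ?_⟩, ?_, ?_, ?_, ?_⟩ <;> linarith

theorem lit_orth_hyp_iff (a₀ a₁ a₂ a₃ b₀ b₁ b₂ b₃ c₀ c₁ c₂ c₃ d₀ d₁ d₂ d₃ : ℝ) :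
    (lit a₀ a₁ a₂ a₃ b₀ b₁ b₂ b₃ c₀ c₁ c₂ c₃ d₀ d₁ d₂ d₃)ᵀ * hyp *
      lit a₀ a₁ a₂ a₃ b₀ b₁ b₂ b₃ c₀ c₁ c₂ c₃ d₀ d₁ d₂ d₃ = hyp ↔
    (a₀ * c₀ + b₀ * d₀ = 0 ∧ a₁ * c₁ + b₁ * d₁ = 0 ∧ a₂ * c₂ + b₂ * d₂ = 0 ∧
      a₃ * c₃ + b₃ * d₃ = 0) ∧
    a₀ * c₁ + b₀ * d₁ + c₀ * a₁ + d₀ * b₁ = 0 ∧ a₀ * c₂ + b₀ * d₂ + c₀ * a₂ + d₀ * b₂ = 1 ∧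
    a₀ * c₃ + b₀ * d₃ + c₀ * a₃ + d₀ * b₃ = 0 ∧ a₁ * c₂ + b₁ * d₂ + c₁ * a₂ + d₁ * b₂ = 0 ∧
    a₁ * c₃ + b₁ * d₃ + c₁ * a₃ + d₁ * b₃ = 1 ∧ a₂ * c₃ + b₂ * d₃ + c₂ * a₃ + d₂ * b₃ = 0 := by
  rw [lit_transpose, hyp, lit_mul, lit_mul, lit_inj]
  constructor
  · rintro ⟨⟨h1, h2, h3, h4⟩, ⟨-, h5, h6, h7⟩, ⟨-, -, h8, h9⟩, -, -, -, h10⟩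
    refine ⟨⟨?_, ?_, ?_, ?_⟩, ?_, ?_, ?_, ?_, ?_, ?_⟩ <;> linarith
  · rintro ⟨⟨h1, h2, h3, h4⟩, h5, h6, h7, h8, h9, h10⟩
    refine ⟨⟨?_, ?_, ?_, ?_⟩, ⟨?_, ?_, ?_, ?_⟩, ⟨?_, ?_, ?_, ?_⟩, ?_, ?_, ?_, ?_⟩ <;> linarith

theorem one_mem_orthCentralizer (H M : Mat) : (1 : Mat) ∈ orthCentralizer H M := by
  simp [orthCentralizer]

theorem neg_mem_orthCentralizer {H M A : Mat} (hA : A ∈ orthCentralizer H M) :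
    -A ∈ orthCentralizer H M := by
  simpa [orthCentralizer] using hA

theorem mul_mem_orthCentralizer {H M A B : Mat} (hA : A ∈ orthCentralizer H M)
    (hB : B ∈ orthCentralizer H M) : A * B ∈ orthCentralizer H M := by
  refine ⟨?_, ?_⟩
  · calc (A * B)ᵀ * H * (A * B) = Bᵀ * (Aᵀ * H * A) * B := by
          simp only [Matrix.transpose_mul, Matrix.mul_assoc]
      _ = H := by rw [hA.1, hB.1]
  · rw [Matrix.mul_assoc, hB.2, ← Matrix.mul_assoc, hA.2, Matrix.mul_assoc]


theorem eq_one_or_eq_neg_one_of_sq {x : ℝ} (h : x ^ 2 = 1) : x = 1 ∨ x = -1 :=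
  mul_self_eq_one_iff.1 (by rw [← sq, h])

theorem Z1_eq_lit : Z1 = lit 1 0 0 0 0 (-1) 0 0 0 0 (-1) 0 0 0 0 (-1) := diagonal_eq_lit _

theorem Z2_eq_lit : Z2 = lit 1 0 0 0 0 1 0 0 0 0 1 0 0 0 0 (-1) := diagonal_eq_lit _

theorem Z3_eq_lit : Z3 = lit 1 0 0 0 0 (-1) 0 0 0 0 (-1) 0 0 0 0 1 := diagonal_eq_lit _

theorem Z4_eq_lit : Z4 = lit 1 0 0 0 0 (-1) 0 0 0 0 1 0 0 0 0 (-1) := diagonal_eq_lit _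

theorem generated_mul {X : Set Mat} {A B : Mat} (hA : A ∈ generated X) (hB : B ∈ generated X) :
    A * B ∈ generated X := by
  obtain ⟨g, hg, rfl⟩ := hA
  obtain ⟨h, hh, rfl⟩ := hB
  exact ⟨g * h, mul_mem hg hh, rfl⟩

theorem isUnit_of_orth {H A : Mat} (hH : IsUnit H) (hA : Aᵀ * H * A = H) : IsUnit A := by
  rw [Matrix.isUnit_iff_isUnit_det] at hH ⊢
  rw [← hA, Matrix.det_mul] at hH
  exact isUnit_of_mul_isUnit_right hH

theorem eta_mul_eta : eta * eta = 1 := by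
  rw [eta_eq_lit, lit_mul, one_eq_lit]
  norm_num

theorem hyp_mul_hyp : hyp * hyp = 1 := by
  rw [hyp, lit_mul, one_eq_lit]
  norm_num

theorem isUnit_eta : IsUnit eta := IsUnit.of_mul_eq_one _ eta_mul_eta

theorem mem_generated {X : Set Mat} {A : Mat} (hA : A ∈ X) (hu : IsUnit A) : A ∈ generated X :=
  ⟨hu.unit, Subgroup.subset_closure hA, rfl⟩

/-- The invertible elements of `orthCentralizer H M` form a group, so only the generators need
checking. -/
theorem generated_subset_orthCentralizer {H M : Mat} {X : Set Mat}
    (hX : X ⊆ orthCentralizer H M) : generated X ⊆ orthCentralizer H M := by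
  rintro A ⟨g, hg, rfl⟩
  induction hg using Subgroup.closure_induction with
  | mem g hg => exact hX hg
  | one => exact one_mem_orthCentralizer H M
  | mul g h _ _ hg hh => exact mul_mem_orthCentralizer hg hh
  | inv g _ hg =>
    have h1 : (g : Mat) * ((g⁻¹ : GL (Fin 4) ℝ) : Mat) = 1 := by
      rw [← Units.val_mul]; simp
    have h2 : ((g⁻¹ : GL (Fin 4) ℝ) : Mat)ᵀ * (g : Mat)ᵀ = 1 := by
      rw [← Matrix.transpose_mul, h1, Matrix.transpose_one]
    refine ⟨?_, ?_⟩
    · calc ((g⁻¹ : GL (Fin 4) ℝ) : Mat)ᵀ * H * ((g⁻¹ : GL (Fin 4) ℝ) : Mat)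
          = ((g⁻¹ : GL (Fin 4) ℝ) : Mat)ᵀ * ((g : Mat)ᵀ * H * (g : Mat)) *
              ((g⁻¹ : GL (Fin 4) ℝ) : Mat) := by rw [hg.1]
        _ = (((g⁻¹ : GL (Fin 4) ℝ) : Mat)ᵀ * (g : Mat)ᵀ) * H *
              ((g : Mat) * ((g⁻¹ : GL (Fin 4) ℝ) : Mat)) := by simp only [Matrix.mul_assoc]
        _ = H := by rw [h1, h2, Matrix.one_mul, Matrix.mul_one]
    · have h : Commute (g : Mat) M := hg.2
      exact h.units_inv_left

/-! ### Isotropy groups in adapted bases -/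

theorem pair_subset_orthCentralizer (H M : Mat) : {1, -1} ⊆ orthCentralizer H M := by
  rintro A (rfl | rfl)
  exacts [one_mem_orthCentralizer _ _, neg_mem_orthCentralizer (one_mem_orthCentralizer _ _)]

theorem four_subset_orthCentralizer {H M Z : Mat} (hZ : Z ∈ orthCentralizer H M) :
    {1, -1, Z, -Z} ⊆ orthCentralizer H M := by
  rintro A (rfl | rfl | rfl | rfl)
  exacts [one_mem_orthCentralizer _ _, neg_mem_orthCentralizer (one_mem_orthCentralizer _ _), hZ,
    neg_mem_orthCentralizer hZ]

theorem eight_subset_orthCentralizer {H M Z Z' Z'' : Mat} (hZ : Z ∈ orthCentralizer H M)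
    (hZ' : Z' ∈ orthCentralizer H M) (hZ'' : Z'' ∈ orthCentralizer H M) :
    {1, -1, Z, -Z, Z', -Z', Z'', -Z''} ⊆ orthCentralizer H M := by
  rintro A (rfl | rfl | rfl | rfl | rfl | rfl | rfl | rfl)
  exacts [one_mem_orthCentralizer _ _, neg_mem_orthCentralizer (one_mem_orthCentralizer _ _), hZ,
    neg_mem_orthCentralizer hZ, hZ', neg_mem_orthCentralizer hZ', hZ'', neg_mem_orthCentralizer hZ'']

/-- `M` is a single Jordan block, so a matrix commuting with it is a polynomial in `M`, hence
self-adjoint for `hyp`. Orthogonality therefore reads `A² = 1`. Since `A` is a scalar plus a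
nilpotent, this leaves only `±1`. -/
theorem orthCentralizer_formI {e : ℝ} (he : e = 1 ∨ e = -1) (l : ℝ) :
    orthCentralizer hyp (formI e l) = {1, -1} := by
  refine Set.Subset.antisymm (fun A => ?_) ?_
  · obtain ⟨a₀, a₁, a₂, a₃, b₀, b₁, b₂, b₃, c₀, c₁, c₂, c₃, d₀, d₁, d₂, d₃, rfl⟩ := exists_lit A
    simp only [orthCentralizer, Set.mem_ofPred_eq, lit_orth_hyp_iff, formI, lit_mul,
      Set.mem_insert_iff, Set.mem_singleton_iff, one_eq_lit, lit_neg, lit_inj]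
    rintro ⟨⟨⟨_, _, _, _⟩, _, _, _, _, _, _⟩, ⟨_, _, _, _⟩, ⟨_, _, _, _⟩, ⟨_, _, _, _⟩, _, _, _, _⟩
    -- Here and below the relations are solved one entry at a time. An equality of two entries
    -- eliminates the one on the right, so the surviving names shift along the chain.
    obtain rfl : b₀ = 0 := by linarith
    obtain rfl : c₀ = 0 := by linarith
    obtain rfl : d₀ = 0 := by grind
    obtain rfl : c₁ = 0 := by linarith
    obtain rfl : d₁ = 0 := by grind
    obtain rfl : c₃ = 0 := by linarith
    obtain rfl : b₁ = a₀ := by linarith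
    obtain rfl : c₂ = b₁ := by grind
    obtain rfl : d₃ = c₂ := by linarith
    obtain rfl : b₂ = a₃ := by linarith
    obtain rfl : b₃ = e * a₁ := by grind
    obtain rfl : d₂ = a₁ := by grind
    have : d₃ = 1 ∨ d₃ = -1 := eq_one_or_eq_neg_one_of_sq (by linarith)
    obtain rfl : d₂ = 0 := by grind
    obtain rfl : b₂ = 0 := by grind
    obtain rfl : a₂ = 0 := by grind
    grind
  · exact pair_subset_orthCentralizer _ _

/-- The matrices commuting with `M` form an algebra isomorphic to `ℂ[ε]/(ε²)`, consisting of
self-adjoint elements. Orthogonality is again `A² = 1`, which in this local ring has only the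
solutions `±1`. -/
theorem orthCentralizer_formII {b : ℝ} (hb : b ≠ 0) (a : ℝ) :
    orthCentralizer hyp (formII a b) = {1, -1} := by
  refine Set.Subset.antisymm (fun A => ?_) ?_
  · obtain ⟨a₀, a₁, a₂, a₃, b₀, b₁, b₂, b₃, c₀, c₁, c₂, c₃, d₀, d₁, d₂, d₃, rfl⟩ := exists_lit A
    simp only [orthCentralizer, Set.mem_ofPred_eq, lit_orth_hyp_iff, formII, lit_mul,
      Set.mem_insert_iff, Set.mem_singleton_iff, one_eq_lit, lit_neg, lit_inj]
    rintro ⟨⟨⟨_, _, _, _⟩, _, _, _, _, _, _⟩, ⟨_, _, _, _⟩, ⟨_, _, _, _⟩, ⟨_, _, _, _⟩, _, _, _, _⟩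
    obtain rfl : c₀ = 0 := by grind
    obtain rfl : c₁ = 0 := by grind
    obtain rfl : d₀ = 0 := by grind
    obtain rfl : d₁ = 0 := by grind
    obtain rfl : b₁ = a₀ := by grind
    obtain rfl : b₀ = -a₁ := by grind
    obtain rfl : c₂ = b₁ := by grind
    obtain rfl : d₃ = c₂ := by grind
    obtain rfl : c₃ = -a₁ := by grind
    obtain rfl : d₂ = a₁ := by grind
    obtain rfl : b₃ = -a₂ := by grind
    obtain rfl : b₂ = a₃ := by grind
    -- The remaining diagonal block is the complex number `d₃ + i d₂` up to conjugation, with square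
    -- `1`. The real part `d₃² - d₂² = 1` excludes `d₃ = 0`, and the imaginary part then kills `d₂`.
    have : d₃ ≠ 0 := by
      rintro rfl
      nlinarith [sq_nonneg d₂]
    obtain rfl : d₂ = 0 := by grind
    have : d₃ = 1 ∨ d₃ = -1 := eq_one_or_eq_neg_one_of_sq (by linarith)
    obtain rfl : b₂ = 0 := by grind
    obtain rfl : a₂ = 0 := by grind
    grind
  · exact pair_subset_orthCentralizer _ _

theorem orthCentralizer_formIIIa {l m : ℝ} (hlm : l ≠ m) :
    orthCentralizer eta (formIIIa l m) = {1, -1, Z1, -Z1} := by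
  have hr : 1 / √2 ≠ 0 := by positivity
  have hZ : Z1 ∈ orthCentralizer eta (formIIIa l m) := by
    simp only [orthCentralizer, Set.mem_ofPred_eq, lit_orth_eta_iff, formIIIa, lit_mul, lit_inj,
      Z1_eq_lit]
    norm_num
  refine Set.Subset.antisymm (fun A => ?_) ?_
  · obtain ⟨a₀, a₁, a₂, a₃, b₀, b₁, b₂, b₃, c₀, c₁, c₂, c₃, d₀, d₁, d₂, d₃, rfl⟩ := exists_lit A
    unfold formIIIa
    -- The centralizer depends only on `r ≠ 0`; hiding the root keeps the equations polynomial.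
    generalize 1 / √2 = r at hr
    simp only [orthCentralizer, Set.mem_ofPred_eq, lit_orth_eta_iff, lit_mul,
      Set.mem_insert_iff, Set.mem_singleton_iff, one_eq_lit, Z1_eq_lit, lit_neg, lit_inj]
    rintro ⟨⟨⟨_, _, _, _⟩, _, _, _, _, _, _⟩, ⟨_, _, _, _⟩, ⟨_, _, _, _⟩, ⟨_, _, _, _⟩, _, _, _, _⟩
    obtain rfl : a₂ = 0 := by grind
    obtain rfl : a₁ = 0 := by grind
    obtain rfl : a₃ = 0 := by grind
    obtain rfl : c₀ = 0 := by grind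
    obtain rfl : b₀ = 0 := by grind
    obtain rfl : d₀ = 0 := by grind
    obtain rfl : d₂ = b₂ := by grind
    obtain rfl : c₁ = -d₂ := by grind
    obtain rfl : c₃ = d₂ := by grind
    obtain rfl : d₁ = -b₃ := by grind
    obtain rfl : d₃ = c₂ + b₃ := by grind
    obtain rfl : b₁ = c₂ - b₃ := by grind
    have h0 : a₀ = 1 ∨ a₀ = -1 := eq_one_or_eq_neg_one_of_sq (by linarith)
    have h1 : c₂ = 1 ∨ c₂ = -1 := eq_one_or_eq_neg_one_of_sq (by linarith)
    obtain rfl : c₃ = 0 := by grind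
    obtain rfl : b₃ = 0 := by grind
    grind
  · exact four_subset_orthCentralizer hZ

/-- It suffices to write each element as a product of two generators up to sign, because `-1` is
itself a generator. -/
theorem orthCentralizer_eq_generated {M : Mat} {X : Set Mat} (h1 : -1 ∈ X)
    (hX : X ⊆ orthCentralizer eta M)
    (h : ∀ A ∈ orthCentralizer eta M, ∃ B ∈ X, ∃ C ∈ X, A = B * C ∨ A = -(B * C)) :
    orthCentralizer eta M = generated X := by
  refine Set.Subset.antisymm (fun A hA => ?_) (generated_subset_orthCentralizer hX)
  have hg : ∀ B ∈ X, B ∈ generated X :=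
    fun B hB => mem_generated hB (isUnit_of_orth isUnit_eta (hX hB).1)
  obtain ⟨B, hB, C, hC, rfl | rfl⟩ := h A hA
  · exact generated_mul (hg B hB) (hg C hC)
  · simpa using generated_mul (hg _ h1) (generated_mul (hg B hB) (hg C hC))

theorem T1_mem_orthCentralizer (l h : ℝ) : T1 h ∈ orthCentralizer eta (formIIIa l l) := by
  simp only [orthCentralizer, Set.mem_ofPred_eq, lit_orth_eta_iff, formIIIa, T1, lit_mul, lit_inj]
  refine ⟨⟨⟨?_, ?_, ?_, ?_⟩, ?_, ?_, ?_, ?_, ?_, ?_⟩, ⟨?_, ?_, ?_, ?_⟩, ⟨?_, ?_, ?_, ?_⟩,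
    ⟨?_, ?_, ?_, ?_⟩, ?_, ?_, ?_, ?_⟩ <;> ring

theorem Z1_mem_orthCentralizer_formIIIa (l m : ℝ) : Z1 ∈ orthCentralizer eta (formIIIa l m) := by
  simp only [orthCentralizer, Set.mem_ofPred_eq, lit_orth_eta_iff, formIIIa, lit_mul, lit_inj,
    Z1_eq_lit]
  norm_num

/-- After the relations are solved, the matrix is determined by two signs, `a₀` on the first basis
vector and `c₂` on the Jordan block, and by one real number `a₁`. The signs select an element of
`±1, ±Z1`, and `a₁` is the parameter of `T1` up to sign. -/
theorem eq_mul_T1_of_mem_orthCentralizer {l : ℝ} {A : Mat}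
    (hA : A ∈ orthCentralizer eta (formIIIa l l)) :
    ∃ B ∈ ({-1, Z1} : Set Mat), ∃ h, A = B * T1 h ∨ A = -(B * T1 h) := by
  have hr : 1 / √2 ≠ 0 := by positivity
  revert hA
  obtain ⟨a₀, a₁, a₂, a₃, b₀, b₁, b₂, b₃, c₀, c₁, c₂, c₃, d₀, d₁, d₂, d₃, rfl⟩ := exists_lit A
  unfold formIIIa
  generalize 1 / √2 = r at hr
  simp only [orthCentralizer, Set.mem_ofPred_eq, lit_orth_eta_iff, lit_mul, lit_inj]
  rintro ⟨⟨⟨_, _, _, _⟩, _, _, _, _, _, _⟩, ⟨_, _, _, _⟩, ⟨_, _, _, _⟩, ⟨_, _, _, _⟩, _, _, _, _⟩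
  obtain rfl : a₂ = 0 := by grind
  obtain rfl : a₃ = -a₁ := by grind
  obtain rfl : c₀ = 0 := by grind
  obtain rfl : d₀ = b₀ := by grind
  obtain rfl : d₂ = b₂ := by grind
  obtain rfl : c₁ = -d₂ := by grind
  obtain rfl : c₃ = d₂ := by grind
  obtain rfl : d₁ = -b₃ := by grind
  obtain rfl : d₃ = c₂ + b₃ := by grind
  obtain rfl : b₁ = c₂ - b₃ := by grind
  have h0 : a₀ = 1 ∨ a₀ = -1 := eq_one_or_eq_neg_one_of_sq (by linarith)
  have h1 : c₂ = 1 ∨ c₂ = -1 := eq_one_or_eq_neg_one_of_sq (by linarith)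
  obtain rfl : c₃ = 0 := by grind
  simp only [Set.mem_insert_iff, Set.mem_singleton_iff, exists_eq_or_imp, exists_eq_left, T1,
    Z1_eq_lit, one_eq_lit, lit_neg, lit_mul, lit_inj]
  rcases h0 with rfl | rfl <;> rcases h1 with rfl | rfl
  · exact Or.inl ⟨a₁, by grind⟩
  · exact Or.inr ⟨a₁, by grind⟩
  · exact Or.inr ⟨-a₁, by grind⟩
  · exact Or.inl ⟨-a₁, by grind⟩

theorem orthCentralizer_formIIIa_eq_generated (l : ℝ) :
    orthCentralizer eta (formIIIa l l) = generated ({-1, Z1} ∪ Set.range T1) := by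
  refine orthCentralizer_eq_generated (by simp) ?_ fun A hA => ?_
  · rintro A ((rfl | rfl) | ⟨h, rfl⟩)
    exacts [neg_mem_orthCentralizer (one_mem_orthCentralizer _ _),
      Z1_mem_orthCentralizer_formIIIa _ _, T1_mem_orthCentralizer _ _]
  · obtain ⟨B, hB, h, hA⟩ := eq_mul_T1_of_mem_orthCentralizer hA
    exact ⟨B, Or.inl hB, T1 h, Or.inr ⟨h, rfl⟩, hA⟩

theorem T2_mem_orthCentralizer (l h : ℝ) : T2 h ∈ orthCentralizer eta (formIIIb l l) := by
  simp only [orthCentralizer, Set.mem_ofPred_eq, lit_orth_eta_iff, formIIIb, T2, lit_mul, lit_inj]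
  refine ⟨⟨⟨?_, ?_, ?_, ?_⟩, ?_, ?_, ?_, ?_, ?_, ?_⟩, ⟨?_, ?_, ?_, ?_⟩, ⟨?_, ?_, ?_, ?_⟩,
    ⟨?_, ?_, ?_, ?_⟩, ?_, ?_, ?_, ?_⟩ <;> ring

theorem Z2_mem_orthCentralizer_formIIIb (l m : ℝ) : Z2 ∈ orthCentralizer eta (formIIIb l m) := by
  simp only [orthCentralizer, Set.mem_ofPred_eq, lit_orth_eta_iff, formIIIb, lit_mul, lit_inj,
    Z2_eq_lit]
  norm_num

theorem orthCentralizer_formIIIb {l m : ℝ} (hlm : l ≠ m) :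
    orthCentralizer eta (formIIIb l m) = {1, -1, Z2, -Z2} := by
  have hr : 1 / √2 ≠ 0 := by positivity
  refine Set.Subset.antisymm (fun A => ?_)
    (four_subset_orthCentralizer (Z2_mem_orthCentralizer_formIIIb l m))
  obtain ⟨a₀, a₁, a₂, a₃, b₀, b₁, b₂, b₃, c₀, c₁, c₂, c₃, d₀, d₁, d₂, d₃, rfl⟩ := exists_lit A
  unfold formIIIb
  generalize 1 / √2 = r at hr
  simp only [orthCentralizer, Set.mem_ofPred_eq, lit_orth_eta_iff, lit_mul,
    Set.mem_insert_iff, Set.mem_singleton_iff, one_eq_lit, Z2_eq_lit, lit_neg, lit_inj]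
  rintro ⟨⟨⟨_, _, _, _⟩, _, _, _, _, _, _⟩, ⟨_, _, _, _⟩, ⟨_, _, _, _⟩, ⟨_, _, _, _⟩, _, _, _, _⟩
  obtain rfl : b₃ = 0 := by grind
  obtain rfl : a₃ = 0 := by grind
  obtain rfl : c₃ = 0 := by grind
  obtain rfl : d₁ = 0 := by grind
  obtain rfl : d₀ = 0 := by grind
  obtain rfl : d₂ = 0 := by grind
  obtain rfl : b₀ = a₁ := by grind
  obtain rfl : b₂ = -b₀ := by grind
  obtain rfl : c₁ = b₀ := by grind
  obtain rfl : c₀ = -a₂ := by grind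
  obtain rfl : a₀ = b₁ - a₂ := by grind
  obtain rfl : c₂ = b₁ + a₂ := by grind
  have h0 : d₃ = 1 ∨ d₃ = -1 := eq_one_or_eq_neg_one_of_sq (by linarith)
  have h1 : b₁ = 1 ∨ b₁ = -1 := eq_one_or_eq_neg_one_of_sq (by linarith)
  obtain rfl : c₁ = 0 := by grind
  obtain rfl : a₂ = 0 := by grind
  grind

theorem eq_mul_T2_of_mem_orthCentralizer {l : ℝ} {A : Mat}
    (hA : A ∈ orthCentralizer eta (formIIIb l l)) :
    ∃ B ∈ ({-1, Z2} : Set Mat), ∃ h, A = B * T2 h ∨ A = -(B * T2 h) := by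
  have hr : 1 / √2 ≠ 0 := by positivity
  revert hA
  obtain ⟨a₀, a₁, a₂, a₃, b₀, b₁, b₂, b₃, c₀, c₁, c₂, c₃, d₀, d₁, d₂, d₃, rfl⟩ := exists_lit A
  unfold formIIIb
  generalize 1 / √2 = r at hr
  simp only [orthCentralizer, Set.mem_ofPred_eq, lit_orth_eta_iff, lit_mul, lit_inj]
  rintro ⟨⟨⟨_, _, _, _⟩, _, _, _, _, _, _⟩, ⟨_, _, _, _⟩, ⟨_, _, _, _⟩, ⟨_, _, _, _⟩, _, _, _, _⟩
  obtain rfl : b₃ = 0 := by grind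
  obtain rfl : c₃ = a₃ := by grind
  obtain rfl : d₁ = 0 := by grind
  obtain rfl : d₂ = -d₀ := by grind
  obtain rfl : b₀ = a₁ := by grind
  obtain rfl : b₂ = -b₀ := by grind
  obtain rfl : c₁ = b₀ := by grind
  obtain rfl : c₀ = -a₂ := by grind
  obtain rfl : a₀ = b₁ - a₂ := by grind
  obtain rfl : c₂ = b₁ + a₂ := by grind
  have h0 : d₃ = 1 ∨ d₃ = -1 := eq_one_or_eq_neg_one_of_sq (by linarith)
  have h1 : b₁ = 1 ∨ b₁ = -1 := eq_one_or_eq_neg_one_of_sq (by linarith)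
  obtain rfl : c₁ = 0 := by grind
  simp only [Set.mem_insert_iff, Set.mem_singleton_iff, exists_eq_or_imp, exists_eq_left, T2,
    Z2_eq_lit, one_eq_lit, lit_neg, lit_mul, lit_inj]
  rcases h0 with rfl | rfl <;> rcases h1 with rfl | rfl
  · exact Or.inl ⟨d₀, by grind⟩
  · exact Or.inr ⟨d₀, by grind⟩
  · exact Or.inr ⟨-d₀, by grind⟩
  · exact Or.inl ⟨-d₀, by grind⟩

theorem orthCentralizer_formIIIb_eq_generated (l : ℝ) :
    orthCentralizer eta (formIIIb l l) = generated ({-1, Z2} ∪ Set.range T2) := by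
  refine orthCentralizer_eq_generated (by simp) ?_ fun A hA => ?_
  · rintro A ((rfl | rfl) | ⟨h, rfl⟩)
    exacts [neg_mem_orthCentralizer (one_mem_orthCentralizer _ _),
      Z2_mem_orthCentralizer_formIIIb _ _, T2_mem_orthCentralizer _ _]
  · obtain ⟨B, hB, h, hA⟩ := eq_mul_T2_of_mem_orthCentralizer hA
    exact ⟨B, Or.inl hB, T2 h, Or.inr ⟨h, rfl⟩, hA⟩

theorem Z1_mem_orthCentralizer_formIV (e l m n : ℝ) :
    Z1 ∈ orthCentralizer eta (formIV e l m n) := by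
  simp only [orthCentralizer, Set.mem_ofPred_eq, lit_orth_eta_iff, formIV, lit_mul, lit_inj,
    Z1_eq_lit]
  norm_num

theorem Z2_mem_orthCentralizer_formIV (e l m n : ℝ) :
    Z2 ∈ orthCentralizer eta (formIV e l m n) := by
  simp only [orthCentralizer, Set.mem_ofPred_eq, lit_orth_eta_iff, formIV, lit_mul, lit_inj,
    Z2_eq_lit]
  norm_num

theorem Z3_mem_orthCentralizer_formIV (e l m n : ℝ) :
    Z3 ∈ orthCentralizer eta (formIV e l m n) := by
  simp only [orthCentralizer, Set.mem_ofPred_eq, lit_orth_eta_iff, formIV, lit_mul, lit_inj,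
    Z3_eq_lit]
  norm_num

theorem orthCentralizer_formIV {e : ℝ} (he : e = 1 ∨ e = -1) {l m n : ℝ} (hlm : l ≠ m)
    (hmn : m ≠ n) (hln : l ≠ n) :
    orthCentralizer eta (formIV e l m n) = {1, -1, Z1, -Z1, Z2, -Z2, Z3, -Z3} := by
  refine Set.Subset.antisymm (fun A => ?_) (eight_subset_orthCentralizer
    (Z1_mem_orthCentralizer_formIV ..) (Z2_mem_orthCentralizer_formIV ..)
    (Z3_mem_orthCentralizer_formIV ..))
  obtain ⟨a₀, a₁, a₂, a₃, b₀, b₁, b₂, b₃, c₀, c₁, c₂, c₃, d₀, d₁, d₂, d₃, rfl⟩ := exists_lit A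
  simp only [orthCentralizer, Set.mem_ofPred_eq, lit_orth_eta_iff, formIV, lit_mul,
    Set.mem_insert_iff, Set.mem_singleton_iff, one_eq_lit, Z1_eq_lit, Z2_eq_lit, Z3_eq_lit, lit_neg,
    lit_inj]
  rintro ⟨⟨⟨_, _, _, _⟩, _, _, _, _, _, _⟩, ⟨_, _, _, _⟩, ⟨_, _, _, _⟩, ⟨_, _, _, _⟩, _, _, _, _⟩
  obtain rfl : b₀ = 0 := by grind
  obtain rfl : c₀ = 0 := by grind
  obtain rfl : d₀ = 0 := by grind
  obtain rfl : b₃ = 0 := by grind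
  obtain rfl : c₃ = 0 := by grind
  obtain rfl : a₃ = 0 := by grind
  obtain rfl : a₁ = 0 := by grind
  obtain rfl : a₂ = 0 := by grind
  obtain rfl : d₁ = 0 := by grind
  obtain rfl : d₂ = 0 := by grind
  -- A matrix commuting with the Jordan block of size two is a scalar plus a multiple of its
  -- nilpotent part. The scalar is `c₂ - b₂`, and orthogonality makes it `±1`.
  obtain rfl : c₁ = -b₂ := by grind
  obtain rfl : b₁ = c₂ - 2 * b₂ := by grind
  have h0 : a₀ = 1 ∨ a₀ = -1 := eq_one_or_eq_neg_one_of_sq (by linarith)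
  have h3 : d₃ = 1 ∨ d₃ = -1 := eq_one_or_eq_neg_one_of_sq (by linarith)
  have h2 : c₂ - b₂ = 1 ∨ c₂ - b₂ = -1 := eq_one_or_eq_neg_one_of_sq (by linarith)
  obtain rfl : b₂ = 0 := by grind
  rw [sub_zero] at h2
  rcases h0 with rfl | rfl <;> rcases h2 with rfl | rfl <;> rcases h3 with rfl | rfl <;> norm_num

theorem T3_mem_orthCentralizer (e l m k : ℝ) : T3 k ∈ orthCentralizer eta (formIV e l m m) := by
  simp only [orthCentralizer, Set.mem_ofPred_eq, lit_orth_eta_iff, formIV, T3, lit_mul, lit_inj]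
  refine ⟨⟨⟨?_, ?_, ?_, ?_⟩, ?_, ?_, ?_, ?_, ?_, ?_⟩, ⟨?_, ?_, ?_, ?_⟩, ⟨?_, ?_, ?_, ?_⟩,
    ⟨?_, ?_, ?_, ?_⟩, ?_, ?_, ?_, ?_⟩ <;> ring

theorem eq_mul_T3_of_mem_orthCentralizer {e : ℝ} (he : e = 1 ∨ e = -1) {l m : ℝ} (hlm : l ≠ m)
    {A : Mat} (hA : A ∈ orthCentralizer eta (formIV e l m m)) :
    ∃ B ∈ ({-1, Z1, Z2, Z3} : Set Mat), ∃ k, A = B * T3 k ∨ A = -(B * T3 k) := by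
  revert hA
  obtain ⟨a₀, a₁, a₂, a₃, b₀, b₁, b₂, b₃, c₀, c₁, c₂, c₃, d₀, d₁, d₂, d₃, rfl⟩ := exists_lit A
  simp only [orthCentralizer, Set.mem_ofPred_eq, lit_orth_eta_iff, formIV, lit_mul, lit_inj]
  rintro ⟨⟨⟨_, _, _, _⟩, _, _, _, _, _, _⟩, ⟨_, _, _, _⟩, ⟨_, _, _, _⟩, ⟨_, _, _, _⟩, _, _, _, _⟩
  obtain rfl : b₀ = 0 := by grind
  obtain rfl : c₀ = 0 := by grind
  obtain rfl : d₀ = 0 := by grind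
  obtain rfl : a₃ = 0 := by grind
  obtain rfl : a₁ = 0 := by grind
  obtain rfl : a₂ = 0 := by grind
  obtain rfl : c₃ = b₃ := by grind
  obtain rfl : d₂ = -d₁ := by grind
  obtain rfl : c₁ = -b₂ := by grind
  obtain rfl : b₁ = c₂ - 2 * b₂ := by grind
  have h0 : a₀ = 1 ∨ a₀ = -1 := eq_one_or_eq_neg_one_of_sq (by linarith)
  have h3 : d₃ = 1 ∨ d₃ = -1 := eq_one_or_eq_neg_one_of_sq (by linarith)
  have h2 : c₂ - b₂ = 1 ∨ c₂ - b₂ = -1 := eq_one_or_eq_neg_one_of_sq (by linarith)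
  simp only [Set.mem_insert_iff, Set.mem_singleton_iff, exists_eq_or_imp, exists_eq_left, T3,
    Z1_eq_lit, Z2_eq_lit, Z3_eq_lit, one_eq_lit, lit_neg, lit_mul, lit_inj]
  rcases h0 with rfl | rfl <;> rcases h2 with h2 | h2 <;> rcases h3 with rfl | rfl
  · exact Or.inl ⟨d₁, by grind⟩
  · exact Or.inr (Or.inr (Or.inl ⟨-d₁, by grind⟩))
  · exact Or.inr (Or.inr (Or.inr ⟨d₁, by grind⟩))
  · exact Or.inr (Or.inl ⟨-d₁, by grind⟩)
  · exact Or.inr (Or.inl ⟨d₁, by grind⟩)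
  · exact Or.inr (Or.inr (Or.inr ⟨-d₁, by grind⟩))
  · exact Or.inr (Or.inr (Or.inl ⟨d₁, by grind⟩))
  · exact Or.inl ⟨-d₁, by grind⟩

theorem orthCentralizer_formIV_eq_generated_T3 {e : ℝ} (he : e = 1 ∨ e = -1) {l m : ℝ}
    (hlm : l ≠ m) :
    orthCentralizer eta (formIV e l m m) = generated ({-1, Z1, Z2, Z3} ∪ Set.range T3) := by
  refine orthCentralizer_eq_generated (by simp) ?_ fun A hA => ?_
  · rintro A ((rfl | rfl | rfl | rfl) | ⟨h, rfl⟩)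
    exacts [neg_mem_orthCentralizer (one_mem_orthCentralizer _ _),
      Z1_mem_orthCentralizer_formIV .., Z2_mem_orthCentralizer_formIV ..,
      Z3_mem_orthCentralizer_formIV .., T3_mem_orthCentralizer ..]
  · obtain ⟨B, hB, h, hA⟩ := eq_mul_T3_of_mem_orthCentralizer he hlm hA
    exact ⟨B, Or.inl hB, T3 h, Or.inr ⟨h, rfl⟩, hA⟩

theorem T4_mem_orthCentralizer (e m n k : ℝ) : T4 k ∈ orthCentralizer eta (formIV e m m n) := by
  simp only [orthCentralizer, Set.mem_ofPred_eq, lit_orth_eta_iff, formIV, T4, lit_mul, lit_inj]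
  refine ⟨⟨⟨?_, ?_, ?_, ?_⟩, ?_, ?_, ?_, ?_, ?_, ?_⟩, ⟨?_, ?_, ?_, ?_⟩, ⟨?_, ?_, ?_, ?_⟩,
    ⟨?_, ?_, ?_, ?_⟩, ?_, ?_, ?_, ?_⟩ <;> ring

theorem eq_mul_T4_of_mem_orthCentralizer {e : ℝ} (he : e = 1 ∨ e = -1) {m n : ℝ} (hmn : m ≠ n)
    {A : Mat} (hA : A ∈ orthCentralizer eta (formIV e m m n)) :
    ∃ B ∈ ({-1, Z1, Z2, Z3} : Set Mat), ∃ k, A = B * T4 k ∨ A = -(B * T4 k) := by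
  revert hA
  obtain ⟨a₀, a₁, a₂, a₃, b₀, b₁, b₂, b₃, c₀, c₁, c₂, c₃, d₀, d₁, d₂, d₃, rfl⟩ := exists_lit A
  simp only [orthCentralizer, Set.mem_ofPred_eq, lit_orth_eta_iff, formIV, lit_mul, lit_inj]
  rintro ⟨⟨⟨_, _, _, _⟩, _, _, _, _, _, _⟩, ⟨_, _, _, _⟩, ⟨_, _, _, _⟩, ⟨_, _, _, _⟩, _, _, _, _⟩
  obtain rfl : b₃ = 0 := by grind
  obtain rfl : c₃ = 0 := by grind
  obtain rfl : a₃ = 0 := by grind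
  obtain rfl : d₀ = 0 := by grind
  obtain rfl : d₁ = 0 := by grind
  obtain rfl : d₂ = 0 := by grind
  obtain rfl : c₀ = b₀ := by grind
  obtain rfl : a₂ = -a₁ := by grind
  obtain rfl : c₁ = -b₂ := by grind
  obtain rfl : b₁ = c₂ - 2 * b₂ := by grind
  have h0 : a₀ = 1 ∨ a₀ = -1 := eq_one_or_eq_neg_one_of_sq (by linarith)
  have h3 : d₃ = 1 ∨ d₃ = -1 := eq_one_or_eq_neg_one_of_sq (by linarith)
  have h2 : c₂ - b₂ = 1 ∨ c₂ - b₂ = -1 := eq_one_or_eq_neg_one_of_sq (by linarith)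
  simp only [Set.mem_insert_iff, Set.mem_singleton_iff, exists_eq_or_imp, exists_eq_left, T4,
    Z1_eq_lit, Z2_eq_lit, Z3_eq_lit, one_eq_lit, lit_neg, lit_mul, lit_inj]
  rcases h0 with rfl | rfl <;> rcases h2 with h2 | h2 <;> rcases h3 with rfl | rfl
  · exact Or.inl ⟨-a₁, by grind⟩
  · exact Or.inr (Or.inr (Or.inl ⟨-a₁, by grind⟩))
  · exact Or.inr (Or.inr (Or.inr ⟨-a₁, by grind⟩))
  · exact Or.inr (Or.inl ⟨-a₁, by grind⟩)
  · exact Or.inr (Or.inl ⟨a₁, by grind⟩)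
  · exact Or.inr (Or.inr (Or.inr ⟨a₁, by grind⟩))
  · exact Or.inr (Or.inr (Or.inl ⟨a₁, by grind⟩))
  · exact Or.inl ⟨a₁, by grind⟩

theorem orthCentralizer_formIV_eq_generated_T4 {e : ℝ} (he : e = 1 ∨ e = -1) {m n : ℝ}
    (hmn : m ≠ n) :
    orthCentralizer eta (formIV e m m n) = generated ({-1, Z1, Z2, Z3} ∪ Set.range T4) := by
  refine orthCentralizer_eq_generated (by simp) ?_ fun A hA => ?_
  · rintro A ((rfl | rfl | rfl | rfl) | ⟨h, rfl⟩)
    exacts [neg_mem_orthCentralizer (one_mem_orthCentralizer _ _),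
      Z1_mem_orthCentralizer_formIV .., Z2_mem_orthCentralizer_formIV ..,
      Z3_mem_orthCentralizer_formIV .., T4_mem_orthCentralizer ..]
  · obtain ⟨B, hB, h, hA⟩ := eq_mul_T4_of_mem_orthCentralizer he hmn hA
    exact ⟨B, Or.inl hB, T4 h, Or.inr ⟨h, rfl⟩, hA⟩

/-! ### Isotropy groups described by groups of two-by-two matrices -/

theorem mem_orth_two_iff {d : Fin 2 → ℝ} {A : Matrix (Fin 2) (Fin 2) ℝ} :
    A ∈ orth d ↔ d 0 * A 0 0 ^ 2 + d 1 * A 1 0 ^ 2 = d 0 ∧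
      d 0 * A 0 0 * A 0 1 + d 1 * A 1 0 * A 1 1 = 0 ∧
      d 0 * A 0 1 ^ 2 + d 1 * A 1 1 ^ 2 = d 1 := by
  simp only [orth, Set.mem_ofPred_eq, ← Matrix.ext_iff, Fin.forall_fin_two, Matrix.mul_apply,
    Fin.sum_univ_two, Matrix.transpose_apply, Matrix.diagonal_apply]
  norm_num
  grind

theorem mem_O2_iff {A : Matrix (Fin 2) (Fin 2) ℝ} :
    A ∈ O2 ↔ A 0 0 ^ 2 + A 1 0 ^ 2 = 1 ∧ A 0 0 * A 0 1 + A 1 0 * A 1 1 = 0 ∧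
      A 0 1 ^ 2 + A 1 1 ^ 2 = 1 := by
  simp [O2, mem_orth_two_iff]

theorem mem_O11_iff {A : Matrix (Fin 2) (Fin 2) ℝ} :
    A ∈ O11 ↔ A 0 0 ^ 2 - A 1 0 ^ 2 = 1 ∧ A 0 0 * A 0 1 - A 1 0 * A 1 1 = 0 ∧
      A 0 1 ^ 2 - A 1 1 ^ 2 = -1 := by
  simp [O11, mem_orth_two_iff, ← sub_eq_add_neg]

/-- The eigenvalue `l` is semisimple with eigenspace an `ℝ^{1,1}` spanned by the outer coordinates,
on which the full `O(1,1)` acts. The Jordan block for `m ≠ l` contributes only a sign. -/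
theorem orthCentralizer_formIV_eq_isoT5 {e : ℝ} (he : e = 1 ∨ e = -1) {l m : ℝ} (hlm : l ≠ m) :
    orthCentralizer eta (formIV e l m l) = isoT5 := by
  refine Set.Subset.antisymm (fun A => ?_) ?_
  · obtain ⟨a₀, a₁, a₂, a₃, b₀, b₁, b₂, b₃, c₀, c₁, c₂, c₃, d₀, d₁, d₂, d₃, rfl⟩ := exists_lit A
    simp only [orthCentralizer, Set.mem_ofPred_eq, lit_orth_eta_iff, formIV, lit_mul, lit_inj]
    rintro ⟨⟨⟨_, _, _, _⟩, _, _, _, _, _, _⟩, ⟨_, _, _, _⟩, ⟨_, _, _, _⟩, ⟨_, _, _, _⟩, _, _, _, _⟩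
    obtain rfl : b₀ = 0 := by grind
    obtain rfl : c₀ = 0 := by grind
    obtain rfl : b₃ = 0 := by grind
    obtain rfl : c₃ = 0 := by grind
    obtain rfl : a₁ = 0 := by grind
    obtain rfl : a₂ = 0 := by grind
    obtain rfl : d₁ = 0 := by grind
    obtain rfl : d₂ = 0 := by grind
    obtain rfl : c₁ = -b₂ := by grind
    obtain rfl : b₁ = c₂ - 2 * b₂ := by grind
    have h2 : c₂ - b₂ = 1 ∨ c₂ - b₂ = -1 := eq_one_or_eq_neg_one_of_sq (by linarith)
    obtain rfl : b₂ = 0 := by grind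
    refine ⟨!![a₀, a₃; d₀, d₃], ?_, c₂, ?_, ?_⟩
    · rw [mem_O11_iff]
      simp
      grind
    · simpa using h2
    · simp
  · rintro A ⟨L, hL, s, hs, rfl⟩
    rw [mem_O11_iff] at hL
    generalize L 0 0 = α, L 0 1 = γ, L 1 0 = β, L 1 1 = δ at *
    simp only [orthCentralizer, Set.mem_ofPred_eq, lit_orth_eta_iff, formIV, lit_mul, lit_inj]
    rcases hs with rfl | rfl <;> grind

theorem orthCentralizer_formV_eq_isoT5 {b : ℝ} (hb : b ≠ 0) (l a : ℝ) :
    orthCentralizer eta (formV l a b l) = isoT5 := by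
  refine Set.Subset.antisymm (fun A => ?_) ?_
  · obtain ⟨a₀, a₁, a₂, a₃, b₀, b₁, b₂, b₃, c₀, c₁, c₂, c₃, d₀, d₁, d₂, d₃, rfl⟩ := exists_lit A
    simp only [orthCentralizer, Set.mem_ofPred_eq, lit_orth_eta_iff, formV, lit_mul, lit_inj]
    rintro ⟨⟨⟨_, _, _, _⟩, _, _, _, _, _, _⟩, ⟨_, _, _, _⟩, ⟨_, _, _, _⟩, ⟨_, _, _, _⟩, _, _, _, _⟩
    have hq : (l - a) ^ 2 + b ^ 2 ≠ 0 := by positivity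
    -- The system has determinant `(l - a)² + b²`, nonzero because the eigenvalues `a ± ib` are not
    -- real. It shows that nothing intertwines the real eigenvalue `l` with the rotation block.
    have key : ∀ x y : ℝ, (l - a) * x = b * y → (l - a) * y = -b * x → x = 0 ∧ y = 0 := by
      intro x y h h'
      exact ⟨by grind, by grind⟩
    obtain ⟨rfl, rfl⟩ := key b₀ c₀ (by linarith) (by linarith)
    obtain ⟨rfl, rfl⟩ := key b₃ c₃ (by linarith) (by linarith)
    obtain ⟨rfl, rfl⟩ := key a₂ a₁ (by linarith) (by linarith)
    obtain ⟨rfl, rfl⟩ := key d₂ d₁ (by linarith) (by linarith)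
    obtain rfl : c₁ = -b₂ := by grind
    obtain rfl : b₁ = c₂ := by grind
    have h1 : b₁ ≠ 0 := by
      rintro rfl
      nlinarith [sq_nonneg b₂]
    obtain rfl : b₂ = 0 := by grind
    have h2 : b₁ = 1 ∨ b₁ = -1 := eq_one_or_eq_neg_one_of_sq (by linarith)
    refine ⟨!![a₀, a₃; d₀, d₃], ?_, b₁, h2, ?_⟩
    · rw [mem_O11_iff]
      simp
      grind
    · simp
  · rintro A ⟨L, hL, s, hs, rfl⟩
    rw [mem_O11_iff] at hL
    generalize L 0 0 = α, L 0 1 = γ, L 1 0 = β, L 1 1 = δ at *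
    simp only [orthCentralizer, Set.mem_ofPred_eq, lit_orth_eta_iff, formV, lit_mul, lit_inj]
    rcases hs with rfl | rfl <;> grind

theorem orthCentralizer_formV {l a b n : ℝ} (hb : b ≠ 0) (hln : l ≠ n) :
    orthCentralizer eta (formV l a b n) = {1, -1, Z1, -Z1, Z2, -Z2, Z3, -Z3} := by
  refine Set.Subset.antisymm (fun A => ?_) (eight_subset_orthCentralizer ?_ ?_ ?_)
  · obtain ⟨a₀, a₁, a₂, a₃, b₀, b₁, b₂, b₃, c₀, c₁, c₂, c₃, d₀, d₁, d₂, d₃, rfl⟩ := exists_lit A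
    simp only [orthCentralizer, Set.mem_ofPred_eq, lit_orth_eta_iff, formV, lit_mul,
      Set.mem_insert_iff, Set.mem_singleton_iff, one_eq_lit, Z1_eq_lit, Z2_eq_lit, Z3_eq_lit,
      lit_neg, lit_inj]
    rintro ⟨⟨⟨_, _, _, _⟩, _, _, _, _, _, _⟩, ⟨_, _, _, _⟩, ⟨_, _, _, _⟩, ⟨_, _, _, _⟩, _, _, _, _⟩
    have key : ∀ l x y : ℝ, (l - a) * x = b * y → (l - a) * y = -b * x → x = 0 ∧ y = 0 := by
      intro l x y h h'
      have hq : (l - a) ^ 2 + b ^ 2 ≠ 0 := by positivity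
      exact ⟨by grind, by grind⟩
    obtain ⟨rfl, rfl⟩ := key l b₀ c₀ (by linarith) (by linarith)
    obtain ⟨rfl, rfl⟩ := key n b₃ c₃ (by linarith) (by linarith)
    obtain ⟨rfl, rfl⟩ := key l a₂ a₁ (by linarith) (by linarith)
    obtain ⟨rfl, rfl⟩ := key n d₂ d₁ (by linarith) (by linarith)
    obtain rfl : a₃ = 0 := by grind
    obtain rfl : d₀ = 0 := by grind
    obtain rfl : c₁ = -b₂ := by grind
    obtain rfl : b₁ = c₂ := by grind
    have h1 : b₁ ≠ 0 := by
      rintro rfl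
      nlinarith [sq_nonneg b₂]
    obtain rfl : b₂ = 0 := by grind
    have h0 : a₀ = 1 ∨ a₀ = -1 := eq_one_or_eq_neg_one_of_sq (by linarith)
    have h3 : d₃ = 1 ∨ d₃ = -1 := eq_one_or_eq_neg_one_of_sq (by linarith)
    have h2 : b₁ = 1 ∨ b₁ = -1 := eq_one_or_eq_neg_one_of_sq (by linarith)
    rcases h0 with rfl | rfl <;> rcases h2 with rfl | rfl <;> rcases h3 with rfl | rfl <;> norm_num
  all_goals
    simp only [orthCentralizer, Set.mem_ofPred_eq, lit_orth_eta_iff, formV, lit_mul, lit_inj,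
      Z1_eq_lit, Z2_eq_lit, Z3_eq_lit]
    norm_num

theorem orthCentralizer_formVI {e : ℝ} (he : e = 1 ∨ e = -1) {b : ℝ} (hb : b ≠ 0) (l a : ℝ) :
    orthCentralizer eta (formVI e l a b) = {1, -1, Z3, -Z3} := by
  refine Set.Subset.antisymm (fun A => ?_) (four_subset_orthCentralizer ?_)
  · obtain ⟨a₀, a₁, a₂, a₃, b₀, b₁, b₂, b₃, c₀, c₁, c₂, c₃, d₀, d₁, d₂, d₃, rfl⟩ := exists_lit A
    simp only [orthCentralizer, Set.mem_ofPred_eq, lit_orth_eta_iff, formVI, lit_mul,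
      Set.mem_insert_iff, Set.mem_singleton_iff, one_eq_lit, Z3_eq_lit, lit_neg, lit_inj]
    rintro ⟨⟨⟨_, _, _, _⟩, _, _, _, _, _, _⟩, ⟨_, _, _, _⟩, ⟨_, _, _, _⟩, ⟨_, _, _, _⟩, _, _, _, _⟩
    have key : ∀ x y : ℝ, (l - a) * x = b * y → (l - a) * y = -b * x → x = 0 ∧ y = 0 := by
      intro x y h h'
      have hq : (l - a) ^ 2 + b ^ 2 ≠ 0 := by positivity
      exact ⟨by grind, by grind⟩
    -- The sum of the outer columns is the image of the eigenvector `E₁ + E₄` for `l`, so `key`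
    -- applies to it first. Once it vanishes in the inner coordinates, `key` applies to each column
    -- alone. Below, the difference of the outer rows plays the same part as a left eigenvector.
    obtain ⟨h1, h2⟩ := key (b₀ + b₃) (c₀ + c₃) (by linarith) (by linarith)
    obtain rfl : b₃ = -b₀ := by linarith
    obtain rfl : c₃ = -c₀ := by linarith
    obtain ⟨rfl, rfl⟩ := key b₀ c₀ (by linarith) (by linarith)
    obtain ⟨h3, h4⟩ := key (a₂ - d₂) (a₁ - d₁) (by linarith) (by linarith)
    obtain rfl : d₂ = a₂ := by linarith
    obtain rfl : d₁ = a₁ := by linarith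
    obtain ⟨rfl, rfl⟩ := key d₂ d₁ (by linarith) (by linarith)
    obtain rfl : c₁ = -b₂ := by grind
    obtain rfl : b₁ = c₂ := by grind
    have h1 : b₁ ≠ 0 := by
      rintro rfl
      nlinarith [sq_nonneg b₂]
    obtain rfl : b₂ = 0 := by grind
    obtain rfl : d₀ = -a₃ := by grind
    obtain rfl : a₀ = d₃ - 2 * a₃ := by grind
    have h0 : d₃ - a₃ = 1 ∨ d₃ - a₃ = -1 := eq_one_or_eq_neg_one_of_sq (by linarith)
    have h2 : b₁ = 1 ∨ b₁ = -1 := eq_one_or_eq_neg_one_of_sq (by linarith)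
    obtain rfl : a₃ = 0 := by grind
    rw [sub_zero] at h0
    rcases h0 with rfl | rfl <;> rcases h2 with rfl | rfl <;> norm_num
  · simp only [orthCentralizer, Set.mem_ofPred_eq, lit_orth_eta_iff, formVI, lit_mul, lit_inj,
      Z3_eq_lit]
    norm_num

theorem orthCentralizer_formVII {e w : ℝ} (he : e = 1 ∨ e = -1) (hw : w = 1 ∨ w = -1) {l m : ℝ}
    (hlm : l ≠ m) : orthCentralizer hyp (formVII e w l m) = {1, -1, Z4, -Z4} := by
  refine Set.Subset.antisymm (fun A => ?_) (four_subset_orthCentralizer ?_)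
  · obtain ⟨a₀, a₁, a₂, a₃, b₀, b₁, b₂, b₃, c₀, c₁, c₂, c₃, d₀, d₁, d₂, d₃, rfl⟩ := exists_lit A
    simp only [orthCentralizer, Set.mem_ofPred_eq, lit_orth_hyp_iff, formVII, lit_mul,
      Set.mem_insert_iff, Set.mem_singleton_iff, one_eq_lit, Z4_eq_lit, lit_neg, lit_inj]
    rintro ⟨⟨⟨_, _, _, _⟩, _, _, _, _, _, _⟩, ⟨_, _, _, _⟩, ⟨_, _, _, _⟩, ⟨_, _, _, _⟩, _, _, _, _⟩
    obtain rfl : d₀ = 0 := by grind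
    obtain rfl : c₁ = 0 := by grind
    obtain rfl : c₀ = 0 := by grind
    obtain rfl : d₁ = 0 := by grind
    obtain rfl : b₀ = 0 := by grind
    obtain rfl : a₁ = 0 := by grind
    obtain rfl : d₂ = 0 := by grind
    obtain rfl : c₃ = 0 := by grind
    obtain rfl : b₂ = 0 := by grind
    obtain rfl : a₃ = 0 := by grind
    obtain rfl : c₂ = a₀ := by grind
    obtain rfl : d₃ = b₁ := by grind
    have h0 : c₂ = 1 ∨ c₂ = -1 := eq_one_or_eq_neg_one_of_sq (by linarith)
    have h3 : d₃ = 1 ∨ d₃ = -1 := eq_one_or_eq_neg_one_of_sq (by linarith)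
    obtain rfl : a₂ = 0 := by grind
    obtain rfl : b₃ = 0 := by grind
    rcases h0 with rfl | rfl <;> rcases h3 with rfl | rfl <;> norm_num
  · simp only [orthCentralizer, Set.mem_ofPred_eq, lit_orth_hyp_iff, formVII, lit_mul, lit_inj,
      Z4_eq_lit]
    norm_num

/-- An off-diagonal block intertwines two real `2 × 2` blocks with eigenvalues `a ± ib` and `c ±
id`. Its complex-linear and conjugate-linear parts decouple and vanish when `(c - a)² + (b - d)²`
and `(c - a)² + (b + d)²` are nonzero, that is, when the two spectra are disjoint. Each diagonal
block is then a complex number of square `1`. -/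
theorem orthCentralizer_formVIII {a b c d : ℝ} (hb : b ≠ 0) (hd : d ≠ 0)
    (h : a ≠ c ∨ (b ≠ d ∧ b ≠ -d)) :
    orthCentralizer eta (formVIII a b c d) = {1, -1, Z4, -Z4} := by
  refine Set.Subset.antisymm (fun A => ?_) (four_subset_orthCentralizer ?_)
  · obtain ⟨a₀, a₁, a₂, a₃, b₀, b₁, b₂, b₃, c₀, c₁, c₂, c₃, d₀, d₁, d₂, d₃, rfl⟩ := exists_lit A
    simp only [orthCentralizer, Set.mem_ofPred_eq, lit_orth_eta_iff, formVIII, lit_mul,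
      Set.mem_insert_iff, Set.mem_singleton_iff, one_eq_lit, Z4_eq_lit, lit_neg, lit_inj]
    rintro ⟨⟨⟨_, _, _, _⟩, _, _, _, _, _, _⟩, ⟨_, _, _, _⟩, ⟨_, _, _, _⟩, ⟨_, _, _, _⟩, _, _, _, _⟩
    have key2 : ∀ r x y : ℝ, (c - a) ^ 2 + r ^ 2 ≠ 0 → (c - a) * x = r * y →
        (c - a) * y = -r * x → x = 0 ∧ y = 0 := by
      intro r x y hr h h'
      exact ⟨by grind, by grind⟩
    have hm : (c - a) ^ 2 + (b - d) ^ 2 ≠ 0 := by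
      rcases h with h | h
      · have : c - a ≠ 0 := sub_ne_zero.2 h.symm
        positivity
      · have : b - d ≠ 0 := sub_ne_zero.2 h.1
        positivity
    have hp : (c - a) ^ 2 + (b + d) ^ 2 ≠ 0 := by
      rcases h with h | h
      · have : c - a ≠ 0 := sub_ne_zero.2 h.symm
        positivity
      · have : b + d ≠ 0 := fun h' => h.2 (by linarith)
        positivity
    have key : ∀ x y z w : ℝ, (c - a) * x = b * z + d * y → (c - a) * y = b * w - d * x →
        (c - a) * z = -b * x + d * w → (c - a) * w = -b * y - d * z →
        x = 0 ∧ y = 0 ∧ z = 0 ∧ w = 0 := by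
      intro x y z w h1 h2 h3 h4
      -- `x + w` and `z - y` are the coordinates of the complex-linear part; `x - w` and `z + y` are
      -- those of the conjugate-linear part.
      obtain ⟨h5, h6⟩ := key2 (b - d) (x + w) (z - y) hm (by linarith) (by linarith)
      obtain ⟨h7, h8⟩ := key2 (b + d) (x - w) (z + y) hp (by linarith) (by linarith)
      refine ⟨?_, ?_, ?_, ?_⟩ <;> linarith
    obtain ⟨rfl, rfl, rfl, rfl⟩ := key a₁ a₃ c₁ c₃ (by linarith) (by linarith) (by linarith)
      (by linarith)
    obtain ⟨rfl, h1, h2, rfl⟩ := key b₀ (-d₀) (-b₂) d₂ (by linarith) (by linarith) (by linarith)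
      (by linarith)
    obtain rfl : d₀ = 0 := neg_eq_zero.1 h1
    obtain rfl : b₂ = 0 := neg_eq_zero.1 h2
    obtain rfl : c₀ = -a₂ := by grind
    obtain rfl : c₂ = a₀ := by grind
    obtain rfl : d₁ = -b₃ := by grind
    obtain rfl : d₃ = b₁ := by grind
    have h1 : c₂ ≠ 0 := by
      rintro rfl
      nlinarith [sq_nonneg a₂]
    have h2 : d₃ ≠ 0 := by
      rintro rfl
      nlinarith [sq_nonneg b₃]
    obtain rfl : a₂ = 0 := by grind
    obtain rfl : b₃ = 0 := by grind
    have h0 : c₂ = 1 ∨ c₂ = -1 := eq_one_or_eq_neg_one_of_sq (by linarith)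
    have h3 : d₃ = 1 ∨ d₃ = -1 := eq_one_or_eq_neg_one_of_sq (by linarith)
    rcases h0 with rfl | rfl <;> rcases h3 with rfl | rfl <;> norm_num
  · simp only [orthCentralizer, Set.mem_ofPred_eq, lit_orth_eta_iff, formVIII, lit_mul, lit_inj,
      Z4_eq_lit]
    norm_num

theorem O11_rows {α β γ δ : ℝ} (h1 : α ^ 2 - β ^ 2 = 1) (h2 : α * γ - β * δ = 0)
    (h3 : γ ^ 2 - δ ^ 2 = -1) :
    α ^ 2 - γ ^ 2 = 1 ∧ α * β - γ * δ = 0 ∧ β ^ 2 - δ ^ 2 = -1 := by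
  -- Square `α γ = β δ` and insert `α² = 1 + β²`, `δ² = 1 + γ²`.
  have h4 : γ ^ 2 = β ^ 2 := by grind
  have hα : α ≠ 0 := by
    rintro rfl
    nlinarith [sq_nonneg β]
  have h5 : α * (α * β - γ * δ) = 0 := by grind
  exact ⟨by linarith, (mul_eq_zero.1 h5).resolve_left hα, by linarith⟩

/-- Here `M - l` is `v ↦ (e/2) s(v, n) n` for the null vector `n = E₂ + E₃`, so an orthogonal matrix
commutes with it exactly when it sends `n` to `±n`. In `isoT6` the number `s` is this sign, `L` is
the action on `n^⊥ / n ≅ ℝ^{1,1}`, and `e`, `k` are the two translation parameters. -/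
theorem orthCentralizer_formIV_eq_isoT6 {e : ℝ} (he : e = 1 ∨ e = -1) (l : ℝ) :
    orthCentralizer eta (formIV e l l l) = isoT6 := by
  refine Set.Subset.antisymm (fun A => ?_) ?_
  · obtain ⟨a₀, a₁, a₂, a₃, b₀, b₁, b₂, b₃, c₀, c₁, c₂, c₃, d₀, d₁, d₂, d₃, rfl⟩ := exists_lit A
    simp only [orthCentralizer, Set.mem_ofPred_eq, lit_orth_eta_iff, formIV, lit_mul, lit_inj]
    rintro ⟨⟨⟨_, _, _, _⟩, _, _, _, _, _, _⟩, ⟨_, _, _, _⟩, ⟨_, _, _, _⟩, ⟨_, _, _, _⟩, _, _, _, _⟩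
    obtain rfl : c₀ = b₀ := by grind
    obtain rfl : c₃ = b₃ := by grind
    obtain rfl : a₂ = -a₁ := by grind
    obtain rfl : d₂ = -d₁ := by grind
    obtain rfl : c₁ = -b₂ := by grind
    obtain ⟨s, rfl⟩ : ∃ s, c₂ = s + b₂ := ⟨c₂ - b₂, by ring⟩
    obtain rfl : b₁ = s - b₂ := by grind
    have h2 : s = 1 ∨ s = -1 := eq_one_or_eq_neg_one_of_sq (by linarith)
    obtain ⟨r1, r2, r3⟩ := O11_rows (α := a₀) (β := d₀) (γ := a₃) (δ := d₃) (by linarith)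
      (by linarith) (by linarith)
    -- `k1` and `k2` are linear equations for `a₁`, `d₁` whose coefficient matrix comes from `L`.
    -- The row relations `r1`–`r3` invert it, which produces the vector `(F, G)` in the definition
    -- of `isoT6`.
    have k1 : a₀ * a₁ + c₀ * s - d₀ * d₁ = 0 := by linarith
    have k2 : a₃ * a₁ + c₃ * s - d₃ * d₁ = 0 := by linarith
    have h3 : a₁ = -(s * (a₀ * c₀ - a₃ * c₃)) := by
      linear_combination a₀ * k1 - a₃ * k2 - a₁ * r1 + d₁ * r2
    have h4 : d₁ = -(s * (d₀ * c₀ - d₃ * c₃)) := by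
      linear_combination d₀ * k1 - d₃ * k2 - a₁ * r2 + d₁ * r3
    have h5 : a₁ ^ 2 - d₁ ^ 2 = c₀ ^ 2 - c₃ ^ 2 := by
      rcases h2 with rfl | rfl <;> grind
    refine ⟨!![a₀, a₃; d₀, d₃], ?_, c₀, c₃, a₀ * c₀ - a₃ * c₃, d₀ * c₀ - d₃ * c₃, s, h2, ?_, ?_, ?_⟩
    · rw [mem_O11_iff]
      simp
      grind
    · simp
    · simp
    · simp only [lit_inj]
      simp
      rcases h2 with rfl | rfl <;> grind
  · rintro A ⟨L, hL, g, k, F, G, s, hs, hF, hG, rfl⟩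
    rw [mem_O11_iff] at hL
    generalize L 0 0 = α, L 0 1 = γ, L 1 0 = β, L 1 1 = δ at *
    simp only [orthCentralizer, Set.mem_ofPred_eq, lit_orth_eta_iff, formIV, lit_mul, lit_inj]
    obtain ⟨h1, h2, h3⟩ := hL
    -- `L` preserves the form `diag(1, -1)`, so `(F, G)` has the same norm as `(g, -k)`; `h5` and
    -- `h6` recover `g` and `k` by the inverse of `L`.
    have h4 : F ^ 2 - G ^ 2 = g ^ 2 - k ^ 2 := by
      subst hF hG
      linear_combination g ^ 2 * h1 + k ^ 2 * h3 - 2 * g * k * h2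
    have h5 : α * F - β * G = g := by
      subst hF hG
      linear_combination g * h1 - k * h2
    have h6 : γ * F - δ * G = k := by
      subst hF hG
      linear_combination g * h2 - k * h3
    clear hF hG
    rcases hs with rfl | rfl
    · refine ⟨⟨⟨?_, ?_, ?_, ?_⟩, ?_, ?_, ?_, ?_, ?_, ?_⟩, ⟨?_, ?_, ?_, ?_⟩, ⟨?_, ?_, ?_, ?_⟩,
        ⟨?_, ?_, ?_, ?_⟩, ?_, ?_, ?_, ?_⟩ <;> grind
    · refine ⟨⟨⟨?_, ?_, ?_, ?_⟩, ?_, ?_, ?_, ?_, ?_, ?_⟩, ⟨?_, ?_, ?_, ?_⟩, ⟨?_, ?_, ?_, ?_⟩,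
        ⟨?_, ?_, ?_, ?_⟩, ?_, ?_, ?_, ?_⟩ <;> grind

theorem inv_transpose_of_mem_O2 {A : Matrix (Fin 2) (Fin 2) ℝ} (hA : A ∈ O2) : (Aᵀ)⁻¹ = A := by
  have h : Aᵀ * A = 1 := by
    have h : Aᵀ * Matrix.diagonal ![1, 1] * A = Matrix.diagonal ![1, 1] := hA
    have h1 : (Matrix.diagonal ![1, 1] : Matrix (Fin 2) (Fin 2) ℝ) = 1 := by
      rw [← Matrix.diagonal_one]
      congr 1
      ext i
      fin_cases i <;> rfl
    rwa [h1, Matrix.mul_one] at h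
  exact Matrix.inv_eq_right_inv h

theorem inv_transpose_of_mem_O11 {A : Matrix (Fin 2) (Fin 2) ℝ} (hA : A ∈ O11) :
    (Aᵀ)⁻¹ = !![A 0 0, -A 0 1; -A 1 0, A 1 1] := by
  rw [mem_O11_iff] at hA
  refine Matrix.inv_eq_right_inv ?_
  ext i j
  fin_cases i <;> fin_cases j <;>
    simp [Matrix.mul_apply, Fin.sum_univ_two] <;> grind

theorem blocks_isoVII (A B : Matrix (Fin 2) (Fin 2) ℝ) (t : ℝ) :
    blocks A (t • (A * !![0, -1; 1, 0])) 0 B =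
      lit (A 0 0) (A 0 1) (t * A 0 1) (-(t * A 0 0)) (A 1 0) (A 1 1) (t * A 1 1) (-(t * A 1 0))
        0 0 (B 0 0) (B 0 1) 0 0 (B 1 0) (B 1 1) := by
  simp [blocks, Matrix.mul_apply, Fin.sum_univ_two]

/-- Write the matrix in blocks `(A, B; C, D)` and `M - l = (0, E; 0, 0)` with `E = diag(e, w)`.
Commutation gives `C = 0` and `A E = E D`; preservation of `hyp` gives `D = (Aᵀ)⁻¹`. Hence `A`
preserves `E`, which means `O(2)` for equal signs and `O(1,1)` for opposite ones. The remaining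
condition is that `A⁻¹ B` is skew, so `B = t A J`. -/
theorem orthCentralizer_formVII_eq_isoVII_O2 {e : ℝ} (he : e = 1 ∨ e = -1) (l : ℝ) :
    orthCentralizer hyp (formVII e e l l) = isoVII O2 := by
  refine Set.Subset.antisymm (fun A => ?_) ?_
  · obtain ⟨a₀, a₁, a₂, a₃, b₀, b₁, b₂, b₃, c₀, c₁, c₂, c₃, d₀, d₁, d₂, d₃, rfl⟩ := exists_lit A
    simp only [orthCentralizer, Set.mem_ofPred_eq, lit_orth_hyp_iff, formVII, lit_mul, lit_inj]
    rintro ⟨⟨⟨_, _, _, _⟩, _, _, _, _, _, _⟩, ⟨_, _, _, _⟩, ⟨_, _, _, _⟩, ⟨_, _, _, _⟩, _, _, _, _⟩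
    obtain rfl : c₀ = 0 := by grind
    obtain rfl : c₁ = 0 := by grind
    obtain rfl : d₀ = 0 := by grind
    obtain rfl : d₁ = 0 := by grind
    obtain rfl : c₂ = a₀ := by grind
    obtain rfl : c₃ = a₁ := by grind
    obtain rfl : d₂ = b₀ := by grind
    obtain rfl : d₃ = b₁ := by grind
    have hA : !![c₂, c₃; d₂, d₃] ∈ O2 := by
      rw [mem_O2_iff]
      simp
      grind
    -- The parameter is the lower left entry of `A⁻¹ B`, here with `A⁻¹ = Aᵀ`.
    refine ⟨!![c₂, c₃; d₂, d₃], hA, c₃ * a₂ + d₃ * b₂, ?_⟩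
    have r1 : c₂ ^ 2 + d₂ ^ 2 = 1 := by linarith
    have r2 : c₂ * c₃ + d₂ * d₃ = 0 := by linarith
    have r3 : c₃ ^ 2 + d₃ ^ 2 = 1 := by linarith
    have hd : (c₂ * d₃ - d₂ * c₃) ^ 2 = 1 := by
      linear_combination (c₃ ^ 2 + d₃ ^ 2) * r1 - (c₂ * c₃ + d₂ * d₃) * r2 + r3
    rw [inv_transpose_of_mem_O2 hA, blocks_isoVII, lit_inj]
    simp
    grind
  · rintro X ⟨A, hA, t, rfl⟩
    rw [inv_transpose_of_mem_O2 hA, blocks_isoVII]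
    rw [mem_O2_iff] at hA
    generalize A 0 0 = α, A 0 1 = γ, A 1 0 = β, A 1 1 = δ at *
    simp only [orthCentralizer, Set.mem_ofPred_eq, lit_orth_hyp_iff, formVII, lit_mul, lit_inj]
    grind

theorem orthCentralizer_formVII_eq_isoVII_O11 {e : ℝ} (he : e = 1 ∨ e = -1) (l : ℝ) :
    orthCentralizer hyp (formVII e (-e) l l) = isoVII O11 := by
  refine Set.Subset.antisymm (fun A => ?_) ?_
  · obtain ⟨a₀, a₁, a₂, a₃, b₀, b₁, b₂, b₃, c₀, c₁, c₂, c₃, d₀, d₁, d₂, d₃, rfl⟩ := exists_lit A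
    simp only [orthCentralizer, Set.mem_ofPred_eq, lit_orth_hyp_iff, formVII, lit_mul, lit_inj]
    rintro ⟨⟨⟨_, _, _, _⟩, _, _, _, _, _, _⟩, ⟨_, _, _, _⟩, ⟨_, _, _, _⟩, ⟨_, _, _, _⟩, _, _, _, _⟩
    obtain rfl : c₀ = 0 := by grind
    obtain rfl : c₁ = 0 := by grind
    obtain rfl : d₀ = 0 := by grind
    obtain rfl : d₁ = 0 := by grind
    obtain rfl : c₂ = a₀ := by grind
    obtain rfl : c₃ = -a₁ := by grind
    obtain rfl : d₂ = -b₀ := by grind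
    obtain rfl : d₃ = b₁ := by grind
    have hA : !![c₂, a₁; b₀, d₃] ∈ O11 := by
      rw [mem_O11_iff]
      simp
      grind
    have r1 : c₂ ^ 2 - b₀ ^ 2 = 1 := by linarith
    have r2 : c₂ * a₁ - b₀ * d₃ = 0 := by linarith
    have r3 : a₁ ^ 2 - d₃ ^ 2 = -1 := by linarith
    have hd : (c₂ * d₃ - b₀ * a₁) ^ 2 = 1 := by
      linear_combination (d₃ ^ 2 - a₁ ^ 2) * r1 + (c₂ * a₁ - b₀ * d₃) * r2 - r3
    -- Again the lower left entry of `A⁻¹ B`; the inverse of an `O(1,1)` matrix is its transpose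
    -- with the off-diagonal signs changed.
    refine ⟨!![c₂, a₁; b₀, d₃], hA, d₃ * b₂ - a₁ * a₂, ?_⟩
    rw [inv_transpose_of_mem_O11 hA, blocks_isoVII, lit_inj]
    simp
    grind
  · rintro X ⟨A, hA, t, rfl⟩
    rw [inv_transpose_of_mem_O11 hA, blocks_isoVII]
    rw [mem_O11_iff] at hA
    simp only [Matrix.of_apply, Matrix.cons_val', Matrix.cons_val_zero, Matrix.cons_val_one,
      Matrix.cons_val_fin_one]
    generalize A 0 0 = α, A 0 1 = γ, A 1 0 = β, A 1 1 = δ at *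
    simp only [orthCentralizer, Set.mem_ofPred_eq, lit_orth_hyp_iff, formVII, lit_mul, lit_inj]
    grind

theorem mem_orthogonalGroup_two_complex_iff (Q : Matrix (Fin 2) (Fin 2) ℂ) :
    Q ∈ Matrix.orthogonalGroup (Fin 2) ℂ ↔
      Q 0 0 ^ 2 + Q 1 0 ^ 2 = 1 ∧ Q 0 0 * Q 0 1 + Q 1 0 * Q 1 1 = 0 ∧
      Q 0 1 ^ 2 + Q 1 1 ^ 2 = 1 := by
  rw [Matrix.mem_orthogonalGroup_iff']
  simp only [← Matrix.ext_iff, Fin.forall_fin_two, Matrix.mul_apply,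
    Fin.sum_univ_two, Matrix.transpose_apply, Matrix.one_apply]
  norm_num
  grind

/-- `M - a` is a nonzero multiple of a complex structure on `ℝ⁴ = ℂ²`, so commuting matrices are the
complex-linear ones. The complex structure is self-adjoint, and the scalar product is the real part
of the complex bilinear form `z₁w₁ + z₂w₂`. A complex-linear map preserving the real part preserves
the whole form. -/
theorem orthCentralizer_formVIII_eq_isoVIII {b : ℝ} (hb : b ≠ 0) (a : ℝ) :
    orthCentralizer eta (formVIII a b a b) = isoVIII := by
  refine Set.Subset.antisymm (fun A => ?_) ?_
  · obtain ⟨a₀, a₁, a₂, a₃, b₀, b₁, b₂, b₃, c₀, c₁, c₂, c₃, d₀, d₁, d₂, d₃, rfl⟩ := exists_lit A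
    simp only [orthCentralizer, Set.mem_ofPred_eq, lit_orth_eta_iff, formVIII, lit_mul, lit_inj]
    rintro ⟨⟨⟨_, _, _, _⟩, _, _, _, _, _, _⟩, ⟨_, _, _, _⟩, ⟨_, _, _, _⟩, ⟨_, _, _, _⟩, _, _, _, _⟩
    obtain rfl : c₀ = -a₂ := by grind
    obtain rfl : c₁ = -a₃ := by grind
    obtain rfl : d₀ = -b₂ := by grind
    obtain rfl : d₁ = -b₃ := by grind
    obtain rfl : c₂ = a₀ := by grind
    obtain rfl : c₃ = a₁ := by grind
    obtain rfl : d₂ = b₀ := by grind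
    obtain rfl : d₃ = b₁ := by grind
    refine ⟨!![⟨c₂, -a₂⟩, ⟨c₃, -a₃⟩; ⟨d₂, -b₂⟩, ⟨d₃, -b₃⟩], ?_, ?_⟩
    · rw [mem_orthogonalGroup_two_complex_iff]
      simp [Complex.ext_iff, pow_two]
      grind
    · simp [blocks]
  · rintro X ⟨Q, hQ, rfl⟩
    rw [mem_orthogonalGroup_two_complex_iff] at hQ
    simp only [Complex.ext_iff, pow_two, Complex.add_re, Complex.add_im, Complex.mul_re,
      Complex.mul_im, Complex.one_re, Complex.one_im, Complex.zero_re, Complex.zero_im] at hQ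
    simp only [blocks, Matrix.map_apply, Matrix.neg_apply]
    generalize (Q 0 0).re = x₀, (Q 0 0).im = y₀, (Q 0 1).re = x₁, (Q 0 1).im = y₁,
      (Q 1 0).re = x₂, (Q 1 0).im = y₂, (Q 1 1).re = x₃, (Q 1 1).im = y₃ at *
    simp only [orthCentralizer, Set.mem_ofPred_eq, lit_orth_eta_iff, formVIII, lit_mul, lit_inj]
    obtain ⟨⟨h1, h2⟩, ⟨h3, h4⟩, h5, h6⟩ := hQ
    refine ⟨⟨⟨?_, ?_, ?_, ?_⟩, ?_, ?_, ?_, ?_, ?_, ?_⟩, ⟨?_, ?_, ?_, ?_⟩, ⟨?_, ?_, ?_, ?_⟩,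
      ⟨?_, ?_, ?_, ?_⟩, ?_, ?_, ?_, ?_⟩ <;> linarith

/-! ### Isotropy groups of diagonal matrices -/

theorem lit_mem_orthCentralizer_diagonal (s y : Fin 4 → ℝ)
    (a₀ a₁ a₂ a₃ b₀ b₁ b₂ b₃ c₀ c₁ c₂ c₃ d₀ d₁ d₂ d₃ : ℝ) :
    lit a₀ a₁ a₂ a₃ b₀ b₁ b₂ b₃ c₀ c₁ c₂ c₃ d₀ d₁ d₂ d₃ ∈
      orthCentralizer (Matrix.diagonal s) (Matrix.diagonal y) ↔
    (((s 0 * a₀ ^ 2 + s 1 * b₀ ^ 2 + s 2 * c₀ ^ 2 + s 3 * d₀ ^ 2 = s 0 ∧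
        s 0 * a₁ ^ 2 + s 1 * b₁ ^ 2 + s 2 * c₁ ^ 2 + s 3 * d₁ ^ 2 = s 1 ∧
        s 0 * a₂ ^ 2 + s 1 * b₂ ^ 2 + s 2 * c₂ ^ 2 + s 3 * d₂ ^ 2 = s 2 ∧
        s 0 * a₃ ^ 2 + s 1 * b₃ ^ 2 + s 2 * c₃ ^ 2 + s 3 * d₃ ^ 2 = s 3) ∧
      s 0 * a₀ * a₁ + s 1 * b₀ * b₁ + s 2 * c₀ * c₁ + s 3 * d₀ * d₁ = 0 ∧
      s 0 * a₀ * a₂ + s 1 * b₀ * b₂ + s 2 * c₀ * c₂ + s 3 * d₀ * d₂ = 0 ∧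
      s 0 * a₀ * a₃ + s 1 * b₀ * b₃ + s 2 * c₀ * c₃ + s 3 * d₀ * d₃ = 0 ∧
      s 0 * a₁ * a₂ + s 1 * b₁ * b₂ + s 2 * c₁ * c₂ + s 3 * d₁ * d₂ = 0 ∧
      s 0 * a₁ * a₃ + s 1 * b₁ * b₃ + s 2 * c₁ * c₃ + s 3 * d₁ * d₃ = 0 ∧
      s 0 * a₂ * a₃ + s 1 * b₂ * b₃ + s 2 * c₂ * c₃ + s 3 * d₂ * d₃ = 0)) ∧
    ((y 0 = y 1 ∨ a₁ = 0) ∧ (y 0 = y 2 ∨ a₂ = 0) ∧ (y 0 = y 3 ∨ a₃ = 0) ∧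
      (y 0 = y 1 ∨ b₀ = 0) ∧ (y 1 = y 2 ∨ b₂ = 0) ∧ (y 1 = y 3 ∨ b₃ = 0) ∧
      (y 0 = y 2 ∨ c₀ = 0) ∧ (y 1 = y 2 ∨ c₁ = 0) ∧ (y 2 = y 3 ∨ c₃ = 0) ∧
      (y 0 = y 3 ∨ d₀ = 0) ∧ (y 1 = y 3 ∨ d₁ = 0) ∧ (y 2 = y 3 ∨ d₂ = 0)) := by
  have key : ∀ p q x : ℝ, (p = q ∨ x = 0) ↔ x * q = p * x := by
    intro p q x
    rw [← sub_eq_zero (a := p), ← mul_eq_zero, sub_mul, sub_eq_zero, mul_comm x q, eq_comm]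
  simp only [orthCentralizer, Set.mem_ofPred_eq, diagonal_eq_lit, lit_transpose, lit_mul, lit_inj,
    key]
  generalize s 0 = s0, s 1 = s1, s 2 = s2, s 3 = s3, y 0 = y0, y 1 = y1, y 2 = y2, y 3 = y3
  refine and_congr ⟨?_, ?_⟩ ⟨?_, ?_⟩
  · rintro ⟨⟨h1, h2, h3, h4⟩, ⟨-, h5, h6, h7⟩, ⟨-, -, h8, h9⟩, -, -, -, h10⟩
    refine ⟨⟨?_, ?_, ?_, ?_⟩, ?_, ?_, ?_, ?_, ?_, ?_⟩ <;> linarith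
  · rintro ⟨⟨h1, h2, h3, h4⟩, h5, h6, h7, h8, h9, h10⟩
    refine ⟨⟨?_, ?_, ?_, ?_⟩, ⟨?_, ?_, ?_, ?_⟩, ⟨?_, ?_, ?_, ?_⟩, ?_, ?_, ?_, ?_⟩ <;> linarith
  · rintro ⟨⟨-, h1, h2, h3⟩, ⟨h4, -, h5, h6⟩, ⟨h7, h8, -, h9⟩, h10, h11, h12, -⟩
    refine ⟨?_, ?_, ?_, ?_, ?_, ?_, ?_, ?_, ?_, ?_, ?_, ?_⟩ <;> linarith
  · rintro ⟨h1, h2, h3, h4, h5, h6, h7, h8, h9, h10, h11, h12⟩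
    refine ⟨⟨?_, ?_, ?_, ?_⟩, ⟨?_, ?_, ?_, ?_⟩, ⟨?_, ?_, ?_, ?_⟩, ?_, ?_, ?_, ?_⟩ <;> linarith

/-- A permutation of the coordinates moves coinciding eigenvalues to the front, at the price of
permuting the signs of `eta`. This reduces the subtypes with one pair, two pairs or a triple to the
three normal positions treated below for an arbitrary diagonal form `s`. -/
theorem mem_orthCentralizer_formIX_iff (σ : Equiv.Perm (Fin 4)) (y : Fin 4 → ℝ) (A : Mat) :
    A ∈ orthCentralizer eta (formIX y) ↔ A.submatrix σ σ ∈
      orthCentralizer (Matrix.diagonal (![1, 1, -1, -1] ∘ σ)) (Matrix.diagonal (y ∘ σ)) := by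
  have hinj : ∀ B C : Mat, B.submatrix σ σ = C.submatrix σ σ ↔ B = C := fun B C =>
    (Matrix.reindex σ.symm σ.symm).injective.eq_iff
  simp only [orthCentralizer, Set.mem_ofPred_eq, formIX, eta]
  rw [Matrix.transpose_submatrix, ← Matrix.submatrix_diagonal_equiv, ← Matrix.submatrix_diagonal_equiv,
    Matrix.submatrix_mul_equiv, Matrix.submatrix_mul_equiv, Matrix.submatrix_mul_equiv,
    Matrix.submatrix_mul_equiv, hinj, hinj]

theorem mem_orth_three_iff {d : Fin 3 → ℝ} {A : Matrix (Fin 3) (Fin 3) ℝ} :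
    A ∈ orth d ↔ (d 0 * A 0 0 ^ 2 + d 1 * A 1 0 ^ 2 + d 2 * A 2 0 ^ 2 = d 0 ∧
      d 0 * A 0 1 ^ 2 + d 1 * A 1 1 ^ 2 + d 2 * A 2 1 ^ 2 = d 1 ∧
      d 0 * A 0 2 ^ 2 + d 1 * A 1 2 ^ 2 + d 2 * A 2 2 ^ 2 = d 2) ∧
      d 0 * A 0 0 * A 0 1 + d 1 * A 1 0 * A 1 1 + d 2 * A 2 0 * A 2 1 = 0 ∧
      d 0 * A 0 0 * A 0 2 + d 1 * A 1 0 * A 1 2 + d 2 * A 2 0 * A 2 2 = 0 ∧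
      d 0 * A 0 1 * A 0 2 + d 1 * A 1 1 * A 1 2 + d 2 * A 2 1 * A 2 2 = 0 := by
  have h3 : ∀ p : Fin 3 → Prop, (∀ i, p i) ↔ p 0 ∧ p 1 ∧ p 2 := fun p =>
    ⟨fun h => ⟨h 0, h 1, h 2⟩, fun h i => by fin_cases i <;> simp_all⟩
  simp only [orth, Set.mem_ofPred_eq, ← Matrix.ext_iff, h3, Matrix.mul_apply,
    Fin.sum_univ_three, Matrix.transpose_apply, Matrix.diagonal_apply, Fin.reduceEq, reduceIte]
  constructor
  · rintro ⟨⟨h1, h2, h3⟩, ⟨-, h4, h5⟩, -, -, h6⟩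
    refine ⟨⟨?_, ?_, ?_⟩, ?_, ?_, ?_⟩ <;> linarith
  · rintro ⟨⟨h1, h2, h3⟩, h4, h5, h6⟩
    refine ⟨⟨?_, ?_, ?_⟩, ⟨?_, ?_, ?_⟩, ?_, ?_, ?_⟩ <;> linarith

theorem mem_orthCentralizer_diagonal_pair {s y : Fin 4 → ℝ} (hs : ∀ i, s i ≠ 0) (h01 : y 0 = y 1)
    (h02 : y 0 ≠ y 2) (h03 : y 0 ≠ y 3) (h23 : y 2 ≠ y 3) (X : Mat) :
    X ∈ orthCentralizer (Matrix.diagonal s) (Matrix.diagonal y) ↔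
      ∃ A ∈ orth ![s 0, s 1], ∃ e f : ℝ, (e = 1 ∨ e = -1) ∧ (f = 1 ∨ f = -1) ∧
        X = blocks A 0 0 (Matrix.diagonal ![e, f]) := by
  have h12 : y 1 ≠ y 2 := h01 ▸ h02
  have h13 : y 1 ≠ y 3 := h01 ▸ h03
  constructor
  · obtain ⟨a₀, a₁, a₂, a₃, b₀, b₁, b₂, b₃, c₀, c₁, c₂, c₃, d₀, d₁, d₂, d₃, rfl⟩ := exists_lit X
    rw [lit_mem_orthCentralizer_diagonal]
    simp only [h01, h12, h13, h23, true_or, true_and, false_or]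
    rintro ⟨⟨⟨h1, h2, h3, h4⟩, h5, -, -, -, -, -⟩, rfl, rfl, rfl, rfl, rfl, rfl, rfl, rfl, rfl, rfl⟩
    refine ⟨!![a₀, a₁; b₀, b₁], ?_, c₂, d₃, ?_, ?_, ?_⟩
    · rw [mem_orth_two_iff]
      simp
      grind
    · exact eq_one_or_eq_neg_one_of_sq (mul_left_cancel₀ (hs 2) (by linarith))
    · exact eq_one_or_eq_neg_one_of_sq (mul_left_cancel₀ (hs 3) (by linarith))
    · simp [blocks]
  · rintro ⟨A, hA, e, f, he, hf, rfl⟩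
    rw [blocks, lit_mem_orthCentralizer_diagonal]
    rw [mem_orth_two_iff] at hA
    simp at hA
    rcases he with rfl | rfl <;> rcases hf with rfl | rfl <;> simp [h01] <;> grind

theorem mem_orthCentralizer_diagonal_pairs {s y : Fin 4 → ℝ} (h01 : y 0 = y 1)
    (h02 : y 0 ≠ y 2) (h23 : y 2 = y 3) (X : Mat) :
    X ∈ orthCentralizer (Matrix.diagonal s) (Matrix.diagonal y) ↔
      ∃ A ∈ orth ![s 0, s 1], ∃ B ∈ orth ![s 2, s 3], X = blocks A 0 0 B := by
  have h12 : y 1 ≠ y 2 := h01 ▸ h02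
  have h13 : y 1 ≠ y 3 := h23 ▸ h12
  constructor
  · obtain ⟨a₀, a₁, a₂, a₃, b₀, b₁, b₂, b₃, c₀, c₁, c₂, c₃, d₀, d₁, d₂, d₃, rfl⟩ := exists_lit X
    rw [lit_mem_orthCentralizer_diagonal]
    simp only [h01, h13, h23, true_or, true_and, and_true, false_or]
    rintro ⟨⟨⟨h1, h2, h3, h4⟩, h5, -, -, -, -, h6⟩, rfl, rfl, rfl, rfl, rfl, rfl, rfl, rfl⟩
    refine ⟨!![a₀, a₁; b₀, b₁], ?_, !![c₂, c₃; d₂, d₃], ?_, ?_⟩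
    · rw [mem_orth_two_iff]
      simp
      grind
    · rw [mem_orth_two_iff]
      simp
      grind
    · simp [blocks]
  · rintro ⟨A, hA, B, hB, rfl⟩
    rw [blocks, lit_mem_orthCentralizer_diagonal]
    rw [mem_orth_two_iff] at hA hB
    simp at hA hB
    simp [h01, h23]
    grind

theorem mem_orthCentralizer_diagonal_triple {s y : Fin 4 → ℝ} (hs : ∀ i, s i ≠ 0)
    (h01 : y 0 = y 1) (h12 : y 1 = y 2) (h23 : y 2 ≠ y 3) (X : Mat) :
    X ∈ orthCentralizer (Matrix.diagonal s) (Matrix.diagonal y) ↔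
      ∃ A ∈ orth ![s 0, s 1, s 2], ∃ f : ℝ, (f = 1 ∨ f = -1) ∧
        X = !![A 0 0, A 0 1, A 0 2, 0; A 1 0, A 1 1, A 1 2, 0; A 2 0, A 2 1, A 2 2, 0;
          0, 0, 0, f] := by
  constructor
  · obtain ⟨a₀, a₁, a₂, a₃, b₀, b₁, b₂, b₃, c₀, c₁, c₂, c₃, d₀, d₁, d₂, d₃, rfl⟩ := exists_lit X
    rw [lit_mem_orthCentralizer_diagonal]
    simp only [h01, h12, h23, true_or, true_and, false_or]
    rintro ⟨⟨⟨h1, h2, h3, h4⟩, h5, h6, -, h7, -, -⟩, rfl, rfl, rfl, rfl, rfl, rfl⟩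
    refine ⟨!![a₀, a₁, a₂; b₀, b₁, b₂; c₀, c₁, c₂], ?_, d₃, ?_, ?_⟩
    · rw [mem_orth_three_iff]
      simp
      grind
    · exact eq_one_or_eq_neg_one_of_sq (mul_left_cancel₀ (hs 3) (by linarith))
    · simp
  · rintro ⟨A, hA, f, hf, rfl⟩
    rw [lit_mem_orthCentralizer_diagonal]
    rw [mem_orth_three_iff] at hA
    simp at hA
    rcases hf with rfl | rfl <;> simp [h01, h12] <;> grind

theorem orthCentralizer_formIX {y : Fin 4 → ℝ} (hy : ∀ i j, i ≠ j → y i ≠ y j) :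
    orthCentralizer eta (formIX y) = signMatrices := by
  ext X
  constructor
  · obtain ⟨a₀, a₁, a₂, a₃, b₀, b₁, b₂, b₃, c₀, c₁, c₂, c₃, d₀, d₁, d₂, d₃, rfl⟩ := exists_lit X
    rw [formIX, eta, lit_mem_orthCentralizer_diagonal]
    simp only [hy 0 1 (by decide), hy 0 2 (by decide), hy 0 3 (by decide), hy 1 2 (by decide),
      hy 1 3 (by decide), hy 2 3 (by decide), false_or]
    rintro ⟨⟨⟨h1, h2, h3, h4⟩, -⟩, rfl, rfl, rfl, rfl, rfl, rfl, rfl, rfl, rfl, rfl, rfl, rfl⟩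
    simp at h1 h2 h3 h4
    refine ⟨![a₀, b₁, c₂, d₃], ?_, ?_⟩
    · intro i
      fin_cases i
      exacts [h1, h2, h3, h4]
    · rw [diagonal_eq_lit]
      rfl
  · rintro ⟨d, hd, rfl⟩
    rw [diagonal_eq_lit, formIX, eta, lit_mem_orthCentralizer_diagonal]
    simp [hd]

theorem orthCentralizer_zero : orthCentralizer eta (formIX ![0, 0, 0, 0]) =
    orth ![1, 1, -1, -1] := by
  have : formIX ![0, 0, 0, 0] = 0 := by
    rw [formIX, diagonal_eq_lit, zero_eq_lit]
    rfl
  rw [this]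
  simp [orthCentralizer, orth, eta]

theorem orth_neg_one_neg_one : orth ![(-1 : ℝ), -1] = O2 := by
  ext A
  rw [mem_orth_two_iff, mem_O2_iff]
  simp
  grind

/-- The permutation of `Fin 4` with the given values. -/
def permOfVec (f : Fin 4 → Fin 4) (hf : Function.Injective f) : Equiv.Perm (Fin 4) :=
  Equiv.ofBijective f (Finite.injective_iff_bijective.1 hf)

theorem orthCentralizer_formIX_eq_isoPair {i j k l : Fin 4}
    (hf : Function.Injective ![i, j, k, l]) {G : Set (Matrix (Fin 2) (Fin 2) ℝ)}
    (hG : orth ![(![1, 1, -1, -1] : Fin 4 → ℝ) i, (![1, 1, -1, -1] : Fin 4 → ℝ) j] = G)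
    {y : Fin 4 → ℝ} (hij : y i = y j) (hik : y i ≠ y k) (hil : y i ≠ y l) (hkl : y k ≠ y l) :
    orthCentralizer eta (formIX y) = isoPair i j k l G := by
  ext X
  rw [mem_orthCentralizer_formIX_iff (permOfVec _ hf), mem_orthCentralizer_diagonal_pair]
  · subst hG
    rfl
  · intro m
    show (![1, 1, -1, -1] : Fin 4 → ℝ) (permOfVec _ hf m) ≠ 0
    generalize permOfVec _ hf m = m
    fin_cases m <;> norm_num
  exacts [hij, hik, hil, hkl]

theorem orthCentralizer_formIX_eq_isoPairs {i j k l : Fin 4}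
    (hf : Function.Injective ![i, j, k, l]) {G G' : Set (Matrix (Fin 2) (Fin 2) ℝ)}
    (hG : orth ![(![1, 1, -1, -1] : Fin 4 → ℝ) i, (![1, 1, -1, -1] : Fin 4 → ℝ) j] = G)
    (hG' : orth ![(![1, 1, -1, -1] : Fin 4 → ℝ) k, (![1, 1, -1, -1] : Fin 4 → ℝ) l] = G')
    {y : Fin 4 → ℝ} (hij : y i = y j) (hik : y i ≠ y k) (hkl : y k = y l) :
    orthCentralizer eta (formIX y) = isoPairs i j k l G G' := by
  ext X
  rw [mem_orthCentralizer_formIX_iff (permOfVec _ hf), mem_orthCentralizer_diagonal_pairs]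
  · subst hG hG'
    rfl
  exacts [hij, hik, hkl]

theorem orthCentralizer_formIX_eq_isoTriple {i j k l : Fin 4}
    (hf : Function.Injective ![i, j, k, l]) {G : Set (Matrix (Fin 3) (Fin 3) ℝ)}
    (hG : orth ![(![1, 1, -1, -1] : Fin 4 → ℝ) i, (![1, 1, -1, -1] : Fin 4 → ℝ) j,
      (![1, 1, -1, -1] : Fin 4 → ℝ) k] = G)
    {y : Fin 4 → ℝ} (hij : y i = y j) (hjk : y j = y k) (hkl : y k ≠ y l) :
    orthCentralizer eta (formIX y) = isoTriple i j k l G := by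
  ext X
  rw [mem_orthCentralizer_formIX_iff (permOfVec _ hf), mem_orthCentralizer_diagonal_triple]
  · subst hG
    rfl
  · intro m
    show (![1, 1, -1, -1] : Fin 4 → ℝ) (permOfVec _ hf m) ≠ 0
    generalize permOfVec _ hf m = m
    fin_cases m <;> norm_num
  exacts [hij, hjk, hkl]

/-! ### Dimensions of orbits -/

/-- The skew-symmetric matrix with given entries above the diagonal. -/
def skew (v : Fin 6 → ℝ) : Mat :=
  lit 0 (v 0) (v 1) (v 2) (-v 0) 0 (v 3) (v 4) (-v 1) (-v 3) 0 (v 5) (-v 2) (-v 4) (-v 5) 0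

theorem skew_add (v w : Fin 6 → ℝ) : skew (v + w) = skew v + skew w := by
  ext i j
  fin_cases i <;> fin_cases j <;> simp [skew] <;> ring

theorem skew_smul (c : ℝ) (v : Fin 6 → ℝ) : skew (c • v) = c • skew v := by
  ext i j
  fin_cases i <;> fin_cases j <;> simp [skew]

/-- The commutators of `M` with the matrices that are skew-adjoint for the scalar product with Gram
matrix `H`, if `H² = 1`. -/
def adMap (H M : Mat) : (Fin 6 → ℝ) →ₗ[ℝ] Mat where
  toFun v := H * skew v * M - M * (H * skew v)
  map_add' v w := by
    rw [skew_add, Matrix.mul_add, Matrix.add_mul, Matrix.mul_add]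
    abel
  map_smul' c v := by
    simp [skew_smul, smul_sub]

/-- The kernel of `adMap` is the Lie algebra of the isotropy group. The hypotheses say that the
coordinates listed by `J` determine an element of the kernel and take arbitrary values on it, so the
kernel has dimension `d`. Rank and nullity add up to `6`. -/
theorem finrank_range_adMap {H M : Mat} {n d : ℕ} (hnd : n + d = 6) (J : Fin d → Fin 6)
    (h1 : ∀ v, H * skew v * M = M * (H * skew v) → (∀ j, v (J j) = 0) → ∀ i, v i = 0)
    (h2 : ∀ t : Fin d → ℝ, ∃ v, H * skew v * M = M * (H * skew v) ∧ ∀ j, v (J j) = t j) :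
    Module.finrank ℝ (LinearMap.range (adMap H M)) = n := by
  have hker : ∀ v, v ∈ LinearMap.ker (adMap H M) ↔ H * skew v * M = M * (H * skew v) :=
    fun v => by rw [LinearMap.mem_ker]; exact sub_eq_zero
  let c : LinearMap.ker (adMap H M) →ₗ[ℝ] (Fin d → ℝ) :=
    (LinearMap.funLeft ℝ ℝ J).comp (LinearMap.ker (adMap H M)).subtype
  have hc : Function.Bijective c := by
    refine ⟨?_, fun t => ?_⟩
    · rw [← LinearMap.ker_eq_bot, LinearMap.ker_eq_bot']
      intro v hv
      ext i
      exact h1 v ((hker _).1 v.2) (fun j => congrFun hv j) i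
    · obtain ⟨v, hv, hvt⟩ := h2 t
      exact ⟨⟨v, (hker v).2 hv⟩, funext hvt⟩
  have hd := (LinearEquiv.ofBijective c hc).finrank_eq
  have := LinearMap.finrank_range_add_finrank_ker (adMap H M)
  simp only [Module.finrank_fin_fun] at hd this
  omega

theorem eta_mul_skew (v : Fin 6 → ℝ) : eta * skew v =
    lit 0 (v 0) (v 1) (v 2) (-v 0) 0 (v 3) (v 4) (v 1) (v 3) 0 (-v 5) (v 2) (v 4) (v 5) 0 := by
  rw [eta_eq_lit, skew, lit_mul, lit_inj]
  norm_num

theorem hyp_mul_skew (v : Fin 6 → ℝ) : hyp * skew v =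
    lit (-v 1) (-v 3) 0 (v 5) (-v 2) (-v 4) (-v 5) 0 0 (v 0) (v 1) (v 2) (-v 0) 0 (v 3) (v 4) := by
  rw [hyp, skew, lit_mul, lit_inj]
  norm_num

theorem finrank_range_adMap_eq_six {H M : Mat}
    (h : ∀ v, H * skew v * M = M * (H * skew v) → ∀ i, v i = 0) :
    Module.finrank ℝ (LinearMap.range (adMap H M)) = 6 :=
  finrank_range_adMap (d := 0) rfl ![] (fun v hv _ => h v hv)
    fun _ => ⟨0, by simp [show skew 0 = 0 by simpa using skew_smul 0 0],
      fun j => j.elim0⟩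

theorem finrank_adMap_formI {e : ℝ} (he : e = 1 ∨ e = -1) (l : ℝ) :
    Module.finrank ℝ (LinearMap.range (adMap hyp (formI e l))) = 6 := by
  refine finrank_range_adMap_eq_six fun v hv => ?_
  rw [hyp_mul_skew, formI, lit_mul, lit_mul, lit_inj] at hv
  obtain ⟨⟨_, _, _, _⟩, ⟨_, _, _, _⟩, ⟨_, _, _, _⟩, _, _, _, _⟩ := hv
  intro i
  fin_cases i <;> simp only [Fin.zero_eta, Fin.mk_one, Fin.reduceFinMk] <;> grind

theorem finrank_adMap_formII {b : ℝ} (hb : b ≠ 0) (a : ℝ) :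
    Module.finrank ℝ (LinearMap.range (adMap hyp (formII a b))) = 6 := by
  refine finrank_range_adMap_eq_six fun v hv => ?_
  rw [hyp_mul_skew, formII, lit_mul, lit_mul, lit_inj] at hv
  obtain ⟨⟨_, _, _, _⟩, ⟨_, _, _, _⟩, ⟨_, _, _, _⟩, _, _, _, _⟩ := hv
  intro i
  fin_cases i <;> simp only [Fin.zero_eta, Fin.mk_one, Fin.reduceFinMk] <;> grind

theorem finrank_adMap_formIIIa {l m : ℝ} (hlm : l ≠ m) :
    Module.finrank ℝ (LinearMap.range (adMap eta (formIIIa l m))) = 6 := by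
  refine finrank_range_adMap_eq_six fun v hv => ?_
  have hr : 1 / √2 ≠ 0 := by positivity
  unfold formIIIa at hv
  generalize 1 / √2 = r at hr hv
  rw [eta_mul_skew, lit_mul, lit_mul, lit_inj] at hv
  obtain ⟨⟨_, _, _, _⟩, ⟨_, _, _, _⟩, ⟨_, _, _, _⟩, _, _, _, _⟩ := hv
  intro i
  fin_cases i <;> simp only [Fin.zero_eta, Fin.mk_one, Fin.reduceFinMk] <;> grind

theorem finrank_adMap_formIIIb {l m : ℝ} (hlm : l ≠ m) :
    Module.finrank ℝ (LinearMap.range (adMap eta (formIIIb l m))) = 6 := by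
  refine finrank_range_adMap_eq_six fun v hv => ?_
  have hr : 1 / √2 ≠ 0 := by positivity
  unfold formIIIb at hv
  generalize 1 / √2 = r at hr hv
  rw [eta_mul_skew, lit_mul, lit_mul, lit_inj] at hv
  obtain ⟨⟨_, _, _, _⟩, ⟨_, _, _, _⟩, ⟨_, _, _, _⟩, _, _, _, _⟩ := hv
  intro i
  fin_cases i <;> simp only [Fin.zero_eta, Fin.mk_one, Fin.reduceFinMk] <;> grind

theorem finrank_adMap_formIV {e : ℝ} (he : e = 1 ∨ e = -1) {l m n : ℝ} (hlm : l ≠ m)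
    (hmn : m ≠ n) (hln : l ≠ n) :
    Module.finrank ℝ (LinearMap.range (adMap eta (formIV e l m n))) = 6 := by
  refine finrank_range_adMap_eq_six fun v hv => ?_
  rw [eta_mul_skew, formIV, lit_mul, lit_mul, lit_inj] at hv
  obtain ⟨⟨_, _, _, _⟩, ⟨_, _, _, _⟩, ⟨_, _, _, _⟩, _, _, _, _⟩ := hv
  intro i
  fin_cases i <;> simp only [Fin.zero_eta, Fin.mk_one, Fin.reduceFinMk] <;> grind

theorem finrank_adMap_formIIIa_self (l : ℝ) :
    Module.finrank ℝ (LinearMap.range (adMap eta (formIIIa l l))) = 5 := by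
  refine finrank_range_adMap (d := 1) rfl ![0] (fun v hv hJ => ?_)
    -- This is `t 0` times the derivative of `T1` at `0`. The witnesses for the other one-parameter
    -- families `T2`, `T3`, `T4` arise in the same way, with the opposite sign for `T4`.
    fun t => ⟨![t 0, 0, -t 0, 0, 0, 0], ?_, ?_⟩
  all_goals
    have hr : 1 / √2 ≠ 0 := by positivity
    try unfold formIIIa at hv
    try unfold formIIIa
    generalize 1 / √2 = r at *
  · rw [eta_mul_skew, lit_mul, lit_mul, lit_inj] at hv
    obtain ⟨⟨_, _, _, _⟩, ⟨_, _, _, _⟩, ⟨_, _, _, _⟩, _, _, _, _⟩ := hv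
    simp at hJ
    intro i
    fin_cases i <;> simp only [Fin.zero_eta, Fin.mk_one, Fin.reduceFinMk] <;> grind
  · rw [eta_mul_skew, lit_mul, lit_mul, lit_inj]
    simp
    try grind
  · simp [Fin.forall_fin_succ]

theorem finrank_adMap_formIIIb_self (l : ℝ) :
    Module.finrank ℝ (LinearMap.range (adMap eta (formIIIb l l))) = 5 := by
  refine finrank_range_adMap (d := 1) rfl ![2] (fun v hv hJ => ?_)
    fun t => ⟨![0, 0, t 0, 0, 0, -t 0], ?_, ?_⟩
  all_goals
    have hr : 1 / √2 ≠ 0 := by positivity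
    try unfold formIIIb at hv
    try unfold formIIIb
    generalize 1 / √2 = r at *
  · rw [eta_mul_skew, lit_mul, lit_mul, lit_inj] at hv
    obtain ⟨⟨_, _, _, _⟩, ⟨_, _, _, _⟩, ⟨_, _, _, _⟩, _, _, _, _⟩ := hv
    simp at hJ
    intro i
    fin_cases i <;> simp only [Fin.zero_eta, Fin.mk_one, Fin.reduceFinMk] <;> grind
  · rw [eta_mul_skew, lit_mul, lit_mul, lit_inj]
    simp
    try grind
  · simp [Fin.forall_fin_succ]

theorem finrank_adMap_formIV_right {e : ℝ} (he : e = 1 ∨ e = -1) {l m : ℝ} (hlm : l ≠ m) :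
    Module.finrank ℝ (LinearMap.range (adMap eta (formIV e l m m))) = 5 := by
  refine finrank_range_adMap (d := 1) rfl ![4] (fun v hv hJ => ?_)
    fun t => ⟨![0, 0, 0, 0, t 0, -t 0], ?_, ?_⟩
  · rw [eta_mul_skew, formIV, lit_mul, lit_mul, lit_inj] at hv
    obtain ⟨⟨_, _, _, _⟩, ⟨_, _, _, _⟩, ⟨_, _, _, _⟩, _, _, _, _⟩ := hv
    simp at hJ
    intro i
    fin_cases i <;> simp only [Fin.zero_eta, Fin.mk_one, Fin.reduceFinMk] <;> grind
  · rw [eta_mul_skew, formIV, lit_mul, lit_mul, lit_inj]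
    simp
    try grind
  · simp [Fin.forall_fin_succ]

theorem finrank_adMap_formIV_left {e : ℝ} (he : e = 1 ∨ e = -1) {m n : ℝ} (hmn : m ≠ n) :
    Module.finrank ℝ (LinearMap.range (adMap eta (formIV e m m n))) = 5 := by
  refine finrank_range_adMap (d := 1) rfl ![0] (fun v hv hJ => ?_)
    fun t => ⟨![t 0, -t 0, 0, 0, 0, 0], ?_, ?_⟩
  · rw [eta_mul_skew, formIV, lit_mul, lit_mul, lit_inj] at hv
    obtain ⟨⟨_, _, _, _⟩, ⟨_, _, _, _⟩, ⟨_, _, _, _⟩, _, _, _, _⟩ := hv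
    simp at hJ
    intro i
    fin_cases i <;> simp only [Fin.zero_eta, Fin.mk_one, Fin.reduceFinMk] <;> grind
  · rw [eta_mul_skew, formIV, lit_mul, lit_mul, lit_inj]
    simp
    try grind
  · simp [Fin.forall_fin_succ]

theorem finrank_adMap_formIV_outer {e : ℝ} (he : e = 1 ∨ e = -1) {l m : ℝ} (hlm : l ≠ m) :
    Module.finrank ℝ (LinearMap.range (adMap eta (formIV e l m l))) = 5 := by
  refine finrank_range_adMap (d := 1) rfl ![2] (fun v hv hJ => ?_)
    fun t => ⟨![0, 0, t 0, 0, 0, 0], ?_, ?_⟩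
  · rw [eta_mul_skew, formIV, lit_mul, lit_mul, lit_inj] at hv
    obtain ⟨⟨_, _, _, _⟩, ⟨_, _, _, _⟩, ⟨_, _, _, _⟩, _, _, _, _⟩ := hv
    simp at hJ
    intro i
    fin_cases i <;> simp only [Fin.zero_eta, Fin.mk_one, Fin.reduceFinMk] <;> grind
  · rw [eta_mul_skew, formIV, lit_mul, lit_mul, lit_inj]
    simp
    try grind
  · simp [Fin.forall_fin_succ]

theorem finrank_adMap_formIV_all {e : ℝ} (he : e = 1 ∨ e = -1) (l : ℝ) :
    Module.finrank ℝ (LinearMap.range (adMap eta (formIV e l l l))) = 3 := by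
  refine finrank_range_adMap (d := 3) rfl ![0, 2, 4] (fun v hv hJ => ?_)
    fun t => ⟨![t 0, -t 0, t 1, 0, t 2, -t 2], ?_, ?_⟩
  · rw [eta_mul_skew, formIV, lit_mul, lit_mul, lit_inj] at hv
    obtain ⟨⟨_, _, _, _⟩, ⟨_, _, _, _⟩, ⟨_, _, _, _⟩, _, _, _, _⟩ := hv
    simp [Fin.forall_fin_succ] at hJ
    intro i
    fin_cases i <;> simp only [Fin.zero_eta, Fin.mk_one, Fin.reduceFinMk] <;> grind
  · rw [eta_mul_skew, formIV, lit_mul, lit_mul, lit_inj]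
    simp
    try grind
  · simp [Fin.forall_fin_succ]

theorem finrank_adMap_formV {l a b n : ℝ} (hb : b ≠ 0) (hln : l ≠ n) :
    Module.finrank ℝ (LinearMap.range (adMap eta (formV l a b n))) = 6 := by
  refine finrank_range_adMap_eq_six fun v hv => ?_
  have key : ∀ l x y : ℝ, (l - a) * x = b * y → (l - a) * y = -b * x → x = 0 ∧ y = 0 := by
    intro l x y h h'
    have hq : (l - a) ^ 2 + b ^ 2 ≠ 0 := by positivity
    exact ⟨by grind, by grind⟩
  rw [eta_mul_skew, formV, lit_mul, lit_mul, lit_inj] at hv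
  obtain ⟨⟨_, _, _, _⟩, ⟨_, _, _, _⟩, ⟨_, _, _, _⟩, _, _, _, _⟩ := hv
  obtain ⟨h0, h1⟩ := key l (v 0) (-v 1) (by linarith) (by linarith)
  obtain ⟨h2, h3⟩ := key n (v 5) (v 4) (by linarith) (by linarith)
  intro i
  fin_cases i <;> simp only [Fin.zero_eta, Fin.mk_one, Fin.reduceFinMk] <;> grind

theorem finrank_adMap_formV_self {b : ℝ} (hb : b ≠ 0) (l a : ℝ) :
    Module.finrank ℝ (LinearMap.range (adMap eta (formV l a b l))) = 5 := by
  refine finrank_range_adMap (d := 1) rfl ![2] (fun v hv hJ => ?_)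
    fun t => ⟨![0, 0, t 0, 0, 0, 0], ?_, ?_⟩
  have key : ∀ l x y : ℝ, (l - a) * x = b * y → (l - a) * y = -b * x → x = 0 ∧ y = 0 := by
    intro l x y h h'
    have hq : (l - a) ^ 2 + b ^ 2 ≠ 0 := by positivity
    exact ⟨by grind, by grind⟩
  · rw [eta_mul_skew, formV, lit_mul, lit_mul, lit_inj] at hv
    obtain ⟨⟨_, _, _, _⟩, ⟨_, _, _, _⟩, ⟨_, _, _, _⟩, _, _, _, _⟩ := hv
    simp at hJ
    obtain ⟨h0, h1⟩ := key l (v 0) (-v 1) (by linarith) (by linarith)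
    obtain ⟨h2, h3⟩ := key l (v 5) (v 4) (by linarith) (by linarith)
    intro i
    fin_cases i <;> simp only [Fin.zero_eta, Fin.mk_one, Fin.reduceFinMk] <;> grind
  · rw [eta_mul_skew, formV, lit_mul, lit_mul, lit_inj]
    simp
    try grind
  · simp [Fin.forall_fin_succ]

theorem finrank_adMap_formVI {e : ℝ} (he : e = 1 ∨ e = -1) {b : ℝ} (hb : b ≠ 0) (l a : ℝ) :
    Module.finrank ℝ (LinearMap.range (adMap eta (formVI e l a b))) = 6 := by
  refine finrank_range_adMap_eq_six fun v hv => ?_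
  have key : ∀ l x y : ℝ, (l - a) * x = b * y → (l - a) * y = -b * x → x = 0 ∧ y = 0 := by
    intro l x y h h'
    have hq : (l - a) ^ 2 + b ^ 2 ≠ 0 := by positivity
    exact ⟨by grind, by grind⟩
  rw [eta_mul_skew, formVI, lit_mul, lit_mul, lit_inj] at hv
  obtain ⟨⟨_, _, _, _⟩, ⟨_, _, _, _⟩, ⟨_, _, _, _⟩, _, _, _, _⟩ := hv
  obtain ⟨h0, h1⟩ := key l (v 0 - v 4) (-(v 1 - v 5)) (by linarith) (by linarith)
  obtain ⟨h2, h3⟩ := key l (v 0) (-v 1) (by grind) (by grind)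
  intro i
  fin_cases i <;> simp only [Fin.zero_eta, Fin.mk_one, Fin.reduceFinMk] <;> grind

theorem finrank_adMap_formVII {e w : ℝ} (he : e = 1 ∨ e = -1) (hw : w = 1 ∨ w = -1) {l m : ℝ}
    (hlm : l ≠ m) :
    Module.finrank ℝ (LinearMap.range (adMap hyp (formVII e w l m))) = 6 := by
  refine finrank_range_adMap_eq_six fun v hv => ?_
  rw [hyp_mul_skew, formVII, lit_mul, lit_mul, lit_inj] at hv
  obtain ⟨⟨_, _, _, _⟩, ⟨_, _, _, _⟩, ⟨_, _, _, _⟩, _, _, _, _⟩ := hv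
  intro i
  fin_cases i <;> simp only [Fin.zero_eta, Fin.mk_one, Fin.reduceFinMk] <;> grind

theorem finrank_adMap_formVII_eq {e : ℝ} (he : e = 1 ∨ e = -1) (l : ℝ) :
    Module.finrank ℝ (LinearMap.range (adMap hyp (formVII e e l l))) = 4 := by
  refine finrank_range_adMap (d := 2) rfl ![2, 5] (fun v hv hJ => ?_)
    fun t => ⟨![0, 0, t 0, -t 0, 0, t 1], ?_, ?_⟩
  · rw [hyp_mul_skew, formVII, lit_mul, lit_mul, lit_inj] at hv
    obtain ⟨⟨_, _, _, _⟩, ⟨_, _, _, _⟩, ⟨_, _, _, _⟩, _, _, _, _⟩ := hv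
    simp [Fin.forall_fin_succ] at hJ
    intro i
    fin_cases i <;> simp only [Fin.zero_eta, Fin.mk_one, Fin.reduceFinMk] <;> grind
  · rw [hyp_mul_skew, formVII, lit_mul, lit_mul, lit_inj]
    simp
    try grind
  · simp [Fin.forall_fin_succ]

theorem finrank_adMap_formVII_neg {e : ℝ} (he : e = 1 ∨ e = -1) (l : ℝ) :
    Module.finrank ℝ (LinearMap.range (adMap hyp (formVII e (-e) l l))) = 4 := by
  refine finrank_range_adMap (d := 2) rfl ![2, 5] (fun v hv hJ => ?_)
    fun t => ⟨![0, 0, t 0, t 0, 0, t 1], ?_, ?_⟩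
  · rw [hyp_mul_skew, formVII, lit_mul, lit_mul, lit_inj] at hv
    obtain ⟨⟨_, _, _, _⟩, ⟨_, _, _, _⟩, ⟨_, _, _, _⟩, _, _, _, _⟩ := hv
    simp [Fin.forall_fin_succ] at hJ
    intro i
    fin_cases i <;> simp only [Fin.zero_eta, Fin.mk_one, Fin.reduceFinMk] <;> grind
  · rw [hyp_mul_skew, formVII, lit_mul, lit_mul, lit_inj]
    simp
    try grind
  · simp [Fin.forall_fin_succ]

theorem finrank_adMap_formVIII {a b c d : ℝ} (hb : b ≠ 0) (hd : d ≠ 0)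
    (h : a ≠ c ∨ (b ≠ d ∧ b ≠ -d)) :
    Module.finrank ℝ (LinearMap.range (adMap eta (formVIII a b c d))) = 6 := by
  refine finrank_range_adMap_eq_six fun v hv => ?_
  have key2 : ∀ r x y : ℝ, (c - a) ^ 2 + r ^ 2 ≠ 0 → (c - a) * x = r * y →
      (c - a) * y = -r * x → x = 0 ∧ y = 0 := by
    intro r x y hr h h'
    exact ⟨by grind, by grind⟩
  have hm : (c - a) ^ 2 + (b - d) ^ 2 ≠ 0 := by
    rcases h with h | h
    · have : c - a ≠ 0 := sub_ne_zero.2 h.symm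
      positivity
    · have : b - d ≠ 0 := sub_ne_zero.2 h.1
      positivity
  have hp : (c - a) ^ 2 + (b + d) ^ 2 ≠ 0 := by
    rcases h with h | h
    · have : c - a ≠ 0 := sub_ne_zero.2 h.symm
      positivity
    · have : b + d ≠ 0 := fun h' => h.2 (by linarith)
      positivity
  rw [eta_mul_skew, formVIII, lit_mul, lit_mul, lit_inj] at hv
  obtain ⟨⟨_, _, _, _⟩, ⟨_, _, _, _⟩, ⟨_, _, _, _⟩, _, _, _, _⟩ := hv
  obtain ⟨h0, h1⟩ := key2 (b - d) (v 0 - v 5) (v 3 - v 2) hm (by linarith) (by linarith)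
  obtain ⟨h2, h3⟩ := key2 (b + d) (v 0 + v 5) (v 3 + v 2) hp (by linarith) (by linarith)
  intro i
  fin_cases i <;> simp only [Fin.zero_eta, Fin.mk_one, Fin.reduceFinMk] <;> grind

theorem finrank_adMap_formVIII_self {b : ℝ} (hb : b ≠ 0) (a : ℝ) :
    Module.finrank ℝ (LinearMap.range (adMap eta (formVIII a b a b))) = 4 := by
  refine finrank_range_adMap (d := 2) rfl ![0, 2] (fun v hv hJ => ?_)
    fun t => ⟨![t 0, 0, t 1, -t 1, 0, -t 0], ?_, ?_⟩
  · rw [eta_mul_skew, formVIII, lit_mul, lit_mul, lit_inj] at hv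
    obtain ⟨⟨_, _, _, _⟩, ⟨_, _, _, _⟩, ⟨_, _, _, _⟩, _, _, _, _⟩ := hv
    simp [Fin.forall_fin_succ] at hJ
    intro i
    fin_cases i <;> simp only [Fin.zero_eta, Fin.mk_one, Fin.reduceFinMk] <;> grind
  · rw [eta_mul_skew, formVIII, lit_mul, lit_mul, lit_inj]
    simp
    try grind
  · simp [Fin.forall_fin_succ]

/-- The row of the `i`-th entry above the diagonal of a `4 × 4` matrix. -/
def entryRow : Fin 6 → Fin 4 := ![0, 0, 0, 1, 1, 2]

/-- The column of the `i`-th entry above the diagonal of a `4 × 4` matrix. -/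
def entryCol : Fin 6 → Fin 4 := ![1, 2, 3, 2, 3, 3]

theorem eta_mul_skew_comm_formIX_iff (v : Fin 6 → ℝ) (y : Fin 4 → ℝ) :
    eta * skew v * formIX y = formIX y * (eta * skew v) ↔
      ∀ i, y (entryRow i) = y (entryCol i) ∨ v i = 0 := by
  have key : ∀ p q x : ℝ, (p = q ∨ x = 0) ↔ x * q = p * x := by
    intro p q x
    rw [← sub_eq_zero (a := p), ← mul_eq_zero, sub_mul, sub_eq_zero, mul_comm x q, eq_comm]
  simp only [key]
  rw [eta_mul_skew, formIX, diagonal_eq_lit, lit_mul, lit_mul, lit_inj]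
  constructor
  · rintro ⟨⟨-, h0, h1, h2⟩, ⟨-, -, h3, h4⟩, ⟨-, -, -, h5⟩, -⟩ i
    fin_cases i <;> simp [entryRow, entryCol] <;> linarith
  · intro h
    have h0 : v 0 * y 1 = y 0 * v 0 := h 0
    have h1 : v 1 * y 2 = y 0 * v 1 := h 1
    have h2 : v 2 * y 3 = y 0 * v 2 := h 2
    have h3 : v 3 * y 2 = y 1 * v 3 := h 3
    have h4 : v 4 * y 3 = y 1 * v 4 := h 4
    have h5 : v 5 * y 3 = y 2 * v 5 := h 5
    refine ⟨⟨?_, ?_, ?_, ?_⟩, ⟨?_, ?_, ?_, ?_⟩, ⟨?_, ?_, ?_, ?_⟩, ?_, ?_, ?_, ?_⟩ <;> linarith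

/-- For diagonal `M` the commutation relations separate: an entry of the skew matrix is free when
its two eigenvalues agree and zero otherwise. Thus `J` lists the coinciding pairs. -/
theorem finrank_adMap_formIX {y : Fin 4 → ℝ} {n d : ℕ} (hnd : n + d = 6) (J : Fin d → Fin 6)
    (hJ : Function.Injective J) (h : ∀ i, y (entryRow i) = y (entryCol i) ↔ ∃ j, J j = i) :
    Module.finrank ℝ (LinearMap.range (adMap eta (formIX y))) = n := by
  refine finrank_range_adMap hnd J (fun v hv hvJ i => ?_) fun t =>
    ⟨Function.extend J t 0, ?_, fun j => hJ.extend_apply t 0 j⟩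
  · rw [eta_mul_skew_comm_formIX_iff] at hv
    rcases hv i with hi | hi
    · obtain ⟨j, rfl⟩ := (h i).1 hi
      exact hvJ j
    · exact hi
  · rw [eta_mul_skew_comm_formIX_iff]
    intro i
    by_cases hi : ∃ j, J j = i
    · exact Or.inl ((h i).2 hi)
    · exact Or.inr (by rw [Function.extend_apply' _ _ _ hi]; rfl)

/-! ### Smooth retracts are submanifolds -/

-- The derivative `p` of a retraction at a fixed point is a projection. The map `f x = p (r x - x₀)
-- + (1 - p) (x - r x)` has derivative `p² + (1 - p)² = 1` at `x₀`, so it is a local diffeomorphism.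
-- On `A` one has `r x = x`, and `f x` lies in the range of `p`. Conversely, if `f x` lies in that
-- range, then the second term vanishes, so `f (r x) = f x`; injectivity of `f` gives `x = r x ∈ A`.
open Topology Filter in
theorem exists_chart_of_retraction {E : Type*} [NormedAddCommGroup E] [NormedSpace ℝ E]
    [CompleteSpace E] {A : Set E} {x₀ : E} (hx₀ : x₀ ∈ A) {r : E → E} (hr : ContDiffAt ℝ ω r x₀)
    (hrA : ∀ᶠ x in 𝓝 x₀, r x ∈ A) (hrid : ∀ᶠ x in 𝓝 x₀, x ∈ A → r x = x) :
    ∃ φ : OpenPartialHomeomorph E E,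
      x₀ ∈ φ.source ∧ ContDiffOn ℝ ∞ φ φ.source ∧ ContDiffOn ℝ ∞ φ.symm φ.target ∧
      φ '' (φ.source ∩ A) =
        φ.target ∩ (LinearMap.range (fderiv ℝ r x₀ : E →ₗ[ℝ] E) : Set E) := by
  set p := fderiv ℝ r x₀ with hp
  have hdr : HasFDerivAt r p x₀ := (hr.differentiableAt (by simp)).hasFDerivAt
  have hrx₀ : r x₀ = x₀ := hrid.self_of_nhds hx₀
  have hcont : Tendsto r (𝓝 x₀) (𝓝 x₀) := by
    simpa [ContinuousAt, hrx₀] using hr.continuousAt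
  have hrr : ∀ᶠ x in 𝓝 x₀, r (r x) = r x := by
    filter_upwards [hrA, hcont.eventually hrid] with x h1 h2 using h2 h1
  have hpp : ∀ v, p (p v) = p v := by
    have h1 : HasFDerivAt (fun x => r (r x)) (p.comp p) x₀ := by
      have : HasFDerivAt r p (r x₀) := by rwa [hrx₀]
      exact this.comp x₀ hdr
    have h2 : HasFDerivAt (fun x => r (r x)) p x₀ := hdr.congr_of_eventuallyEq hrr
    intro v
    exact congrArg (fun f : E →L[ℝ] E => f v) (h1.unique h2)
  set f : E → E := fun x => p (r x - x₀) + ((x - r x) - p (x - r x)) with hf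
  have hfs : ContDiffAt ℝ ω f x₀ := by
    have h1 : ContDiffAt ℝ ω (fun x => x - r x) x₀ := contDiffAt_id.sub hr
    exact (p.contDiff.contDiffAt.comp x₀ (hr.sub contDiffAt_const)).add
      (h1.sub (p.contDiff.contDiffAt.comp x₀ h1))
  have hfd : HasFDerivAt f ((ContinuousLinearEquiv.refl ℝ E : E ≃L[ℝ] E) : E →L[ℝ] E) x₀ := by
    have h1 : HasFDerivAt (fun x => x - r x) (ContinuousLinearMap.id ℝ E - p) x₀ :=
      (hasFDerivAt_id x₀).sub hdr
    have h2 := (p.hasFDerivAt.comp x₀ (hdr.sub_const x₀)).add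
      (h1.sub (p.hasFDerivAt.comp x₀ h1))
    refine h2.congr_fderiv ?_
    ext v
    simp [hpp]
  have hω : (ω : WithTop ℕ∞) ≠ 0 := by simp
  set Φ := hfs.toOpenPartialHomeomorph f hfd hω with hΦ
  have hΦf : ∀ x, Φ x = f x := fun x => rfl
  have hΦx₀ : x₀ ∈ Φ.source := hfs.mem_toOpenPartialHomeomorph_source hfd hω
  have hsymm : ContDiffAt ℝ ω Φ.symm (f x₀) := hfs.to_localInverse hfd hω
  -- `ContDiffAt` of class `ω` at a point passes to a neighbourhood; for class `∞` this would not be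
  -- automatic. For this reason the retractions are taken analytic although the charts only need to
  -- be smooth.
  have hsymm' : ∀ᶠ x in 𝓝 x₀, ContDiffAt ℝ ω Φ.symm (f x) :=
    hfd.continuousAt.eventually (hsymm.eventually (by simp))
  have hev : ∀ᶠ x in 𝓝 x₀, ContDiffAt ℝ ω f x ∧ ContDiffAt ℝ ω Φ.symm (f x) ∧ r x ∈ A ∧
      r x ∈ Φ.source ∧ (x ∈ A → r x = x) ∧ r (r x) = r x := by
    filter_upwards [hfs.eventually (by simp), hsymm', hrA,
      hcont.eventually (Φ.open_source.mem_nhds hΦx₀), hrid, hrr] with x h1 h2 h3 h4 h5 h6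
    exact ⟨h1, h2, h3, h4, h5, h6⟩
  obtain ⟨V, hV, hVo, hxV⟩ := eventually_nhds_iff.1 hev
  refine ⟨Φ.restrOpen V hVo, ⟨hΦx₀, hxV⟩, ?_, ?_, ?_⟩
  · intro x hx
    exact ((hV x hx.2).1.of_le (by simp)).contDiffWithinAt
  · intro y hy
    have hy' : y ∈ Φ.target ∧ Φ.symm y ∈ V := by
      simpa using hy
    have h := (hV _ hy'.2).2.1
    rw [← hΦf, Φ.right_inv hy'.1] at h
    exact (h.of_le (by simp)).contDiffWithinAt
  · ext y
    constructor
    · rintro ⟨x, ⟨hx, hxA⟩, rfl⟩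
      refine ⟨(Φ.restrOpen V hVo).map_source hx, ?_⟩
      have hxx := (hV x hx.2).2.2.2.2.1 hxA
      refine ⟨x - x₀, ?_⟩
      show p (x - x₀) = f x
      simp [hf, hxx]
    · rintro ⟨hy, v, hv⟩
      obtain ⟨x, hx, rfl⟩ : ∃ x ∈ (Φ.restrOpen V hVo).source, Φ.restrOpen V hVo x = y :=
        ⟨_, (Φ.restrOpen V hVo).map_target hy, (Φ.restrOpen V hVo).right_inv hy⟩
      obtain ⟨-, -, h3, h4, -, h6⟩ := hV x hx.2
      have hv' : p v = f x := hv
      have h7 : p (f x) = f x := by rw [← hv', hpp]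
      have h8 : (x - r x) - p (x - r x) = 0 := by
        have h9 : p (f x) = p (r x - x₀) := by
          simp only [hf, map_add, map_sub, hpp]
          abel
        rw [h9] at h7
        exact (left_eq_add (a := p (r x - x₀))).1 h7
      have h10 : f (r x) = f x := by
        simp only [hf, h6, sub_self, map_zero, add_zero, h8]
      have h11 : r x = x := Φ.injOn h4 hx.1 h10
      exact ⟨x, ⟨hx, h11 ▸ h3⟩, rfl⟩

theorem IsSubmanifold.of_retractions {E : Type*} [NormedAddCommGroup E] [NormedSpace ℝ E]
    [CompleteSpace E] {A : Set E} {n : ℕ}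
    (h : ∀ x ∈ A, ∃ r : E → E, ContDiffAt ℝ ω r x ∧ (∀ᶠ y in nhds x, r y ∈ A) ∧
      (∀ᶠ y in nhds x, y ∈ A → r y = y) ∧
      Module.finrank ℝ (LinearMap.range (fderiv ℝ r x : E →ₗ[ℝ] E)) = n) :
    IsSubmanifold n A := by
  intro x hx
  obtain ⟨r, h1, h2, h3, h4⟩ := h x hx
  obtain ⟨φ, h5, h6, h7, h8⟩ := exists_chart_of_retraction hx h1 h2 h3
  exact ⟨φ, _, h5, h6, h7, h4, h8⟩

/-- Retractions are built in a normed algebra of matrices, whereas the orbits are asserted to be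
submanifolds of the space of arrays with its own norm; the two are linearly homeomorphic. -/
theorem IsSubmanifold.preimage {E F : Type*} [NormedAddCommGroup E] [NormedSpace ℝ E]
    [NormedAddCommGroup F] [NormedSpace ℝ F] (e : E ≃L[ℝ] F) {A : Set F} {n : ℕ}
    (hA : IsSubmanifold n A) : IsSubmanifold n (e ⁻¹' A) := by
  intro x hx
  obtain ⟨φ, G, h1, h2, h3, h4, h5⟩ := hA (e x) hx
  refine ⟨(e.toHomeomorph.toOpenPartialHomeomorph.trans φ).trans
    e.symm.toHomeomorph.toOpenPartialHomeomorph, G.map (e.symm : F →ₗ[ℝ] E), ?_, ?_, ?_, ?_, ?_⟩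
  · simpa using h1
  · refine (e.symm.contDiff.comp_contDiffOn (h2.comp e.contDiff.contDiffOn fun y hy => ?_))
    simpa using hy
  · refine (e.symm.contDiff.comp_contDiffOn (h3.comp e.contDiff.contDiffOn fun y hy => ?_))
    simpa using hy
  · rw [← h4]
    exact LinearEquiv.finrank_map_eq e.symm.toLinearEquiv G
  · ext y
    have h6 : e y ∈ φ '' (φ.source ∩ A) ↔ e y ∈ φ.target ∩ (G : Set F) := by rw [h5]
    simp only [Set.mem_image, Set.mem_inter_iff, SetLike.mem_coe] at h6
    constructor
    · rintro ⟨z, ⟨hz, hzA⟩, rfl⟩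
      have hz' : e z ∈ φ.source := by simpa using hz
      have := h6.1 ⟨e z, ⟨hz', hzA⟩, by simp⟩
      refine ⟨by simpa using this.1, ⟨φ (e z), ?_, by simp⟩⟩
      simpa using this.2
    · rintro ⟨hy, w, hw, rfl⟩
      have hy' : w ∈ φ.target := by simpa using hy
      obtain ⟨z, ⟨hz, hzA⟩, hzw⟩ := h6.2 ⟨by simpa using hy', by simpa using hw⟩
      refine ⟨e.symm z, ⟨by simpa using hz, by simpa using hzA⟩, ?_⟩
      simpa using hzw

/-! ### Local sections of orbit maps of self-adjoint elements -/

section Algebra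

open Topology Filter

variable {𝔸 : Type*} [NormedRing 𝔸] [NormedAlgebra ℝ 𝔸]

/-- Inverse function theorem for squaring, whose derivative at `1` is multiplication by `2`. -/
theorem exists_smooth_sqrt [CompleteSpace 𝔸] : ∃ s : 𝔸 → 𝔸, ContDiffAt ℝ ω s 1 ∧ s 1 = 1 ∧
    ∀ᶠ a in 𝓝 (1 : 𝔸), s a * s a = a := by
  have hω : (ω : WithTop ℕ∞) ≠ 0 := by simp
  have hf : ContDiffAt ℝ ω (fun x : 𝔸 => x * x) 1 := contDiffAt_id.mul contDiffAt_id
  let e : 𝔸 ≃L[ℝ] 𝔸 := ContinuousLinearEquiv.smulLeft (Units.mk0 (2 : ℝ) two_ne_zero)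
  have hfd : HasFDerivAt (fun x : 𝔸 => x * x) (e : 𝔸 →L[ℝ] 𝔸) 1 := by
    refine ((hasFDerivAt_id (1 : 𝔸)).mul' (hasFDerivAt_id (1 : 𝔸))).congr_fderiv ?_
    ext v
    simp [e, two_smul, Units.smul_def]
  refine ⟨hf.localInverse hfd hω, ?_, ?_, ?_⟩
  · have := hf.to_localInverse hfd hω
    rwa [mul_one (1 : 𝔸)] at this
  · have := hf.localInverse_apply_image hfd hω
    rwa [mul_one (1 : 𝔸)] at this
  · have := (hf.hasStrictFDerivAt' hfd hω).eventually_right_inverse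
    rwa [mul_one (1 : 𝔸)] at this

/-- For `P` and `Q` near `1` the map `D ↦ P D + D Q` is close to `2 D`, hence injective. This is the
form in which uniqueness of square roots near `1` is used, both to see that a root is self-adjoint
and that it commutes with what its square commutes with. -/
theorem eq_zero_of_mul_add_mul_eq_zero {P Q D : 𝔸} (hP : ‖P - 1‖ < 1) (hQ : ‖Q - 1‖ < 1)
    (h : P * D + D * Q = 0) : D = 0 := by
  by_contra hD
  have hD' : 0 < ‖D‖ := norm_pos_iff.2 hD
  have h1 : (2 : ℝ) • D = -((P - 1) * D + D * (Q - 1)) := by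
    rw [two_smul, sub_mul, mul_sub, one_mul, mul_one]
    have : D + D = -(P * D + D * Q - D - D) := by rw [h]; abel
    rw [this]
    abel
  have h2 : 2 * ‖D‖ ≤ ‖P - 1‖ * ‖D‖ + ‖D‖ * ‖Q - 1‖ := by
    calc 2 * ‖D‖ = ‖(2 : ℝ) • D‖ := by rw [norm_smul]; norm_num
      _ = ‖(P - 1) * D + D * (Q - 1)‖ := by rw [h1, norm_neg]
      _ ≤ _ := (norm_add_le _ _).trans (add_le_add (norm_mul_le _ _) (norm_mul_le _ _))
  nlinarith

/-- A linear right inverse of `T` onto its range, extended to the whole space. -/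
theorem exists_generalized_inverse {V : Type*} [AddCommGroup V] [Module ℝ V] (T : V →ₗ[ℝ] V) :
    ∃ G : V →ₗ[ℝ] V, ∀ x, T (G (T x)) = T x := by
  obtain ⟨g, hg⟩ := T.rangeRestrict.exists_rightInverse_of_surjective T.range_rangeRestrict
  obtain ⟨G, hG⟩ := g.exists_extend
  refine ⟨G, fun x => ?_⟩
  have h1 : G (T x) = g (T.rangeRestrict x) := LinearMap.congr_fun hG (T.rangeRestrict x)
  have h2 := LinearMap.congr_fun hg (T.rangeRestrict x)
  rw [h1]
  exact congrArg Subtype.val h2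

/-- Near `S₀`, an element `S` conjugate to `S₀` is intertwined with `S₀` by an element that depends
smoothly on `S` and equals `1` at `S₀`. -/
theorem exists_smooth_intertwiner [FiniteDimensional ℝ 𝔸] (S₀ : 𝔸) :
    ∃ P : 𝔸 → 𝔸, ContDiffAt ℝ ω P S₀ ∧ P S₀ = 1 ∧
      ∀ᶠ S in 𝓝 S₀, ∀ Q : 𝔸ˣ, S * Q = Q * S₀ → S * P S = P S * S₀ := by
  have : CompleteSpace 𝔸 := FiniteDimensional.complete ℝ 𝔸
  let T : 𝔸 →ₗ[ℝ] 𝔸 := LinearMap.mulRight ℝ S₀ - LinearMap.mulLeft ℝ S₀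
  have hT : ∀ x, T x = x * S₀ - S₀ * x := fun x => rfl
  obtain ⟨G, hG⟩ := exists_generalized_inverse T
  let G' : 𝔸 →L[ℝ] 𝔸 := G.toContinuousLinearMap
  -- The equation `S x = x S₀` reads `T x = (S - S₀) x`. It is replaced by `x = 1 + G ((S - S₀) x)`,
  -- that is `N S x = 1`, which has a unique smooth solution for `S` near `S₀`.
  let N : 𝔸 → (𝔸 →L[ℝ] 𝔸) := fun S => 1 - G'.comp (ContinuousLinearMap.mul ℝ 𝔸 (S - S₀))
  have hN : ∀ S x, N S x = x - G ((S - S₀) * x) := fun S x => rfl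
  have hNS₀ : N S₀ = 1 := by
    ext x
    simp [hN]
  have hmul : ContDiff ℝ ω fun S : 𝔸 => ContinuousLinearMap.mul ℝ 𝔸 (S - S₀) :=
    (ContinuousLinearMap.mul ℝ 𝔸).contDiff.comp (contDiff_id.sub contDiff_const)
  have hcomp : ContDiff ℝ ω fun S : 𝔸 => G'.comp (ContinuousLinearMap.mul ℝ 𝔸 (S - S₀)) :=
    ContDiff.clm_comp (g := fun _ : 𝔸 => G') contDiff_const hmul
  have hNs : ContDiff ℝ ω N := ContDiff.sub (f := fun _ : 𝔸 => (1 : 𝔸 →L[ℝ] 𝔸)) contDiff_const hcomp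
  refine ⟨fun S => Ring.inverse (N S) 1, ?_, ?_, ?_⟩
  · have h1 : ContDiffAt ℝ ω (fun S => Ring.inverse (N S)) S₀ := by
      refine ContDiffAt.comp (g := (Ring.inverse : (𝔸 →L[ℝ] 𝔸) → (𝔸 →L[ℝ] 𝔸))) S₀ ?_ hNs.contDiffAt
      rw [hNS₀]
      exact contDiffAt_ringInverse ℝ 1
    exact h1.clm_apply contDiffAt_const
  · simp [hNS₀]
  · have hunit : ∀ᶠ S in 𝓝 S₀, IsUnit (N S) := by
      refine hNs.continuous.continuousAt.eventually (Units.isOpen.mem_nhds ?_)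
      rw [hNS₀]
      exact isUnit_one
    filter_upwards [hunit] with S hS Q hQ
    obtain ⟨u, hu⟩ := hS
    -- The elements `Q Z` with `Z` in the centralizer `ker T` of `S₀` all intertwine. On them `(S -
    -- S₀) x = T x`, so `N S x = x - G (T x)` is killed by `T`.
    have hmaps : ∀ Z ∈ LinearMap.ker T, N S (Q * Z) ∈ LinearMap.ker T := by
      intro Z hZ
      rw [LinearMap.mem_ker, hT, sub_eq_zero] at hZ
      have h1 : (S - S₀) * (Q * Z) = T (Q * Z) := by
        rw [hT, sub_mul, ← mul_assoc, hQ, mul_assoc, ← hZ, mul_assoc]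
      rw [LinearMap.mem_ker, hN, h1, map_sub, hG, sub_self]
    let ψ : LinearMap.ker T →ₗ[ℝ] LinearMap.ker T :=
      (((N S : 𝔸 →ₗ[ℝ] 𝔸).comp (LinearMap.mulLeft ℝ (Q : 𝔸))).restrict hmaps)
    have hψ : ∀ Z, (ψ Z : 𝔸) = N S (Q * Z) := fun Z => rfl
    have hNinj : ∀ x, (↑u⁻¹ : 𝔸 →L[ℝ] 𝔸) (N S x) = x := by
      intro x
      rw [← hu]
      exact congrArg (fun f : 𝔸 →L[ℝ] 𝔸 => f x) u.inv_mul
    have hψinj : Function.Injective ψ := by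
      rw [← LinearMap.ker_eq_bot, LinearMap.ker_eq_bot']
      intro Z hZ
      have h1 : N S (Q * Z) = 0 := by rw [← hψ, hZ]; rfl
      have h2 : (Q : 𝔸) * Z = 0 := by rw [← hNinj (Q * Z), h1, map_zero]
      ext
      simpa using h2
    -- By finite dimension the injective map `ψ` of `ker T` to itself reaches `1`. So the solution
    -- of `N S x = 1` has the form `Q Z` and does intertwine.
    obtain ⟨Z, hZ⟩ := LinearMap.injective_iff_surjective.1 hψinj ⟨1, by simp [hT]⟩
    have h1 : N S (Q * Z) = 1 := by rw [← hψ, hZ]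
    have h2 : Ring.inverse (N S) 1 = Q * Z := by
      rw [← hu, Ring.inverse_unit, ← h1, hNinj]
    have hZ' := Z.2
    rw [LinearMap.mem_ker, hT, sub_eq_zero] at hZ'
    simp only [h2]
    rw [← mul_assoc, hQ, mul_assoc, ← hZ', mul_assoc]

/-- The adjoints with respect to a scalar product form an anti-involution. -/
structure IsAntiInvolution (τ : 𝔸 →L[ℝ] 𝔸) : Prop where
  map_mul : ∀ a b, τ (a * b) = τ b * τ a
  map_one : τ 1 = 1
  invol : ∀ a, τ (τ a) = a

/-- The elements that are orthogonal with respect to an anti-involution. -/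
def orthSet (τ : 𝔸 →L[ℝ] 𝔸) : Set 𝔸 := {g | τ g * g = 1 ∧ g * τ g = 1}

theorem mul_mem_orthSet {τ : 𝔸 →L[ℝ] 𝔸} (hτ : IsAntiInvolution τ) {g h : 𝔸} (hg : g ∈ orthSet τ)
    (hh : h ∈ orthSet τ) : g * h ∈ orthSet τ := by
  refine ⟨?_, ?_⟩
  · rw [hτ.map_mul, mul_assoc, ← mul_assoc (τ g), hg.1, one_mul, hh.1]
  · rw [hτ.map_mul, mul_assoc, ← mul_assoc h, hh.2, one_mul, hg.2]

theorem star_mem_orthSet {τ : 𝔸 →L[ℝ] 𝔸} (hτ : IsAntiInvolution τ) {g : 𝔸} (hg : g ∈ orthSet τ) :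
    τ g ∈ orthSet τ := by
  refine ⟨?_, ?_⟩ <;> rw [hτ.invol]
  exacts [hg.2, hg.1]

/-- The orbit map `g ↦ g S₀ g⁻¹` of a self-adjoint element has a smooth local section. -/
theorem exists_local_section [FiniteDimensional ℝ 𝔸] {τ : 𝔸 →L[ℝ] 𝔸} (hτ : IsAntiInvolution τ)
    {S₀ : 𝔸} (hS₀ : τ S₀ = S₀) :
    ∃ L : 𝔸 → 𝔸, ContDiffAt ℝ ω L S₀ ∧ L S₀ = 1 ∧ (∀ᶠ S in 𝓝 S₀, L S ∈ orthSet τ) ∧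
      ∀ᶠ S in 𝓝 S₀, (∃ g ∈ orthSet τ, S = g * S₀ * τ g) → L S * S₀ * τ (L S) = S := by
  have : CompleteSpace 𝔸 := FiniteDimensional.complete ℝ 𝔸
  obtain ⟨P, hP, hP1, hPS⟩ := exists_smooth_intertwiner S₀
  obtain ⟨s, hs, hs1, hss⟩ := exists_smooth_sqrt (𝔸 := 𝔸)
  -- Polar decomposition: with `Q` the square root of `τ P * P`, the element `P Q⁻¹` is orthogonal.
  set Q : 𝔸 → 𝔸 := fun S => s (τ (P S) * P S) with hQ
  have hPP : ContDiffAt ℝ ω (fun S => τ (P S) * P S) S₀ :=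
    (τ.contDiff.contDiffAt.comp S₀ hP).mul hP
  have hPP1 : τ (P S₀) * P S₀ = 1 := by rw [hP1, hτ.map_one, mul_one]
  have hQs : ContDiffAt ℝ ω Q S₀ := by
    refine ContDiffAt.comp S₀ ?_ hPP
    rwa [hPP1]
  have hQ1 : Q S₀ = 1 := by simp only [hQ, hPP1, hs1]
  have hQi : ContDiffAt ℝ ω (fun S => Ring.inverse (Q S)) S₀ := by
    refine ContDiffAt.comp (g := (Ring.inverse : 𝔸 → 𝔸)) S₀ ?_ hQs
    rw [hQ1]
    exact contDiffAt_ringInverse ℝ 1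
  have hLs : ContDiffAt ℝ ω (fun S => P S * Ring.inverse (Q S)) S₀ := hP.mul hQi
  have hQQ : ∀ᶠ S in 𝓝 S₀, Q S * Q S = τ (P S) * P S := by
    have := hPP.continuousAt.tendsto
    rw [hPP1] at this
    exact this.eventually hss
  have hQu : ∀ᶠ S in 𝓝 S₀, IsUnit (Q S) := by
    refine hQs.continuousAt.eventually (Units.isOpen.mem_nhds ?_)
    rw [hQ1]
    exact isUnit_one
  have hPu : ∀ᶠ S in 𝓝 S₀, IsUnit (P S) := by
    refine hP.continuousAt.eventually (Units.isOpen.mem_nhds ?_)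
    rw [hP1]
    exact isUnit_one
  have hQn : ∀ᶠ S in 𝓝 S₀, ‖Q S - 1‖ < 1 := by
    have : ContinuousAt (fun S => ‖Q S - 1‖) S₀ := (hQs.continuousAt.sub continuousAt_const).norm
    refine this.eventually (Iio_mem_nhds ?_)
    simp [hQ1]
  have hτQn : ∀ᶠ S in 𝓝 S₀, ‖τ (Q S) - 1‖ < 1 := by
    have : ContinuousAt (fun S => ‖τ (Q S) - 1‖) S₀ :=
      ((τ.continuous.continuousAt.comp hQs.continuousAt).sub continuousAt_const).norm
    refine this.eventually (Iio_mem_nhds ?_)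
    simp [hQ1, hτ.map_one]
  -- Both are square roots near `1` of the self-adjoint element `τ P * P`.
  have hτQ : ∀ᶠ S in 𝓝 S₀, τ (Q S) = Q S := by
    filter_upwards [hQQ, hQn, hτQn] with S h1 h2 h3
    have h4 : τ (Q S) * τ (Q S) = Q S * Q S := by
      rw [← hτ.map_mul, h1, hτ.map_mul, hτ.invol]
    refine sub_eq_zero.1 (eq_zero_of_mul_add_mul_eq_zero h3 h2 ?_)
    rw [mul_sub, sub_mul, h4]
    abel
  have horth : ∀ᶠ S in 𝓝 S₀, P S * Ring.inverse (Q S) ∈ orthSet τ := by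
    filter_upwards [hQQ, hQu, hPu, hτQ] with S h1 h2 h3 h4
    have h5 : τ (P S * Ring.inverse (Q S)) * (P S * Ring.inverse (Q S)) = 1 := by
      have h6 : τ (Ring.inverse (Q S)) * Q S = 1 := by
        calc τ (Ring.inverse (Q S)) * Q S = τ (Ring.inverse (Q S)) * τ (Q S) := by rw [h4]
          _ = 1 := by rw [← hτ.map_mul, Ring.mul_inverse_cancel _ h2, hτ.map_one]
      calc τ (P S * Ring.inverse (Q S)) * (P S * Ring.inverse (Q S))
          = τ (Ring.inverse (Q S)) * (τ (P S) * P S) * Ring.inverse (Q S) := by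
            rw [hτ.map_mul]
            simp only [mul_assoc]
        _ = (τ (Ring.inverse (Q S)) * Q S) * (Q S * Ring.inverse (Q S)) := by
            rw [← h1]
            simp only [mul_assoc]
        _ = 1 := by rw [h6, Ring.mul_inverse_cancel _ h2, mul_one]
    -- For an invertible element the left inverse `τ` just found is also a right inverse.
    obtain ⟨u, hu⟩ : IsUnit (P S * Ring.inverse (Q S)) := h3.mul h2.ringInverse
    refine ⟨h5, ?_⟩
    rw [← hu] at h5 ⊢
    have h7 : τ (u : 𝔸) = ↑u⁻¹ := by
      rw [← mul_one (τ (u : 𝔸)), ← u.mul_inv, ← mul_assoc, h5, one_mul]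
    rw [h7, Units.mul_inv]
  refine ⟨fun S => P S * Ring.inverse (Q S), hLs, by simp [hP1, hQ1], horth, ?_⟩
  filter_upwards [hPS, hQQ, hQn, hQu, horth] with S h1 h2 h3 h4 h5
  rintro ⟨g, hg, rfl⟩
  set S := g * S₀ * τ g with hS
  have hτS : τ S = S := by
    rw [hS, hτ.map_mul, hτ.map_mul, hτ.invol, hS₀, mul_assoc]
  have h6 : S * P S = P S * S₀ := by
    refine h1 ⟨g, τ g, hg.2, hg.1⟩ ?_
    show g * S₀ * τ g * g = g * S₀
    rw [mul_assoc, hg.1, mul_one]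
  have h7 : τ (P S) * S = S₀ * τ (P S) := by
    rw [← hτS, ← hτ.map_mul, hτS, h6, hτ.map_mul, hS₀]
  -- `P` intertwines in one direction and `τ P` in the other, so `Q² = τ P * P` commutes with `S₀`.
  -- Then `Q` commutes as well, because its commutator `D` with `S₀` satisfies `Q D + D Q = 0`.
  have h8 : Q S * Q S * S₀ = S₀ * (Q S * Q S) := by
    rw [h2, mul_assoc, ← h6, ← mul_assoc, h7, mul_assoc]
  have h9 : Commute (Q S) S₀ := by
    refine sub_eq_zero.1 (eq_zero_of_mul_add_mul_eq_zero h3 h3 ?_)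
    rw [mul_sub, sub_mul]
    simp only [← mul_assoc] at h8 ⊢
    rw [h8]
    abel
  have h10 : S * (P S * Ring.inverse (Q S)) = P S * Ring.inverse (Q S) * S₀ := by
    obtain ⟨u, hu⟩ := h4
    rw [← hu] at h9
    rw [← hu, Ring.inverse_unit, ← mul_assoc, h6, mul_assoc, mul_assoc, h9.units_inv_left.eq]
  rw [← h10, mul_assoc, h5.2, mul_one]

/-- The reversal of products is invisible on powers of a single element, and continuity passes to
the series. -/
theorem map_exp_of_isAntiInvolution [CompleteSpace 𝔸] {τ : 𝔸 →L[ℝ] 𝔸} (hτ : IsAntiInvolution τ)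
    (X : 𝔸) : τ (NormedSpace.exp X) = NormedSpace.exp (τ X) := by
  have hpow : ∀ n : ℕ, τ (X ^ n) = τ X ^ n := by
    intro n
    induction n with
    | zero => simp [hτ.map_one]
    | succ n ih => rw [pow_succ, hτ.map_mul, ih, pow_succ']
  rw [NormedSpace.exp_eq_tsum ℝ]
  simp only
  rw [τ.map_tsum (NormedSpace.expSeries_summable' X)]
  simp [hpow]

/-- The space tangent to the orbit of `S` at `S`. -/
def tangentAt (τ : 𝔸 →L[ℝ] 𝔸) (S : 𝔸) : Submodule ℝ 𝔸 :=
  (LinearMap.ker ((τ : 𝔸 →ₗ[ℝ] 𝔸) + LinearMap.id)).map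
    (LinearMap.mulRight ℝ S - LinearMap.mulLeft ℝ S)

theorem exp_smul_mem_orthSet [CompleteSpace 𝔸] {τ : 𝔸 →L[ℝ] 𝔸} (hτ : IsAntiInvolution τ) {X : 𝔸}
    (hX : τ X = -X) (t : ℝ) : NormedSpace.exp (t • X) ∈ orthSet τ := by
  have hQ : NormedAlgebra ℚ 𝔸 := NormedAlgebra.restrictScalars ℚ ℝ 𝔸
  have h : τ (t • X) = -(t • X) := by rw [map_smul, hX, smul_neg]
  have h1 : Commute (-(t • X)) (t • X) := (Commute.refl _).neg_left
  refine ⟨?_, ?_⟩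
  · rw [map_exp_of_isAntiInvolution hτ, h, ← NormedSpace.exp_add_of_commute h1]
    simp
  · rw [map_exp_of_isAntiInvolution hτ, h, ← NormedSpace.exp_add_of_commute h1.symm]
    simp

/-- With `L` the local section, `r y = L y * S * τ (L y)` lands in the orbit and fixes its points.
Differentiating `τ L * L = 1` at `S`, where `L = 1`, shows that `dL` takes skew-adjoint values, so
`dr` takes values in the commutators with `S`. All of these occur, as the orbit curves generated by
skew-adjoint elements show. -/
theorem exists_retraction_orbit [FiniteDimensional ℝ 𝔸] {τ : 𝔸 →L[ℝ] 𝔸} (hτ : IsAntiInvolution τ)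
    {S : 𝔸} (hS : τ S = S) :
    ∃ r : 𝔸 → 𝔸, ContDiffAt ℝ ω r S ∧ (∀ᶠ y in 𝓝 S, ∃ g ∈ orthSet τ, r y = g * S * τ g) ∧
      (∀ᶠ y in 𝓝 S, (∃ g ∈ orthSet τ, y = g * S * τ g) → r y = y) ∧
      LinearMap.range (fderiv ℝ r S : 𝔸 →ₗ[ℝ] 𝔸) = tangentAt τ S := by
  have : CompleteSpace 𝔸 := FiniteDimensional.complete ℝ 𝔸
  obtain ⟨L, hL, hL1, hLo, hLS⟩ := exists_local_section hτ hS
  have hτL : ContDiffAt ℝ ω (fun y => τ (L y)) S := τ.contDiff.contDiffAt.comp S hL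
  have hr : ContDiffAt ℝ ω (fun y => L y * S * τ (L y)) S :=
    (hL.mul contDiffAt_const).mul hτL
  refine ⟨fun y => L y * S * τ (L y), hr, hLo.mono fun y hy => ⟨L y, hy, rfl⟩, hLS, ?_⟩
  have hdL : HasFDerivAt L (fderiv ℝ L S) S := (hL.differentiableAt (by simp)).hasFDerivAt
  have hdτL : HasFDerivAt (fun y => τ (L y)) (τ.comp (fderiv ℝ L S)) S :=
    τ.hasFDerivAt.comp S hdL
  have hskew : ∀ v, τ (fderiv ℝ L S v) = -fderiv ℝ L S v := by
    intro v
    have h1 := hdτL.mul' hdL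
    have h2 : HasFDerivAt (fun y => τ (L y) * L y) (0 : 𝔸 →L[ℝ] 𝔸) S := by
      refine (hasFDerivAt_const (1 : 𝔸) S).congr_of_eventuallyEq ?_
      filter_upwards [hLo] with y hy using hy.1
    have h3 := congrArg (fun f : 𝔸 →L[ℝ] 𝔸 => f v) (h1.unique h2)
    simp only [hL1, hτ.map_one] at h3
    rw [eq_neg_iff_add_eq_zero]
    simpa [add_comm] using h3
  have hdr : ∀ v, fderiv ℝ (fun y => L y * S * τ (L y)) S v
      = fderiv ℝ L S v * S - S * fderiv ℝ L S v := by
    intro v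
    have h1 := ((hdL.mul' (hasFDerivAt_const S S)).mul' hdτL).fderiv
    have h2 := congrArg (fun f : 𝔸 →L[ℝ] 𝔸 => f v) h1
    have h3 : fderiv ℝ (fun y => L y * S * τ (L y)) S v = _ := h2
    rw [h3]
    simp [hL1, hτ.map_one, hskew]
    abel
  apply le_antisymm
  · rintro _ ⟨v, rfl⟩
    refine ⟨fderiv ℝ L S v, ?_, ?_⟩
    · simp [hskew]
    · simp [hdr]
  · rintro _ ⟨X, hX, rfl⟩
    have hX' : τ X = -X := by
      rw [eq_neg_iff_add_eq_zero]
      simpa using hX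
    -- The curve `exp (tX) S τ(exp (tX))` stays in the orbit, where `r` is the identity. Hence the
    -- derivative of `r` fixes its initial velocity `X S - S X`.
    refine ⟨X * S - S * X, ?_⟩
    have hc : HasDerivAt (fun t : ℝ => NormedSpace.exp (t • X)) X 0 := by
      have := hasDerivAt_exp_smul_const X (0 : ℝ)
      simpa using this
    have hτc : HasDerivAt (fun t : ℝ => τ (NormedSpace.exp (t • X))) (-X) 0 := by
      have := τ.hasFDerivAt.comp_hasDerivAt (0 : ℝ) hc
      rwa [hX'] at this
    have hγ : HasDerivAt (fun t : ℝ => NormedSpace.exp (t • X) * S * τ (NormedSpace.exp (t • X)))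
        (X * S - S * X) 0 := by
      have := (hc.mul (hasDerivAt_const (0 : ℝ) S)).mul hτc
      refine this.congr_deriv ?_
      simp [hτ.map_one]
      abel
    have hγ0 : NormedSpace.exp ((0 : ℝ) • X) * S * τ (NormedSpace.exp ((0 : ℝ) • X)) = S := by
      simp [hτ.map_one]
    have h1 := (hr.differentiableAt (by simp)).hasFDerivAt
    have h2 : HasDerivAt (fun t : ℝ => (fun y => L y * S * τ (L y))
        (NormedSpace.exp (t • X) * S * τ (NormedSpace.exp (t • X))))
        (fderiv ℝ (fun y => L y * S * τ (L y)) S (X * S - S * X)) 0 := by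
      refine HasFDerivAt.comp_hasDerivAt (l := fun y => L y * S * τ (L y)) (0 : ℝ) ?_ hγ
      rwa [hγ0]
    have h3 := hγ.continuousAt.tendsto
    rw [hγ0] at h3
    refine (h2.congr_of_eventuallyEq ?_).unique hγ
    filter_upwards [h3.eventually hLS] with t ht
    exact (ht ⟨_, exp_smul_mem_orthSet hτ hX' t, rfl⟩).symm

theorem isSubmanifold_orbit [FiniteDimensional ℝ 𝔸] {τ : 𝔸 →L[ℝ] 𝔸} (hτ : IsAntiInvolution τ)
    {S₀ : 𝔸} (hS₀ : τ S₀ = S₀) {n : ℕ}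
    (hn : ∀ g ∈ orthSet τ, Module.finrank ℝ (tangentAt τ (g * S₀ * τ g)) = n) :
    IsSubmanifold n {S | ∃ g ∈ orthSet τ, S = g * S₀ * τ g} := by
  have : CompleteSpace 𝔸 := FiniteDimensional.complete ℝ 𝔸
  refine IsSubmanifold.of_retractions ?_
  rintro _ ⟨g, hg, rfl⟩
  have hS : τ (g * S₀ * τ g) = g * S₀ * τ g := by
    rw [hτ.map_mul, hτ.map_mul, hτ.invol, hS₀, mul_assoc]
  obtain ⟨r, h1, h2, h3, h4⟩ := exists_retraction_orbit hτ hS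
  refine ⟨r, h1, h2.mono ?_, h3.mono ?_, by rw [h4, hn g hg]⟩
  · rintro y ⟨h, hh, hy⟩
    refine ⟨h * g, mul_mem_orthSet hτ hh hg, ?_⟩
    rw [hy, hτ.map_mul]
    simp only [mul_assoc]
  · rintro y hy ⟨h, hh, rfl⟩
    -- The orbit is recentred at `g S₀ τ g`; since `τ g` is the inverse of `g`, the element `h * τ
    -- g` carries the new base point where `h` carries the old one.
    refine hy ⟨h * τ g, mul_mem_orthSet hτ hh (star_mem_orthSet hτ hg), ?_⟩
    have hgg : ∀ z, τ g * (g * z) = z := fun z => by rw [← mul_assoc, hg.1, one_mul]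
    rw [hτ.map_mul, hτ.invol]
    simp only [mul_assoc, hgg]

end Algebra

/-! ### Orbits in `ℝ^{2,2}` -/

/-- The element of `O(2,2)` with a given matrix. -/
def toO22 (A : Mat) (hA : Aᵀ * eta * A = eta) : O22 :=
  have h : eta * Aᵀ * eta * A = 1 := by
    rw [Matrix.mul_assoc, Matrix.mul_assoc, ← Matrix.mul_assoc Aᵀ, hA, eta_mul_eta]
  ⟨⟨A, eta * Aᵀ * eta, mul_eq_one_comm.1 h, h⟩, hA⟩

@[simp]
theorem coe_toO22 (A : Mat) (hA : Aᵀ * eta * A = eta) :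
    ((toO22 A hA : GL (Fin 4) ℝ) : Mat) = A := rfl

theorem orth_O22 (L : O22) : ((L : GL (Fin 4) ℝ) : Mat)ᵀ * eta * ((L : GL (Fin 4) ℝ) : Mat) = eta :=
  L.2

theorem O22_ext {L L' : O22} (h : ((L : GL (Fin 4) ℝ) : Mat) = ((L' : GL (Fin 4) ℝ) : Mat)) :
    L = L' := Subtype.ext (Units.ext h)

theorem O22_inv_eq (L : O22) : (((L : GL (Fin 4) ℝ)⁻¹ : GL (Fin 4) ℝ) : Mat) =
    eta * ((L : GL (Fin 4) ℝ) : Mat)ᵀ * eta := by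
  have : L = toO22 _ (orth_O22 L) := O22_ext rfl
  conv_lhs => rw [this]
  rfl

theorem act_eq (L : O22) (S : Mat) : act L S =
    ((L : GL (Fin 4) ℝ) : Mat) * S * (eta * ((L : GL (Fin 4) ℝ) : Mat)ᵀ * eta) := by
  rw [act, O22_inv_eq]

theorem act_one (S : Mat) : act 1 S = S := by simp [act]

theorem act_mul (L L' : O22) (S : Mat) : act (L * L') S = act L (act L' S) := by
  simp [act, Matrix.mul_assoc]

theorem act_eq_iff {L : O22} {S T : Mat} :
    act L S = T ↔ ((L : GL (Fin 4) ℝ) : Mat) * S = T * ((L : GL (Fin 4) ℝ) : Mat) := by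
  rw [act, Units.mul_inv_eq_iff_eq_mul]

theorem act_eq_act_iff {L L' : O22} {S : Mat} : act L S = act L' S ↔ L⁻¹ * L' ∈ isotropy S := by
  have h : L⁻¹ * L' ∈ isotropy S ↔ act (L⁻¹ * L') S = S := act_eq_iff.symm
  rw [h, act_mul]
  constructor
  · intro h
    rw [← h, ← act_mul, inv_mul_cancel, act_one]
  · intro h
    conv_lhs => rw [← h, ← act_mul, mul_inv_cancel, act_one]

theorem act_mem_orbit (L : O22) (S : Mat) : act L S ∈ orbit S := ⟨L, rfl⟩

theorem orbit_act (L : O22) (S : Mat) : orbit (act L S) = orbit S := by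
  ext T
  constructor
  · rintro ⟨L', rfl⟩
    exact ⟨L' * L, (act_mul _ _ _).symm⟩
  · rintro ⟨L', rfl⟩
    exact ⟨L' * L⁻¹, by rw [← act_mul, inv_mul_cancel_right]⟩

/-- `O(2,2)` carries the topology of a space of matrices. -/
def O22Homeomorph : O22 ≃ₜ {A : Mat // Aᵀ * eta * A = eta} where
  toFun L := ⟨((L : GL (Fin 4) ℝ) : Mat), L.2⟩
  invFun A := toO22 A.1 A.2
  left_inv L := O22_ext rfl
  right_inv A := rfl
  continuous_toFun :=
    (Units.continuous_val.comp continuous_subtype_val).subtype_mk _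
  continuous_invFun := by
    refine Continuous.subtype_mk (Units.continuous_iff.2 ⟨continuous_subtype_val, ?_⟩) _
    exact ((continuous_const.matrix_mul continuous_subtype_val.matrix_transpose).matrix_mul
      continuous_const :
        Continuous fun A : {A : Mat // Aᵀ * eta * A = eta} => eta * (A : Mat)ᵀ * eta)

theorem isInducing_O22 : Topology.IsInducing fun L : O22 => ((L : GL (Fin 4) ℝ) : Mat) :=
  Topology.IsInducing.subtypeVal.comp O22Homeomorph.isInducing

theorem continuous_O22_coe : Continuous fun L : O22 => ((L : GL (Fin 4) ℝ) : Mat) :=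
  isInducing_O22.continuous

theorem continuous_toO22 {X : Type*} [TopologicalSpace X] {f : X → Mat} (hf : Continuous f)
    (h : ∀ x, (f x)ᵀ * eta * f x = eta) : Continuous fun x => toO22 (f x) (h x) :=
  isInducing_O22.continuous_iff.2 hf

theorem continuous_act (S : Mat) : Continuous fun L : O22 => act L S := by
  simp only [act_eq]
  exact (continuous_O22_coe.matrix_mul continuous_const).matrix_mul
    ((continuous_const.matrix_mul continuous_O22_coe.matrix_transpose).matrix_mul
      continuous_const)

theorem eta_mul_eta_mul (A : Mat) : eta * (eta * A) = A := by
  rw [← Matrix.mul_assoc, eta_mul_eta, Matrix.one_mul]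

theorem isSelfAdjoint_iff (S : Mat) : eta.IsSelfAdjoint S ↔ eta * Sᵀ * eta = S := by
  rw [Matrix.IsSelfAdjoint, Matrix.IsAdjointPair]
  constructor
  · intro h
    rw [Matrix.mul_assoc, h, ← Matrix.mul_assoc, eta_mul_eta, Matrix.one_mul]
  · intro h
    calc Sᵀ * eta = eta * (eta * Sᵀ * eta) := by simp only [Matrix.mul_assoc, eta_mul_eta_mul]
      _ = eta * S := by rw [h]

theorem eta_transpose : etaᵀ = eta := by simp [eta]

/-- The adjoint with respect to the standard scalar product. -/
def etaAdjoint : Mat →ₗ[ℝ] Mat where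
  toFun A := eta * Aᵀ * eta
  map_add' A B := by simp [Matrix.mul_add, Matrix.add_mul]
  map_smul' c A := by simp

theorem etaAdjoint_apply (A : Mat) : etaAdjoint A = eta * Aᵀ * eta := rfl

theorem etaAdjoint_mul (A B : Mat) : etaAdjoint (A * B) = etaAdjoint B * etaAdjoint A := by
  simp only [etaAdjoint_apply, Matrix.transpose_mul, Matrix.mul_assoc, eta_mul_eta_mul]

theorem etaAdjoint_one : etaAdjoint 1 = 1 := by simp [etaAdjoint_apply, eta_mul_eta]

theorem etaAdjoint_etaAdjoint (A : Mat) : etaAdjoint (etaAdjoint A) = A := by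
  simp only [etaAdjoint_apply, Matrix.transpose_mul, Matrix.mul_assoc, eta_mul_eta_mul,
    eta_transpose, Matrix.transpose_transpose, eta_mul_eta, Matrix.mul_one]

theorem etaAdjoint_mul_self_iff (A : Mat) : etaAdjoint A * A = 1 ↔ Aᵀ * eta * A = eta := by
  rw [etaAdjoint_apply]
  constructor
  · intro h
    calc Aᵀ * eta * A = eta * (eta * Aᵀ * eta * A) := by
          simp only [Matrix.mul_assoc, eta_mul_eta_mul]
      _ = eta := by rw [h, Matrix.mul_one]
  · intro h
    rw [Matrix.mul_assoc, Matrix.mul_assoc, ← Matrix.mul_assoc Aᵀ, h, eta_mul_eta]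

/-- The commutators of `S` with the matrices that are skew-adjoint for the standard scalar
product. -/
def orbitTangent (S : Mat) : Submodule ℝ Mat :=
  (LinearMap.ker (etaAdjoint + LinearMap.id)).map (LinearMap.mulRight ℝ S - LinearMap.mulLeft ℝ S)

/-! ### The matrix algebra as a normed algebra with anti-involution -/

section Norm

attribute [local instance] Matrix.linftyOpNormedRing Matrix.linftyOpNormedAlgebra

/-- The adjoint with respect to the standard scalar product, as a continuous linear map. -/
def etaAdjointL : Mat →L[ℝ] Mat := etaAdjoint.toContinuousLinearMap

theorem isAntiInvolution_etaAdjointL : IsAntiInvolution etaAdjointL :=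
  ⟨etaAdjoint_mul, etaAdjoint_one, etaAdjoint_etaAdjoint⟩

theorem mem_orthSet_etaAdjointL_iff (A : Mat) :
    A ∈ orthSet etaAdjointL ↔ Aᵀ * eta * A = eta := by
  rw [← etaAdjoint_mul_self_iff]
  exact ⟨fun h => h.1, fun h => ⟨h, mul_eq_one_comm.1 h⟩⟩

theorem mem_orbit_iff_orthSet {S T : Mat} :
    T ∈ orbit S ↔ ∃ g ∈ orthSet etaAdjointL, T = g * S * etaAdjointL g := by
  constructor
  · rintro ⟨L, rfl⟩
    exact ⟨_, (mem_orthSet_etaAdjointL_iff _).2 (orth_O22 L), act_eq L S⟩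
  · rintro ⟨g, hg, rfl⟩
    have h := (mem_orthSet_etaAdjointL_iff g).1 hg
    exact ⟨toO22 g h, (act_eq (toO22 g h) S).symm⟩

theorem isSubmanifold_orbit_norm {S : Mat} (hS : eta.IsSelfAdjoint S) {n : ℕ}
    (hn : ∀ T ∈ orbit S, Module.finrank ℝ (orbitTangent T) = n) : IsSubmanifold n (orbit S) := by
  have : orbit S = {T | ∃ g ∈ orthSet etaAdjointL, T = g * S * etaAdjointL g} :=
    Set.ext fun T => mem_orbit_iff_orthSet
  rw [this]
  exact isSubmanifold_orbit isAntiInvolution_etaAdjointL ((isSelfAdjoint_iff S).1 hS)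
    fun g hg => hn _ (mem_orbit_iff_orthSet.2 ⟨g, hg, rfl⟩)

theorem isSubmanifold_of_preimage_orbit {S : Mat} (hS : eta.IsSelfAdjoint S) {n : ℕ}
    (hn : ∀ T ∈ orbit S, Module.finrank ℝ (orbitTangent T) = n) :
    IsSubmanifold n ((Matrix.of : (Fin 4 → Fin 4 → ℝ) ≃ Mat) ⁻¹' orbit S) :=
  (isSubmanifold_orbit_norm hS hn).preimage
    (Matrix.ofLinearEquiv ℝ : (Fin 4 → Fin 4 → ℝ) ≃ₗ[ℝ] Mat).toContinuousLinearEquiv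

theorem exists_local_section_norm {S : Mat} (hS : eta.IsSelfAdjoint S) :
    ∃ L : Mat → Mat, ContinuousAt L S ∧ L S = 1 ∧
      (∀ᶠ T in nhds S, (L T)ᵀ * eta * L T = eta) ∧
      ∀ᶠ T in nhds S, T ∈ orbit S → L T * S * (eta * (L T)ᵀ * eta) = T := by
  obtain ⟨L, h1, h2, h3, h4⟩ :=
    exists_local_section isAntiInvolution_etaAdjointL ((isSelfAdjoint_iff S).1 hS)
  exact ⟨L, h1.continuousAt, h2, h3.mono fun T hT => (mem_orthSet_etaAdjointL_iff _).1 hT,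
    h4.mono fun T hT hTS => hT (mem_orbit_iff_orthSet.1 hTS)⟩

end Norm

/-- The auxiliary norm is dropped here: only its topology, the product topology, matters. -/
theorem exists_local_section_orbit {S : Mat} (hS : eta.IsSelfAdjoint S) :
    ∃ L : Mat → Mat, ContinuousAt L S ∧ L S = 1 ∧
      (∀ᶠ T in nhds S, (L T)ᵀ * eta * L T = eta) ∧
      ∀ᶠ T in nhds S, T ∈ orbit S → L T * S * (eta * (L T)ᵀ * eta) = T :=
  exists_local_section_norm hS

theorem isSelfAdjoint_act {S : Mat} (hS : eta.IsSelfAdjoint S) (L : O22) :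
    eta.IsSelfAdjoint (act L S) := by
  rw [isSelfAdjoint_iff] at hS ⊢
  change etaAdjoint S = S at hS
  change etaAdjoint _ = _
  rw [act_eq, ← etaAdjoint_apply, etaAdjoint_mul, etaAdjoint_mul, etaAdjoint_etaAdjoint, hS,
    Matrix.mul_assoc]

-- A local section `σ` at `act L S` lifts nearby points `T` of the orbit to `σ T * L`, which is
-- close to `L`. So the image of a neighbourhood of `L` is a neighbourhood.
open Topology Filter in
theorem isOpenMap_act {S : Mat} (hS : eta.IsSelfAdjoint S) :
    IsOpenMap fun L : O22 => (⟨act L S, act_mem_orbit L S⟩ : orbit S) := by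
  rw [isOpenMap_iff_nhds_le]
  intro L U hU
  rw [mem_map, isInducing_O22.nhds_eq_comap] at hU
  obtain ⟨V, hV, hVU⟩ := hU
  obtain ⟨σ, h1, h2, h3, h4⟩ := exists_local_section_orbit (isSelfAdjoint_act hS L)
  have h5 : ContinuousAt (fun T => σ T * ((L : GL (Fin 4) ℝ) : Mat)) (act L S) :=
    h1.mul continuousAt_const
  have h6 : ∀ᶠ T in 𝓝 (act L S), σ T * ((L : GL (Fin 4) ℝ) : Mat) ∈ V := by
    refine h5.eventually ?_
    simp only [h2, Matrix.one_mul]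
    exact hV
  rw [nhds_subtype_eq_comap]
  refine ⟨_, h6.and (h3.and h4), ?_⟩
  rintro ⟨T, hT⟩ ⟨h7, h8, h9⟩
  have h10 := h9 (by rwa [orbit_act])
  have h11 : toO22 (σ T) h8 * L ∈
      (fun L : O22 => (⟨act L S, act_mem_orbit L S⟩ : orbit S)) ⁻¹' U := hVU h7
  have h12 : act (toO22 (σ T) h8 * L) S = T := by
    rw [act_mul, act_eq (toO22 (σ T) h8)]
    exact h10
  have h13 : (⟨act (toO22 (σ T) h8 * L) S, act_mem_orbit _ S⟩ : orbit S) ∈ U := h11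
  simpa only [h12] using h13

/-- The orbit is homeomorphic to `O(2,2)` modulo the isotropy subgroup. -/
theorem exists_homeomorph_orbit {S : Mat} (hS : eta.IsSelfAdjoint S) :
    ∃ e : (O22 ⧸ isotropy S) ≃ₜ orbit S, ∀ L : O22, (e (QuotientGroup.mk L) : Mat) = act L S := by
  let f : O22 → orbit S := fun L => ⟨act L S, act_mem_orbit L S⟩
  have hf : Continuous f := (continuous_act S).subtype_mk _
  let F : O22 ⧸ isotropy S → orbit S := Quotient.lift f fun L L' h =>
    Subtype.ext (act_eq_act_iff.2 (QuotientGroup.leftRel_apply.1 h))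
  have hF : ∀ L : O22, F (QuotientGroup.mk L) = f L := fun L => rfl
  have hbij : Function.Bijective F := by
    refine ⟨?_, ?_⟩
    · intro x y
      induction x using QuotientGroup.induction_on with
      | H L =>
        induction y using QuotientGroup.induction_on with
        | H L' =>
          intro h
          exact QuotientGroup.eq.2 (act_eq_act_iff.1 (congrArg Subtype.val h))
    · rintro ⟨_, L, rfl⟩
      exact ⟨QuotientGroup.mk L, rfl⟩
  have hFc : Continuous F := hf.quotient_lift _
  have hFo : IsOpenMap F := by
    intro U hU
    have h1 : F '' U = f '' ((QuotientGroup.mk : O22 → O22 ⧸ isotropy S) ⁻¹' U) := by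
      ext T
      constructor
      · rintro ⟨x, hx, rfl⟩
        induction x using QuotientGroup.induction_on with
        | H L => exact ⟨L, hx, rfl⟩
      · rintro ⟨L, hL, rfl⟩
        exact ⟨_, hL, rfl⟩
    rw [h1]
    exact isOpenMap_act hS _ (hU.preimage QuotientGroup.continuous_mk)
  exact ⟨(Equiv.ofBijective F hbij).toHomeomorphOfContinuousOpen hFc hFo, fun L => rfl⟩

/-! ### Endomorphisms with a given matrix representation -/

theorem HasMatrix.eq {b : GL (Fin 4) ℝ} {M S : Mat} (h : HasMatrix b M S) :
    S = (b : Mat) * M * ((b⁻¹ : GL (Fin 4) ℝ) : Mat) := by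
  rw [← show S * (b : Mat) = (b : Mat) * M from h, Units.mul_inv_cancel_right]

theorem hasMatrix_conj (b : GL (Fin 4) ℝ) (M : Mat) :
    HasMatrix b M ((b : Mat) * M * ((b⁻¹ : GL (Fin 4) ℝ) : Mat)) := by
  rw [HasMatrix, Units.inv_mul_cancel_right]

theorem IsFrame.transport {H : Mat} {b b' : GL (Fin 4) ℝ} (hb : IsFrame H b) (hb' : IsFrame H b') :
    b' * b⁻¹ ∈ O22 := by
  have h1 : (b : Mat) * ((b⁻¹ : GL (Fin 4) ℝ) : Mat) = 1 := Units.mul_inv b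
  change ((b' * b⁻¹ : GL (Fin 4) ℝ) : Mat)ᵀ * eta * ((b' * b⁻¹ : GL (Fin 4) ℝ) : Mat) = eta
  calc ((b' * b⁻¹ : GL (Fin 4) ℝ) : Mat)ᵀ * eta * ((b' * b⁻¹ : GL (Fin 4) ℝ) : Mat)
      = ((b⁻¹ : GL (Fin 4) ℝ) : Mat)ᵀ * ((b' : Mat)ᵀ * eta * (b' : Mat)) *
          ((b⁻¹ : GL (Fin 4) ℝ) : Mat) := by
        simp only [Units.val_mul, Matrix.transpose_mul, Matrix.mul_assoc]
    _ = ((b⁻¹ : GL (Fin 4) ℝ) : Mat)ᵀ * ((b : Mat)ᵀ * eta * (b : Mat)) *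
          ((b⁻¹ : GL (Fin 4) ℝ) : Mat) := by
        rw [show (b' : Mat)ᵀ * eta * (b' : Mat) = H from hb',
          show (b : Mat)ᵀ * eta * (b : Mat) = H from hb]
    _ = ((b : Mat) * ((b⁻¹ : GL (Fin 4) ℝ) : Mat))ᵀ * eta *
          ((b : Mat) * ((b⁻¹ : GL (Fin 4) ℝ) : Mat)) := by
        simp only [Matrix.transpose_mul, Matrix.mul_assoc]
    _ = eta := by rw [h1, Matrix.transpose_one, Matrix.one_mul, Matrix.mul_one]

theorem IsFrame.O22_mul {H : Mat} {b : GL (Fin 4) ℝ} (hb : IsFrame H b) (L : O22) :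
    IsFrame H (L * b) := by
  change ((L * b : GL (Fin 4) ℝ) : Mat)ᵀ * eta * ((L * b : GL (Fin 4) ℝ) : Mat) = H
  calc ((L * b : GL (Fin 4) ℝ) : Mat)ᵀ * eta * ((L * b : GL (Fin 4) ℝ) : Mat)
      = (b : Mat)ᵀ * (((L : GL (Fin 4) ℝ) : Mat)ᵀ * eta * ((L : GL (Fin 4) ℝ) : Mat)) *
          (b : Mat) := by
        simp only [Units.val_mul, Matrix.transpose_mul, Matrix.mul_assoc]
    _ = H := by rw [orth_O22]; exact hb

/-- The element `b' b⁻¹` takes one adapted basis to another, is orthogonal because the Gram matrices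
agree, and conjugates the endomorphism with matrix `M` in the first basis to the one in the second.
-/
theorem realizing_eq_orbit {H M S : Mat} (hS : S ∈ realizing H M) : realizing H M = orbit S := by
  obtain ⟨b, hb, hbS⟩ := hS
  ext T
  constructor
  · rintro ⟨b', hb', hT⟩
    refine ⟨⟨b' * b⁻¹, hb.transport hb'⟩, ?_⟩
    rw [eq_comm, act_eq_iff, hbS.eq, hT.eq]
    simp [Matrix.mul_assoc]
  · rintro ⟨L, rfl⟩
    refine ⟨L * b, hb.O22_mul L, ?_⟩
    rw [HasMatrix, hbS.eq, act]
    simp [Matrix.mul_assoc]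

/-- This passes from the isotropy group, independent of bases, to the matrix computations. As the
right side involves only `H` and `M`, the answer is the same in every adapted basis. -/
theorem mem_orthCentralizer_iff_of_frame {H M S : Mat} {b : GL (Fin 4) ℝ} (hb : IsFrame H b)
    (hS : HasMatrix b M S) :
    {A : Mat | ∃ L ∈ isotropy S, A = ((b⁻¹ * (L : GL (Fin 4) ℝ) * b : GL (Fin 4) ℝ) : Mat)} =
      orthCentralizer H M := by
  have hu : ((b⁻¹ : GL (Fin 4) ℝ) : Mat) * (b : Mat) = 1 := Units.inv_mul b
  have hu' : (b : Mat) * ((b⁻¹ : GL (Fin 4) ℝ) : Mat) = 1 := Units.mul_inv b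
  have hc : ∀ X : Mat, (b : Mat) * (((b⁻¹ : GL (Fin 4) ℝ) : Mat) * X) = X := fun X => by
    rw [← Matrix.mul_assoc, hu', Matrix.one_mul]
  have hc' : ∀ X : Mat, ((b⁻¹ : GL (Fin 4) ℝ) : Mat) * ((b : Mat) * X) = X := fun X => by
    rw [← Matrix.mul_assoc, hu, Matrix.one_mul]
  have hct' : ∀ X : Mat, ((b⁻¹ : GL (Fin 4) ℝ) : Mat)ᵀ * ((b : Mat)ᵀ * X) = X := fun X => by
    rw [← Matrix.mul_assoc, ← Matrix.transpose_mul, hu', Matrix.transpose_one, Matrix.one_mul]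
  have hbH : (b : Mat)ᵀ * (eta * (b : Mat)) = H := by rw [← Matrix.mul_assoc]; exact hb
  have hSb : S = (b : Mat) * (M * ((b⁻¹ : GL (Fin 4) ℝ) : Mat)) := by
    rw [hS.eq, Matrix.mul_assoc]
  ext A
  constructor
  · rintro ⟨L, hL, rfl⟩
    have hL' : ((L : GL (Fin 4) ℝ) : Mat) * S = S * ((L : GL (Fin 4) ℝ) : Mat) := hL
    have hLo := orth_O22 L
    set l : Mat := ((L : GL (Fin 4) ℝ) : Mat)
    have hA : ((b⁻¹ * (L : GL (Fin 4) ℝ) * b : GL (Fin 4) ℝ) : Mat) =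
        ((b⁻¹ : GL (Fin 4) ℝ) : Mat) * (l * (b : Mat)) := by
      simp only [Units.val_mul, Matrix.mul_assoc, l]
    rw [hA]
    refine ⟨?_, ?_⟩
    · calc _ = (b : Mat)ᵀ * (lᵀ * eta * l) * (b : Mat) := by
            rw [← hbH]
            simp only [Matrix.transpose_mul, Matrix.mul_assoc, hc, hct']
        _ = H := by rw [hLo, Matrix.mul_assoc, hbH]
    · calc _ = ((b⁻¹ : GL (Fin 4) ℝ) : Mat) * (l * S) * (b : Mat) := by
            rw [hSb]
            simp only [Matrix.mul_assoc, hu, Matrix.mul_one]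
        _ = _ := by
            rw [hL', hSb]
            simp only [Matrix.mul_assoc, hc']
  · rintro ⟨hA1, hA2⟩
    have hl : ((b : Mat) * (A * ((b⁻¹ : GL (Fin 4) ℝ) : Mat)))ᵀ * eta *
        ((b : Mat) * (A * ((b⁻¹ : GL (Fin 4) ℝ) : Mat))) = eta := by
      calc _ = ((b⁻¹ : GL (Fin 4) ℝ) : Mat)ᵀ * (Aᵀ * H * A) * ((b⁻¹ : GL (Fin 4) ℝ) : Mat) := by
            rw [← hbH]
            simp only [Matrix.transpose_mul, Matrix.mul_assoc]
        _ = eta := by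
            rw [hA1, ← hbH]
            simp only [Matrix.mul_assoc, hct', hu', Matrix.mul_one]
    refine ⟨toO22 _ hl, ?_, ?_⟩
    · change (b : Mat) * (A * ((b⁻¹ : GL (Fin 4) ℝ) : Mat)) * S =
        S * ((b : Mat) * (A * ((b⁻¹ : GL (Fin 4) ℝ) : Mat)))
      calc _ = (b : Mat) * (A * M) * ((b⁻¹ : GL (Fin 4) ℝ) : Mat) := by
            rw [hSb]
            simp only [Matrix.mul_assoc, hc']
        _ = _ := by
            rw [hA2, hSb]
            simp only [Matrix.mul_assoc, hc']
    · simp only [Units.val_mul, coe_toO22, Matrix.mul_assoc, hc', hu, Matrix.mul_one]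

theorem isSelfAdjoint_of_mem_realizing {H M S : Mat} (hM : Mᵀ * H = H * M)
    (hS : S ∈ realizing H M) : eta.IsSelfAdjoint S := by
  obtain ⟨b, hb, hbS⟩ := hS
  have hu : (b : Mat) * ((b⁻¹ : GL (Fin 4) ℝ) : Mat) = 1 := Units.mul_inv b
  have hbH : (b : Mat)ᵀ * (eta * (b : Mat)) = H := by rw [← Matrix.mul_assoc]; exact hb
  have h1 : ((b⁻¹ : GL (Fin 4) ℝ) : Mat)ᵀ * (H * M) * ((b⁻¹ : GL (Fin 4) ℝ) : Mat) = eta * S := by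
    rw [hbS.eq, ← hbH, ← Matrix.mul_assoc, ← Matrix.mul_assoc, ← Matrix.transpose_mul, hu]
    simp [Matrix.mul_assoc]
  have h2 : ((b⁻¹ : GL (Fin 4) ℝ) : Mat)ᵀ * (Mᵀ * H) * ((b⁻¹ : GL (Fin 4) ℝ) : Mat) =
      Sᵀ * eta := by
    rw [hbS.eq, ← hbH]
    simp [Matrix.mul_assoc]
  change Sᵀ * eta = eta * S
  rw [← h1, ← h2, hM]

theorem trace_eq_of_mem_realizing {H M S : Mat} (hS : S ∈ realizing H M) : S.trace = M.trace := by
  obtain ⟨b, hb, hbS⟩ := hS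
  rw [hbS.eq, Matrix.trace_mul_comm, ← Matrix.mul_assoc, ← Units.val_mul]
  simp

theorem charpoly_eq_of_mem_realizing {H M S : Mat} (hS : S ∈ realizing H M) :
    S.charpoly = M.charpoly := by
  obtain ⟨b, hb, hbS⟩ := hS
  rw [hbS.eq, Matrix.coe_units_inv, Matrix.charpoly_units_conj]

theorem exists_skew {X : Mat} (h : Xᵀ = -X) : ∃ v, X = skew v := by
  have h' : ∀ i j, X j i = -X i j := fun i j => congrFun (congrFun h i) j
  have h0 : ∀ i, X i i = 0 := fun i => by have := h' i i; linarith
  refine ⟨![X 0 1, X 0 2, X 0 3, X 1 2, X 1 3, X 2 3], ?_⟩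
  rw [skew]
  ext i j
  fin_cases i <;> fin_cases j
  all_goals first | exact h0 _ | exact h' _ _ | rfl

theorem skew_transpose (v : Fin 6 → ℝ) : (skew v)ᵀ = -skew v := by
  rw [skew, lit_transpose, lit_neg, lit_inj]
  simp

/-- Conjugation by an invertible matrix. -/
def conjEquiv (b : GL (Fin 4) ℝ) : Mat ≃ₗ[ℝ] Mat where
  toFun X := (b : Mat) * X * ((b⁻¹ : GL (Fin 4) ℝ) : Mat)
  invFun X := ((b⁻¹ : GL (Fin 4) ℝ) : Mat) * X * (b : Mat)
  map_add' X Y := by rw [Matrix.mul_add, Matrix.add_mul]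
  map_smul' c X := by simp
  left_inv X := by
    simp only [Matrix.mul_assoc, Units.inv_mul, Matrix.mul_one]
    rw [← Matrix.mul_assoc, Units.inv_mul, Matrix.one_mul]
  right_inv X := by
    simp only [Matrix.mul_assoc, Units.mul_inv, Matrix.mul_one]
    rw [← Matrix.mul_assoc, Units.mul_inv, Matrix.one_mul]

theorem conjEquiv_apply (b : GL (Fin 4) ℝ) (X : Mat) :
    conjEquiv b X = (b : Mat) * X * ((b⁻¹ : GL (Fin 4) ℝ) : Mat) := rfl

theorem conjEquiv_mul (b : GL (Fin 4) ℝ) (X Y : Mat) :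
    conjEquiv b (X * Y) = conjEquiv b X * conjEquiv b Y := by
  simp only [conjEquiv_apply]
  simp [Matrix.mul_assoc]

theorem etaAdjoint_conjEquiv_eq_neg_iff {H : Mat} {b : GL (Fin 4) ℝ}
    (hb : IsFrame H b) (Y : Mat) :
    etaAdjoint (conjEquiv b Y) = -conjEquiv b Y ↔ (H * Y)ᵀ = -(H * Y) := by
  have hbH : (b : Mat)ᵀ * (eta * (b : Mat)) = H := by rw [← Matrix.mul_assoc]; exact hb
  set X := conjEquiv b Y with hX
  have hXb : X * (b : Mat) = (b : Mat) * Y := by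
    rw [hX, conjEquiv_apply, Units.inv_mul_cancel_right]
  have h1 : H * Y = (b : Mat)ᵀ * (eta * X) * (b : Mat) := by
    rw [← hbH, Matrix.mul_assoc, Matrix.mul_assoc, ← hXb]
    simp only [Matrix.mul_assoc]
  have h2 : (H * Y)ᵀ = (b : Mat)ᵀ * (Xᵀ * eta) * (b : Mat) := by
    rw [h1]
    simp only [Matrix.transpose_mul, Matrix.transpose_transpose, Matrix.mul_assoc, eta_transpose]
  have h3 : etaAdjoint X = -X ↔ Xᵀ * eta = -(eta * X) := by
    rw [etaAdjoint_apply]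
    constructor
    · intro h
      rw [← Matrix.mul_neg, ← h, Matrix.mul_assoc, eta_mul_eta_mul]
    · intro h
      rw [Matrix.mul_assoc, h, Matrix.mul_neg, eta_mul_eta_mul]
  have h4 : -((b : Mat)ᵀ * (eta * X) * (b : Mat)) = (b : Mat)ᵀ * -(eta * X) * (b : Mat) := by
    rw [Matrix.mul_neg, Matrix.neg_mul]
  rw [h3, h2, h1, h4]
  constructor
  · intro h
    rw [h]
  · intro h
    have hb1 : IsUnit (b : Mat) := b.isUnit
    have hb2 : IsUnit (b : Mat)ᵀ := by
      rwa [Matrix.isUnit_transpose]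
    exact hb2.mul_left_cancel (hb1.mul_right_cancel h)

/-- In the basis `b`, skew-adjointness of `Y` means that `H Y` is skew-symmetric. Because `H² = 1`,
these `Y` are exactly the `H * skew v`, so conjugation by `b` carries the range of `adMap` onto the
tangent space. -/
theorem finrank_orbitTangent {H M S : Mat} (hHH : H * H = 1) {b : GL (Fin 4) ℝ}
    (hb : IsFrame H b) (hS : HasMatrix b M S) :
    Module.finrank ℝ (orbitTangent S) = Module.finrank ℝ (LinearMap.range (adMap H M)) := by
  have : orbitTangent S = (LinearMap.range (adMap H M)).map (conjEquiv b : Mat →ₗ[ℝ] Mat) := by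
    have hS' : S = conjEquiv b M := hS.eq
    ext T
    constructor
    · rintro ⟨X, hX, rfl⟩
      obtain ⟨Y, rfl⟩ := (conjEquiv b).surjective X
      have hX' : etaAdjoint (conjEquiv b Y) = -conjEquiv b Y := by
        rw [eq_neg_iff_add_eq_zero]
        simpa using hX
      obtain ⟨v, hv⟩ := exists_skew ((etaAdjoint_conjEquiv_eq_neg_iff hb Y).1 hX')
      refine ⟨adMap H M v, ⟨v, rfl⟩, ?_⟩
      have hY : H * skew v = Y := by rw [← hv, ← Matrix.mul_assoc, hHH, Matrix.one_mul]
      change conjEquiv b (H * skew v * M - M * (H * skew v)) =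
        conjEquiv b Y * S - S * conjEquiv b Y
      rw [hY, map_sub, conjEquiv_mul b Y, conjEquiv_mul b M, hS']
    · rintro ⟨_, ⟨v, rfl⟩, rfl⟩
      refine ⟨conjEquiv b (H * skew v), ?_, ?_⟩
      · have h1 := (etaAdjoint_conjEquiv_eq_neg_iff hb (H * skew v)).2 (by
          rw [← Matrix.mul_assoc, hHH, Matrix.one_mul, skew_transpose])
        change etaAdjoint (conjEquiv b (H * skew v)) + conjEquiv b (H * skew v) = 0
        rw [h1, neg_add_cancel]
      · change conjEquiv b (H * skew v) * S - S * conjEquiv b (H * skew v) =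
          conjEquiv b (H * skew v * M - M * (H * skew v))
        rw [map_sub, conjEquiv_mul b (H * skew v), conjEquiv_mul b M, hS']
  rw [this]
  exact LinearEquiv.finrank_map_eq (conjEquiv b) _

theorem isSubmanifold_orbit_of_mem_realizing {H M S : Mat} (hHH : H * H = 1)
    (hM : Mᵀ * H = H * M) {n : ℕ} (hn : Module.finrank ℝ (LinearMap.range (adMap H M)) = n)
    (hS : S ∈ realizing H M) :
    IsSubmanifold n ((Matrix.of : (Fin 4 → Fin 4 → ℝ) ≃ Mat) ⁻¹' orbit S) := by
  refine isSubmanifold_of_preimage_orbit (isSelfAdjoint_of_mem_realizing hM hS) fun T hT => ?_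
  rw [← realizing_eq_orbit hS] at hT
  obtain ⟨b, hb, hbT⟩ := hT
  rw [finrank_orbitTangent hHH hb hbT, hn]

/-! ### Counting connected components -/

/-- A component maps to a single point of a discrete space, so it lies in one fibre; if the fibres
are connected, the components are the fibres. -/
theorem natCard_connectedComponents {X I : Type*} [TopologicalSpace X] [TopologicalSpace I]
    [DiscreteTopology I] {f : X → I} (hf : Continuous f) (hs : Function.Surjective f)
    (hc : ∀ i, IsPreconnected (f ⁻¹' {i})) : Nat.card (ConnectedComponents X) = Nat.card I := by
  refine Nat.card_congr (Equiv.ofBijective hf.connectedComponentsLift ⟨?_, ?_⟩)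
  · intro x y
    obtain ⟨x, rfl⟩ := ConnectedComponents.surjective_coe x
    obtain ⟨y, rfl⟩ := ConnectedComponents.surjective_coe y
    intro h
    have h' : f x = f y := h
    exact ConnectedComponents.coe_eq_coe'.2
      ((hc (f y)).subset_connectedComponent (x := y) rfl h')
  · intro i
    obtain ⟨x, rfl⟩ := hs i
    exact ⟨x, rfl⟩

/-! ### The identity component of `O(2,2)` -/

/-- The identity component of `O(2,2)`. -/
def SO22 : Subgroup O22 := Subgroup.connectedComponentOfOne O22

theorem mem_SO22_of_path {γ : ℝ → Mat} (hγ : Continuous γ) (h : ∀ t, (γ t)ᵀ * eta * γ t = eta)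
    (h0 : γ 0 = 1) (t : ℝ) : toO22 (γ t) (h t) ∈ SO22 := by
  have h1 : IsPreconnected (Set.range fun t => toO22 (γ t) (h t)) :=
    isPreconnected_range (continuous_toO22 hγ h)
  refine h1.subset_connectedComponent (x := 1) ⟨0, O22_ext ?_⟩ ⟨t, rfl⟩
  simp [h0]

theorem continuous_lit {X : Type*} [TopologicalSpace X]
    {a₀ a₁ a₂ a₃ b₀ b₁ b₂ b₃ c₀ c₁ c₂ c₃ d₀ d₁ d₂ d₃ : X → ℝ}
    (ha₀ : Continuous a₀) (ha₁ : Continuous a₁) (ha₂ : Continuous a₂) (ha₃ : Continuous a₃)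
    (hb₀ : Continuous b₀) (hb₁ : Continuous b₁) (hb₂ : Continuous b₂) (hb₃ : Continuous b₃)
    (hc₀ : Continuous c₀) (hc₁ : Continuous c₁) (hc₂ : Continuous c₂) (hc₃ : Continuous c₃)
    (hd₀ : Continuous d₀) (hd₁ : Continuous d₁) (hd₂ : Continuous d₂) (hd₃ : Continuous d₃) :
    Continuous fun x => lit (a₀ x) (a₁ x) (a₂ x) (a₃ x) (b₀ x) (b₁ x) (b₂ x) (b₃ x)
      (c₀ x) (c₁ x) (c₂ x) (c₃ x) (d₀ x) (d₁ x) (d₂ x) (d₃ x) := by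
  refine continuous_matrix fun i j => ?_
  fin_cases i <;> fin_cases j <;> assumption

theorem exists_cos_sin {c s : ℝ} (h : c ^ 2 + s ^ 2 = 1) : ∃ t, c = Real.cos t ∧ s = Real.sin t := by
  have h1 : -1 ≤ c := by nlinarith [sq_nonneg s]
  have h2 : c ≤ 1 := by nlinarith [sq_nonneg s]
  rcases le_total 0 s with hs | hs
  · refine ⟨Real.arccos c, (Real.cos_arccos h1 h2).symm, ?_⟩
    rw [Real.sin_arccos, eq_comm, Real.sqrt_eq_iff_mul_self_eq (by nlinarith) hs]
    linarith
  · refine ⟨-Real.arccos c, by rw [Real.cos_neg, Real.cos_arccos h1 h2], ?_⟩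
    rw [Real.sin_neg, Real.sin_arccos, eq_neg_iff_add_eq_zero, add_comm,
      ← eq_neg_iff_add_eq_zero, Real.sqrt_eq_iff_mul_self_eq (by nlinarith) (by linarith)]
    linarith

theorem exists_cosh_sinh {c s : ℝ} (h : c ^ 2 - s ^ 2 = 1) (hc : 0 ≤ c) :
    ∃ t, c = Real.cosh t ∧ s = Real.sinh t := by
  refine ⟨Real.arsinh s, ?_, (Real.sinh_arsinh s).symm⟩
  rw [Real.cosh_arsinh, eq_comm, Real.sqrt_eq_iff_mul_self_eq (by positivity) hc]
  linarith

theorem exists_mem_SO22_rot12 {c s : ℝ} (h : c ^ 2 + s ^ 2 = 1) : ∃ g ∈ SO22,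
    ((g : GL (Fin 4) ℝ) : Mat) = lit c s 0 0 (-s) c 0 0 0 0 1 0 0 0 0 1 := by
  obtain ⟨t, rfl, rfl⟩ := exists_cos_sin h
  refine ⟨_, mem_SO22_of_path (γ := fun t => lit (Real.cos t) (Real.sin t) 0 0 (-Real.sin t)
    (Real.cos t) 0 0 0 0 1 0 0 0 0 1) (by apply continuous_lit <;> fun_prop) (fun t => ?_)
    (by simp [one_eq_lit]) t, rfl⟩
  have := Real.sin_sq_add_cos_sq t
  rw [lit_orth_eta_iff]
  refine ⟨⟨?_, ?_, ?_, ?_⟩, ?_, ?_, ?_, ?_, ?_, ?_⟩ <;> linarith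

theorem exists_mem_SO22_rot34 {c s : ℝ} (h : c ^ 2 + s ^ 2 = 1) : ∃ g ∈ SO22,
    ((g : GL (Fin 4) ℝ) : Mat) = lit 1 0 0 0 0 1 0 0 0 0 c s 0 0 (-s) c := by
  obtain ⟨t, rfl, rfl⟩ := exists_cos_sin h
  refine ⟨_, mem_SO22_of_path (γ := fun t => lit 1 0 0 0 0 1 0 0 0 0 (Real.cos t) (Real.sin t) 0 0
    (-Real.sin t) (Real.cos t)) (by apply continuous_lit <;> fun_prop) (fun t => ?_)
    (by simp [one_eq_lit]) t, rfl⟩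
  have := Real.sin_sq_add_cos_sq t
  rw [lit_orth_eta_iff]
  refine ⟨⟨?_, ?_, ?_, ?_⟩, ?_, ?_, ?_, ?_, ?_, ?_⟩ <;> linarith

theorem exists_mem_SO22_boost13 {c s : ℝ} (h : c ^ 2 - s ^ 2 = 1) (hc : 0 ≤ c) : ∃ g ∈ SO22,
    ((g : GL (Fin 4) ℝ) : Mat) = lit c 0 s 0 0 1 0 0 s 0 c 0 0 0 0 1 := by
  obtain ⟨t, rfl, rfl⟩ := exists_cosh_sinh h hc
  refine ⟨_, mem_SO22_of_path (γ := fun t => lit (Real.cosh t) 0 (Real.sinh t) 0 0 1 0 0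
    (Real.sinh t) 0 (Real.cosh t) 0 0 0 0 1) (by apply continuous_lit <;> fun_prop) (fun t => ?_)
    (by simp [one_eq_lit]) t, rfl⟩
  have := Real.cosh_sq_sub_sinh_sq t
  rw [lit_orth_eta_iff]
  refine ⟨⟨?_, ?_, ?_, ?_⟩, ?_, ?_, ?_, ?_, ?_, ?_⟩ <;> linarith

theorem exists_mem_SO22_boost23 {c s : ℝ} (h : c ^ 2 - s ^ 2 = 1) (hc : 0 ≤ c) : ∃ g ∈ SO22,
    ((g : GL (Fin 4) ℝ) : Mat) = lit 1 0 0 0 0 c s 0 0 s c 0 0 0 0 1 := by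
  obtain ⟨t, rfl, rfl⟩ := exists_cosh_sinh h hc
  refine ⟨_, mem_SO22_of_path (γ := fun t => lit 1 0 0 0 0 (Real.cosh t) (Real.sinh t) 0 0
    (Real.sinh t) (Real.cosh t) 0 0 0 0 1) (by apply continuous_lit <;> fun_prop) (fun t => ?_)
    (by simp [one_eq_lit]) t, rfl⟩
  have := Real.cosh_sq_sub_sinh_sq t
  rw [lit_orth_eta_iff]
  refine ⟨⟨?_, ?_, ?_, ?_⟩, ?_, ?_, ?_, ?_, ?_, ?_⟩ <;> linarith

theorem exists_rotation (x y : ℝ) : ∃ c s r : ℝ, c ^ 2 + s ^ 2 = 1 ∧ 0 ≤ r ∧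
    r ^ 2 = x ^ 2 + y ^ 2 ∧ c * x + s * y = r ∧ -s * x + c * y = 0 := by
  have hr2 : √(x ^ 2 + y ^ 2) ^ 2 = x ^ 2 + y ^ 2 := Real.sq_sqrt (by positivity)
  have hr0 := Real.sqrt_nonneg (x ^ 2 + y ^ 2)
  set r := √(x ^ 2 + y ^ 2)
  rcases hr0.eq_or_lt with hr | hr
  · rw [← hr] at hr2
    have hx : x = 0 := by nlinarith [sq_nonneg x, sq_nonneg y]
    have hy : y = 0 := by nlinarith [sq_nonneg x, sq_nonneg y]
    exact ⟨1, 0, 0, by norm_num, le_rfl, by simp [hx, hy], by simp [hx], by simp [hy]⟩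
  · refine ⟨x / r, y / r, r, ?_, hr.le, hr2, ?_, ?_⟩
    · field_simp
      linarith
    · field_simp
      linarith
    · field_simp
      ring

theorem O22_mul_coe (g L : O22) : (((g * L : O22) : GL (Fin 4) ℝ) : Mat) =
    ((g : GL (Fin 4) ℝ) : Mat) * ((L : GL (Fin 4) ℝ) : Mat) := rfl

/-- Rotations in the two definite planes and a boost mixing them move the first column to `E₁`. -/
theorem exists_SO22_mul_eq_of_column (L : O22) : ∃ g ∈ SO22, ∃ b₁ b₂ b₃ c₁ c₂ c₃ d₁ d₂ d₃ : ℝ,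
    (((g * L : O22) : GL (Fin 4) ℝ) : Mat) = lit 1 0 0 0 0 b₁ b₂ b₃ 0 c₁ c₂ c₃ 0 d₁ d₂ d₃ := by
  -- Once the first column is `E₁`, orthogonality of the other columns to it clears the first row.
  have key : ∀ L : O22, ((L : GL (Fin 4) ℝ) : Mat) 0 0 = 1 → ((L : GL (Fin 4) ℝ) : Mat) 1 0 = 0 →
      ((L : GL (Fin 4) ℝ) : Mat) 2 0 = 0 → ((L : GL (Fin 4) ℝ) : Mat) 3 0 = 0 →
      ∃ b₁ b₂ b₃ c₁ c₂ c₃ d₁ d₂ d₃ : ℝ,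
        ((L : GL (Fin 4) ℝ) : Mat) = lit 1 0 0 0 0 b₁ b₂ b₃ 0 c₁ c₂ c₃ 0 d₁ d₂ d₃ := by
    intro L h0 h1 h2 h3
    have ho := orth_O22 L
    obtain ⟨a₀, a₁, a₂, a₃, b₀, b₁, b₂, b₃, c₀, c₁, c₂, c₃, d₀, d₁, d₂, d₃, hL⟩ :=
      exists_lit ((L : GL (Fin 4) ℝ) : Mat)
    rw [hL] at h0 h1 h2 h3 ho
    rw [lit_orth_eta_iff] at ho
    obtain ⟨-, h4, h5, h6, -⟩ := ho
    change a₀ = 1 at h0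
    change b₀ = 0 at h1
    change c₀ = 0 at h2
    change d₀ = 0 at h3
    subst h0 h1 h2 h3
    refine ⟨b₁, b₂, b₃, c₁, c₂, c₃, d₁, d₂, d₃, ?_⟩
    rw [hL, lit_inj]
    refine ⟨⟨rfl, ?_, ?_, ?_⟩, ⟨rfl, rfl, rfl, rfl⟩, ⟨rfl, rfl, rfl, rfl⟩, rfl, rfl, rfl, rfl⟩ <;>
      linarith
  have ho := orth_O22 L
  obtain ⟨a₀, a₁, a₂, a₃, b₀, b₁, b₂, b₃, c₀, c₁, c₂, c₃, d₀, d₁, d₂, d₃, hL⟩ :=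
    exists_lit ((L : GL (Fin 4) ℝ) : Mat)
  rw [hL, lit_orth_eta_iff] at ho
  obtain ⟨c, s, r, h1, h2, h3, h4, h5⟩ := exists_rotation a₀ b₀
  obtain ⟨c', s', r', h1', h2', h3', h4', h5'⟩ := exists_rotation c₀ d₀
  obtain ⟨g, hg, hgm⟩ := exists_mem_SO22_rot12 h1
  obtain ⟨g', hg', hgm'⟩ := exists_mem_SO22_rot34 h1'
  -- The rotations leave the first column `(r, 0, r', 0)` with `r ≥ 0`; the boost with `cosh = r`
  -- and `sinh = -r'` takes it to `E₁`.
  have h6 : r ^ 2 - (-r') ^ 2 = 1 := by linarith [ho.1.1]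
  obtain ⟨g'', hg'', hgm''⟩ := exists_mem_SO22_boost13 h6 h2
  have hm := O22_mul_coe g'' (g' * (g * L))
  rw [O22_mul_coe g', O22_mul_coe g, hL, hgm, hgm', hgm'', lit_mul, lit_mul, lit_mul] at hm
  refine ⟨g'' * g' * g, mul_mem (mul_mem hg'' hg') hg, ?_⟩
  rw [mul_assoc, mul_assoc]
  refine key _ ?_ ?_ ?_ ?_
  · rw [hm]
    simp only [Matrix.of_apply, Matrix.cons_val]
    linear_combination r * h4 - r' * h4' + h6
  · rw [hm]
    simp only [Matrix.of_apply, Matrix.cons_val]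
    linear_combination h5
  · rw [hm]
    simp only [Matrix.of_apply, Matrix.cons_val]
    linear_combination -r' * h4 + r * h4'
  · rw [hm]
    simp only [Matrix.of_apply, Matrix.cons_val]
    linear_combination h5'

theorem exists_SO22_mul_eq_of_two_columns {L : O22} {b₁ b₂ b₃ c₁ c₂ c₃ d₁ d₂ d₃ : ℝ}
    (hL : ((L : GL (Fin 4) ℝ) : Mat) = lit 1 0 0 0 0 b₁ b₂ b₃ 0 c₁ c₂ c₃ 0 d₁ d₂ d₃) :
    ∃ g ∈ SO22, ∃ s t : ℝ, (s = 1 ∨ s = -1) ∧ (t = 1 ∨ t = -1) ∧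
      (((g * L : O22) : GL (Fin 4) ℝ) : Mat) = lit 1 0 0 0 0 s 0 0 0 0 1 0 0 0 0 t := by
  have key : ∀ L : O22, ∀ s b₂ b₃ c₂ c₃ d₂ d₃ : ℝ, (s = 1 ∨ s = -1) →
      ((L : GL (Fin 4) ℝ) : Mat) = lit 1 0 0 0 0 s b₂ b₃ 0 0 c₂ c₃ 0 0 d₂ d₃ →
      ∃ g ∈ SO22, ∃ t : ℝ, (t = 1 ∨ t = -1) ∧
        (((g * L : O22) : GL (Fin 4) ℝ) : Mat) = lit 1 0 0 0 0 s 0 0 0 0 1 0 0 0 0 t := by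
    intro L s b₂ b₃ c₂ c₃ d₂ d₃ hs hL
    have ho := orth_O22 L
    rw [hL, lit_orth_eta_iff] at ho
    obtain ⟨⟨-, -, h0, -⟩, -, -, -, hb₂, hb₃, -⟩ := ho
    have hs0 : s ≠ 0 := by rcases hs with rfl | rfl <;> norm_num
    have hb₂' : b₂ = 0 := by
      refine (mul_eq_zero.1 (?_ : s * b₂ = 0)).resolve_left hs0
      linarith
    have hb₃' : b₃ = 0 := by
      refine (mul_eq_zero.1 (?_ : s * b₃ = 0)).resolve_left hs0
      linarith
    subst hb₂' hb₃'
    obtain ⟨c, s', r, h1, h2, h3, h4, h5⟩ := exists_rotation c₂ d₂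
    have hr : r = 1 := by nlinarith
    subst hr
    obtain ⟨g, hg, hgm⟩ := exists_mem_SO22_rot34 h1
    have hm : (((g * L : O22) : GL (Fin 4) ℝ) : Mat) =
        lit 1 0 0 0 0 s 0 0 0 0 1 (c * c₃ + s' * d₃) 0 0 0 (-s' * c₃ + c * d₃) := by
      rw [O22_mul_coe, hL, hgm, lit_mul, lit_inj]
      refine ⟨⟨?_, ?_, ?_, ?_⟩, ⟨?_, ?_, ?_, ?_⟩, ⟨?_, ?_, ?_, ?_⟩, ?_, ?_, ?_, ?_⟩ <;> linarith
    have ho := orth_O22 (g * L)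
    rw [hm, lit_orth_eta_iff] at ho
    obtain ⟨⟨-, -, -, h6⟩, -, -, -, -, -, h7⟩ := ho
    have h8 : c * c₃ + s' * d₃ = 0 := by linarith
    rw [h8] at hm h6
    exact ⟨g, hg, _, eq_one_or_eq_neg_one_of_sq (by linarith), hm⟩
  have ho := orth_O22 L
  rw [hL, lit_orth_eta_iff] at ho
  obtain ⟨⟨-, h0, -⟩, -⟩ := ho
  obtain ⟨c, s', r, h1, h2, h3, h4, h5⟩ := exists_rotation c₁ d₁
  -- After the rotation the second column is `(0, b₁, r, 0)`, where `b₁` may be negative, but a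
  -- boost in the identity component needs a nonnegative `cosh`. So the column can only be brought
  -- to `s E₂`, with `s` the sign of `b₁`.
  obtain ⟨s, hs, hsb⟩ : ∃ s : ℝ, (s = 1 ∨ s = -1) ∧ 0 ≤ s * b₁ := by
    rcases le_total 0 b₁ with h | h
    · exact ⟨1, Or.inl rfl, by linarith⟩
    · exact ⟨-1, Or.inr rfl, by linarith⟩
  have hs2 : s ^ 2 = 1 := by rcases hs with rfl | rfl <;> norm_num
  obtain ⟨g, hg, hgm⟩ := exists_mem_SO22_rot34 h1
  have h6 : (s * b₁) ^ 2 - (-s * r) ^ 2 = 1 := by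
    linear_combination (b₁ ^ 2 - r ^ 2) * hs2 + h0 - h3
  obtain ⟨g', hg', hgm'⟩ := exists_mem_SO22_boost23 h6 hsb
  have hm := O22_mul_coe g' (g * L)
  rw [O22_mul_coe g, hL, hgm, hgm', lit_mul, lit_mul] at hm
  have hm' : (((g' * (g * L) : O22) : GL (Fin 4) ℝ) : Mat) =
      lit 1 0 0 0 0 s (s * b₁ * b₂ + -s * r * (c * c₂ + s' * d₂))
        (s * b₁ * b₃ + -s * r * (c * c₃ + s' * d₃)) 0 0
        (-s * r * b₂ + s * b₁ * (c * c₂ + s' * d₂)) (-s * r * b₃ + s * b₁ * (c * c₃ + s' * d₃)) 0 0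
        (-s' * c₂ + c * d₂) (-s' * c₃ + c * d₃) := by
    rw [hm, lit_inj]
    refine ⟨⟨?_, ?_, ?_, ?_⟩, ⟨?_, ?_, ?_, ?_⟩, ⟨?_, ?_, ?_, ?_⟩, ?_, ?_, ?_, ?_⟩ <;> try ring1
    · linear_combination -s * r * h4 + s * h0 - s * h3
    · linear_combination s * b₁ * h4
    · linear_combination h5
  obtain ⟨g'', hg'', t, ht, h7⟩ := key _ _ _ _ _ _ _ _ hs hm'
  exact ⟨g'' * g' * g, mul_mem (mul_mem hg'' hg') hg, s, t, hs, ht, by rw [mul_assoc, mul_assoc, h7]⟩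

/-- `O(2,2)` is generated by its identity component and the reflections in the second and the
fourth coordinate. -/
theorem exists_SO22_mul_eq_diagonal (L : O22) : ∃ g ∈ SO22, ∃ s t : ℝ, (s = 1 ∨ s = -1) ∧
    (t = 1 ∨ t = -1) ∧
    (((g * L : O22) : GL (Fin 4) ℝ) : Mat) = lit 1 0 0 0 0 s 0 0 0 0 1 0 0 0 0 t := by
  obtain ⟨g, hg, b₁, b₂, b₃, c₁, c₂, c₃, d₁, d₂, d₃, h⟩ := exists_SO22_mul_eq_of_column L
  obtain ⟨g', hg', s, t, hs, ht, h'⟩ := exists_SO22_mul_eq_of_two_columns h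
  refine ⟨g' * g, mul_mem hg' hg, s, t, hs, ht, ?_⟩
  rw [mul_assoc, h']

/-! ### The components of `O(2,2)` -/

/-- The upper left minor of size two. -/
def upperMinor (A : Mat) : ℝ := A 0 0 * A 1 1 - A 0 1 * A 1 0

/-- The lower right minor of size two. -/
def lowerMinor (A : Mat) : ℝ := A 2 2 * A 3 3 - A 2 3 * A 3 2

theorem continuous_upperMinor : Continuous upperMinor := by
  unfold upperMinor
  fun_prop

theorem continuous_lowerMinor : Continuous lowerMinor := by
  unfold lowerMinor
  fun_prop

/-- If `U` and `V` are the upper and lower halves of the first two columns, then `Uᵀ U = 1 + Vᵀ V`.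
The determinant of the right side is `1` plus a sum of squares. -/
theorem upperMinor_ne_zero {A : Mat} (hA : Aᵀ * eta * A = eta) : upperMinor A ≠ 0 := by
  obtain ⟨a₀, a₁, a₂, a₃, b₀, b₁, b₂, b₃, c₀, c₁, c₂, c₃, d₀, d₁, d₂, d₃, rfl⟩ := exists_lit A
  rw [lit_orth_eta_iff] at hA
  obtain ⟨⟨h1, h2, -, -⟩, h3, -⟩ := hA
  change a₀ * b₁ - a₁ * b₀ ≠ 0
  intro h
  have h4 : (a₀ * b₁ - a₁ * b₀) ^ 2 =
      1 + (c₀ ^ 2 + d₀ ^ 2) + (c₁ ^ 2 + d₁ ^ 2) + (c₀ * d₁ - c₁ * d₀) ^ 2 := by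
    linear_combination (a₁ ^ 2 + b₁ ^ 2) * h1 + (1 + c₀ ^ 2 + d₀ ^ 2) * h2 -
      (a₀ * a₁ + b₀ * b₁ + c₀ * c₁ + d₀ * d₁) * h3
  rw [h] at h4
  nlinarith [sq_nonneg c₀, sq_nonneg d₀, sq_nonneg c₁, sq_nonneg d₁,
    sq_nonneg (c₀ * d₁ - c₁ * d₀)]

theorem lowerMinor_ne_zero {A : Mat} (hA : Aᵀ * eta * A = eta) : lowerMinor A ≠ 0 := by
  obtain ⟨a₀, a₁, a₂, a₃, b₀, b₁, b₂, b₃, c₀, c₁, c₂, c₃, d₀, d₁, d₂, d₃, rfl⟩ := exists_lit A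
  rw [lit_orth_eta_iff] at hA
  obtain ⟨⟨-, -, h1, h2⟩, -, -, -, -, -, h3⟩ := hA
  change c₂ * d₃ - c₃ * d₂ ≠ 0
  intro h
  have h4 : (c₂ * d₃ - c₃ * d₂) ^ 2 =
      1 + (a₂ ^ 2 + b₂ ^ 2) + (a₃ ^ 2 + b₃ ^ 2) + (a₂ * b₃ - a₃ * b₂) ^ 2 := by
    linear_combination -(c₃ ^ 2 + d₃ ^ 2) * h1 - (1 + a₂ ^ 2 + b₂ ^ 2) * h2 +
      (a₂ * a₃ + b₂ * b₃ + c₂ * c₃ + d₂ * d₃) * h3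
  rw [h] at h4
  nlinarith [sq_nonneg a₂, sq_nonneg b₂, sq_nonneg a₃, sq_nonneg b₃,
    sq_nonneg (a₂ * b₃ - a₃ * b₂)]

/-- The sign of a nonzero real number. -/
def unitSign (x : ℝ) : ℤˣ := if 0 < x then 1 else -1

theorem unitSign_of_pos {x : ℝ} (h : 0 < x) : unitSign x = 1 := if_pos h

theorem unitSign_of_neg {x : ℝ} (h : x < 0) : unitSign x = -1 := if_neg h.not_gt

theorem continuous_unitSign {X : Type*} [TopologicalSpace X] {f : X → ℝ} (hf : Continuous f)
    (h : ∀ x, f x ≠ 0) : Continuous fun x => unitSign (f x) := by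
  refine IsLocallyConstant.continuous ((IsLocallyConstant.iff_eventually_eq _).2 fun x => ?_)
  rcases (h x).lt_or_gt with hx | hx
  · filter_upwards [hf.continuousAt.eventually (Iio_mem_nhds hx)] with y hy
    rw [unitSign_of_neg hy, unitSign_of_neg hx]
  · filter_upwards [hf.continuousAt.eventually (Ioi_mem_nhds hx)] with y hy
    rw [unitSign_of_pos hy, unitSign_of_pos hx]

/-- The component of an element of `O(2,2)`: whether it preserves the orientations of maximal
positive and of maximal negative subspaces. -/
def orientation (A : Mat) : ℤˣ × ℤˣ := (unitSign (upperMinor A), unitSign (lowerMinor A))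

theorem continuous_orientation :
    Continuous fun L : O22 => orientation ((L : GL (Fin 4) ℝ) : Mat) :=
  (continuous_unitSign (continuous_upperMinor.comp continuous_O22_coe)
    fun L => upperMinor_ne_zero (orth_O22 L)).prodMk
  (continuous_unitSign (continuous_lowerMinor.comp continuous_O22_coe)
    fun L => lowerMinor_ne_zero (orth_O22 L))

theorem isPreconnected_SO22 : IsPreconnected (SO22 : Set O22) := isPreconnected_connectedComponent

theorem orientation_SO22_mul {g : O22} (hg : g ∈ SO22) (L : O22) :
    orientation (((g * L : O22) : GL (Fin 4) ℝ) : Mat) =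
      orientation ((L : GL (Fin 4) ℝ) : Mat) := by
  have h := isPreconnected_SO22.constant
    (f := fun g : O22 => orientation (((g * L : O22) : GL (Fin 4) ℝ) : Mat))
    (continuous_orientation.comp (continuous_mul_const L)).continuousOn hg (one_mem SO22)
  simpa using h

theorem exists_SO22_mul_eq (L : O22) : ∃ g ∈ SO22, ∃ d : O22, L = g * d ∧
    ∃ s t : ℝ, (s = 1 ∨ s = -1) ∧ (t = 1 ∨ t = -1) ∧
      ((d : GL (Fin 4) ℝ) : Mat) = lit 1 0 0 0 0 s 0 0 0 0 1 0 0 0 0 t := by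
  obtain ⟨g, hg, s, t, hs, ht, h⟩ := exists_SO22_mul_eq_diagonal L
  exact ⟨g⁻¹, inv_mem hg, g * L, by group, s, t, hs, ht, h⟩

theorem orientation_diagonal (s t : ℝ) : orientation (lit 1 0 0 0 0 s 0 0 0 0 1 0 0 0 0 t) =
    (unitSign s, unitSign t) := by
  simp [orientation, upperMinor, lowerMinor]

theorem unitSign_one : unitSign 1 = 1 := unitSign_of_pos one_pos

theorem unitSign_neg_one : unitSign (-1) = -1 := unitSign_of_neg (by norm_num)

/-- The identity component is normal and does not affect `orientation`, so the claim reduces to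
products of diagonal sign matrices. -/
theorem orientation_mul (L L' : O22) :
    orientation (((L * L' : O22) : GL (Fin 4) ℝ) : Mat) =
      orientation ((L : GL (Fin 4) ℝ) : Mat) * orientation ((L' : GL (Fin 4) ℝ) : Mat) := by
  obtain ⟨g, hg, d, rfl, s, t, hs, ht, hd⟩ := exists_SO22_mul_eq L
  obtain ⟨g', hg', d', rfl, s', t', hs', ht', hd'⟩ := exists_SO22_mul_eq L'
  have h1 : g * d * (g' * d') = (g * (d * g' * d⁻¹)) * (d * d') := by group
  -- Conjugation is continuous and fixes `1`, so it preserves the component of `1`.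
  have h2 : d * g' * d⁻¹ ∈ SO22 :=
    (isPreconnected_SO22.image (fun x => d * x * d⁻¹)
      (by fun_prop)).subset_connectedComponent (x := 1) ⟨1, one_mem SO22, by group⟩ ⟨g', hg', rfl⟩
  rw [h1, orientation_SO22_mul (mul_mem hg h2), orientation_SO22_mul hg, orientation_SO22_mul hg',
    O22_mul_coe, hd, hd', orientation_diagonal, orientation_diagonal]
  have h3 : lit 1 0 0 0 0 s 0 0 0 0 1 0 0 0 0 t * lit 1 0 0 0 0 s' 0 0 0 0 1 0 0 0 0 t' =
      lit 1 0 0 0 0 (s * s') 0 0 0 0 1 0 0 0 0 (t * t') := by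
    rw [lit_mul, lit_inj]
    norm_num
  rw [h3, orientation_diagonal]
  have h4 : ∀ x y : ℝ, (x = 1 ∨ x = -1) → (y = 1 ∨ y = -1) →
      unitSign (x * y) = unitSign x * unitSign y := by
    rintro x y (rfl | rfl) (rfl | rfl) <;> simp [unitSign_one, unitSign_neg_one]
  rw [h4 s s' hs hs', h4 t t' ht ht', Prod.mk_mul_mk]

theorem exists_SO22_of_orientation_eq {L L' : O22}
    (h : orientation ((L : GL (Fin 4) ℝ) : Mat) = orientation ((L' : GL (Fin 4) ℝ) : Mat)) :
    ∃ g ∈ SO22, L' = g * L := by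
  obtain ⟨g, hg, d, rfl, s, t, hs, ht, hd⟩ := exists_SO22_mul_eq L
  obtain ⟨g', hg', d', rfl, s', t', hs', ht', hd'⟩ := exists_SO22_mul_eq L'
  rw [orientation_SO22_mul hg, orientation_SO22_mul hg', hd, hd', orientation_diagonal,
    orientation_diagonal, Prod.mk_inj] at h
  have h4 : ∀ x y : ℝ, (x = 1 ∨ x = -1) → (y = 1 ∨ y = -1) →
      unitSign x = unitSign y → x = y := by
    rintro x y (rfl | rfl) (rfl | rfl) <;> simp [unitSign_one, unitSign_neg_one]
  have h5 : d = d' := O22_ext (by rw [hd, hd', h4 s s' hs hs' h.1, h4 t t' ht ht' h.2])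
  exact ⟨g' * g⁻¹, mul_mem hg' (inv_mem hg), by rw [h5]; group⟩

theorem exists_orientation_eq (x : ℤˣ × ℤˣ) :
    ∃ L : O22, orientation ((L : GL (Fin 4) ℝ) : Mat) = x := by
  have h1 : ∀ u : ℤˣ, ∃ s : ℝ, s ^ 2 = 1 ∧ unitSign s = u := by
    intro u
    rcases Int.units_eq_one_or u with rfl | rfl
    · exact ⟨1, by norm_num, unitSign_one⟩
    · exact ⟨-1, by norm_num, unitSign_neg_one⟩
  obtain ⟨s, hs, hs'⟩ := h1 x.1
  obtain ⟨t, ht, ht'⟩ := h1 x.2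
  refine ⟨toO22 (lit 1 0 0 0 0 s 0 0 0 0 1 0 0 0 0 t) ?_, ?_⟩
  · rw [lit_orth_eta_iff]
    refine ⟨⟨?_, ?_, ?_, ?_⟩, ?_, ?_, ?_, ?_, ?_, ?_⟩ <;> linarith
  · rw [coe_toO22, orientation_diagonal, hs', ht']

/-- The components of an orbit correspond to the quotient of the group of components of `O(2,2)` by
the image of the isotropy subgroup. -/
theorem numComponents_orbit {J : Type*} [Group J] [TopologicalSpace J] [DiscreteTopology J]
    {S : Mat} (hS : eta.IsSelfAdjoint S) (ψ : ℤˣ × ℤˣ →* J) (hψ : Function.Surjective ψ)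
    (h1 : ∀ L ∈ isotropy S, ψ (orientation ((L : GL (Fin 4) ℝ) : Mat)) = 1)
    (h2 : ∀ x, ψ x = 1 → ∃ L ∈ isotropy S, orientation ((L : GL (Fin 4) ℝ) : Mat) = x) :
    numComponents (orbit S) = Nat.card J := by
  -- Elements carrying `S` to the same point differ by an isotropy element, on which `ψ ∘
  -- orientation` is trivial; hence this composite descends to the orbit.
  have hχ : ∀ T : orbit S, ∃ j : J, ∀ L : O22, act L S = T →
      ψ (orientation ((L : GL (Fin 4) ℝ) : Mat)) = j := by
    rintro ⟨_, L, rfl⟩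
    refine ⟨ψ (orientation ((L : GL (Fin 4) ℝ) : Mat)), fun L' hL' => ?_⟩
    have h3 := h1 _ (act_eq_act_iff.1 (show act L S = act L' S from hL'.symm))
    have h4 : L' = L * (L⁻¹ * L') := by group
    rw [h4, orientation_mul, map_mul, h3, mul_one]
  choose F hF using hχ
  let f : O22 → orbit S := fun L => ⟨act L S, act_mem_orbit L S⟩
  have hf : Continuous f := (continuous_act S).subtype_mk _
  have hFf : ∀ L, F (f L) = ψ (orientation ((L : GL (Fin 4) ℝ) : Mat)) := fun L => (hF _ L rfl).symm
  have hfs : Function.Surjective f := by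
    rintro ⟨_, L, rfl⟩
    exact ⟨L, rfl⟩
  have hFc : Continuous F := by
    rw [((isOpenMap_act hS).isQuotientMap hf hfs).continuous_iff]
    have : F ∘ f = fun L : O22 => ψ (orientation ((L : GL (Fin 4) ℝ) : Mat)) := funext hFf
    rw [this]
    exact (continuous_of_discreteTopology (f := ψ)).comp continuous_orientation
  refine natCard_connectedComponents hFc (fun j => ?_) fun j => ?_
  · obtain ⟨x, rfl⟩ := hψ j
    obtain ⟨L, rfl⟩ := exists_orientation_eq x
    exact ⟨f L, hFf L⟩
  · obtain ⟨x, rfl⟩ := hψ j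
    obtain ⟨L, rfl⟩ := exists_orientation_eq x
    have h3 : F ⁻¹' {ψ (orientation ((L : GL (Fin 4) ℝ) : Mat))} =
        (fun g => f (g * L)) '' (SO22 : Set O22) := by
      ext T
      constructor
      · intro hT
        obtain ⟨L', rfl⟩ := hfs T
        have h4 : ψ (orientation ((L' : GL (Fin 4) ℝ) : Mat)) =
            ψ (orientation ((L : GL (Fin 4) ℝ) : Mat)) := (hFf L').symm.trans hT
        have h5 : L' = L * (L⁻¹ * L') := by group
        rw [h5, orientation_mul, map_mul, mul_eq_left] at h4
        -- Multiplying `L` by the isotropy element `k` does not change the endomorphism but gives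
        -- the orientation of `L'`. The two then differ by an element of the identity component, so
        -- each fibre is the image of a connected set.
        obtain ⟨k, hk, hkx⟩ := h2 _ h4
        obtain ⟨g, hg, h6⟩ := exists_SO22_of_orientation_eq (L := L * k) (L' := L')
          (by rw [orientation_mul, hkx, ← orientation_mul, ← h5])
        refine ⟨g, hg, Subtype.ext ?_⟩
        change act (g * L) S = act L' S
        rw [h6, act_eq_act_iff]
        have h7 : (g * L)⁻¹ * (g * (L * k)) = k := by group
        rwa [h7]
      · rintro ⟨g, hg, rfl⟩
        change F (f (g * L)) = _
        rw [hFf, orientation_SO22_mul hg]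
    rw [h3]
    exact isPreconnected_SO22.image _ (hf.comp (continuous_mul_const L)).continuousOn

/-! ### Components of orbits, from the matrices of the isotropy subgroup -/

theorem conjEquiv_one (A : Mat) : conjEquiv 1 A = A := by simp [conjEquiv_apply]

theorem numComponents_orbit_of_frame {J : Type*} [Group J] {H M S : Mat} {b : GL (Fin 4) ℝ}
    (hb : IsFrame H b) (hM : Mᵀ * H = H * M) (hS : S ∈ realizing H M)
    (ψ : ℤˣ × ℤˣ →* J) (hψ : Function.Surjective ψ)
    (h1 : ∀ A ∈ orthCentralizer H M, ψ (orientation (conjEquiv b A)) = 1)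
    (h2 : ∀ x, ψ x = 1 → ∃ A ∈ orthCentralizer H M, orientation (conjEquiv b A) = x) :
    numComponents (orbit S) = Nat.card J := by
  have hbM := hasMatrix_conj b M
  have hS₀ : conjEquiv b M ∈ realizing H M := ⟨b, hb, hbM⟩
  rw [← realizing_eq_orbit hS, realizing_eq_orbit hS₀]
  have hK := mem_orthCentralizer_iff_of_frame hb hbM
  have hc : ∀ L : O22, conjEquiv b ((b⁻¹ * (L : GL (Fin 4) ℝ) * b : GL (Fin 4) ℝ) : Mat) =
      ((L : GL (Fin 4) ℝ) : Mat) := by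
    intro L
    rw [conjEquiv_apply, ← Units.val_mul, ← Units.val_mul]
    congr 1
    group
  let _ : TopologicalSpace J := ⊥
  have _ : DiscreteTopology J := ⟨rfl⟩
  refine numComponents_orbit (isSelfAdjoint_of_mem_realizing hM hS₀) ψ hψ (fun L hL => ?_)
    fun x hx => ?_
  · have h3 := h1 _ (hK.subset ⟨L, hL, rfl⟩)
    rwa [hc] at h3
  · obtain ⟨A, hA, hAx⟩ := h2 x hx
    obtain ⟨L, hL, rfl⟩ := hK.superset hA
    exact ⟨L, hL, by rwa [hc] at hAx⟩

theorem isFrame_one : IsFrame eta 1 := by simp [IsFrame]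

theorem orientation_one : orientation 1 = 1 := by
  simp [orientation, upperMinor, lowerMinor, unitSign_one, Prod.one_eq_mk]

theorem orientation_Z1 : orientation Z1 = (-1, 1) := by
  simp [orientation, upperMinor, lowerMinor, Z1_eq_lit, unitSign_one, unitSign_neg_one]

theorem orientation_Z2 : orientation Z2 = (1, -1) := by
  simp [orientation, upperMinor, lowerMinor, Z2_eq_lit, unitSign_one, unitSign_neg_one]

theorem orientation_Z1_mul_Z2 : orientation (Z1 * Z2) = (-1, -1) := by
  rw [Z1_eq_lit, Z2_eq_lit, lit_mul]
  simp [orientation, upperMinor, lowerMinor, unitSign_neg_one]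

theorem numComponents_orbit_eq_one {M S : Mat} (hM : Mᵀ * eta = eta * M)
    (hS : S ∈ realizing eta M) (h1 : Z1 ∈ orthCentralizer eta M)
    (h2 : Z2 ∈ orthCentralizer eta M) : numComponents (orbit S) = 1 := by
  rw [numComponents_orbit_of_frame isFrame_one hM hS (1 : ℤˣ × ℤˣ →* Unit)
    (fun _ => ⟨1, rfl⟩) (fun _ _ => rfl), Nat.card_unique]
  rintro ⟨x, y⟩ -
  simp only [conjEquiv_one]
  rcases Int.units_eq_one_or x with rfl | rfl <;> rcases Int.units_eq_one_or y with rfl | rfl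
  · exact ⟨1, one_mem_orthCentralizer _ _, orientation_one⟩
  · exact ⟨Z2, h2, orientation_Z2⟩
  · exact ⟨Z1, h1, orientation_Z1⟩
  · exact ⟨Z1 * Z2, mul_mem_orthCentralizer h1 h2, orientation_Z1_mul_Z2⟩

theorem natCard_units_int : Nat.card ℤˣ = 2 := by simp

/-- Here the isotropy group meets exactly the components of `O(2,2)` whose lower sign is positive,
so the lower sign labels the components of the orbit. The next lemmas are the analogues for the
upper sign and for the product of both signs. -/
theorem numComponents_orbit_eq_two_of_lower {M S : Mat} (hM : Mᵀ * eta = eta * M)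
    (hS : S ∈ realizing eta M) (h1 : Z1 ∈ orthCentralizer eta M)
    (h2 : ∀ A ∈ orthCentralizer eta M, 0 < lowerMinor A) : numComponents (orbit S) = 2 := by
  rw [numComponents_orbit_of_frame isFrame_one hM hS (MonoidHom.snd ℤˣ ℤˣ)
    (fun x => ⟨(1, x), rfl⟩) (fun A hA => ?_), natCard_units_int]
  · rintro ⟨x, y⟩ (rfl : y = 1)
    simp only [conjEquiv_one]
    rcases Int.units_eq_one_or x with rfl | rfl
    · exact ⟨1, one_mem_orthCentralizer _ _, orientation_one⟩
    · exact ⟨Z1, h1, orientation_Z1⟩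
  · rw [conjEquiv_one]
    exact unitSign_of_pos (h2 A hA)

theorem numComponents_orbit_eq_two_of_upper {M S : Mat} (hM : Mᵀ * eta = eta * M)
    (hS : S ∈ realizing eta M) (h1 : Z2 ∈ orthCentralizer eta M)
    (h2 : ∀ A ∈ orthCentralizer eta M, 0 < upperMinor A) : numComponents (orbit S) = 2 := by
  rw [numComponents_orbit_of_frame isFrame_one hM hS (MonoidHom.fst ℤˣ ℤˣ)
    (fun x => ⟨(x, 1), rfl⟩) (fun A hA => ?_), natCard_units_int]
  · rintro ⟨x, y⟩ (rfl : x = 1)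
    simp only [conjEquiv_one]
    rcases Int.units_eq_one_or y with rfl | rfl
    · exact ⟨1, one_mem_orthCentralizer _ _, orientation_one⟩
    · exact ⟨Z2, h1, orientation_Z2⟩
  · rw [conjEquiv_one]
    exact unitSign_of_pos (h2 A hA)

theorem numComponents_orbit_eq_two_of_mul {H M S : Mat} {b : GL (Fin 4) ℝ} (hb : IsFrame H b)
    (hM : Mᵀ * H = H * M) (hS : S ∈ realizing H M)
    (h1 : ∀ A ∈ orthCentralizer H M,
      0 < upperMinor (conjEquiv b A) * lowerMinor (conjEquiv b A))
    {Z : Mat} (hZ : Z ∈ orthCentralizer H M) (hZ' : upperMinor (conjEquiv b Z) < 0) :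
    numComponents (orbit S) = 2 := by
  rw [numComponents_orbit_of_frame hb hM hS (MonoidHom.coprod (MonoidHom.id ℤˣ) (MonoidHom.id ℤˣ))
    (fun x => ⟨(x, 1), by simp⟩) (fun A hA => ?_), natCard_units_int]
  · rintro ⟨x, y⟩ hxy
    have hxy' : x * y = 1 := hxy
    obtain rfl : x = y := by
      rw [← Int.units_inv_eq_self x]
      exact (eq_inv_of_mul_eq_one_right hxy').symm
    rcases Int.units_eq_one_or x with rfl | rfl
    · refine ⟨1, one_mem_orthCentralizer _ _, ?_⟩
      have : conjEquiv b 1 = 1 := by simp [conjEquiv_apply]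
      rw [this, orientation_one]
      rfl
    · refine ⟨Z, hZ, ?_⟩
      have h2 := h1 Z hZ
      rw [orientation, unitSign_of_neg hZ', unitSign_of_neg (by nlinarith)]
  · have h2 := h1 A hA
    change unitSign (upperMinor (conjEquiv b A)) * unitSign (lowerMinor (conjEquiv b A)) = 1
    rcases lt_trichotomy (upperMinor (conjEquiv b A)) 0 with h | h | h
    · rw [unitSign_of_neg h, unitSign_of_neg (by nlinarith)]
      rfl
    · rw [h] at h2
      simp at h2
    · rw [unitSign_of_pos h, unitSign_of_pos (by nlinarith)]
      rfl

/-- Both minors of `-1` have even size, so `-1` has the orientation of `1` and no components are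
identified. -/
theorem numComponents_orbit_eq_four {H M S : Mat} {b : GL (Fin 4) ℝ} (hb : IsFrame H b)
    (hM : Mᵀ * H = H * M) (hS : S ∈ realizing H M) (h : orthCentralizer H M = {1, -1}) :
    numComponents (orbit S) = 4 := by
  rw [numComponents_orbit_of_frame hb hM hS (MonoidHom.id _) (fun x => ⟨x, rfl⟩) (fun A hA => ?_)]
  · simp
  · rintro x rfl
    refine ⟨1, one_mem_orthCentralizer _ _, ?_⟩
    have : conjEquiv b 1 = 1 := by simp [conjEquiv_apply]
    rw [this, orientation_one]
  · have h1 : conjEquiv b 1 = 1 := by simp [conjEquiv_apply]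
    rw [h] at hA
    rcases hA with rfl | rfl
    · rw [h1]
      exact orientation_one
    · rw [map_neg, h1]
      simp [orientation, upperMinor, lowerMinor, unitSign_one, Prod.one_eq_mk]

/-! ### Components of parameter domains -/

/-- The index of the piece containing a point is locally constant because the pieces are open, and
its fibres are connected; so the pieces are the components. -/
theorem components_of_partition {X I : Type*} [TopologicalSpace X] [Finite I] {D : Set X}
    (U : I → Set X) (ho : ∀ i, IsOpen (U i)) (hc : ∀ i, IsPreconnected (U i))
    (hn : ∀ i, (U i).Nonempty) (hd : ∀ i j x, x ∈ U i → x ∈ U j → i = j)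
    (hD : ∀ x, x ∈ D ↔ ∃ i, x ∈ U i) :
    numComponents D = Nat.card I ∧
      ∀ x ∈ D, ∀ x' ∈ connectedComponentIn D x, ∃ i, x ∈ U i ∧ x' ∈ U i := by
  let _ : TopologicalSpace I := ⊥
  have _ : DiscreteTopology I := ⟨rfl⟩
  have h : ∀ x : D, ∃ i, (x : X) ∈ U i := fun x => (hD x).1 x.2
  choose f hf using h
  have hfe : ∀ (x : D) i, (x : X) ∈ U i → f x = i := fun x i hx => hd _ _ _ (hf x) hx
  have hfc : Continuous f := by
    refine IsLocallyConstant.continuous ((IsLocallyConstant.iff_eventually_eq _).2 fun x => ?_)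
    filter_upwards [((ho (f x)).preimage continuous_subtype_val).mem_nhds (hf x)] with y hy
    exact hfe y _ hy
  refine ⟨natCard_connectedComponents hfc (fun i => ?_) fun i => ?_, fun x hx x' hx' => ?_⟩
  · obtain ⟨x, hx⟩ := hn i
    exact ⟨⟨x, (hD x).2 ⟨i, hx⟩⟩, hfe _ _ hx⟩
  · rw [← Topology.IsInducing.subtypeVal.isPreconnected_image]
    convert hc i
    ext x
    constructor
    · rintro ⟨y, rfl, rfl⟩
      exact hf y
    · intro hx
      exact ⟨⟨x, (hD x).2 ⟨i, hx⟩⟩, hfe _ _ hx, rfl⟩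
  · rw [connectedComponentIn_eq_image hx] at hx'
    obtain ⟨y, hy, rfl⟩ := hx'
    have h1 := isPreconnected_connectedComponent.constant hfc.continuousOn hy
      (mem_connectedComponent (x := (⟨x, hx⟩ : D)))
    exact ⟨f ⟨x, hx⟩, hf ⟨x, hx⟩, h1 ▸ hf y⟩

theorem isOpen_pos {m : ℕ} (l : (Fin m → ℝ) →ₗ[ℝ] ℝ) : IsOpen {x | 0 < l x} :=
  isOpen_lt continuous_const l.continuous_of_finiteDimensional

theorem convex_pos {m : ℕ} (l : (Fin m → ℝ) →ₗ[ℝ] ℝ) : Convex ℝ {x | 0 < l x} :=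
  convex_halfSpace_gt l.isLinear 0

/-- Each sign pattern of the linear forms defines an intersection of open half-spaces, which is open
and convex. The joint surjectivity `hl` makes every pattern occur. -/
theorem components_of_signs {m r : ℕ} {D : Set (Fin m → ℝ)} (l : Fin r → (Fin m → ℝ) →ₗ[ℝ] ℝ)
    (hl : ∀ y : Fin r → ℝ, ∃ x, ∀ j, l j x = y j) (hD : ∀ x, x ∈ D ↔ ∀ j, l j x ≠ 0) :
    numComponents D = 2 ^ r ∧
      ∀ x ∈ D, ∀ x' ∈ connectedComponentIn D x, ∀ j, 0 < l j x * l j x' := by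
  let U : (Fin r → ℤˣ) → Set (Fin m → ℝ) := fun s => ⋂ j, {x | 0 < (((s j : ℤ) : ℝ) • l j) x}
  have hU : ∀ s x, x ∈ U s ↔ ∀ j, 0 < ((s j : ℤ) : ℝ) * l j x := fun s x => by simp [U]
  have hu : ∀ u : ℤˣ, ((u : ℤ) : ℝ) * ((u : ℤ) : ℝ) = 1 := by
    intro u
    rcases Int.units_eq_one_or u with rfl | rfl <;> norm_num
  have h := components_of_partition (D := D) U (fun s => isOpen_iInter_of_finite fun j => isOpen_pos _)
    (fun s => (convex_iInter fun j => convex_pos _).isPreconnected) (fun s => ?_)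
    (fun s t x hs ht => ?_) (fun x => ?_)
  · refine ⟨by rw [h.1]; simp, fun x hx x' hx' j => ?_⟩
    obtain ⟨s, h1, h2⟩ := h.2 x hx x' hx'
    have h3 := mul_pos ((hU s x).1 h1 j) ((hU s x').1 h2 j)
    have h4 : ((s j : ℤ) : ℝ) * l j x * (((s j : ℤ) : ℝ) * l j x') = l j x * l j x' := by
      linear_combination (l j x * l j x') * hu (s j)
    rwa [h4] at h3
  · obtain ⟨x, hx⟩ := hl fun j => ((s j : ℤ) : ℝ)
    refine ⟨x, (hU s x).2 fun j => ?_⟩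
    rw [hx, hu]
    exact one_pos
  · ext j
    have h1 := (hU s x).1 hs j
    have h2 := (hU t x).1 ht j
    rcases Int.units_eq_one_or (s j) with h3 | h3 <;> rcases Int.units_eq_one_or (t j) with h4 | h4 <;>
      rw [h3] at h1 ⊢ <;> rw [h4] at h2 ⊢ <;> norm_num at h1 h2 <;> linarith
  · rw [hD]
    constructor
    · intro hx
      refine ⟨fun j => unitSign (l j x), (hU _ x).2 fun j => ?_⟩
      rcases (hx j).lt_or_gt with h | h
      · rw [unitSign_of_neg h]
        simpa using h
      · rw [unitSign_of_pos h]
        simpa using h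
    · rintro ⟨s, hs⟩ j h
      have := (hU s x).1 hs j
      rw [h, mul_zero] at this
      exact this.false

/-- Each ordering of the values is an open convex chamber. The forms are surjective only up to a
common shift, since the trace is fixed, but a shift does not affect the order. In a chamber the set
of values determines the labelled values, because increasing functions with equal range coincide. -/
theorem components_of_orderings {m k : ℕ} {D : Set (Fin m → ℝ)} (l : Fin k → (Fin m → ℝ) →ₗ[ℝ] ℝ)
    (hl : ∀ y : Fin k → ℝ, ∃ x c, ∀ i, l i x = y i + c)
    (hD : ∀ x, x ∈ D ↔ Function.Injective fun i => l i x) :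
    numComponents D = k.factorial ∧
      ∀ x ∈ D, ∀ x' ∈ connectedComponentIn D x,
        (Set.range fun i => l i x) = (Set.range fun i => l i x') → ∀ i, l i x = l i x' := by
  let U : Equiv.Perm (Fin k) → Set (Fin m → ℝ) := fun σ =>
    ⋂ i, ⋂ j, ⋂ (_ : i < j), {x | 0 < (l (σ j) - l (σ i)) x}
  have hU : ∀ σ x, x ∈ U σ ↔ StrictMono fun i => l (σ i) x := fun σ x => by
    simp [U, StrictMono]
  have hr : ∀ (σ : Equiv.Perm (Fin k)) x,
      (Set.range fun i => l (σ i) x) = Set.range fun i => l i x :=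
    fun σ x => σ.surjective.range_comp fun i => l i x
  have h := components_of_partition (D := D) U
    (fun σ => isOpen_iInter_of_finite fun i => isOpen_iInter_of_finite fun j =>
      isOpen_iInter_of_finite fun _ => isOpen_pos _)
    (fun σ => (convex_iInter fun i => convex_iInter fun j => convex_iInter fun _ =>
      convex_pos _).isPreconnected) (fun σ => ?_)
    (fun σ τ x hσ hτ => ?_) (fun x => ?_)
  · refine ⟨by rw [h.1, Nat.card_perm, Nat.card_fin], fun x hx x' hx' hxx i => ?_⟩
    obtain ⟨σ, h1, h2⟩ := h.2 x hx x' hx'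
    rw [hU] at h1 h2
    rw [← hr σ x, ← hr σ x', StrictMono.range_inj h1 h2] at hxx
    simpa using congrFun hxx (σ.symm i)
  · obtain ⟨x, c, hx⟩ := hl fun i => ((σ.symm i : ℕ) : ℝ)
    refine ⟨x, (hU σ x).2 fun i j hij => ?_⟩
    simp only [hx, Equiv.symm_apply_apply]
    have : ((i : ℕ) : ℝ) < ((j : ℕ) : ℝ) := by exact_mod_cast hij
    linarith
  · rw [hU] at hσ hτ
    have h1 := (StrictMono.range_inj hσ hτ).1 (by rw [hr, hr])
    have h2 : Function.Injective fun i => l i x := by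
      intro i j hij
      have h3 := hσ.injective (a₁ := σ.symm i) (a₂ := σ.symm j) (by simpa using hij)
      exact σ.symm.injective h3
    ext i
    exact congrArg Fin.val (h2 (congrFun h1 i))
  · rw [hD]
    constructor
    · intro hx
      refine ⟨Tuple.sort fun i => l i x, (hU _ x).2 ?_⟩
      exact (Tuple.monotone_sort fun i => l i x).strictMono_of_injective
        (hx.comp (Tuple.sort _).injective)
    · rintro ⟨σ, hσ⟩ i j hij
      rw [hU] at hσ
      have h3 := hσ.injective (a₁ := σ.symm i) (a₂ := σ.symm j) (by simpa using hij)
      exact σ.symm.injective h3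

/-! ### Assembling a computation -/

/-- Everything that holds for all types at once is discharged here. What is left for each type is
the solution of the trace condition, the centralizer, the rank, two counts of components, and the
separation of orbits by the characteristic polynomial. -/
theorem computation_of {m n p q k : ℕ} {H : Mat} {M : (Fin k → ℝ) → Mat}
    {C : Set (Fin k → ℝ)} {ι : (Fin m → ℝ) → (Fin k → ℝ)} {D : Set (Fin m → ℝ)} {K : Set Mat}
    (hHH : H * H = 1) {b : GL (Fin 4) ℝ} (hb : IsFrame H b) (hM : ∀ y, (M y)ᵀ * H = H * M y)
    (htr : ∀ y, y ∈ C ∧ (M y).trace = 0 ↔ ∃ x ∈ D, ι x = y) (hι : Set.InjOn ι D)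
    (hD : IsOpen D) (hK : ∀ x ∈ D, orthCentralizer H (M (ι x)) = K)
    (hn : ∀ x ∈ D, Module.finrank ℝ (LinearMap.range (adMap H (M (ι x)))) = n)
    (hq : ∀ x ∈ D, ∀ S ∈ realizing H (M (ι x)), numComponents (orbit S) = q)
    (hp : numComponents D = p)
    (hd : ∀ x ∈ D, ∀ x' ∈ connectedComponentIn D x,
      (M (ι x)).charpoly = (M (ι x')).charpoly → x' = x) :
    Computation m n p q H M C ι D K where
  traceless := Set.ext htr
  injOn := hι
  isOpen_domain := hD
  subtype_eq := by
    ext S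
    simp only [tracelessSubtype, tracelessSelfAdjoint, Set.mem_ofPred_eq, Set.mem_iUnion]
    constructor
    · rintro ⟨⟨-, h1⟩, y, hy, hS⟩
      rw [trace_eq_of_mem_realizing hS] at h1
      obtain ⟨x, hx, rfl⟩ := (htr y).1 ⟨hy, h1⟩
      exact ⟨x, hx, hS⟩
    · rintro ⟨x, hx, hS⟩
      obtain ⟨h1, h2⟩ := (htr _).2 ⟨x, hx, rfl⟩
      exact ⟨⟨isSelfAdjoint_of_mem_realizing (hM _) hS, by rw [trace_eq_of_mem_realizing hS, h2]⟩,
        _, h1, hS⟩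
  nonempty x _ := ⟨_, b, hb, hasMatrix_conj b _⟩
  orbit_eq x _ S hS := realizing_eq_orbit hS
  isotropy_eq x hx b S hb hS := by rw [mem_orthCentralizer_iff_of_frame hb hS, hK x hx]
  orbit_homeo x _ S hS := exists_homeomorph_orbit (isSelfAdjoint_of_mem_realizing (hM _) hS)
  orbit_dim x hx S hS := isSubmanifold_orbit_of_mem_realizing hHH (hM _) (hn x hx) hS
  orbit_components := hq
  families := hp
  distinct x hx x' hx' hne := by
    rw [Set.disjoint_left]
    intro S hS hS'
    refine hne (hd x hx x' hx' ?_)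
    rw [← charpoly_eq_of_mem_realizing hS, charpoly_eq_of_mem_realizing hS']

theorem computation_point {n q k : ℕ} {H : Mat} {M : (Fin k → ℝ) → Mat}
    {C : Set (Fin k → ℝ)} {y₀ : Fin k → ℝ} {K : Set Mat}
    (hHH : H * H = 1) {b : GL (Fin 4) ℝ} (hb : IsFrame H b) (hM : ∀ y, (M y)ᵀ * H = H * M y)
    (htr : ∀ y, y ∈ C ∧ (M y).trace = 0 ↔ y = y₀) (hK : orthCentralizer H (M y₀) = K)
    (hn : Module.finrank ℝ (LinearMap.range (adMap H (M y₀))) = n)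
    (hq : ∀ S ∈ realizing H (M y₀), numComponents (orbit S) = q) :
    Computation 0 n 1 q H M C (fun _ => y₀) Set.univ K := by
  refine computation_of hHH hb hM (fun y => ?_) (fun x _ y _ _ => Subsingleton.elim x y) isOpen_univ
    (fun _ _ => hK) (fun _ _ => hn) (fun _ _ => hq) ?_ (fun x _ x' _ _ => Subsingleton.elim x' x)
  · rw [htr]
    exact ⟨fun h => ⟨0, trivial, h.symm⟩, fun ⟨_, _, h⟩ => h.symm⟩
  · have : PreconnectedSpace (Set.univ : Set (Fin 0 → ℝ)) :=
      Subtype.preconnectedSpace isPreconnected_univ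
    have : Nonempty (Set.univ : Set (Fin 0 → ℝ)) := ⟨⟨0, trivial⟩⟩
    exact Nat.card_unique

/-- With one parameter, the determinant is a nonzero multiple of its fourth power and already
separates parameters of equal sign. -/
theorem computation_line {n q k : ℕ} {H : Mat} {M : (Fin k → ℝ) → Mat}
    {C : Set (Fin k → ℝ)} {ι : (Fin 1 → ℝ) → (Fin k → ℝ)} {K : Set Mat}
    (hHH : H * H = 1) {b : GL (Fin 4) ℝ} (hb : IsFrame H b) (hM : ∀ y, (M y)ᵀ * H = H * M y)
    (htr : ∀ y, y ∈ C ∧ (M y).trace = 0 ↔ ∃ x : Fin 1 → ℝ, x 0 ≠ 0 ∧ ι x = y)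
    (hK : ∀ x : Fin 1 → ℝ, x 0 ≠ 0 → orthCentralizer H (M (ι x)) = K)
    (hn : ∀ x : Fin 1 → ℝ, x 0 ≠ 0 →
      Module.finrank ℝ (LinearMap.range (adMap H (M (ι x)))) = n)
    (hq : ∀ x : Fin 1 → ℝ, x 0 ≠ 0 → ∀ S ∈ realizing H (M (ι x)), numComponents (orbit S) = q)
    {i : Fin k} {c : ℝ} (hc : c ≠ 0) (hi : ∀ x, ι x i = c * x 0)
    {c' : ℝ} (hc' : c' ≠ 0) (hdet : ∀ x, (M (ι x)).det = c' * x 0 ^ 4) :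
    Computation 1 n 2 q H M C ι {x | x 0 ≠ 0} K := by
  have h := components_of_signs (D := {x : Fin 1 → ℝ | x 0 ≠ 0}) (r := 1)
    (fun _ => LinearMap.proj 0) (fun y => ⟨y, fun j => by simp [Subsingleton.elim j 0]⟩)
    (fun x => by simp)
  refine computation_of hHH hb hM htr (fun x _ y _ hxy => ?_)
    (isOpen_ne_fun (continuous_apply 0) continuous_const) hK hn hq h.1 fun x hx x' hx' hch => ?_
  · have h1 := congrFun hxy i
    rw [hi, hi] at h1
    ext j
    rw [Subsingleton.elim j 0]
    exact mul_left_cancel₀ hc h1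
  · have h1 : (M (ι x)).det = (M (ι x')).det := by
      rw [Matrix.det_eq_sign_charpoly_coeff, Matrix.det_eq_sign_charpoly_coeff, hch]
    rw [hdet, hdet] at h1
    have h2 : x 0 ^ 4 = x' 0 ^ 4 := mul_left_cancel₀ hc' h1
    have h3 : 0 < x 0 * x' 0 := h.2 x hx x' hx' 0
    ext j
    rw [Subsingleton.elim j 0]
    have h4 : (x 0 - x' 0) * ((x 0 + x' 0) * (x 0 ^ 2 + x' 0 ^ 2)) = 0 := by linear_combination h2
    rcases mul_eq_zero.1 h4 with h5 | h5
    · linarith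
    · rcases mul_eq_zero.1 h5 with h6 | h6
      · nlinarith [sq_nonneg (x 0)]
      · nlinarith [sq_nonneg (x 0), sq_nonneg (x' 0), sq_nonneg (x 0 - x' 0)]

/-! ### Characteristic polynomials -/

theorem det_fin_four {R : Type*} [CommRing R] (A : Matrix (Fin 4) (Fin 4) R) : A.det =
    (A 0 0 * A 1 1 - A 0 1 * A 1 0) * (A 2 2 * A 3 3 - A 2 3 * A 3 2) -
    (A 0 0 * A 1 2 - A 0 2 * A 1 0) * (A 2 1 * A 3 3 - A 2 3 * A 3 1) +
    (A 0 0 * A 1 3 - A 0 3 * A 1 0) * (A 2 1 * A 3 2 - A 2 2 * A 3 1) +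
    (A 0 1 * A 1 2 - A 0 2 * A 1 1) * (A 2 0 * A 3 3 - A 2 3 * A 3 0) -
    (A 0 1 * A 1 3 - A 0 3 * A 1 1) * (A 2 0 * A 3 2 - A 2 2 * A 3 0) +
    (A 0 2 * A 1 3 - A 0 3 * A 1 2) * (A 2 0 * A 3 1 - A 2 1 * A 3 0) := by
  rw [Matrix.det_succ_row_zero]
  simp only [Fin.sum_univ_four, Matrix.det_fin_three, Matrix.submatrix_apply, Fin.succAbove]
  simp [show (1 : Fin 4) < 2 from by decide]
  ring

theorem det_lit (a₀ a₁ a₂ a₃ b₀ b₁ b₂ b₃ c₀ c₁ c₂ c₃ d₀ d₁ d₂ d₃ : ℝ) :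
    (lit a₀ a₁ a₂ a₃ b₀ b₁ b₂ b₃ c₀ c₁ c₂ c₃ d₀ d₁ d₂ d₃).det =
    (a₀ * b₁ - a₁ * b₀) * (c₂ * d₃ - c₃ * d₂) - (a₀ * b₂ - a₂ * b₀) * (c₁ * d₃ - c₃ * d₁) +
    (a₀ * b₃ - a₃ * b₀) * (c₁ * d₂ - c₂ * d₁) + (a₁ * b₂ - a₂ * b₁) * (c₀ * d₃ - c₃ * d₀) -
    (a₁ * b₃ - a₃ * b₁) * (c₀ * d₂ - c₂ * d₀) + (a₂ * b₃ - a₃ * b₂) * (c₀ * d₁ - c₁ * d₀) :=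
  det_fin_four _

/-- Evaluation in an algebra over `ℝ` allows complex arguments, which is how types without real
eigenvalues are separated. -/
theorem aeval_charpoly {A : Type*} [CommRing A] [Algebra ℝ A] (M : Mat) (z : A) :
    Polynomial.aeval z M.charpoly = (Matrix.scalar (Fin 4) z - M.map (algebraMap ℝ A)).det := by
  rw [← Matrix.eval_charpoly, Matrix.charpoly_map, Polynomial.eval_map_algebraMap]

theorem aeval_charpoly_lit {A : Type*} [CommRing A] [Algebra ℝ A]
    (a₀ a₁ a₂ a₃ b₀ b₁ b₂ b₃ c₀ c₁ c₂ c₃ d₀ d₁ d₂ d₃ : ℝ) (z : A) :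
    Polynomial.aeval z (lit a₀ a₁ a₂ a₃ b₀ b₁ b₂ b₃ c₀ c₁ c₂ c₃ d₀ d₁ d₂ d₃).charpoly =
    let r := algebraMap ℝ A
    ((z - r a₀) * (z - r b₁) - r a₁ * r b₀) * ((z - r c₂) * (z - r d₃) - r c₃ * r d₂) -
    ((z - r a₀) * r b₂ + r a₂ * r b₀) * (r c₁ * (z - r d₃) + r c₃ * r d₁) +
    ((z - r a₀) * r b₃ + r a₃ * r b₀) * (-r c₁ * r d₂ - (z - r c₂) * r d₁) +
    (r a₁ * r b₂ + r a₂ * (z - r b₁)) * (-r c₀ * (z - r d₃) - r c₃ * r d₀) -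
    (r a₁ * r b₃ + r a₃ * (z - r b₁)) * (r c₀ * r d₂ + (z - r c₂) * r d₀) +
    (r a₂ * r b₃ - r a₃ * r b₂) * (r c₀ * r d₁ - r c₁ * r d₀) := by
  rw [aeval_charpoly, det_fin_four]
  simp
  ring

theorem aeval_charpoly_formIV {A : Type*} [CommRing A] [Algebra ℝ A] (e l m n : ℝ) (z : A) :
    Polynomial.aeval z (formIV e l m n).charpoly = (z - algebraMap ℝ A l) *
      (z - algebraMap ℝ A m) ^ 2 * (z - algebraMap ℝ A n) := by
  rw [formIV, aeval_charpoly_lit]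
  simp only [map_zero, map_add, map_sub, map_neg]
  ring

/-! ### Types I, II, III, VI, VII and VIII -/

theorem trace_lit (a₀ a₁ a₂ a₃ b₀ b₁ b₂ b₃ c₀ c₁ c₂ c₃ d₀ d₁ d₂ d₃ : ℝ) :
    (lit a₀ a₁ a₂ a₃ b₀ b₁ b₂ b₃ c₀ c₁ c₂ c₃ d₀ d₁ d₂ d₃).trace = a₀ + b₁ + c₂ + d₃ := by
  simp [Matrix.trace, Fin.sum_univ_four]

theorem eta_symm_lit_iff (a₀ a₁ a₂ a₃ b₀ b₁ b₂ b₃ c₀ c₁ c₂ c₃ d₀ d₁ d₂ d₃ : ℝ) :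
    (lit a₀ a₁ a₂ a₃ b₀ b₁ b₂ b₃ c₀ c₁ c₂ c₃ d₀ d₁ d₂ d₃)ᵀ * eta =
      eta * lit a₀ a₁ a₂ a₃ b₀ b₁ b₂ b₃ c₀ c₁ c₂ c₃ d₀ d₁ d₂ d₃ ↔
    a₁ = b₀ ∧ a₂ = -c₀ ∧ a₃ = -d₀ ∧ b₂ = -c₁ ∧ b₃ = -d₁ ∧ c₃ = d₂ := by
  rw [lit_transpose, eta_eq_lit, lit_mul, lit_mul, lit_inj]
  constructor
  · rintro ⟨⟨-, h1, h2, h3⟩, ⟨-, -, h4, h5⟩, ⟨-, -, -, h6⟩, -⟩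
    refine ⟨?_, ?_, ?_, ?_, ?_, ?_⟩ <;> linarith
  · rintro ⟨rfl, rfl, rfl, rfl, rfl, rfl⟩
    simp

theorem hyp_symm_lit_iff (a₀ a₁ a₂ a₃ b₀ b₁ b₂ b₃ c₀ c₁ c₂ c₃ d₀ d₁ d₂ d₃ : ℝ) :
    (lit a₀ a₁ a₂ a₃ b₀ b₁ b₂ b₃ c₀ c₁ c₂ c₃ d₀ d₁ d₂ d₃)ᵀ * hyp =
      hyp * lit a₀ a₁ a₂ a₃ b₀ b₁ b₂ b₃ c₀ c₁ c₂ c₃ d₀ d₁ d₂ d₃ ↔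
    a₀ = c₂ ∧ b₁ = d₃ ∧ a₁ = d₂ ∧ b₀ = c₃ ∧ a₃ = b₂ ∧ c₁ = d₀ := by
  rw [lit_transpose, hyp, lit_mul, lit_mul, lit_inj]
  constructor
  · rintro ⟨⟨-, h1, h2, h3⟩, ⟨-, -, h4, h5⟩, ⟨-, -, -, h6⟩, -⟩
    refine ⟨?_, ?_, ?_, ?_, ?_, ?_⟩ <;> linarith
  · rintro ⟨rfl, rfl, rfl, rfl, rfl, rfl⟩
    simp

/-- A Witt basis. -/
def wittFrame : GL (Fin 4) ℝ where
  val := lit 1 0 (1 / 2) 0 0 1 0 (1 / 2) 1 0 (-(1 / 2)) 0 0 1 0 (-(1 / 2))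
  inv := lit (1 / 2) 0 (1 / 2) 0 0 (1 / 2) 0 (1 / 2) 1 0 (-1) 0 0 1 0 (-1)
  val_inv := by
    rw [lit_mul, one_eq_lit, lit_inj]
    norm_num
  inv_val := by
    rw [lit_mul, one_eq_lit, lit_inj]
    norm_num

theorem isFrame_wittFrame : IsFrame hyp wittFrame := by
  change (lit 1 0 (1 / 2) 0 0 1 0 (1 / 2) 1 0 (-(1 / 2)) 0 0 1 0 (-(1 / 2)))ᵀ * eta *
    lit 1 0 (1 / 2) 0 0 1 0 (1 / 2) 1 0 (-(1 / 2)) 0 0 1 0 (-(1 / 2)) = hyp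
  rw [lit_transpose, eta_eq_lit, lit_mul, lit_mul, hyp, lit_inj]
  norm_num

theorem conjEquiv_wittFrame (a₀ a₁ a₂ a₃ b₀ b₁ b₂ b₃ c₀ c₁ c₂ c₃ d₀ d₁ d₂ d₃ : ℝ) :
    conjEquiv wittFrame (lit a₀ a₁ a₂ a₃ b₀ b₁ b₂ b₃ c₀ c₁ c₂ c₃ d₀ d₁ d₂ d₃) =
      lit 1 0 (1 / 2) 0 0 1 0 (1 / 2) 1 0 (-(1 / 2)) 0 0 1 0 (-(1 / 2)) *
        lit a₀ a₁ a₂ a₃ b₀ b₁ b₂ b₃ c₀ c₁ c₂ c₃ d₀ d₁ d₂ d₃ *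
        lit (1 / 2) 0 (1 / 2) 0 0 (1 / 2) 0 (1 / 2) 1 0 (-1) 0 0 1 0 (-1) := rfl

theorem upperMinor_lit (a₀ a₁ a₂ a₃ b₀ b₁ b₂ b₃ c₀ c₁ c₂ c₃ d₀ d₁ d₂ d₃ : ℝ) :
    upperMinor (lit a₀ a₁ a₂ a₃ b₀ b₁ b₂ b₃ c₀ c₁ c₂ c₃ d₀ d₁ d₂ d₃) = a₀ * b₁ - a₁ * b₀ := rfl

theorem lowerMinor_lit (a₀ a₁ a₂ a₃ b₀ b₁ b₂ b₃ c₀ c₁ c₂ c₃ d₀ d₁ d₂ d₃ : ℝ) :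
    lowerMinor (lit a₀ a₁ a₂ a₃ b₀ b₁ b₂ b₃ c₀ c₁ c₂ c₃ d₀ d₁ d₂ d₃) = c₂ * d₃ - c₃ * d₂ := rfl

theorem upperMinor_conjEquiv_wittFrame (a₀ a₁ a₂ a₃ b₀ b₁ b₂ b₃ c₀ c₁ c₂ c₃ d₀ d₁ d₂ d₃ : ℝ) :
    upperMinor (conjEquiv wittFrame (lit a₀ a₁ a₂ a₃ b₀ b₁ b₂ b₃ c₀ c₁ c₂ c₃ d₀ d₁ d₂ d₃)) =
      ((a₀ + c₂) / 2 + c₀ / 4 + a₂) * ((b₁ + d₃) / 2 + d₁ / 4 + b₃) -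
        ((a₁ + c₃) / 2 + c₁ / 4 + a₃) * ((b₀ + d₂) / 2 + d₀ / 4 + b₂) := by
  rw [conjEquiv_wittFrame, lit_mul, lit_mul, upperMinor_lit]
  ring

theorem lowerMinor_conjEquiv_wittFrame (a₀ a₁ a₂ a₃ b₀ b₁ b₂ b₃ c₀ c₁ c₂ c₃ d₀ d₁ d₂ d₃ : ℝ) :
    lowerMinor (conjEquiv wittFrame (lit a₀ a₁ a₂ a₃ b₀ b₁ b₂ b₃ c₀ c₁ c₂ c₃ d₀ d₁ d₂ d₃)) =
      ((a₀ + c₂) / 2 - c₀ / 4 - a₂) * ((b₁ + d₃) / 2 - d₁ / 4 - b₃) -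
        ((a₁ + c₃) / 2 - c₁ / 4 - a₃) * ((b₀ + d₂) / 2 - d₀ / 4 - b₂) := by
  rw [conjEquiv_wittFrame, lit_mul, lit_mul, lowerMinor_lit]
  ring

theorem upperMinor_neg (A : Mat) : upperMinor (-A) = upperMinor A := by simp [upperMinor]

theorem lowerMinor_neg (A : Mat) : lowerMinor (-A) = lowerMinor A := by simp [lowerMinor]

theorem upperMinor_one : upperMinor 1 = 1 := by simp [upperMinor]

theorem lowerMinor_one : lowerMinor 1 = 1 := by simp [lowerMinor]

theorem numComponents_orbit_eq_two_of_four {H M S Z : Mat} {b : GL (Fin 4) ℝ} (hb : IsFrame H b)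
    (hM : Mᵀ * H = H * M) (hS : S ∈ realizing H M) (h : orthCentralizer H M = {1, -1, Z, -Z})
    (h1 : upperMinor (conjEquiv b Z) < 0) (h2 : lowerMinor (conjEquiv b Z) < 0) :
    numComponents (orbit S) = 2 := by
  have h3 : conjEquiv b 1 = 1 := by simp [conjEquiv_apply]
  refine numComponents_orbit_eq_two_of_mul hb hM hS (fun A hA => ?_) (Z := Z) (by simp [h]) h1
  rw [h] at hA
  rcases hA with rfl | rfl | rfl | rfl <;>
    try simp only [map_neg, upperMinor_neg, lowerMinor_neg]
  · norm_num [h3, upperMinor_one, lowerMinor_one]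
  · norm_num [h3, upperMinor_one, lowerMinor_one]
  · exact mul_pos_of_neg_of_neg h1 h2
  · exact mul_pos_of_neg_of_neg h1 h2

theorem formI_symm (e l : ℝ) : (formI e l)ᵀ * hyp = hyp * formI e l := by
  rw [formI, hyp_symm_lit_iff]
  simp

theorem computation_formI {e : ℝ} (he : e = 1 ∨ e = -1) : Computation 0 6 1 4 hyp
    (fun y : Fin 1 → ℝ => formI e (y 0)) {y | True} (fun _ => ![0]) Set.univ {1, -1} := by
  refine computation_point hyp_mul_hyp isFrame_wittFrame (fun y => formI_symm e (y 0)) (fun y => ?_)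
    (orthCentralizer_formI he _) (finrank_adMap_formI he _) fun S hS =>
      numComponents_orbit_eq_four isFrame_wittFrame (formI_symm _ _) hS (orthCentralizer_formI he _)
  rw [formI, trace_lit]
  constructor
  · rintro ⟨-, h⟩
    ext i
    fin_cases i
    simp
    linarith
  · rintro rfl
    simp

theorem formII_symm (a b : ℝ) : (formII a b)ᵀ * hyp = hyp * formII a b := by
  rw [formII, hyp_symm_lit_iff]
  simp

theorem computation_formII : Computation 1 6 2 4 hyp
    (fun y : Fin 2 → ℝ => formII (y 0) (y 1)) {y | y 1 ≠ 0} (fun x => ![0, x 0]) {x | x 0 ≠ 0}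
    {1, -1} := by
  refine computation_line hyp_mul_hyp isFrame_wittFrame (fun y => formII_symm _ _) (fun y => ?_)
    (fun x hx => orthCentralizer_formII hx _) (fun x hx => finrank_adMap_formII hx _)
    (fun x hx S hS => numComponents_orbit_eq_four isFrame_wittFrame (formII_symm _ _) hS
      (orthCentralizer_formII hx _)) (i := 1) one_ne_zero (fun x => by simp) one_ne_zero
    (fun x => ?_)
  · rw [formII, trace_lit]
    constructor
    · rintro ⟨h1, h2⟩
      refine ⟨![y 1], h1, ?_⟩
      ext i
      fin_cases i
      · simp
        linarith
      · simp
    · rintro ⟨x, hx, rfl⟩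
      exact ⟨hx, by simp⟩
  · rw [formII, det_lit]
    simp
    ring

theorem formIIIa_symm (l m : ℝ) : (formIIIa l m)ᵀ * eta = eta * formIIIa l m := by
  rw [formIIIa, eta_symm_lit_iff]
  simp

/-- The Jordan block of size three occupies an `ℝ^{1,2}`, which contains both negative directions. A
sign on the block therefore reverses two negative directions at once and keeps the lower minor
positive. In type IIIb the same happens to the positive directions and the upper minor. -/
theorem numComponents_orbit_formIIIa {l m : ℝ} {S : Mat}
    (hS : S ∈ realizing eta (formIIIa l m)) : numComponents (orbit S) = 2 := by
  refine numComponents_orbit_eq_two_of_lower (formIIIa_symm l m) hS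
    (Z1_mem_orthCentralizer_formIIIa l m) fun A hA => ?_
  by_cases hlm : l = m
  · subst hlm
    obtain ⟨B, hB, h, hA | hA⟩ := eq_mul_T1_of_mem_orthCentralizer hA <;> rw [hA] <;>
      try rw [lowerMinor_neg]
    all_goals rcases hB with rfl | rfl
    all_goals
      first
      | rw [neg_one_mul, lowerMinor_neg, T1, lowerMinor_lit]
      | rw [Z1_eq_lit, T1, lit_mul, lowerMinor_lit]
      nlinarith [sq_nonneg h]
  · rw [orthCentralizer_formIIIa hlm] at hA
    rcases hA with rfl | rfl | rfl | rfl <;>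
      simp [lowerMinor_neg, lowerMinor_one, Z1_eq_lit, lowerMinor_lit]

theorem computation_formIIIa : Computation 1 6 2 2 eta
    (fun y : Fin 2 → ℝ => formIIIa (y 0) (y 1)) {y | y 0 ≠ y 1} (fun x => ![-3 * x 0, x 0])
    {x | x 0 ≠ 0} {1, -1, Z1, -Z1} := by
  have hne : ∀ x : Fin 1 → ℝ, x 0 ≠ 0 → -3 * x 0 ≠ x 0 := fun x hx h => hx (by linarith)
  refine computation_line eta_mul_eta isFrame_one (fun y => formIIIa_symm _ _) (fun y => ?_)
    (fun x hx => orthCentralizer_formIIIa (hne x hx)) (fun x hx => finrank_adMap_formIIIa (hne x hx))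
    (fun x hx S hS => numComponents_orbit_formIIIa hS) (i := 1) one_ne_zero (fun x => by simp)
    (c' := -3) (by norm_num) (fun x => ?_)
  · rw [formIIIa, trace_lit]
    constructor
    · rintro ⟨h1, h2⟩
      refine ⟨![y 1], fun h => h1 ?_, ?_⟩
      · simp at h
        linarith
      · ext i
        fin_cases i
        · simp
          linarith
        · simp
    · rintro ⟨x, hx, rfl⟩
      exact ⟨hne x hx, by simp; ring⟩
  · rw [formIIIa, det_lit]
    simp
    ring

theorem computation_formIIIa_self : Computation 0 5 1 2 eta
    (fun y : Fin 2 → ℝ => formIIIa (y 0) (y 1)) {y | y 0 = y 1} (fun _ => ![0, 0]) Set.univ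
    (generated ({-1, Z1} ∪ Set.range T1)) := by
  refine computation_point eta_mul_eta isFrame_one (fun y => formIIIa_symm _ _) (fun y => ?_)
    (orthCentralizer_formIIIa_eq_generated _) (finrank_adMap_formIIIa_self _)
    fun S hS => numComponents_orbit_formIIIa hS
  rw [formIIIa, trace_lit]
  constructor
  · rintro ⟨h1 : y 0 = y 1, h2⟩
    ext i
    fin_cases i <;> simp <;> linarith
  · rintro rfl
    simp

theorem formIIIb_symm (l m : ℝ) : (formIIIb l m)ᵀ * eta = eta * formIIIb l m := by
  rw [formIIIb, eta_symm_lit_iff]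
  simp

theorem numComponents_orbit_formIIIb {l m : ℝ} {S : Mat}
    (hS : S ∈ realizing eta (formIIIb l m)) : numComponents (orbit S) = 2 := by
  refine numComponents_orbit_eq_two_of_upper (formIIIb_symm l m) hS
    (Z2_mem_orthCentralizer_formIIIb l m) fun A hA => ?_
  by_cases hlm : l = m
  · subst hlm
    obtain ⟨B, hB, h, hA | hA⟩ := eq_mul_T2_of_mem_orthCentralizer hA <;> rw [hA] <;>
      try rw [upperMinor_neg]
    all_goals rcases hB with rfl | rfl
    all_goals
      first
      | rw [neg_one_mul, upperMinor_neg, T2, upperMinor_lit]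
      | rw [Z2_eq_lit, T2, lit_mul, upperMinor_lit]
      nlinarith [sq_nonneg h]
  · rw [orthCentralizer_formIIIb hlm] at hA
    rcases hA with rfl | rfl | rfl | rfl <;>
      simp [upperMinor_neg, upperMinor_one, Z2_eq_lit, upperMinor_lit]

theorem computation_formIIIb : Computation 1 6 2 2 eta
    (fun y : Fin 2 → ℝ => formIIIb (y 0) (y 1)) {y | y 0 ≠ y 1} (fun x => ![x 0, -3 * x 0])
    {x | x 0 ≠ 0} {1, -1, Z2, -Z2} := by
  have hne : ∀ x : Fin 1 → ℝ, x 0 ≠ 0 → x 0 ≠ -3 * x 0 := fun x hx h => hx (by linarith)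
  refine computation_line eta_mul_eta isFrame_one (fun y => formIIIb_symm _ _) (fun y => ?_)
    (fun x hx => orthCentralizer_formIIIb (hne x hx)) (fun x hx => finrank_adMap_formIIIb (hne x hx))
    (fun x hx S hS => numComponents_orbit_formIIIb hS) (i := 0) one_ne_zero (fun x => by simp)
    (c' := -3) (by norm_num) (fun x => ?_)
  · rw [formIIIb, trace_lit]
    constructor
    · rintro ⟨h1, h2⟩
      refine ⟨![y 0], fun h => h1 ?_, ?_⟩
      · simp at h
        linarith
      · ext i
        fin_cases i
        · simp
        · simp
          linarith
    · rintro ⟨x, hx, rfl⟩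
      exact ⟨hne x hx, by simp; ring⟩
  · rw [formIIIb, det_lit]
    simp
    ring

theorem computation_formIIIb_self : Computation 0 5 1 2 eta
    (fun y : Fin 2 → ℝ => formIIIb (y 0) (y 1)) {y | y 0 = y 1} (fun _ => ![0, 0]) Set.univ
    (generated ({-1, Z2} ∪ Set.range T2)) := by
  refine computation_point eta_mul_eta isFrame_one (fun y => formIIIb_symm _ _) (fun y => ?_)
    (orthCentralizer_formIIIb_eq_generated _) (finrank_adMap_formIIIb_self _)
    fun S hS => numComponents_orbit_formIIIb hS
  rw [formIIIb, trace_lit]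
  constructor
  · rintro ⟨h1 : y 0 = y 1, h2⟩
    ext i
    fin_cases i <;> simp <;> linarith
  · rintro rfl
    simp

theorem formVI_symm (e l a b : ℝ) : (formVI e l a b)ᵀ * eta = eta * formVI e l a b := by
  rw [formVI, eta_symm_lit_iff]
  simp

theorem aeval_charpoly_formVI {A : Type*} [CommRing A] [Algebra ℝ A] (e l a b : ℝ) (z : A) :
    Polynomial.aeval z (formVI e l a b).charpoly =
      (z - algebraMap ℝ A l) ^ 2 * ((z - algebraMap ℝ A a) ^ 2 + algebraMap ℝ A b ^ 2) := by
  rw [formVI, aeval_charpoly_lit]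
  simp only [map_zero, map_add, map_sub, map_neg]
  ring

theorem eq_of_double_root {l b l' b' : ℝ} (hb : 0 < b * b')
    (h : ∀ t : ℝ, (t - l) ^ 2 * ((t + l) ^ 2 + b ^ 2) = (t - l') ^ 2 * ((t + l') ^ 2 + b' ^ 2)) :
    l' = l ∧ b' = b := by
  have hb' : b' ≠ 0 := fun h0 => by simp [h0] at hb
  -- `l` is a root on the left; on the right the only real root is `l'` because `b' ≠ 0`.
  have h1 := h l
  have h2 : (l - l') ^ 2 * ((l + l') ^ 2 + b' ^ 2) = 0 := by linear_combination -h1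
  have h3 : l' = l := by
    rcases mul_eq_zero.1 h2 with h3 | h3
    · linarith [pow_eq_zero_iff (two_ne_zero) |>.1 h3]
    · have := sq_pos_of_ne_zero hb'
      nlinarith [sq_nonneg (l + l')]
  subst h3
  -- With the double roots equal, any other point compares the quadratic factors; at `l' + 1` the
  -- factor in front is `1`.
  have h4 := h (l' + 1)
  have h5 : (b - b') * (b + b') = 0 := by linear_combination h4
  refine ⟨rfl, ?_⟩
  rcases mul_eq_zero.1 h5 with h6 | h6
  · linarith
  · nlinarith [sq_nonneg b]

theorem aeval_real_of_charpoly_eq {M M' : Mat} (h : M.charpoly = M'.charpoly) (t : ℝ) :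
    Polynomial.aeval t M.charpoly = Polynomial.aeval t M'.charpoly := by rw [h]

theorem computation_formVI {e : ℝ} (he : e = 1 ∨ e = -1) : Computation 2 6 2 2 eta
    (fun y : Fin 3 → ℝ => formVI e (y 0) (y 1) (y 2)) {y | y 2 ≠ 0} (fun x => ![x 0, -x 0, x 1])
    {x | x 1 ≠ 0} {1, -1, Z3, -Z3} := by
  have h := components_of_signs (D := {x : Fin 2 → ℝ | x 1 ≠ 0}) (r := 1)
    (fun _ => LinearMap.proj 1) (fun y => ⟨fun _ => y 0, fun j => by simp [Subsingleton.elim j 0]⟩)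
    (fun x => by simp)
  refine computation_of eta_mul_eta isFrame_one (fun y => formVI_symm _ _ _ _) (fun y => ?_)
    (fun x _ x' _ hxx => ?_) (isOpen_ne_fun (continuous_apply 1) continuous_const)
    (fun x hx => orthCentralizer_formVI he hx _ _) (fun x hx => finrank_adMap_formVI he hx _ _)
    (fun x hx S hS => ?_) h.1 fun x hx x' hx' hch => ?_
  · rw [formVI, trace_lit]
    constructor
    · rintro ⟨h1, h2⟩
      refine ⟨![y 0, y 2], h1, ?_⟩
      ext i
      fin_cases i
      · simp
      · simp
        linarith
      · simp
    · rintro ⟨x, hx, rfl⟩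
      refine ⟨hx, ?_⟩
      simp
      ring
  · have h0 : x 0 = x' 0 := congrFun hxx 0
    have h1 : x 1 = x' 1 := congrFun hxx 2
    ext i
    fin_cases i <;> assumption
  · refine numComponents_orbit_eq_two_of_four isFrame_one (formVI_symm _ _ _ _) hS
      (orthCentralizer_formVI he hx _ _) ?_ ?_ <;>
    norm_num [conjEquiv_one, Z3_eq_lit, upperMinor_lit, lowerMinor_lit]
  · have h1 : 0 < x 1 * x' 1 := h.2 x hx x' hx' 0
    have h2 := eq_of_double_root (l := x 0) (l' := x' 0) h1 fun t => by
      have := aeval_real_of_charpoly_eq hch t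
      rw [aeval_charpoly_formVI, aeval_charpoly_formVI] at this
      simpa using this
    ext i
    fin_cases i
    exacts [h2.1, h2.2]

theorem formVII_symm (e w l m : ℝ) : (formVII e w l m)ᵀ * hyp = hyp * formVII e w l m := by
  rw [formVII, hyp_symm_lit_iff]
  simp

theorem upperMinor_conjEquiv_Z4 : upperMinor (conjEquiv wittFrame Z4) < 0 := by
  rw [Z4_eq_lit, upperMinor_conjEquiv_wittFrame]
  norm_num

theorem lowerMinor_conjEquiv_Z4 : lowerMinor (conjEquiv wittFrame Z4) < 0 := by
  rw [Z4_eq_lit, lowerMinor_conjEquiv_wittFrame]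
  norm_num

theorem computation_formVII {e w : ℝ} (he : e = 1 ∨ e = -1) (hw : w = 1 ∨ w = -1) :
    Computation 1 6 2 2 hyp (fun y : Fin 2 → ℝ => formVII e w (y 0) (y 1)) {y | y 0 ≠ y 1}
      (fun x => ![x 0, -x 0]) {x | x 0 ≠ 0} {1, -1, Z4, -Z4} := by
  have hne : ∀ x : Fin 1 → ℝ, x 0 ≠ 0 → x 0 ≠ -x 0 := fun x hx h => hx (by linarith)
  refine computation_line hyp_mul_hyp isFrame_wittFrame (fun y => formVII_symm _ _ _ _)
    (fun y => ?_) (fun x hx => orthCentralizer_formVII he hw (hne x hx))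
    (fun x hx => finrank_adMap_formVII he hw (hne x hx))
    (fun x hx S hS => numComponents_orbit_eq_two_of_four isFrame_wittFrame (formVII_symm _ _ _ _) hS
      (orthCentralizer_formVII he hw (hne x hx)) upperMinor_conjEquiv_Z4 lowerMinor_conjEquiv_Z4)
    (i := 0) one_ne_zero (fun x => by simp) one_ne_zero (fun x => ?_)
  · rw [formVII, trace_lit]
    constructor
    · rintro ⟨h1, h2⟩
      refine ⟨![y 0], fun h => h1 ?_, ?_⟩
      · simp at h
        linarith
      · ext i
        fin_cases i
        · simp
        · simp
          linarith
    · rintro ⟨x, hx, rfl⟩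
      exact ⟨hne x hx, by simp⟩
  · rw [formVII, det_lit]
    simp
    ring

theorem Z4_mem_orthCentralizer_formVII (e w l m : ℝ) :
    Z4 ∈ orthCentralizer hyp (formVII e w l m) := by
  simp only [orthCentralizer, Set.mem_ofPred_eq, lit_orth_hyp_iff, formVII, lit_mul, lit_inj,
    Z4_eq_lit]
  norm_num

theorem numComponents_orbit_formVII_O2 {e : ℝ} (he : e = 1 ∨ e = -1) {l : ℝ} {S : Mat}
    (hS : S ∈ realizing hyp (formVII e e l l)) : numComponents (orbit S) = 2 := by
  refine numComponents_orbit_eq_two_of_mul isFrame_wittFrame (formVII_symm _ _ _ _) hS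
    (fun A hA => ?_) (Z4_mem_orthCentralizer_formVII _ _ _ _) upperMinor_conjEquiv_Z4
  rw [orthCentralizer_formVII_eq_isoVII_O2 he] at hA
  obtain ⟨B, hB, t, rfl⟩ := hA
  rw [inv_transpose_of_mem_O2 hB, blocks_isoVII, upperMinor_conjEquiv_wittFrame,
    lowerMinor_conjEquiv_wittFrame]
  rw [mem_O2_iff] at hB
  generalize B 0 0 = α, B 0 1 = γ, B 1 0 = β, B 1 1 = δ at *
  obtain ⟨h1, h2, h3⟩ := hB
  have h4 : (α * δ - γ * β) ^ 2 = 1 := by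
    linear_combination (γ ^ 2 + δ ^ 2) * h1 + h3 - (α * γ + β * δ) * h2
  have h5 : 0 < (1 + t ^ 2) ^ 2 := by positivity
  -- Both minors equal `(1 + t²)` times the determinant of the `O(2)` block, so their signs agree.
  calc 0 < (1 + t ^ 2) ^ 2 := h5
    _ = (α * δ - γ * β) ^ 2 * (1 + t ^ 2) ^ 2 := by rw [h4, one_mul]
    _ = _ := by ring

theorem numComponents_orbit_formVII_O11 {e : ℝ} (he : e = 1 ∨ e = -1) {l : ℝ} {S : Mat}
    (hS : S ∈ realizing hyp (formVII e (-e) l l)) : numComponents (orbit S) = 2 := by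
  refine numComponents_orbit_eq_two_of_mul isFrame_wittFrame (formVII_symm _ _ _ _) hS
    (fun A hA => ?_) (Z4_mem_orthCentralizer_formVII _ _ _ _) upperMinor_conjEquiv_Z4
  rw [orthCentralizer_formVII_eq_isoVII_O11 he] at hA
  obtain ⟨B, hB, t, rfl⟩ := hA
  rw [inv_transpose_of_mem_O11 hB, blocks_isoVII, upperMinor_conjEquiv_wittFrame,
    lowerMinor_conjEquiv_wittFrame]
  rw [mem_O11_iff] at hB
  simp only [Matrix.of_apply, Matrix.cons_val', Matrix.cons_val_zero, Matrix.cons_val_one,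
    Matrix.cons_val_fin_one]
  generalize B 0 0 = α, B 0 1 = γ, B 1 0 = β, B 1 1 = δ at *
  obtain ⟨h1, h2, h3⟩ := hB
  obtain ⟨h4, h5, -⟩ := O11_rows h1 h2 h3
  have h6 : δ ^ 2 = α ^ 2 := by linarith
  -- For an `O(1,1)` block of determinant `σ = ±1` one has `α δ = σ α²`, so the left side is the
  -- square of `σ (α² + t²)`. The product of the minors differs from it by `t² (α β - γ δ)²`, which
  -- is zero.
  have h7 : (α * δ + t ^ 2 * (α * δ - γ * β)) ^ 2 = (α ^ 2 + t ^ 2) ^ 2 := by grind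
  have h8 : 0 < (α ^ 2 + t ^ 2) ^ 2 := by
    have : 0 < α ^ 2 := by nlinarith [sq_nonneg β]
    positivity
  calc 0 < (α * δ + t ^ 2 * (α * δ - γ * β)) ^ 2 := h7 ▸ h8
    _ = (α * δ + t ^ 2 * (α * δ - γ * β)) ^ 2 - t ^ 2 * (α * β - γ * δ) ^ 2 := by rw [h5]; ring
    _ = _ := by ring

theorem computation_formVII_eq {e : ℝ} (he : e = 1 ∨ e = -1) : Computation 0 4 1 2 hyp
    (fun y : Fin 2 → ℝ => formVII e e (y 0) (y 1)) {y | y 0 = y 1} (fun _ => ![0, 0]) Set.univ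
    (isoVII O2) := by
  refine computation_point hyp_mul_hyp isFrame_wittFrame (fun y => formVII_symm _ _ _ _)
    (fun y => ?_) (orthCentralizer_formVII_eq_isoVII_O2 he _) (finrank_adMap_formVII_eq he _)
    fun S hS => numComponents_orbit_formVII_O2 he hS
  rw [formVII, trace_lit]
  constructor
  · rintro ⟨h1 : y 0 = y 1, h2⟩
    ext i
    fin_cases i <;> simp <;> linarith
  · rintro rfl
    simp

theorem computation_formVII_neg {e : ℝ} (he : e = 1 ∨ e = -1) : Computation 0 4 1 2 hyp
    (fun y : Fin 2 → ℝ => formVII e (-e) (y 0) (y 1)) {y | y 0 = y 1} (fun _ => ![0, 0]) Set.univ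
    (isoVII O11) := by
  refine computation_point hyp_mul_hyp isFrame_wittFrame (fun y => formVII_symm _ _ _ _)
    (fun y => ?_) (orthCentralizer_formVII_eq_isoVII_O11 he _) (finrank_adMap_formVII_neg he _)
    fun S hS => numComponents_orbit_formVII_O11 he hS
  rw [formVII, trace_lit]
  constructor
  · rintro ⟨h1 : y 0 = y 1, h2⟩
    ext i
    fin_cases i <;> simp <;> linarith
  · rintro rfl
    simp

theorem formVIII_symm (a b c d : ℝ) : (formVIII a b c d)ᵀ * eta = eta * formVIII a b c d := by
  rw [formVIII, eta_symm_lit_iff]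
  simp

theorem aeval_charpoly_formVIII {A : Type*} [CommRing A] [Algebra ℝ A] (a b c d : ℝ) (z : A) :
    Polynomial.aeval z (formVIII a b c d).charpoly =
      ((z - algebraMap ℝ A a) ^ 2 + algebraMap ℝ A b ^ 2) *
        ((z - algebraMap ℝ A c) ^ 2 + algebraMap ℝ A d ^ 2) := by
  rw [formVIII, aeval_charpoly_lit]
  simp only [map_zero, map_neg]
  ring

theorem numComponents_orbit_formVIII {a b c d : ℝ} (hb : b ≠ 0) (hd : d ≠ 0)
    (h : a ≠ c ∨ (b ≠ d ∧ b ≠ -d)) {S : Mat} (hS : S ∈ realizing eta (formVIII a b c d)) :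
    numComponents (orbit S) = 2 := by
  refine numComponents_orbit_eq_two_of_four isFrame_one (formVIII_symm _ _ _ _) hS
    (orthCentralizer_formVIII hb hd h) ?_ ?_ <;>
  norm_num [conjEquiv_one, Z4_eq_lit, upperMinor_lit, lowerMinor_lit]

theorem eq_of_complex_root {a b a' b' : ℝ} (hb : b ≠ 0)
    (h : ((a : ℂ) + b * Complex.I - a') ^ 2 + (b' : ℂ) ^ 2 = 0) : a = a' ∧ b ^ 2 = b' ^ 2 := by
  have h1 := congrArg Complex.re h
  have h2 := congrArg Complex.im h
  simp [sq] at h1 h2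
  have h3 : (a - a') * b = 0 := by linarith
  have h4 : a - a' = 0 := (mul_eq_zero.1 h3).resolve_right hb
  rw [h4] at h1
  exact ⟨by linarith, by linarith⟩

theorem eq_of_sq_eq_of_mul_pos {b b' : ℝ} (h : 0 < b * b') (hsq : b ^ 2 = b' ^ 2) : b' = b := by
  rcases sq_eq_sq_iff_eq_or_eq_neg.1 hsq with h1 | h1
  · exact h1.symm
  · rw [h1] at h
    nlinarith [sq_nonneg b']

theorem computation_formVIII : Computation 3 6 8 2 eta
    (fun y : Fin 4 → ℝ => formVIII (y 0) (y 1) (y 2) (y 3))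
    {y | y 1 ≠ 0 ∧ y 3 ≠ 0 ∧ y 0 ≠ y 2} (fun x => ![x 0, x 1, -x 0, x 2])
    {x | x 0 ≠ 0 ∧ x 1 ≠ 0 ∧ x 2 ≠ 0} {1, -1, Z4, -Z4} := by
  have h := components_of_signs (D := {x : Fin 3 → ℝ | x 0 ≠ 0 ∧ x 1 ≠ 0 ∧ x 2 ≠ 0}) (r := 3)
    (fun j => LinearMap.proj j) (fun y => ⟨y, fun j => rfl⟩)
    (fun x => by simp [Fin.forall_fin_succ])
  have hne : ∀ x : Fin 3 → ℝ, x 0 ≠ 0 → x 0 ≠ -x 0 := fun x hx h => hx (by linarith)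
  refine computation_of eta_mul_eta isFrame_one (fun y => formVIII_symm _ _ _ _) (fun y => ?_)
    (fun x _ x' _ hxx => ?_) ?_
    (fun x hx => orthCentralizer_formVIII hx.2.1 hx.2.2 (Or.inl (hne x hx.1)))
    (fun x hx => finrank_adMap_formVIII hx.2.1 hx.2.2 (Or.inl (hne x hx.1)))
    (fun x hx S hS => numComponents_orbit_formVIII hx.2.1 hx.2.2 (Or.inl (hne x hx.1)) hS) h.1
    fun x hx x' hx' hch => ?_
  · rw [formVIII, trace_lit]
    constructor
    · rintro ⟨⟨h1, h2, h3⟩, h4⟩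
      refine ⟨![y 0, y 1, y 3], ⟨fun h => h3 ?_, h1, h2⟩, ?_⟩
      · simp at h
        linarith
      · ext i
        fin_cases i
        · simp
        · simp
        · simp
          linarith
        · simp
    · rintro ⟨x, ⟨h1, h2, h3⟩, rfl⟩
      exact ⟨⟨h2, h3, hne x h1⟩, by simp⟩
  · have h0 : x 0 = x' 0 := congrFun hxx 0
    have h1 : x 1 = x' 1 := congrFun hxx 1
    have h2 : x 2 = x' 2 := congrFun hxx 3
    ext i
    fin_cases i <;> assumption
  · exact (isOpen_ne_fun (continuous_apply 0) continuous_const).inter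
      ((isOpen_ne_fun (continuous_apply 1) continuous_const).inter
        (isOpen_ne_fun (continuous_apply 2) continuous_const))
  · have h0 : 0 < x 0 * x' 0 := h.2 x hx x' hx' 0
    have h1 : 0 < x 1 * x' 1 := h.2 x hx x' hx' 1
    have h2 : 0 < x 2 * x' 2 := h.2 x hx x' hx' 2
    have h3 : ∀ z : ℂ, ((z - x 0) ^ 2 + (x 1 : ℂ) ^ 2) * ((z + x 0) ^ 2 + (x 2 : ℂ) ^ 2) =
        ((z - x' 0) ^ 2 + (x' 1 : ℂ) ^ 2) * ((z + x' 0) ^ 2 + (x' 2 : ℂ) ^ 2) := by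
      intro z
      have h4 : Polynomial.aeval z (formVIII (x 0) (x 1) (-x 0) (x 2)).charpoly =
        Polynomial.aeval z (formVIII (x' 0) (x' 1) (-x' 0) (x' 2)).charpoly := congrArg _ hch
      rw [aeval_charpoly_formVIII, aeval_charpoly_formVIII] at h4
      simpa using h4
    -- The polynomials are compared at a root of each quadratic factor on the left. Since `x 0` and
    -- `x' 0` have the same sign, a root with real part `x 0` cannot belong to the factor with real
    -- part `-x' 0`, so the factors are matched; the imaginary parts then agree up to sign.
    have h4 := h3 (x 0 + x 1 * Complex.I)
    have h5 := h3 (-x 0 + x 2 * Complex.I)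
    have h6 : ((x 0 : ℂ) + x 1 * Complex.I - x 0) ^ 2 + (x 1 : ℂ) ^ 2 = 0 := by
      linear_combination (x 1 : ℂ) ^ 2 * Complex.I_sq
    have h7 : (-(x 0 : ℂ) + x 2 * Complex.I + x 0) ^ 2 + (x 2 : ℂ) ^ 2 = 0 := by
      linear_combination (x 2 : ℂ) ^ 2 * Complex.I_sq
    rw [h6, zero_mul, eq_comm, mul_eq_zero] at h4
    rw [h7, mul_zero, eq_comm, mul_eq_zero] at h5
    have h8 : x 0 = x' 0 ∧ x 1 ^ 2 = x' 1 ^ 2 := by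
      rcases h4 with h4 | h4
      · exact eq_of_complex_root hx.2.1 h4
      · have := eq_of_complex_root (a' := -x' 0) hx.2.1 (by push_cast; rwa [sub_neg_eq_add])
        exfalso
        rw [this.1] at h0
        nlinarith [sq_nonneg (x' 0)]
    have h9 : x 2 ^ 2 = x' 2 ^ 2 := by
      rcases h5 with h5 | h5
      · have := eq_of_complex_root (a := -x 0) (a' := x' 0) hx.2.2 (by push_cast; exact h5)
        exfalso
        rw [← this.1] at h0
        nlinarith [sq_nonneg (x 0)]
      · exact (eq_of_complex_root (a := -x 0) (a' := -x' 0) hx.2.2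
          (by push_cast; rwa [sub_neg_eq_add])).2
    ext i
    fin_cases i
    exacts [h8.1.symm, eq_of_sq_eq_of_mul_pos h1 h8.2, eq_of_sq_eq_of_mul_pos h2 h9]

/-- The four lines cut the plane into eight sectors. The four linear forms are dependent, so not all
sign patterns occur; the sectors are indexed instead by the signs of `x 0`, `x 1` and `|x 0| - |x
1|`. Once the first two are fixed, the third form is linear. -/
theorem components_formVIII :
    numComponents {x : Fin 2 → ℝ | x 0 ≠ 0 ∧ x 1 ≠ 0 ∧ x 0 ≠ x 1 ∧ x 0 ≠ -x 1} = 8 ∧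
    ∀ x ∈ {x : Fin 2 → ℝ | x 0 ≠ 0 ∧ x 1 ≠ 0 ∧ x 0 ≠ x 1 ∧ x 0 ≠ -x 1},
      ∀ x' ∈ connectedComponentIn {x : Fin 2 → ℝ | x 0 ≠ 0 ∧ x 1 ≠ 0 ∧ x 0 ≠ x 1 ∧ x 0 ≠ -x 1} x,
        0 < x 0 * x' 0 ∧ 0 < x 1 * x' 1 ∧
          0 < (x 0 ^ 2 - x 1 ^ 2) * (x' 0 ^ 2 - x' 1 ^ 2) := by
  let p : Fin 2 → (Fin 2 → ℝ) →ₗ[ℝ] ℝ := fun j => LinearMap.proj j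
  let U : ℤˣ × ℤˣ × ℤˣ → Set (Fin 2 → ℝ) := fun s =>
    {x | 0 < (((s.1 : ℤ) : ℝ) • p 0) x} ∩ ({x | 0 < (((s.2.1 : ℤ) : ℝ) • p 1) x} ∩
      {x | 0 < (((s.2.2 : ℤ) : ℝ) • (((s.1 : ℤ) : ℝ) • p 0 - ((s.2.1 : ℤ) : ℝ) • p 1)) x})
  have hU : ∀ s x, x ∈ U s ↔ 0 < ((s.1 : ℤ) : ℝ) * x 0 ∧ 0 < ((s.2.1 : ℤ) : ℝ) * x 1 ∧
      0 < ((s.2.2 : ℤ) : ℝ) * (((s.1 : ℤ) : ℝ) * x 0 - ((s.2.1 : ℤ) : ℝ) * x 1) :=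
    fun s x => by simp [U, p]
  have hu : ∀ u : ℤˣ, ((u : ℤ) : ℝ) ^ 2 = 1 := by
    intro u
    rcases Int.units_eq_one_or u with rfl | rfl <;> norm_num
  have huniq : ∀ (u v : ℤˣ) (t : ℝ), 0 < ((u : ℤ) : ℝ) * t → 0 < ((v : ℤ) : ℝ) * t → u = v := by
    intro u v t h1 h2
    rcases Int.units_eq_one_or u with rfl | rfl <;> rcases Int.units_eq_one_or v with rfl | rfl <;>
      norm_num at h1 h2 ⊢ <;> linarith
  have hsign : ∀ t : ℝ, t ≠ 0 → 0 < ((unitSign t : ℤ) : ℝ) * t := by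
    intro t ht
    rcases ht.lt_or_gt with h | h
    · rw [unitSign_of_neg h]
      simpa using h
    · rw [unitSign_of_pos h]
      simpa using h
  have hmul : ∀ (u : ℤˣ) (t t' : ℝ), 0 < ((u : ℤ) : ℝ) * t → 0 < ((u : ℤ) : ℝ) * t' →
      0 < t * t' := by
    intro u t t' h1 h2
    have h3 := mul_pos h1 h2
    have h4 : ((u : ℤ) : ℝ) * t * (((u : ℤ) : ℝ) * t') = t * t' := by
      linear_combination (t * t') * hu u
    rwa [h4] at h3
  have hdiff : ∀ s x, x ∈ U s → 0 < ((s.2.2 : ℤ) : ℝ) * (x 0 ^ 2 - x 1 ^ 2) := by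
    intro s x hx
    obtain ⟨h1, h2, h3⟩ := (hU s x).1 hx
    have h4 := mul_pos h3 (add_pos h1 h2)
    have h5 : ((s.2.2 : ℤ) : ℝ) * (((s.1 : ℤ) : ℝ) * x 0 - ((s.2.1 : ℤ) : ℝ) * x 1) *
        (((s.1 : ℤ) : ℝ) * x 0 + ((s.2.1 : ℤ) : ℝ) * x 1) =
        ((s.2.2 : ℤ) : ℝ) * (x 0 ^ 2 - x 1 ^ 2) := by
      linear_combination ((s.2.2 : ℤ) : ℝ) * (x 0 ^ 2 * hu s.1 - x 1 ^ 2 * hu s.2.1)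
    rwa [h5] at h4
  have h := components_of_partition
    (D := {x : Fin 2 → ℝ | x 0 ≠ 0 ∧ x 1 ≠ 0 ∧ x 0 ≠ x 1 ∧ x 0 ≠ -x 1}) U
    (fun s => (isOpen_pos _).inter ((isOpen_pos _).inter (isOpen_pos _)))
    (fun s => ((convex_pos _).inter ((convex_pos _).inter (convex_pos _))).isPreconnected)
    (fun s => ?_) (fun s t x hs ht => ?_) (fun x => ?_)
  · refine ⟨by rw [h.1]; simp, fun x hx x' hx' => ?_⟩
    obtain ⟨s, h1, h2⟩ := h.2 x hx x' hx'
    have h3 := (hU s x).1 h1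
    have h4 := (hU s x').1 h2
    exact ⟨hmul _ _ _ h3.1 h4.1, hmul _ _ _ h3.2.1 h4.2.1,
      hmul _ _ _ (hdiff s x h1) (hdiff s x' h2)⟩
  · refine ⟨![((s.1 : ℤ) : ℝ) * (3 + ((s.2.2 : ℤ) : ℝ)), ((s.2.1 : ℤ) : ℝ) * 3], (hU _ _).2 ?_⟩
    have h1 := hu s.1
    have h2 := hu s.2.1
    simp only [Matrix.cons_val_zero, Matrix.cons_val_one, ← mul_assoc, ← sq, h1, h2, one_mul]
    rcases Int.units_eq_one_or s.2.2 with h3 | h3 <;> rw [h3] <;> norm_num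
  · obtain ⟨h1, h2, h3⟩ := (hU s x).1 hs
    obtain ⟨h4, h5, h6⟩ := (hU t x).1 ht
    have h7 := huniq _ _ _ h1 h4
    have h8 := huniq _ _ _ h2 h5
    rw [← h7, ← h8] at h6
    exact Prod.ext h7 (Prod.ext h8 (huniq _ _ _ h3 h6))
  · constructor
    · rintro ⟨h1, h2, h3, h4⟩
      refine ⟨⟨unitSign (x 0), unitSign (x 1), unitSign (((unitSign (x 0) : ℤ) : ℝ) * x 0 -
        ((unitSign (x 1) : ℤ) : ℝ) * x 1)⟩, (hU _ _).2 ⟨hsign _ h1, hsign _ h2, hsign _ ?_⟩⟩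
      intro h5
      rcases Int.units_eq_one_or (unitSign (x 0)) with h6 | h6 <;>
        rcases Int.units_eq_one_or (unitSign (x 1)) with h7 | h7 <;>
        rw [h6, h7] at h5 <;> norm_num at h5
      · exact h3 (by linarith)
      · exact h4 (by linarith)
      · exact h4 (by linarith)
      · exact h3 (by linarith)
    · rintro ⟨s, hs⟩
      obtain ⟨h1, h2, h3⟩ := (hU s x).1 hs
      have h4 := hdiff s x hs
      refine ⟨fun h => ?_, fun h => ?_, fun h => ?_, fun h => ?_⟩
      · simp [h] at h1
      · simp [h] at h2
      · simp [h] at h4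
      · simp [h] at h4

theorem computation_formVIII_eq_re : Computation 2 6 8 2 eta
    (fun y : Fin 4 → ℝ => formVIII (y 0) (y 1) (y 2) (y 3))
    {y | y 1 ≠ 0 ∧ y 3 ≠ 0 ∧ y 0 = y 2 ∧ y 1 ≠ y 3 ∧ y 1 ≠ -y 3} (fun x => ![0, x 0, 0, x 1])
    {x | x 0 ≠ 0 ∧ x 1 ≠ 0 ∧ x 0 ≠ x 1 ∧ x 0 ≠ -x 1} {1, -1, Z4, -Z4} := by
  refine computation_of eta_mul_eta isFrame_one (fun y => formVIII_symm _ _ _ _) (fun y => ?_)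
    (fun x _ x' _ hxx => ?_) ?_
    (fun x hx => orthCentralizer_formVIII hx.1 hx.2.1 (Or.inr hx.2.2))
    (fun x hx => finrank_adMap_formVIII hx.1 hx.2.1 (Or.inr hx.2.2))
    (fun x hx S hS => numComponents_orbit_formVIII hx.1 hx.2.1 (Or.inr hx.2.2) hS)
    components_formVIII.1 fun x hx x' hx' hch => ?_
  · rw [formVIII, trace_lit]
    constructor
    · rintro ⟨⟨h1, h2, h3, h4, h5⟩, h6⟩
      refine ⟨![y 1, y 3], ⟨h1, h2, h4, h5⟩, ?_⟩
      ext i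
      fin_cases i <;> simp <;> linarith
    · rintro ⟨x, ⟨h1, h2, h3, h4⟩, rfl⟩
      exact ⟨⟨h1, h2, rfl, h3, h4⟩, by simp⟩
  · have h0 : x 0 = x' 0 := congrFun hxx 1
    have h1 : x 1 = x' 1 := congrFun hxx 3
    ext i
    fin_cases i <;> assumption
  · exact (isOpen_ne_fun (continuous_apply 0) continuous_const).inter
      ((isOpen_ne_fun (continuous_apply 1) continuous_const).inter
        ((isOpen_ne_fun (continuous_apply 0) (continuous_apply 1)).inter
          (isOpen_ne_fun (continuous_apply 0) (continuous_apply 1).neg)))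
  · obtain ⟨h0, h1, h2⟩ := components_formVIII.2 x hx x' hx'
    have h3 : ∀ t : ℝ, (t ^ 2 + x 0 ^ 2) * (t ^ 2 + x 1 ^ 2) =
        (t ^ 2 + x' 0 ^ 2) * (t ^ 2 + x' 1 ^ 2) := by
      intro t
      have := aeval_real_of_charpoly_eq hch t
      rw [aeval_charpoly_formVIII, aeval_charpoly_formVIII] at this
      simpa using this
    have h4 := h3 0
    have h5 := h3 1
    -- The values at `0` and `1` give the product and the sum of the squares, hence the unordered
    -- pair of squares. The sign of `x 0 ^ 2 - x 1 ^ 2`, constant on the component, excludes the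
    -- interchange.
    have h6 : (x 0 ^ 2 - x' 0 ^ 2) * (x 0 ^ 2 - x' 1 ^ 2) = 0 := by
      linear_combination x 0 ^ 2 * h5 - (1 + x 0 ^ 2) * h4
    have h7 : x 0 ^ 2 + x 1 ^ 2 = x' 0 ^ 2 + x' 1 ^ 2 := by linear_combination h5 - h4
    have h8 : x 0 ^ 2 = x' 0 ^ 2 := by
      rcases mul_eq_zero.1 h6 with h8 | h8
      · linarith
      · have h9 : x 0 ^ 2 - x 1 ^ 2 = -(x' 0 ^ 2 - x' 1 ^ 2) := by linarith
        rw [h9] at h2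
        nlinarith [sq_nonneg (x' 0 ^ 2 - x' 1 ^ 2)]
    have h9 : x 1 ^ 2 = x' 1 ^ 2 := by linarith
    ext i
    fin_cases i
    exacts [eq_of_sq_eq_of_mul_pos h0 h8, eq_of_sq_eq_of_mul_pos h1 h9]

theorem Z4_mem_orthCentralizer_formVIII (a b c d : ℝ) :
    Z4 ∈ orthCentralizer eta (formVIII a b c d) := by
  simp only [orthCentralizer, Set.mem_ofPred_eq, lit_orth_eta_iff, formVIII, lit_mul, lit_inj,
    Z4_eq_lit]
  norm_num

theorem numComponents_orbit_formVIII_self {a b : ℝ} (hb : b ≠ 0) {S : Mat}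
    (hS : S ∈ realizing eta (formVIII a b a b)) : numComponents (orbit S) = 2 := by
  refine numComponents_orbit_eq_two_of_mul isFrame_one (formVIII_symm _ _ _ _) hS (fun A hA => ?_)
    (Z4_mem_orthCentralizer_formVIII _ _ _ _)
    (by norm_num [conjEquiv_one, Z4_eq_lit, upperMinor_lit])
  rw [conjEquiv_one]
  have h1 := upperMinor_ne_zero hA.1
  rw [orthCentralizer_formVIII_eq_isoVIII hb] at hA
  obtain ⟨Q, -, rfl⟩ := hA
  -- Both diagonal blocks are the real part of `Q`, so the two minors coincide and their product is
  -- a nonzero square.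
  exact mul_self_pos.2 h1

theorem computation_formVIII_self : Computation 1 4 2 2 eta
    (fun y : Fin 4 → ℝ => formVIII (y 0) (y 1) (y 2) (y 3))
    {y | y 1 ≠ 0 ∧ y 3 ≠ 0 ∧ y 0 = y 2 ∧ y 1 = y 3} (fun x => ![0, x 0, 0, x 0])
    {x | x 0 ≠ 0} isoVIII := by
  refine computation_line eta_mul_eta isFrame_one (fun y => formVIII_symm _ _ _ _) (fun y => ?_)
    (fun x hx => orthCentralizer_formVIII_eq_isoVIII hx _)
    (fun x hx => finrank_adMap_formVIII_self hx _)
    (fun x hx S hS => numComponents_orbit_formVIII_self hx hS)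
    (i := 1) one_ne_zero (fun x => by simp) one_ne_zero (fun x => ?_)
  · rw [formVIII, trace_lit]
    constructor
    · rintro ⟨⟨h1, h2, h3, h4⟩, h5⟩
      refine ⟨![y 1], h1, ?_⟩
      ext i
      fin_cases i <;> simp <;> linarith
    · rintro ⟨x, hx, rfl⟩
      exact ⟨⟨hx, hx, rfl, rfl⟩, by simp⟩
  · rw [formVIII, det_lit]
    simp
    ring

/-! ### Types IV and V -/

/-- The `i`-th coordinate function. -/
abbrev coord {m : ℕ} (i : Fin m) : (Fin m → ℝ) →ₗ[ℝ] ℝ := LinearMap.proj i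

/-- The eigenvalues `-(u + v) / 2, u, v` that remain when the first one has multiplicity two. -/
def doubleEigenvalues : Fin 3 → (Fin 2 → ℝ) →ₗ[ℝ] ℝ :=
  ![-(1 / 2 : ℝ) • (coord 0 + coord 1), coord 0, coord 1]

theorem doubleEigenvalues_zero (x : Fin 2 → ℝ) : doubleEigenvalues 0 x = -(x 0 + x 1) / 2 := by
  simp [doubleEigenvalues]
  ring

theorem doubleEigenvalues_one (x : Fin 2 → ℝ) : doubleEigenvalues 1 x = x 0 := rfl

theorem doubleEigenvalues_two (x : Fin 2 → ℝ) : doubleEigenvalues 2 x = x 1 := rfl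

theorem exists_doubleEigenvalues_eq_iff (z : Fin 3 → ℝ) :
    (∃ x, ∀ i, doubleEigenvalues i x = z i) ↔ 2 * z 0 + z 1 + z 2 = 0 := by
  simp only [Fin.forall_fin_succ, IsEmpty.forall_iff, and_true, Fin.succ_zero_eq_one,
    Fin.succ_one_eq_two, doubleEigenvalues_zero, doubleEigenvalues_one, doubleEigenvalues_two]
  constructor
  · rintro ⟨x, h0, h1, h2⟩
    linarith
  · intro h
    exact ⟨![z 1, z 2], by simp; linarith, rfl, rfl⟩

theorem injective_fin_three_iff (z : Fin 3 → ℝ) :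
    Function.Injective z ↔ z 0 ≠ z 1 ∧ z 0 ≠ z 2 ∧ z 1 ≠ z 2 := by
  refine ⟨fun h => ⟨h.ne (by decide), h.ne (by decide), h.ne (by decide)⟩, fun ⟨h0, h1, h2⟩ => ?_⟩
  intro i j h
  fin_cases i <;> fin_cases j <;> simp_all

theorem injective_doubleEigenvalues_iff (x : Fin 2 → ℝ) :
    (Function.Injective fun i => doubleEigenvalues i x) ↔
      3 * x 0 + x 1 ≠ 0 ∧ x 0 + 3 * x 1 ≠ 0 ∧ x 0 ≠ x 1 := by
  simp only [injective_fin_three_iff, doubleEigenvalues_zero, doubleEigenvalues_one,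
    doubleEigenvalues_two]
  refine and_congr (not_congr ?_) (and_congr_left' (not_congr ?_)) <;>
  constructor <;> intro h <;> linarith

theorem isOpen_injective {m k : ℕ} (l : Fin k → (Fin m → ℝ) →ₗ[ℝ] ℝ) :
    IsOpen {x | Function.Injective fun i => l i x} := by
  have h : {x | Function.Injective fun i => l i x} =
      ⋂ i, ⋂ j, ⋂ _ : i ≠ j, {x | l i x ≠ l j x} := by
    ext x
    simp only [Set.mem_iInter, Set.mem_ofPred_eq, Function.Injective]
    exact forall_congr' fun i => forall_congr' fun j => ⟨fun h hij he => hij (h he),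
      fun h he => by_contra fun hij => h hij he⟩
  rw [h]
  exact isOpen_iInter_of_finite fun i => isOpen_iInter_of_finite fun j =>
    isOpen_iInter_of_finite fun _ => isOpen_ne_fun (l i).continuous_of_finiteDimensional
      (l j).continuous_of_finiteDimensional

/-- Only the set of roots is compared. The double eigenvalue stands first, as in
`doubleEigenvalues`; its multiplicity is not needed, because the ordering of a chamber already
identifies it. -/
theorem range_eq_of_charpoly_formIV {e l m n l' m' n' : ℝ}
    (h : (formIV e l m n).charpoly = (formIV e l' m' n').charpoly) :
    ({m, l, n} : Set ℝ) = {m', l', n'} := by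
  ext t
  have h1 := aeval_real_of_charpoly_eq h t
  rw [aeval_charpoly_formIV, aeval_charpoly_formIV] at h1
  have h2 : ∀ l m n : ℝ, t ∈ ({m, l, n} : Set ℝ) ↔ (t - l) * (t - m) ^ 2 * (t - n) = 0 := by
    intro l m n
    simp only [Set.mem_insert_iff, Set.mem_singleton_iff, mul_eq_zero, sub_eq_zero, ne_eq,
      OfNat.ofNat_ne_zero, not_false_eq_true, pow_eq_zero_iff]
    tauto
  rw [h2, h2]
  exact Eq.congr_left h1

theorem range_fin_three (z : Fin 3 → ℝ) : Set.range z = {z 0, z 1, z 2} := by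
  ext t
  simp [Fin.exists_fin_succ, eq_comm]

theorem formIV_symm (e l m n : ℝ) : (formIV e l m n)ᵀ * eta = eta * formIV e l m n := by
  rw [formIV, eta_symm_lit_iff]
  simp

theorem numComponents_orbit_formIV {e l m n : ℝ} {S : Mat}
    (hS : S ∈ realizing eta (formIV e l m n)) : numComponents (orbit S) = 1 :=
  numComponents_orbit_eq_one (formIV_symm e l m n) hS (Z1_mem_orthCentralizer_formIV ..)
    (Z2_mem_orthCentralizer_formIV ..)

theorem trace_formIV (e l m n : ℝ) : (formIV e l m n).trace = l + 2 * m + n := by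
  rw [formIV, trace_lit]
  ring

theorem det_formIV (e l m n : ℝ) : (formIV e l m n).det = l * m ^ 2 * n := by
  rw [formIV, det_lit]
  ring

theorem components_doubleEigenvalues :
    numComponents {x : Fin 2 → ℝ | Function.Injective fun i => doubleEigenvalues i x} = 6 ∧
      ∀ x ∈ {x : Fin 2 → ℝ | Function.Injective fun i => doubleEigenvalues i x},
        ∀ x' ∈ connectedComponentIn
          {x : Fin 2 → ℝ | Function.Injective fun i => doubleEigenvalues i x} x,
        (Set.range fun i => doubleEigenvalues i x) = (Set.range fun i => doubleEigenvalues i x') →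
          ∀ i, doubleEigenvalues i x = doubleEigenvalues i x' :=
  -- A common shift makes the weighted sum vanish; the weights `2, 1, 1` add up to `4`.
  components_of_orderings doubleEigenvalues (fun y => by
    obtain ⟨x, hx⟩ := (exists_doubleEigenvalues_eq_iff
      fun i => y i + -(2 * y 0 + y 1 + y 2) / 4).2 (by ring)
    exact ⟨x, _, hx⟩) fun _ => Iff.rfl

theorem computation_formIV {e : ℝ} (he : e = 1 ∨ e = -1) : Computation 2 6 6 1 eta
    (fun y : Fin 3 → ℝ => formIV e (y 0) (y 1) (y 2)) {y | y 0 ≠ y 1 ∧ y 1 ≠ y 2 ∧ y 0 ≠ y 2}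
    (fun x => ![x 0, -(x 0 + x 1) / 2, x 1])
    {x | x 0 + 3 * x 1 ≠ 0 ∧ 3 * x 0 + x 1 ≠ 0 ∧ x 0 ≠ x 1}
    {1, -1, Z1, -Z1, Z2, -Z2, Z3, -Z3} := by
  have hD : {x : Fin 2 → ℝ | x 0 + 3 * x 1 ≠ 0 ∧ 3 * x 0 + x 1 ≠ 0 ∧ x 0 ≠ x 1} =
      {x | Function.Injective fun i => doubleEigenvalues i x} := by
    ext x
    simp only [Set.mem_ofPred_eq, injective_doubleEigenvalues_iff]
    tauto
  have hne : ∀ x ∈ {x : Fin 2 → ℝ | Function.Injective fun i => doubleEigenvalues i x},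
      x 0 ≠ -(x 0 + x 1) / 2 ∧ -(x 0 + x 1) / 2 ≠ x 1 ∧ x 0 ≠ x 1 := by
    intro x hx
    simp only [Set.mem_ofPred_eq, injective_fin_three_iff, doubleEigenvalues_zero,
      doubleEigenvalues_one, doubleEigenvalues_two] at hx
    exact ⟨hx.1.symm, hx.2.1, hx.2.2⟩
  rw [hD]
  refine computation_of eta_mul_eta isFrame_one (fun y => formIV_symm _ _ _ _) (fun y => ?_)
    (fun x _ x' _ hxx => ?_) (isOpen_injective _)
    (fun x hx => orthCentralizer_formIV he (hne x hx).1 (hne x hx).2.1 (hne x hx).2.2)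
    (fun x hx => finrank_adMap_formIV he (hne x hx).1 (hne x hx).2.1 (hne x hx).2.2)
    (fun x hx S hS => numComponents_orbit_formIV hS) components_doubleEigenvalues.1
    fun x hx x' hx' hch => ?_
  · rw [trace_formIV]
    constructor
    · rintro ⟨⟨h1, h2, h3⟩, h4⟩
      have h5 : y 1 = -(y 0 + y 2) / 2 := by linarith
      refine ⟨![y 0, y 2], (injective_fin_three_iff _).2 ?_, ?_⟩
      · simp only [doubleEigenvalues_zero, doubleEigenvalues_one, doubleEigenvalues_two]
        show -(y 0 + y 2) / 2 ≠ y 0 ∧ -(y 0 + y 2) / 2 ≠ y 2 ∧ y 0 ≠ y 2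
        rw [← h5]
        exact ⟨h1.symm, h2, h3⟩
      · ext i
        fin_cases i <;> simp [h5]
    · rintro ⟨x, hx, rfl⟩
      refine ⟨hne x hx, ?_⟩
      simp
      ring
  · have h0 : x 0 = x' 0 := congrFun hxx 0
    have h1 : x 1 = x' 1 := congrFun hxx 2
    ext i
    fin_cases i <;> assumption
  · have h1 := components_doubleEigenvalues.2 x hx x' hx' (by
      rw [range_fin_three, range_fin_three]
      simp only [doubleEigenvalues_zero, doubleEigenvalues_one, doubleEigenvalues_two]
      exact range_eq_of_charpoly_formIV hch)
    ext i
    fin_cases i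
    exacts [(h1 1).symm, (h1 2).symm]

theorem computation_formIV_right {e : ℝ} (he : e = 1 ∨ e = -1) : Computation 1 5 2 1 eta
    (fun y : Fin 3 → ℝ => formIV e (y 0) (y 1) (y 2)) {y | y 1 = y 2 ∧ y 0 ≠ y 1}
    (fun x => ![-3 * x 0, x 0, x 0]) {x | x 0 ≠ 0}
    (generated ({-1, Z1, Z2, Z3} ∪ Set.range T3)) := by
  have hne : ∀ x : Fin 1 → ℝ, x 0 ≠ 0 → -3 * x 0 ≠ x 0 := fun x hx h => hx (by linarith)
  refine computation_line eta_mul_eta isFrame_one (fun y => formIV_symm _ _ _ _) (fun y => ?_)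
    (fun x hx => orthCentralizer_formIV_eq_generated_T3 he (hne x hx))
    (fun x hx => finrank_adMap_formIV_right he (hne x hx))
    (fun x hx S hS => numComponents_orbit_formIV hS)
    (i := 1) one_ne_zero (fun x => by simp) (c' := -3) (by norm_num) (fun x => ?_)
  · rw [trace_formIV]
    constructor
    · rintro ⟨⟨h1, h2⟩, h3⟩
      refine ⟨![y 1], fun h => h2 ?_, ?_⟩
      · simp at h
        linarith
      · ext i
        fin_cases i <;> simp <;> linarith
    · rintro ⟨x, hx, rfl⟩
      refine ⟨⟨rfl, hne x hx⟩, ?_⟩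
      simp
      ring
  · rw [det_formIV]
    simp
    ring

theorem computation_formIV_left {e : ℝ} (he : e = 1 ∨ e = -1) : Computation 1 5 2 1 eta
    (fun y : Fin 3 → ℝ => formIV e (y 0) (y 1) (y 2)) {y | y 0 = y 1 ∧ y 1 ≠ y 2}
    (fun x => ![x 0, x 0, -3 * x 0]) {x | x 0 ≠ 0}
    (generated ({-1, Z1, Z2, Z3} ∪ Set.range T4)) := by
  have hne : ∀ x : Fin 1 → ℝ, x 0 ≠ 0 → x 0 ≠ -3 * x 0 := fun x hx h => hx (by linarith)
  refine computation_line eta_mul_eta isFrame_one (fun y => formIV_symm _ _ _ _) (fun y => ?_)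
    (fun x hx => orthCentralizer_formIV_eq_generated_T4 he (hne x hx))
    (fun x hx => finrank_adMap_formIV_left he (hne x hx))
    (fun x hx S hS => numComponents_orbit_formIV hS)
    (i := 1) one_ne_zero (fun x => by simp) (c' := -3) (by norm_num) (fun x => ?_)
  · rw [trace_formIV]
    constructor
    · rintro ⟨⟨h1, h2⟩, h3⟩
      refine ⟨![y 1], fun h => h2 ?_, ?_⟩
      · simp at h
        linarith
      · ext i
        fin_cases i <;> simp <;> linarith
    · rintro ⟨x, hx, rfl⟩
      refine ⟨⟨rfl, hne x hx⟩, ?_⟩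
      simp
      ring
  · rw [det_formIV]
    simp
    ring

theorem computation_formIV_outer {e : ℝ} (he : e = 1 ∨ e = -1) : Computation 1 5 2 1 eta
    (fun y : Fin 3 → ℝ => formIV e (y 0) (y 1) (y 2)) {y | y 0 = y 2 ∧ y 0 ≠ y 1}
    (fun x => ![x 0, -x 0, x 0]) {x | x 0 ≠ 0} isoT5 := by
  have hne : ∀ x : Fin 1 → ℝ, x 0 ≠ 0 → x 0 ≠ -x 0 := fun x hx h => hx (by linarith)
  refine computation_line eta_mul_eta isFrame_one (fun y => formIV_symm _ _ _ _) (fun y => ?_)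
    (fun x hx => orthCentralizer_formIV_eq_isoT5 he (hne x hx))
    (fun x hx => finrank_adMap_formIV_outer he (hne x hx))
    (fun x hx S hS => numComponents_orbit_formIV hS)
    (i := 0) one_ne_zero (fun x => by simp) (c' := 1) one_ne_zero (fun x => ?_)
  · rw [trace_formIV]
    constructor
    · rintro ⟨⟨h1, h2⟩, h3⟩
      refine ⟨![y 0], fun h => h2 ?_, ?_⟩
      · simp at h
        linarith
      · ext i
        fin_cases i <;> simp <;> linarith
    · rintro ⟨x, hx, rfl⟩
      refine ⟨⟨rfl, hne x hx⟩, ?_⟩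
      simp
      ring
  · rw [det_formIV]
    simp
    ring

theorem computation_formIV_all {e : ℝ} (he : e = 1 ∨ e = -1) : Computation 0 3 1 1 eta
    (fun y : Fin 3 → ℝ => formIV e (y 0) (y 1) (y 2)) {y | y 0 = y 1 ∧ y 1 = y 2}
    (fun _ => ![0, 0, 0]) Set.univ isoT6 := by
  refine computation_point eta_mul_eta isFrame_one (fun y => formIV_symm _ _ _ _) (fun y => ?_)
    (orthCentralizer_formIV_eq_isoT6 he 0) (finrank_adMap_formIV_all he 0)
    (fun S hS => numComponents_orbit_formIV hS)
  rw [trace_formIV]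
  constructor
  · rintro ⟨⟨h1, h2⟩, h3⟩
    ext i
    fin_cases i <;> simp <;> linarith
  · rintro rfl
    simp

theorem formV_symm (l a b n : ℝ) : (formV l a b n)ᵀ * eta = eta * formV l a b n := by
  rw [formV, eta_symm_lit_iff]
  simp

theorem Z1_mem_orthCentralizer_formV (l a b n : ℝ) :
    Z1 ∈ orthCentralizer eta (formV l a b n) := by
  simp only [orthCentralizer, Set.mem_ofPred_eq, lit_orth_eta_iff, formV, lit_mul, lit_inj,
    Z1_eq_lit]
  norm_num

theorem Z2_mem_orthCentralizer_formV (l a b n : ℝ) :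
    Z2 ∈ orthCentralizer eta (formV l a b n) := by
  simp only [orthCentralizer, Set.mem_ofPred_eq, lit_orth_eta_iff, formV, lit_mul, lit_inj,
    Z2_eq_lit]
  norm_num

theorem numComponents_orbit_formV {l a b n : ℝ} {S : Mat}
    (hS : S ∈ realizing eta (formV l a b n)) : numComponents (orbit S) = 1 :=
  numComponents_orbit_eq_one (formV_symm l a b n) hS (Z1_mem_orthCentralizer_formV ..)
    (Z2_mem_orthCentralizer_formV ..)

theorem trace_formV (l a b n : ℝ) : (formV l a b n).trace = l + 2 * a + n := by
  rw [formV, trace_lit]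
  ring

theorem aeval_charpoly_formV {A : Type*} [CommRing A] [Algebra ℝ A] (l a b n : ℝ) (z : A) :
    Polynomial.aeval z (formV l a b n).charpoly =
      (z - algebraMap ℝ A l) * (z - algebraMap ℝ A n) *
        ((z - algebraMap ℝ A a) ^ 2 + algebraMap ℝ A b ^ 2) := by
  rw [formV, aeval_charpoly_lit]
  simp only [map_zero, map_neg]
  ring

theorem computation_formV : Computation 3 6 4 1 eta
    (fun y : Fin 4 → ℝ => formV (y 0) (y 1) (y 2) (y 3)) {y | y 2 ≠ 0 ∧ y 0 ≠ y 3}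
    (fun x => ![x 0, -(x 0 + x 1) / 2, x 2, x 1]) {x | x 2 ≠ 0 ∧ x 0 ≠ x 1}
    {1, -1, Z1, -Z1, Z2, -Z2, Z3, -Z3} := by
  have h := components_of_signs (D := {x : Fin 3 → ℝ | x 2 ≠ 0 ∧ x 0 ≠ x 1}) (r := 2)
    ![coord 2, coord 0 - coord 1]
    (fun y => ⟨![y 1, 0, y 0], fun j => by fin_cases j <;> simp⟩)
    (fun x => by simp [Fin.forall_fin_two, sub_eq_zero])
  refine computation_of eta_mul_eta isFrame_one (fun y => formV_symm _ _ _ _) (fun y => ?_)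
    (fun x _ x' _ hxx => ?_)
    ((isOpen_ne_fun (continuous_apply 2) continuous_const).inter
      (isOpen_ne_fun (continuous_apply 0) (continuous_apply 1)))
    (fun x hx => orthCentralizer_formV hx.1 hx.2) (fun x hx => finrank_adMap_formV hx.1 hx.2)
    (fun x hx S hS => numComponents_orbit_formV hS) h.1 fun x hx x' hx' hch => ?_
  · rw [trace_formV]
    constructor
    · rintro ⟨⟨h1, h2⟩, h3⟩
      refine ⟨![y 0, y 3, y 2], ⟨h1, h2⟩, ?_⟩
      ext i
      fin_cases i <;> simp
      linarith
    · rintro ⟨x, hx, rfl⟩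
      refine ⟨hx, ?_⟩
      simp
      ring
  · have h0 : x 0 = x' 0 := congrFun hxx 0
    have h1 : x 1 = x' 1 := congrFun hxx 3
    have h2 : x 2 = x' 2 := congrFun hxx 2
    ext i
    fin_cases i <;> assumption
  · have h1 : 0 < x 2 * x' 2 := h.2 x hx x' hx' 0
    have h2 : 0 < (x 0 - x 1) * (x' 0 - x' 1) := h.2 x hx x' hx' 1
    have h3 : ∀ t : ℝ, (t - x 0) * (t - x 1) * ((t - -(x 0 + x 1) / 2) ^ 2 + x 2 ^ 2) =
        (t - x' 0) * (t - x' 1) * ((t - -(x' 0 + x' 1) / 2) ^ 2 + x' 2 ^ 2) := by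
      intro t
      have := aeval_real_of_charpoly_eq hch t
      rw [aeval_charpoly_formV, aeval_charpoly_formV] at this
      simpa using this
    have hpos : ∀ t : ℝ, (t - -(x' 0 + x' 1) / 2) ^ 2 + x' 2 ^ 2 ≠ 0 := by
      intro t
      have : x' 2 ≠ 0 := fun h0 => by simp [h0] at h1
      positivity
    -- The quadratic factor has no real root, so the real roots match as sets; the sign of `x 0 - x
    -- 1` fixes their order.
    have h4 : ∀ t : ℝ, (t - x 0) * (t - x 1) = 0 → t = x' 0 ∨ t = x' 1 := by
      intro t ht
      have := h3 t
      rw [ht, zero_mul, eq_comm, mul_eq_zero, or_iff_left (hpos t), mul_eq_zero] at this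
      simpa [sub_eq_zero] using this
    have hne : x 0 ≠ x 1 := hx.2
    have h5 : x' 0 = x 0 ∧ x' 1 = x 1 := by
      rcases h4 (x 0) (by ring) with h5 | h5 <;> rcases h4 (x 1) (by ring) with h6 | h6
      · exact absurd (h5.trans h6.symm) hne
      · exact ⟨h5.symm, h6.symm⟩
      · rw [← h5, ← h6] at h2
        nlinarith [sq_nonneg (x 0 - x 1)]
      · exact absurd (h5.trans h6.symm) hne
    have h6 : x 2 ^ 2 = x' 2 ^ 2 := by
      -- At this point the linear factors multiply to `2 (x 0 - x 1)²`, which is nonzero and can be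
      -- cancelled.
      have h7 := h3 (2 * x 0 - x 1)
      rw [h5.1, h5.2] at h7
      have h8 : 2 * (x 0 - x 1) ^ 2 * (x 2 ^ 2 - x' 2 ^ 2) = 0 := by linear_combination h7
      have h9 : 2 * (x 0 - x 1) ^ 2 ≠ 0 := by
        have := sub_ne_zero.2 hne
        positivity
      linarith [(mul_eq_zero.1 h8).resolve_left h9]
    ext i
    fin_cases i
    exacts [h5.1, h5.2, eq_of_sq_eq_of_mul_pos h1 h6]

theorem computation_formV_self : Computation 2 5 2 1 eta
    (fun y : Fin 4 → ℝ => formV (y 0) (y 1) (y 2) (y 3)) {y | y 2 ≠ 0 ∧ y 0 = y 3}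
    (fun x => ![x 0, -x 0, x 1, x 0]) {x | x 1 ≠ 0} isoT5 := by
  have h := components_of_signs (D := {x : Fin 2 → ℝ | x 1 ≠ 0}) (r := 1)
    (fun _ => LinearMap.proj 1) (fun y => ⟨fun _ => y 0, fun j => by simp [Subsingleton.elim j 0]⟩)
    (fun x => by simp)
  refine computation_of eta_mul_eta isFrame_one (fun y => formV_symm _ _ _ _) (fun y => ?_)
    (fun x _ x' _ hxx => ?_) (isOpen_ne_fun (continuous_apply 1) continuous_const)
    (fun x hx => orthCentralizer_formV_eq_isoT5 hx _ _)
    (fun x hx => finrank_adMap_formV_self hx _ _)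
    (fun x hx S hS => numComponents_orbit_formV hS) h.1 fun x hx x' hx' hch => ?_
  · rw [trace_formV]
    constructor
    · rintro ⟨⟨h1, h2⟩, h3⟩
      refine ⟨![y 0, y 2], h1, ?_⟩
      ext i
      fin_cases i <;> simp <;> linarith
    · rintro ⟨x, hx, rfl⟩
      refine ⟨⟨hx, rfl⟩, ?_⟩
      simp
      ring
  · have h0 : x 0 = x' 0 := congrFun hxx 0
    have h1 : x 1 = x' 1 := congrFun hxx 2
    ext i
    fin_cases i <;> assumption
  · have h1 : 0 < x 1 * x' 1 := h.2 x hx x' hx' 0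
    have h2 := eq_of_double_root (l := x 0) (l' := x' 0) h1 fun t => by
      have := aeval_real_of_charpoly_eq hch t
      rw [aeval_charpoly_formV, aeval_charpoly_formV] at this
      simpa [← sq] using this
    ext i
    fin_cases i
    exacts [h2.1, h2.2]

/-! ### Type IX -/

theorem formIX_symm (y : Fin 4 → ℝ) : (formIX y)ᵀ * eta = eta * formIX y := by
  rw [formIX, eta, Matrix.diagonal_transpose, Matrix.diagonal_mul_diagonal,
    Matrix.diagonal_mul_diagonal]
  simp_rw [mul_comm]

theorem diagonal_mem_orthCentralizer_formIX {s : Fin 4 → ℝ} (hs : ∀ i, s i = 1 ∨ s i = -1)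
    (y : Fin 4 → ℝ) : Matrix.diagonal s ∈ orthCentralizer eta (formIX y) := by
  rw [formIX, eta]
  refine ⟨?_, ?_⟩
  · rw [Matrix.diagonal_transpose, Matrix.diagonal_mul_diagonal, Matrix.diagonal_mul_diagonal]
    congr 1
    ext i
    rcases hs i with h | h <;> simp [h]
  · rw [Matrix.diagonal_mul_diagonal, Matrix.diagonal_mul_diagonal]
    simp_rw [mul_comm]

theorem numComponents_orbit_formIX {y : Fin 4 → ℝ} {S : Mat} (hS : S ∈ realizing eta (formIX y)) :
    numComponents (orbit S) = 1 :=
  numComponents_orbit_eq_one (formIX_symm y) hS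
    (diagonal_mem_orthCentralizer_formIX (fun i => by fin_cases i <;> simp) y)
    (diagonal_mem_orthCentralizer_formIX (fun i => by fin_cases i <;> simp) y)

theorem trace_formIX (y : Fin 4 → ℝ) : (formIX y).trace = y 0 + y 1 + y 2 + y 3 := by
  rw [formIX, Matrix.trace_diagonal, Fin.sum_univ_four]

theorem mem_range_iff_aeval_charpoly_formIX (y : Fin 4 → ℝ) (t : ℝ) :
    t ∈ Set.range y ↔ Polynomial.aeval t (formIX y).charpoly = 0 := by
  rw [formIX, Matrix.charpoly_diagonal, map_prod, Finset.prod_eq_zero_iff]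
  simp [sub_eq_zero, eq_comm]

/-- The matrices of type IX whose eigenvalues coincide according to the partition `c`, and are
given by the linear functions `l` of the free parameters. -/
theorem computation_formIX_of {m n k d : ℕ} {C : Set (Fin 4 → ℝ)}
    {ι : (Fin m → ℝ) → (Fin 4 → ℝ)} {D : Set (Fin m → ℝ)} {K : Set Mat} (c : Fin 4 → Fin k)
    (hc : Function.Surjective c) (hC : ∀ y, y ∈ C ↔ ∀ i j, y i = y j ↔ c i = c j)
    (l : Fin k → (Fin m → ℝ) →ₗ[ℝ] ℝ)
    (hl : ∀ z : Fin k → ℝ, (∃ x, ∀ i, l i x = z i) ↔ z (c 0) + z (c 1) + z (c 2) + z (c 3) = 0)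
    (hinj : ∀ x x', (∀ i, l i x = l i x') → x = x')
    (hD : ∀ x, x ∈ D ↔ Function.Injective fun i => l i x) (hι : ∀ x i, ι x i = l (c i) x)
    (hK : ∀ y : Fin 4 → ℝ, (∀ i j, y i = y j ↔ c i = c j) → orthCentralizer eta (formIX y) = K)
    (hnd : n + d = 6) (J : Fin d → Fin 6) (hJ : Function.Injective J)
    (hcJ : ∀ r, c (entryRow r) = c (entryCol r) ↔ ∃ j, J j = r) :
    Computation m n k.factorial 1 eta formIX C ι D K := by
  have hcc : ∀ x ∈ D, ∀ i j, ι x i = ι x j ↔ c i = c j := by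
    intro x hx i j
    rw [hι, hι]
    exact ((hD x).1 hx).eq_iff
  have hrange : ∀ x, Set.range (ι x) = Set.range fun i => l i x := by
    intro x
    rw [show ι x = (fun i => l i x) ∘ c from funext (hι x), hc.range_comp]
  have h := components_of_orderings l (fun y => by
    -- Subtracting the mean, with multiplicities, makes the trace zero.
    obtain ⟨x, hx⟩ := (hl fun i => y i + -(y (c 0) + y (c 1) + y (c 2) + y (c 3)) / 4).2 (by ring)
    exact ⟨x, _, hx⟩) hD
  refine computation_of eta_mul_eta isFrame_one formIX_symm (fun y => ?_) (fun x _ x' _ hxx => ?_)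
    ((Set.ext hD : D = {x | _}) ▸ isOpen_injective l) (fun x hx => hK _ (hcc x hx))
    (fun x hx => finrank_adMap_formIX hnd J hJ fun r => by rw [hcc x hx, hcJ])
    (fun x hx S hS => numComponents_orbit_formIX hS) h.1 fun x hx x' hx' hch => ?_
  · rw [hC, trace_formIX]
    constructor
    · rintro ⟨h1, h2⟩
      -- The eigenvalue of a class is read off at a chosen representative coordinate.
      have h3 : ∀ i, y (Function.surjInv hc (c i)) = y i := fun i =>
        (h1 _ _).2 (Function.surjInv_eq hc _)
      obtain ⟨x, hx⟩ := (hl fun i => y (Function.surjInv hc i)).2 (by simp only [h3, h2])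
      refine ⟨x, (hD x).2 fun i j hij => ?_, funext fun i => by rw [hι, hx, h3]⟩
      simp only [hx] at hij
      rwa [h1, Function.surjInv_eq hc, Function.surjInv_eq hc] at hij
    · rintro ⟨x, hx, rfl⟩
      refine ⟨hcc x hx, ?_⟩
      simp only [hι]
      exact (hl fun i => l i x).1 ⟨x, fun _ => rfl⟩
  · refine hinj _ _ fun i => ?_
    obtain ⟨j, rfl⟩ := hc i
    rw [← hι, ← hι, hxx]
  · refine (hinj _ _ (h.2 x hx x' hx' ?_)).symm
    rw [← hrange, ← hrange]
    ext t
    rw [mem_range_iff_aeval_charpoly_formIX, mem_range_iff_aeval_charpoly_formIX, hch]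

theorem injective_fin_four_iff (z : Fin 4 → ℝ) : Function.Injective z ↔
    z 0 ≠ z 1 ∧ z 0 ≠ z 2 ∧ z 1 ≠ z 2 ∧ z 0 ≠ z 3 ∧ z 1 ≠ z 3 ∧ z 2 ≠ z 3 := by
  refine ⟨fun h => ⟨h.ne (by decide), h.ne (by decide), h.ne (by decide), h.ne (by decide),
    h.ne (by decide), h.ne (by decide)⟩, fun ⟨h0, h1, h2, h3, h4, h5⟩ => ?_⟩
  intro i j h
  fin_cases i <;> fin_cases j <;> simp_all

theorem computation_formIX : Computation 3 6 24 1 eta formIX {y | ∀ i j, i ≠ j → y i ≠ y j}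
    (fun x => ![x 0, x 1, x 2, -(x 0 + x 1 + x 2)])
    {x | x 0 ≠ x 1 ∧ x 0 ≠ x 2 ∧ x 1 ≠ x 2 ∧ 2 * x 0 + x 1 + x 2 ≠ 0 ∧
      x 0 + 2 * x 1 + x 2 ≠ 0 ∧ x 0 + x 1 + 2 * x 2 ≠ 0} signMatrices := by
  refine computation_formIX_of id Function.surjective_id (fun y => ?_)
    ![coord 0, coord 1, coord 2, -(coord 0 + coord 1 + coord 2)] (fun z => ?_)
    (fun x x' h => ?_) (fun x => ?_) (fun x i => by fin_cases i <;> simp)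
    (fun y hy => orthCentralizer_formIX fun i j hij => mt (hy i j).1 hij) (add_zero 6) Fin.elim0
    (fun i => i.elim0) (by decide)
  · exact forall_congr' fun i => forall_congr' fun j =>
      ⟨fun h => ⟨fun h1 => by_contra fun h2 => h h2 h1, fun h1 => congrArg y h1⟩,
        fun h h1 h2 => h1 (h.1 h2)⟩
  · constructor
    · rintro ⟨x, hx⟩
      simp only [id, ← hx]
      simp
    · intro h
      refine ⟨![z 0, z 1, z 2], fun i => ?_⟩
      simp only [id] at h
      fin_cases i <;> simp
      linarith
  · ext i
    fin_cases i
    exacts [h 0, h 1, h 2]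
  · rw [injective_fin_four_iff]
    simp only [Set.mem_ofPred_eq]
    refine and_congr Iff.rfl (and_congr Iff.rfl (and_congr Iff.rfl (and_congr (not_congr ?_)
      (and_congr (not_congr ?_) (not_congr ?_))))) <;>
    · simp
      constructor <;> intro h <;> linarith

/-- Class `0` is the coinciding pair, and `r` is the position of that pair among the entries above
the diagonal. The three distinct eigenvalues have `3! = 6` orderings. -/
theorem computation_formIX_pair {c : Fin 4 → Fin 3} {i j k l : Fin 4}
    (hf : Function.Injective ![i, j, k, l]) {G : Set (Matrix (Fin 2) (Fin 2) ℝ)}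
    (hG : orth ![(![1, 1, -1, -1] : Fin 4 → ℝ) i, (![1, 1, -1, -1] : Fin 4 → ℝ) j] = G)
    (hc : c i = 0 ∧ c j = 0 ∧ c k = 1 ∧ c l = 2)
    (hz : ∀ z : Fin 3 → ℝ, z (c 0) + z (c 1) + z (c 2) + z (c 3) = 2 * z 0 + z 1 + z 2)
    {C : Set (Fin 4 → ℝ)} (hC : ∀ y, y ∈ C ↔ ∀ i j, y i = y j ↔ c i = c j)
    {ι : (Fin 2 → ℝ) → (Fin 4 → ℝ)} (hι : ∀ x i, ι x i = ![-(x 0 + x 1) / 2, x 0, x 1] (c i))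
    {r : Fin 6} (hr : ∀ s, c (entryRow s) = c (entryCol s) ↔ r = s) :
    Computation 2 5 6 1 eta formIX C ι {x | 3 * x 0 + x 1 ≠ 0 ∧ x 0 + 3 * x 1 ≠ 0 ∧ x 0 ≠ x 1}
      (isoPair i j k l G) := by
  obtain ⟨hi, hj, hk, hl⟩ := hc
  refine computation_formIX_of c (fun a => ?_) hC doubleEigenvalues
    (fun z => by rw [exists_doubleEigenvalues_eq_iff, hz]) (fun x x' h => ?_)
    (fun x => (injective_doubleEigenvalues_iff x).symm) (fun x a => ?_)
    (fun y hy => orthCentralizer_formIX_eq_isoPair hf hG ?_ ?_ ?_ ?_) rfl (fun _ : Fin 1 => r)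
    (fun _ _ _ => Subsingleton.elim _ _) (fun s => by simp [hr])
  · fin_cases a
    exacts [⟨i, hi⟩, ⟨k, hk⟩, ⟨l, hl⟩]
  · ext a
    fin_cases a
    exacts [h 1, h 2]
  · rw [hι]
    generalize c a = b
    fin_cases b
    exacts [(doubleEigenvalues_zero x).symm, rfl, rfl]
  all_goals simp [hy, hi, hj, hk, hl]

theorem injective_fin_two_iff (z : Fin 2 → ℝ) : Function.Injective z ↔ z 0 ≠ z 1 := by
  refine ⟨fun h => h.ne (by decide), fun h i j hij => ?_⟩
  fin_cases i <;> fin_cases j <;> simp_all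

/-- With two distinct eigenvalues the trace condition makes the second `a` times the first: `a = -1`
for multiplicities two and two, `a = -3` for three and one. The two families are the two orderings.
-/
theorem computation_formIX_two {n d : ℕ} {K : Set Mat} {c : Fin 4 → Fin 2}
    (hc : Function.Surjective c) {a : ℝ} (ha : a ≠ 1)
    (hz : ∀ z : Fin 2 → ℝ, z (c 0) + z (c 1) + z (c 2) + z (c 3) = 0 ↔ z 1 = a * z 0)
    {C : Set (Fin 4 → ℝ)} (hC : ∀ y, y ∈ C ↔ ∀ i j, y i = y j ↔ c i = c j)
    {ι : (Fin 1 → ℝ) → (Fin 4 → ℝ)} (hι : ∀ x i, ι x i = ![x 0, a * x 0] (c i))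
    (hK : ∀ y : Fin 4 → ℝ, (∀ i j, y i = y j ↔ c i = c j) → orthCentralizer eta (formIX y) = K)
    (hnd : n + d = 6) (J : Fin d → Fin 6) (hJ : Function.Injective J)
    (hcJ : ∀ r, c (entryRow r) = c (entryCol r) ↔ ∃ j, J j = r) :
    Computation 1 n 2 1 eta formIX C ι {x | x 0 ≠ 0} K := by
  refine computation_formIX_of c hc hC ![coord 0, a • coord 0] (fun z => ?_) (fun x x' h => ?_)
    (fun x => ?_) (fun x i => ?_) hK hnd J hJ hcJ
  · rw [hz]
    constructor
    · rintro ⟨x, hx⟩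
      rw [← hx, ← hx]
      simp
    · intro h
      refine ⟨fun _ => z 0, fun i => ?_⟩
      fin_cases i <;> simp [h]
  · ext i
    rw [Subsingleton.elim i 0]
    exact h 0
  · rw [injective_fin_two_iff]
    show x 0 ≠ 0 ↔ x 0 ≠ a * x 0
    refine not_congr ⟨fun h => by simp [h], fun h => ?_⟩
    exact (mul_eq_zero.1 (by linear_combination h : (1 - a) * x 0 = 0)).resolve_left
      (sub_ne_zero.2 ha.symm)
  · rw [hι]
    generalize c i = b
    fin_cases b <;> rfl

theorem computation_formIX_all : Computation 0 0 1 1 eta formIX {y | ∀ i j, y i = y j}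
    (fun _ => ![0, 0, 0, 0]) Set.univ (orth ![1, 1, -1, -1]) := by
  refine computation_point eta_mul_eta isFrame_one formIX_symm (fun y => ?_) orthCentralizer_zero
    (finrank_adMap_formIX (zero_add 6) id Function.injective_id fun i => ?_)
    (fun S hS => numComponents_orbit_formIX hS)
  · rw [trace_formIX]
    constructor
    · rintro ⟨h1, h2⟩
      rw [h1 1 0, h1 2 0, h1 3 0] at h2
      ext i
      rw [h1 i 0]
      fin_cases i <;> simp <;> linarith
    · rintro rfl
      refine ⟨fun i j => ?_, by simp⟩
      fin_cases i <;> fin_cases j <;> rfl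
  · refine ⟨fun _ => ⟨i, rfl⟩, fun _ => ?_⟩
    fin_cases i <;> rfl

theorem forall_eq_iff_eq_iff {k : ℕ} (y : Fin 4 → ℝ) (c : Fin 4 → Fin k) :
    (∀ i j, y i = y j ↔ c i = c j) ↔ (y 0 = y 1 ↔ c 0 = c 1) ∧ (y 0 = y 2 ↔ c 0 = c 2) ∧
      (y 0 = y 3 ↔ c 0 = c 3) ∧ (y 1 = y 2 ↔ c 1 = c 2) ∧ (y 1 = y 3 ↔ c 1 = c 3) ∧
      (y 2 = y 3 ↔ c 2 = c 3) := by
  refine ⟨fun h => ⟨h _ _, h _ _, h _ _, h _ _, h _ _, h _ _⟩, fun ⟨h0, h1, h2, h3, h4, h5⟩ => ?_⟩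
  intro i j
  have h (i j) (h : y i = y j ↔ c i = c j) : y j = y i ↔ c j = c i := by
    rw [eq_comm, h, eq_comm]
  fin_cases i <;> fin_cases j <;>
  first
  | exact ⟨fun _ => rfl, fun _ => rfl⟩
  | assumption
  | exact h _ _ ‹_›

theorem computation_formIX_nu_sigma : Computation 2 5 6 1 eta formIX
    {y | y 2 = y 3 ∧ y 0 ≠ y 2 ∧ y 1 ≠ y 2 ∧ y 0 ≠ y 1}
    (fun x => ![x 0, x 1, -(x 0 + x 1) / 2, -(x 0 + x 1) / 2])
    {x | 3 * x 0 + x 1 ≠ 0 ∧ x 0 + 3 * x 1 ≠ 0 ∧ x 0 ≠ x 1} (isoPair 2 3 0 1 O2) := by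
  refine computation_formIX_pair (c := ![1, 2, 0, 0]) (r := 5) (by decide)
    (by simpa using orth_neg_one_neg_one) (by decide) (fun z => ?_) (fun y => ?_)
    (fun x i => ?_) (by decide)
  · simp
    ring
  · rw [forall_eq_iff_eq_iff]
    simp
    grind
  · fin_cases i <;> simp

theorem computation_formIX_lambda_mu : Computation 2 5 6 1 eta formIX
    {y | y 0 = y 1 ∧ y 2 ≠ y 0 ∧ y 3 ≠ y 0 ∧ y 2 ≠ y 3}
    (fun x => ![-(x 0 + x 1) / 2, -(x 0 + x 1) / 2, x 0, x 1])
    {x | 3 * x 0 + x 1 ≠ 0 ∧ x 0 + 3 * x 1 ≠ 0 ∧ x 0 ≠ x 1} (isoPair 0 1 2 3 O2) := by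
  refine computation_formIX_pair (c := ![0, 0, 1, 2]) (r := 0) (by decide) (by simp [O2])
    (by decide) (fun z => ?_) (fun y => ?_) (fun x i => ?_) (by decide)
  · simp
    ring
  · rw [forall_eq_iff_eq_iff]
    simp
    grind
  · fin_cases i <;> simp

theorem computation_formIX_lambda_sigma : Computation 2 5 6 1 eta formIX
    {y | y 0 = y 3 ∧ y 1 ≠ y 0 ∧ y 2 ≠ y 0 ∧ y 1 ≠ y 2}
    (fun x => ![-(x 0 + x 1) / 2, x 0, x 1, -(x 0 + x 1) / 2])
    {x | 3 * x 0 + x 1 ≠ 0 ∧ x 0 + 3 * x 1 ≠ 0 ∧ x 0 ≠ x 1} (isoPair 0 3 1 2 O11) := by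
  refine computation_formIX_pair (c := ![0, 1, 2, 0]) (r := 2) (by decide) (by simp [O11])
    (by decide) (fun z => ?_) (fun y => ?_) (fun x i => ?_) (by decide)
  · simp
    ring
  · rw [forall_eq_iff_eq_iff]
    simp
    grind
  · fin_cases i <;> simp

theorem computation_formIX_mu_nu : Computation 2 5 6 1 eta formIX
    {y | y 1 = y 2 ∧ y 0 ≠ y 1 ∧ y 3 ≠ y 1 ∧ y 0 ≠ y 3}
    (fun x => ![x 0, -(x 0 + x 1) / 2, -(x 0 + x 1) / 2, x 1])
    {x | 3 * x 0 + x 1 ≠ 0 ∧ x 0 + 3 * x 1 ≠ 0 ∧ x 0 ≠ x 1} (isoPair 1 2 0 3 O11) := by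
  refine computation_formIX_pair (c := ![1, 0, 0, 2]) (r := 3) (by decide) (by simp [O11])
    (by decide) (fun z => ?_) (fun y => ?_) (fun x i => ?_) (by decide)
  · simp
    ring
  · rw [forall_eq_iff_eq_iff]
    simp
    grind
  · fin_cases i <;> simp

theorem computation_formIX_lambda_nu : Computation 2 5 6 1 eta formIX
    {y | y 0 = y 2 ∧ y 1 ≠ y 0 ∧ y 3 ≠ y 0 ∧ y 1 ≠ y 3}
    (fun x => ![-(x 0 + x 1) / 2, x 0, -(x 0 + x 1) / 2, x 1])
    {x | 3 * x 0 + x 1 ≠ 0 ∧ x 0 + 3 * x 1 ≠ 0 ∧ x 0 ≠ x 1} (isoPair 0 2 1 3 O11) := by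
  refine computation_formIX_pair (c := ![0, 1, 0, 2]) (r := 1) (by decide) (by simp [O11])
    (by decide) (fun z => ?_) (fun y => ?_) (fun x i => ?_) (by decide)
  · simp
    ring
  · rw [forall_eq_iff_eq_iff]
    simp
    grind
  · fin_cases i <;> simp

theorem computation_formIX_mu_sigma : Computation 2 5 6 1 eta formIX
    {y | y 1 = y 3 ∧ y 0 ≠ y 1 ∧ y 2 ≠ y 1 ∧ y 0 ≠ y 2}
    (fun x => ![x 0, -(x 0 + x 1) / 2, x 1, -(x 0 + x 1) / 2])
    {x | 3 * x 0 + x 1 ≠ 0 ∧ x 0 + 3 * x 1 ≠ 0 ∧ x 0 ≠ x 1} (isoPair 1 3 0 2 O11) := by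
  refine computation_formIX_pair (c := ![1, 0, 2, 0]) (r := 4) (by decide) (by simp [O11])
    (by decide) (fun z => ?_) (fun y => ?_) (fun x i => ?_) (by decide)
  · simp
    ring
  · rw [forall_eq_iff_eq_iff]
    simp
    grind
  · fin_cases i <;> simp

theorem computation_formIX_lambda_mu_nu_sigma : Computation 1 4 2 1 eta formIX
    {y | y 0 = y 1 ∧ y 2 = y 3 ∧ y 0 ≠ y 2} (fun x => ![x 0, x 0, -x 0, -x 0])
    {x | x 0 ≠ 0} (isoPairs 0 1 2 3 O2 O2) := by
  refine computation_formIX_two (c := ![0, 0, 1, 1]) (a := -1) (by decide) (by norm_num)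
    (fun z => ?_) (fun y => ?_) (fun x i => ?_) (fun y hy => orthCentralizer_formIX_eq_isoPairs
      (by decide) (by simp [O2]) (by simpa using orth_neg_one_neg_one) ?_ ?_ ?_)
    (d := 2) rfl ![0, 5] (by decide) (by decide)
  · simp
    constructor <;> intro h <;> linarith
  · rw [forall_eq_iff_eq_iff]
    simp
    grind
  · fin_cases i <;> simp
  all_goals simp [hy]

theorem computation_formIX_lambda_nu_mu_sigma : Computation 1 4 2 1 eta formIX
    {y | y 0 = y 2 ∧ y 1 = y 3 ∧ y 0 ≠ y 1} (fun x => ![x 0, -x 0, x 0, -x 0])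
    {x | x 0 ≠ 0} (isoPairs 0 2 1 3 O11 O11) := by
  refine computation_formIX_two (c := ![0, 1, 0, 1]) (a := -1) (by decide) (by norm_num)
    (fun z => ?_) (fun y => ?_) (fun x i => ?_) (fun y hy => orthCentralizer_formIX_eq_isoPairs
      (by decide) (by simp [O11]) (by simp [O11]) ?_ ?_ ?_)
    (d := 2) rfl ![1, 4] (by decide) (by decide)
  · simp
    constructor <;> intro h <;> linarith
  · rw [forall_eq_iff_eq_iff]
    simp
    grind
  · fin_cases i <;> simp
  all_goals simp [hy]

theorem computation_formIX_lambda_sigma_mu_nu : Computation 1 4 2 1 eta formIX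
    {y | y 0 = y 3 ∧ y 1 = y 2 ∧ y 0 ≠ y 1} (fun x => ![x 0, -x 0, -x 0, x 0])
    {x | x 0 ≠ 0} (isoPairs 0 3 1 2 O11 O11) := by
  refine computation_formIX_two (c := ![0, 1, 1, 0]) (a := -1) (by decide) (by norm_num)
    (fun z => ?_) (fun y => ?_) (fun x i => ?_) (fun y hy => orthCentralizer_formIX_eq_isoPairs
      (by decide) (by simp [O11]) (by simp [O11]) ?_ ?_ ?_)
    (d := 2) rfl ![2, 3] (by decide) (by decide)
  · simp
    constructor <;> intro h <;> linarith
  · rw [forall_eq_iff_eq_iff]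
    simp
    grind
  · fin_cases i <;> simp
  all_goals simp [hy]

theorem computation_formIX_lambda_mu_nu : Computation 1 3 2 1 eta formIX
    {y | y 0 = y 1 ∧ y 1 = y 2 ∧ y 3 ≠ y 0} (fun x => ![x 0, x 0, x 0, -3 * x 0])
    {x | x 0 ≠ 0} (isoTriple 0 1 2 3 O21) := by
  refine computation_formIX_two (c := ![0, 0, 0, 1]) (a := -3) (by decide) (by norm_num)
    (fun z => ?_) (fun y => ?_) (fun x i => ?_) (fun y hy => orthCentralizer_formIX_eq_isoTriple
      (by decide) (by simp [O21]) ?_ ?_ ?_) (d := 3) rfl ![0, 1, 3] (by decide) (by decide)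
  · simp
    constructor <;> intro h <;> linarith
  · rw [forall_eq_iff_eq_iff]
    simp
    grind
  · fin_cases i <;> simp
  all_goals simp [hy]

theorem computation_formIX_lambda_mu_sigma : Computation 1 3 2 1 eta formIX
    {y | y 0 = y 1 ∧ y 1 = y 3 ∧ y 2 ≠ y 0} (fun x => ![x 0, x 0, -3 * x 0, x 0])
    {x | x 0 ≠ 0} (isoTriple 0 1 3 2 O21) := by
  refine computation_formIX_two (c := ![0, 0, 1, 0]) (a := -3) (by decide) (by norm_num)
    (fun z => ?_) (fun y => ?_) (fun x i => ?_) (fun y hy => orthCentralizer_formIX_eq_isoTriple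
      (by decide) (by simp [O21]) ?_ ?_ ?_) (d := 3) rfl ![0, 2, 4] (by decide) (by decide)
  · simp
    constructor <;> intro h <;> linarith
  · rw [forall_eq_iff_eq_iff]
    simp
    grind
  · fin_cases i <;> simp
  all_goals simp [hy]

theorem computation_formIX_lambda_nu_sigma : Computation 1 3 2 1 eta formIX
    {y | y 0 = y 2 ∧ y 2 = y 3 ∧ y 1 ≠ y 0} (fun x => ![x 0, -3 * x 0, x 0, x 0])
    {x | x 0 ≠ 0} (isoTriple 0 2 3 1 O12) := by
  refine computation_formIX_two (c := ![0, 1, 0, 0]) (a := -3) (by decide) (by norm_num)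
    (fun z => ?_) (fun y => ?_) (fun x i => ?_) (fun y hy => orthCentralizer_formIX_eq_isoTriple
      (by decide) (by simp [O12]) ?_ ?_ ?_) (d := 3) rfl ![1, 2, 5] (by decide) (by decide)
  · simp
    constructor <;> intro h <;> linarith
  · rw [forall_eq_iff_eq_iff]
    simp
    grind
  · fin_cases i <;> simp
  all_goals simp [hy]

theorem computation_formIX_mu_nu_sigma : Computation 1 3 2 1 eta formIX
    {y | y 1 = y 2 ∧ y 2 = y 3 ∧ y 0 ≠ y 1} (fun x => ![-3 * x 0, x 0, x 0, x 0])
    {x | x 0 ≠ 0} (isoTriple 1 2 3 0 O12) := by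
  refine computation_formIX_two (c := ![1, 0, 0, 0]) (a := -3) (by decide) (by norm_num)
    (fun z => ?_) (fun y => ?_) (fun x i => ?_) (fun y hy => orthCentralizer_formIX_eq_isoTriple
      (by decide) (by simp [O12]) ?_ ?_ ?_) (d := 3) rfl ![3, 4, 5] (by decide) (by decide)
  · simp
    constructor <;> intro h <;> linarith
  · rw [forall_eq_iff_eq_iff]
    simp
    grind
  · fin_cases i <;> simp
  all_goals simp [hy]

end NeutralEnd

end

open NeutralEnd in
theorem mainTheorem3 :
    -- Type I
    (∀ e : ℝ, (e = 1 ∨ e = -1) → Computation 0 6 1 4 hyp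
      (fun y : Fin 1 → ℝ => formI e (y 0))
      {y | True}
      (fun x => ![0]) Set.univ {1, -1}) ∧
    -- Type II
    (Computation 1 6 2 4 hyp
      (fun y : Fin 2 → ℝ => formII (y 0) (y 1))
      {y | y 1 ≠ 0}
      (fun x => ![0, x 0])
      {x | x 0 ≠ 0} {1, -1}) ∧
    -- Type IIIa, generic
    (Computation 1 6 2 2 eta
      (fun y : Fin 2 → ℝ => formIIIa (y 0) (y 1))
      {y | y 0 ≠ y 1}
      (fun x => ![-3 * x 0, x 0])
      {x | x 0 ≠ 0} {1, -1, Z1, -Z1}) ∧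
    -- Type IIIa, coincident eigenvalues
    (Computation 0 5 1 2 eta
      (fun y : Fin 2 → ℝ => formIIIa (y 0) (y 1))
      {y | y 0 = y 1}
      (fun x => ![0, 0]) Set.univ (generated ({-1, Z1} ∪ Set.range T1))) ∧
    -- Type IIIb, generic
    (Computation 1 6 2 2 eta
      (fun y : Fin 2 → ℝ => formIIIb (y 0) (y 1))
      {y | y 0 ≠ y 1}
      (fun x => ![x 0, -3 * x 0])
      {x | x 0 ≠ 0} {1, -1, Z2, -Z2}) ∧
    -- Type IIIb, coincident eigenvalues
    (Computation 0 5 1 2 eta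
      (fun y : Fin 2 → ℝ => formIIIb (y 0) (y 1))
      {y | y 0 = y 1}
      (fun x => ![0, 0]) Set.univ (generated ({-1, Z2} ∪ Set.range T2))) ∧
    -- Type IV, generic
    (∀ e : ℝ, (e = 1 ∨ e = -1) → Computation 2 6 6 1 eta
      (fun y : Fin 3 → ℝ => formIV e (y 0) (y 1) (y 2))
      {y | y 0 ≠ y 1 ∧ y 1 ≠ y 2 ∧ y 0 ≠ y 2}
      (fun x => ![x 0, -(x 0 + x 1) / 2, x 1])
      {x | x 0 + 3 * x 1 ≠ 0 ∧ 3 * x 0 + x 1 ≠ 0 ∧ x 0 ≠ x 1}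
      {1, -1, Z1, -Z1, Z2, -Z2, Z3, -Z3}) ∧
    -- Type IV, mu = nu
    (∀ e : ℝ, (e = 1 ∨ e = -1) → Computation 1 5 2 1 eta
      (fun y : Fin 3 → ℝ => formIV e (y 0) (y 1) (y 2))
      {y | y 1 = y 2 ∧ y 0 ≠ y 1}
      (fun x => ![-3 * x 0, x 0, x 0])
      {x | x 0 ≠ 0} (generated ({-1, Z1, Z2, Z3} ∪ Set.range T3))) ∧
    -- Type IV, lambda = mu
    (∀ e : ℝ, (e = 1 ∨ e = -1) → Computation 1 5 2 1 eta
      (fun y : Fin 3 → ℝ => formIV e (y 0) (y 1) (y 2))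
      {y | y 0 = y 1 ∧ y 1 ≠ y 2}
      (fun x => ![x 0, x 0, -3 * x 0])
      {x | x 0 ≠ 0} (generated ({-1, Z1, Z2, Z3} ∪ Set.range T4))) ∧
    -- Type IV, lambda = nu
    (∀ e : ℝ, (e = 1 ∨ e = -1) → Computation 1 5 2 1 eta
      (fun y : Fin 3 → ℝ => formIV e (y 0) (y 1) (y 2))
      {y | y 0 = y 2 ∧ y 0 ≠ y 1}
      (fun x => ![x 0, -x 0, x 0])
      {x | x 0 ≠ 0} isoT5) ∧
    -- Type IV, all eigenvalues coincident
    (∀ e : ℝ, (e = 1 ∨ e = -1) → Computation 0 3 1 1 eta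
      (fun y : Fin 3 → ℝ => formIV e (y 0) (y 1) (y 2))
      {y | y 0 = y 1 ∧ y 1 = y 2}
      (fun x => ![0, 0, 0]) Set.univ isoT6) ∧
    -- Type V, generic
    (Computation 3 6 4 1 eta
      (fun y : Fin 4 → ℝ => formV (y 0) (y 1) (y 2) (y 3))
      {y | y 2 ≠ 0 ∧ y 0 ≠ y 3}
      (fun x => ![x 0, -(x 0 + x 1) / 2, x 2, x 1])
      {x | x 2 ≠ 0 ∧ x 0 ≠ x 1}
      {1, -1, Z1, -Z1, Z2, -Z2, Z3, -Z3}) ∧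
    -- Type V, lambda = nu
    (Computation 2 5 2 1 eta
      (fun y : Fin 4 → ℝ => formV (y 0) (y 1) (y 2) (y 3))
      {y | y 2 ≠ 0 ∧ y 0 = y 3}
      (fun x => ![x 0, -x 0, x 1, x 0])
      {x | x 1 ≠ 0} isoT5) ∧
    -- Type VI
    (∀ e : ℝ, (e = 1 ∨ e = -1) → Computation 2 6 2 2 eta
      (fun y : Fin 3 → ℝ => formVI e (y 0) (y 1) (y 2))
      {y | y 2 ≠ 0}
      (fun x => ![x 0, -x 0, x 1])
      {x | x 1 ≠ 0} {1, -1, Z3, -Z3}) ∧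
    -- Type VII, generic
    (∀ e w : ℝ, (e = 1 ∨ e = -1) → (w = 1 ∨ w = -1) → Computation 1 6 2 2 hyp
      (fun y : Fin 2 → ℝ => formVII e w (y 0) (y 1))
      {y | y 0 ≠ y 1}
      (fun x => ![x 0, -x 0])
      {x | x 0 ≠ 0} {1, -1, Z4, -Z4}) ∧
    -- Type VII, coincident eigenvalues, equal signs
    (∀ e : ℝ, (e = 1 ∨ e = -1) → Computation 0 4 1 2 hyp
      (fun y : Fin 2 → ℝ => formVII e e (y 0) (y 1))
      {y | y 0 = y 1}
      (fun x => ![0, 0]) Set.univ (isoVII O2)) ∧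
    -- Type VII, coincident eigenvalues, opposite signs
    (∀ e : ℝ, (e = 1 ∨ e = -1) → Computation 0 4 1 2 hyp
      (fun y : Fin 2 → ℝ => formVII e (-e) (y 0) (y 1))
      {y | y 0 = y 1}
      (fun x => ![0, 0]) Set.univ (isoVII O11)) ∧
    -- Type VIII, distinct real parts
    (Computation 3 6 8 2 eta
      (fun y : Fin 4 → ℝ => formVIII (y 0) (y 1) (y 2) (y 3))
      {y | y 1 ≠ 0 ∧ y 3 ≠ 0 ∧ y 0 ≠ y 2}
      (fun x => ![x 0, x 1, -x 0, x 2])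
      {x | x 0 ≠ 0 ∧ x 1 ≠ 0 ∧ x 2 ≠ 0}
      {1, -1, Z4, -Z4}) ∧
    -- Type VIII, equal real parts, distinct conjugate pairs
    (Computation 2 6 8 2 eta
      (fun y : Fin 4 → ℝ => formVIII (y 0) (y 1) (y 2) (y 3))
      {y | y 1 ≠ 0 ∧ y 3 ≠ 0 ∧ y 0 = y 2 ∧ y 1 ≠ y 3 ∧ y 1 ≠ -y 3}
      (fun x => ![0, x 0, 0, x 1])
      {x | x 0 ≠ 0 ∧ x 1 ≠ 0 ∧ x 0 ≠ x 1 ∧ x 0 ≠ -x 1}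
      {1, -1, Z4, -Z4}) ∧
    -- Type VIII, coincident eigenvalues
    (Computation 1 4 2 2 eta
      (fun y : Fin 4 → ℝ => formVIII (y 0) (y 1) (y 2) (y 3))
      {y | y 1 ≠ 0 ∧ y 3 ≠ 0 ∧ y 0 = y 2 ∧ y 1 = y 3}
      (fun x => ![0, x 0, 0, x 0])
      {x | x 0 ≠ 0} isoVIII) ∧
    -- Type IX, generic
    (Computation 3 6 24 1 eta formIX {y | ∀ i j, i ≠ j → y i ≠ y j}
      (fun x => ![x 0, x 1, x 2, -(x 0 + x 1 + x 2)])
      {x | x 0 ≠ x 1 ∧ x 0 ≠ x 2 ∧ x 1 ≠ x 2 ∧ 2 * x 0 + x 1 + x 2 ≠ 0 ∧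
        x 0 + 2 * x 1 + x 2 ≠ 0 ∧ x 0 + x 1 + 2 * x 2 ≠ 0}
      signMatrices) ∧
    -- Type IX, nu = sigma only
    (Computation 2 5 6 1 eta formIX {y | y 2 = y 3 ∧ y 0 ≠ y 2 ∧ y 1 ≠ y 2 ∧ y 0 ≠ y 1}
      (fun x => ![x 0, x 1, -(x 0 + x 1) / 2, -(x 0 + x 1) / 2])
      {x | 3 * x 0 + x 1 ≠ 0 ∧ x 0 + 3 * x 1 ≠ 0 ∧ x 0 ≠ x 1}
      (isoPair 2 3 0 1 O2)) ∧
    -- Type IX, lambda = mu only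
    (Computation 2 5 6 1 eta formIX {y | y 0 = y 1 ∧ y 2 ≠ y 0 ∧ y 3 ≠ y 0 ∧ y 2 ≠ y 3}
      (fun x => ![-(x 0 + x 1) / 2, -(x 0 + x 1) / 2, x 0, x 1])
      {x | 3 * x 0 + x 1 ≠ 0 ∧ x 0 + 3 * x 1 ≠ 0 ∧ x 0 ≠ x 1}
      (isoPair 0 1 2 3 O2)) ∧
    -- Type IX, lambda = sigma only
    (Computation 2 5 6 1 eta formIX {y | y 0 = y 3 ∧ y 1 ≠ y 0 ∧ y 2 ≠ y 0 ∧ y 1 ≠ y 2}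
      (fun x => ![-(x 0 + x 1) / 2, x 0, x 1, -(x 0 + x 1) / 2])
      {x | 3 * x 0 + x 1 ≠ 0 ∧ x 0 + 3 * x 1 ≠ 0 ∧ x 0 ≠ x 1}
      (isoPair 0 3 1 2 O11)) ∧
    -- Type IX, mu = nu only
    (Computation 2 5 6 1 eta formIX {y | y 1 = y 2 ∧ y 0 ≠ y 1 ∧ y 3 ≠ y 1 ∧ y 0 ≠ y 3}
      (fun x => ![x 0, -(x 0 + x 1) / 2, -(x 0 + x 1) / 2, x 1])
      {x | 3 * x 0 + x 1 ≠ 0 ∧ x 0 + 3 * x 1 ≠ 0 ∧ x 0 ≠ x 1}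
      (isoPair 1 2 0 3 O11)) ∧
    -- Type IX, lambda = nu only
    (Computation 2 5 6 1 eta formIX {y | y 0 = y 2 ∧ y 1 ≠ y 0 ∧ y 3 ≠ y 0 ∧ y 1 ≠ y 3}
      (fun x => ![-(x 0 + x 1) / 2, x 0, -(x 0 + x 1) / 2, x 1])
      {x | 3 * x 0 + x 1 ≠ 0 ∧ x 0 + 3 * x 1 ≠ 0 ∧ x 0 ≠ x 1}
      (isoPair 0 2 1 3 O11)) ∧
    -- Type IX, mu = sigma only
    (Computation 2 5 6 1 eta formIX {y | y 1 = y 3 ∧ y 0 ≠ y 1 ∧ y 2 ≠ y 1 ∧ y 0 ≠ y 2}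
      (fun x => ![x 0, -(x 0 + x 1) / 2, x 1, -(x 0 + x 1) / 2])
      {x | 3 * x 0 + x 1 ≠ 0 ∧ x 0 + 3 * x 1 ≠ 0 ∧ x 0 ≠ x 1}
      (isoPair 1 3 0 2 O11)) ∧
    -- Type IX, lambda = mu and nu = sigma
    (Computation 1 4 2 1 eta formIX {y | y 0 = y 1 ∧ y 2 = y 3 ∧ y 0 ≠ y 2}
      (fun x => ![x 0, x 0, -x 0, -x 0])
      {x | x 0 ≠ 0} (isoPairs 0 1 2 3 O2 O2)) ∧
    -- Type IX, lambda = nu and mu = sigma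
    (Computation 1 4 2 1 eta formIX {y | y 0 = y 2 ∧ y 1 = y 3 ∧ y 0 ≠ y 1}
      (fun x => ![x 0, -x 0, x 0, -x 0])
      {x | x 0 ≠ 0} (isoPairs 0 2 1 3 O11 O11)) ∧
    -- Type IX, lambda = sigma and mu = nu
    (Computation 1 4 2 1 eta formIX {y | y 0 = y 3 ∧ y 1 = y 2 ∧ y 0 ≠ y 1}
      (fun x => ![x 0, -x 0, -x 0, x 0])
      {x | x 0 ≠ 0} (isoPairs 0 3 1 2 O11 O11)) ∧
    -- Type IX, lambda = mu = nu only
    (Computation 1 3 2 1 eta formIX {y | y 0 = y 1 ∧ y 1 = y 2 ∧ y 3 ≠ y 0}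
      (fun x => ![x 0, x 0, x 0, -3 * x 0])
      {x | x 0 ≠ 0} (isoTriple 0 1 2 3 O21)) ∧
    -- Type IX, lambda = mu = sigma only
    (Computation 1 3 2 1 eta formIX {y | y 0 = y 1 ∧ y 1 = y 3 ∧ y 2 ≠ y 0}
      (fun x => ![x 0, x 0, -3 * x 0, x 0])
      {x | x 0 ≠ 0} (isoTriple 0 1 3 2 O21)) ∧
    -- Type IX, lambda = nu = sigma only
    (Computation 1 3 2 1 eta formIX {y | y 0 = y 2 ∧ y 2 = y 3 ∧ y 1 ≠ y 0}
      (fun x => ![x 0, -3 * x 0, x 0, x 0])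
      {x | x 0 ≠ 0} (isoTriple 0 2 3 1 O12)) ∧
    -- Type IX, mu = nu = sigma only
    (Computation 1 3 2 1 eta formIX {y | y 1 = y 2 ∧ y 2 = y 3 ∧ y 0 ≠ y 1}
      (fun x => ![-3 * x 0, x 0, x 0, x 0])
      {x | x 0 ≠ 0} (isoTriple 1 2 3 0 O12)) ∧
    -- Type IX, all eigenvalues coincident
    (Computation 0 0 1 1 eta formIX {y | ∀ i j, y i = y j}
      (fun x => ![0, 0, 0, 0]) Set.univ (orth ![1, 1, -1, -1])) := by
  exact ⟨fun _ he => computation_formI he, computation_formII, computation_formIIIa,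
    computation_formIIIa_self, computation_formIIIb, computation_formIIIb_self,
    fun _ he => computation_formIV he, fun _ he => computation_formIV_right he,
    fun _ he => computation_formIV_left he, fun _ he => computation_formIV_outer he,
    fun _ he => computation_formIV_all he, computation_formV, computation_formV_self,
    fun _ he => computation_formVI he, fun _ _ he hw => computation_formVII he hw,
    fun _ he => computation_formVII_eq he, fun _ he => computation_formVII_neg he,
    computation_formVIII, computation_formVIII_eq_re, computation_formVIII_self,
    computation_formIX, computation_formIX_nu_sigma, computation_formIX_lambda_mu,
    computation_formIX_lambda_sigma, computation_formIX_mu_nu, computation_formIX_lambda_nu,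
    computation_formIX_mu_sigma, computation_formIX_lambda_mu_nu_sigma,
    computation_formIX_lambda_nu_mu_sigma, computation_formIX_lambda_sigma_mu_nu,
    computation_formIX_lambda_mu_nu, computation_formIX_lambda_mu_sigma,
    computation_formIX_lambda_nu_sigma, computation_formIX_mu_nu_sigma, computation_formIX_all⟩
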